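/- **Theorem (density of CPWL extreme points).** Let $n\ge 1$ and $\Omega=(0,1)^n\subseteq\mathbb R^n$. For $f\in L^1_{\mathrm{loc}}(\Omega)$ let $$|\mathrm D^2 f|(\Omega)=\sup_F\int_\Omega\sum_{i,j=1}^n f\,\partial_i\partial_jF_{i,j}\,\mathrm d\mathcal L^n\in[0,\infty],$$ where the supremum runs over all $F\in C_c^\infty(\Omega)^{n\times n}$ such that all singular values of $F(x)$ are at most $1$ for every $x$ (this is the Hessian–Schatten total variation with exponent $p=1$). Let $\mathrm{CPWL}(\Omega)$ be the set of continuous $f:\Omega\to\mathbb R$ for which there is a locally finite decomposition $\{P_k\}_k$ of $\mathbb R^n$ into $n$-dimensional convex polytopes (convex hulls of finitely many points), intersecting only at their boundaries, such that $f$ is affine on each $P_k\cap\Omega$. Let $\mathcal A\subseteq L^1(\Omega)$ be the subspace of affine functions, $\pi:L^1(\Omega)\to L^1(\Omega)/\mathcal A$ the projection, and $$\mathcal B=\pi\big(\{f\in L^1(\Omega):|\mathrm D^2f|(\Omega)\le 1\}\big),\qquad \mathcal E=\pi(\mathrm{CPWL}(\Omega))\cap\mathrm{ext}(\mathcal B).$$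 Closures below are taken in the quotient topology of $L^1(\Omega)/\mathcal A$. If $n=2$, then: 1. $\mathrm{ext}(\mathcal B)\subseteq\overline{\mathcal E}$; 2. in particular, every $f$ that is extreme, modulo affine functions, in $K=\{f\in L^1_{\mathrm{loc}}(\Omega):|\mathrm D^2f|(\Omega)\le1\}$ belongs to $L^1(\Omega)$ and satisfies $\pi(f)\in\overline{\mathcal E}$. Here $f\in K$ is called extreme modulo affine functions if, whenever $f=(1-t)f_1+tf_2$ with $f_1,f_2\in K$ and $t\in(0,1)$, the functions $f_1-f$ and $f_2-f$ are affine; this holds in particular for every extreme point of $K$. Moreover, for any $n\ge1$, (1) and (2) hold whenever $\mathrm{CPWL}(\Omega)$ is dense in energy, that is, whenever for every $f\in L^1_{\mathrm{loc}}(\Omega)$ with $|\mathrm D^2 f|(\Omega)<\infty$ there are $f_k\in\mathrm{CPWL}(\Omega)$ with $f_k-f\to0$ in $L^1(\Omega)$ and $|\mathrm D^2f_k|(\Omega)\to|\mathrm D^2f|(\Omega)$. -/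

import Mathlib

open MeasureTheory Filter Topology
open scoped ENNReal ContDiff

noncomputable section

namespace HessianSchatten

/-- The Euclidean space `ℝⁿ`. -/
abbrev Eu (n : ℕ) : Type := EuclideanSpace ℝ (Fin n)

/-- The open unit cube `Ω = (0,1)ⁿ`. -/
def cube (n : ℕ) : Set (Eu n) := {x | ∀ i, 0 < x i ∧ x i < 1}

/-- The Schatten `p`-norm of a square matrix: the `ℓᵖ` norm of the vector of its `n` singular
values, counted with multiplicity. -/
def schattenNorm {n : ℕ} (p : ℝ≥0∞) (M : Matrix (Fin n) (Fin n) ℝ) : ℝ :=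
  ‖WithLp.toLp p (fun i : Fin n => (Matrix.toEuclideanLin M).singularValues (i : ℕ))‖

/-- The partial derivative `∂ᵢ φ`. -/
def partialDeriv {n : ℕ} (i : Fin n) (φ : Eu n → ℝ) : Eu n → ℝ :=
  fun x => fderiv ℝ φ x (EuclideanSpace.single i 1)

/-- Matrix fields `F ∈ C_c^∞(A)^{n × n}` with `|F(x)|_q ≤ 1` for all `x`. (As `F` is continuous,
the pointwise bound is the bound on the essential supremum of `|F|_q`.) -/
structure IsTestField {n : ℕ} (q : ℝ≥0∞) (A : Set (Eu n))
    (F : Eu n → Matrix (Fin n) (Fin n) ℝ) : Prop where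
  contDiff : ∀ i j, ContDiff ℝ ∞ (fun x => F x i j)
  hasCompactSupport : ∀ i j, HasCompactSupport (fun x => F x i j)
  tsupport_subset : ∀ i j, tsupport (fun x => F x i j) ⊆ A
  norm_le_one : ∀ x, schattenNorm q (F x) ≤ 1

/-- The Hessian–Schatten total variation `|D²_p f|(A)` of a locally integrable function `f` on the
open set `A`, an extended nonnegative number. (The supremum is nonnegative since `F = 0` is allowed,
so truncating the integrals at `0` does not change it.) -/
def htv {n : ℕ} (p : ℝ≥0∞) (f : Eu n → ℝ) (A : Set (Eu n)) : ℝ≥0∞ :=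
  ⨆ (F : Eu n → Matrix (Fin n) (Fin n) ℝ) (_ : IsTestField p.conjExponent A F),
    ENNReal.ofReal (∫ x in A, ∑ i, ∑ j, f x * partialDeriv i (partialDeriv j fun y => F y i j) x)

/-- An `n`-dimensional convex polytope in `ℝⁿ`: the convex hull of finitely many points, with
nonempty interior. -/
def IsPolytope {n : ℕ} (P : Set (Eu n)) : Prop :=
  (∃ s : Finset (Eu n), P = convexHull ℝ (s : Set (Eu n))) ∧ (interior P).Nonempty

/-- A locally finite decomposition of `ℝⁿ` in `n`-dimensional convex polytopes which intersect only
at their boundaries. -/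
structure IsPolytopalDecomposition {n : ℕ} (𝒯 : Set (Set (Eu n))) : Prop where
  isPolytope : ∀ P ∈ 𝒯, IsPolytope P
  covers : ⋃₀ 𝒯 = Set.univ
  inter_subset : ∀ P ∈ 𝒯, ∀ Q ∈ 𝒯, P ≠ Q → P ∩ Q ⊆ frontier P ∩ frontier Q
  locallyFinite : ∀ (x : Eu n) (r : ℝ), {P ∈ 𝒯 | (P ∩ Metric.ball x r).Nonempty}.Finite

/-- `f ∈ CPWL(Ω)`: `f` is continuous on `Ω` and piecewise affine. Only the values of `f` on `Ω`
matter. -/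
def IsCPWL {n : ℕ} (Ω : Set (Eu n)) (f : Eu n → ℝ) : Prop :=
  ContinuousOn f Ω ∧ ∃ 𝒯 : Set (Set (Eu n)), IsPolytopalDecomposition 𝒯 ∧
    ∀ P ∈ 𝒯, ∃ a : Eu n →ᵃ[ℝ] ℝ, ∀ x ∈ P ∩ Ω, f x = a x

/-- Lebesgue measure on the cube. -/
abbrev cubeMeasure (n : ℕ) : Measure (Eu n) := volume.restrict (cube n)

/-- The Banach space `L¹(Ω)`. -/
abbrev L1Cube (n : ℕ) : Type := Lp ℝ 1 (cubeMeasure n)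

/-- The subspace `𝒜` of affine functions in `L¹(Ω)`. -/
def affineSubmodule (n : ℕ) : Submodule ℝ (L1Cube n) where
  carrier := {f | ∃ a : Eu n →ᵃ[ℝ] ℝ, f =ᵐ[cubeMeasure n] a}
  add_mem' := by
    rintro f g ⟨a, ha⟩ ⟨b, hb⟩
    refine ⟨a + b, ?_⟩
    filter_upwards [Lp.coeFn_add f g, ha, hb] with x h h1 h2
    rw [h, Pi.add_apply, h1, h2]; rfl
  zero_mem' := ⟨0, by
    filter_upwards [Lp.coeFn_zero ℝ 1 (cubeMeasure n)] with x h
    rw [h]; rfl⟩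
  smul_mem' := by
    rintro c f ⟨a, ha⟩
    refine ⟨c • a, ?_⟩
    filter_upwards [Lp.coeFn_smul c f, ha] with x h h1
    rw [h, Pi.smul_apply, h1]; rfl

/-- `L¹(Ω)/𝒜`, with the topology of the quotient norm. -/
abbrev L1ModAffine (n : ℕ) : Type := L1Cube n ⧸ affineSubmodule n

/-- The canonical projection `π : L¹(Ω) → L¹(Ω)/𝒜`. -/
abbrev proj (n : ℕ) : L1Cube n →ₗ[ℝ] L1ModAffine n := (affineSubmodule n).mkQ

/-- The unit ball `ℬ = π({f ∈ L¹(Ω) : |D²f|(Ω) ≤ 1})`, with `p = 1`. -/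
def unitBall (n : ℕ) : Set (L1ModAffine n) :=
  proj n '' {f : L1Cube n | htv 1 f (cube n) ≤ 1}

/-- The elements of `L¹(Ω)` which have a representative in `CPWL(Ω)`. -/
def cpwlL1 (n : ℕ) : Set (L1Cube n) :=
  {f | ∃ g : Eu n → ℝ, IsCPWL (cube n) g ∧ f =ᵐ[cubeMeasure n] g}

/-- The CPWL extreme points `ℰ = π(CPWL(Ω)) ∩ ext(ℬ)`. -/
def cpwlExtremePoints (n : ℕ) : Set (L1ModAffine n) :=
  proj n '' cpwlL1 n ∩ (unitBall n).extremePoints ℝ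

/-- The set `{f ∈ L¹_loc(Ω) : |D²f|(Ω) ≤ 1}` of almost everywhere classes of functions on `Ω`. -/
def locUnitBall (n : ℕ) : Set (Eu n →ₘ[cubeMeasure n] ℝ) :=
  {f | LocallyIntegrableOn f (cube n) ∧ htv 1 f (cube n) ≤ 1}

/-- `f` is an extreme point of `K` modulo affine functions: `f ∈ K`, and whenever `f` lies in an
open segment with endpoints `f₁, f₂ ∈ K`, the differences `f₁ - f` and `f₂ - f` are affine. Every
extreme point of `K` in the strict sense has this property. -/
def IsExtremeModAffine {n : ℕ} (K : Set (Eu n →ₘ[cubeMeasure n] ℝ))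
    (f : Eu n →ₘ[cubeMeasure n] ℝ) : Prop :=
  f ∈ K ∧ ∀ f₁ ∈ K, ∀ f₂ ∈ K, f ∈ openSegment ℝ f₁ f₂ →
    (∃ a : Eu n →ᵃ[ℝ] ℝ, ⇑(f₁ - f) =ᵐ[cubeMeasure n] a) ∧
    (∃ a : Eu n →ᵃ[ℝ] ℝ, ⇑(f₂ - f) =ᵐ[cubeMeasure n] a)

/-- Density in energy of `CPWL(Ω)` for `Ω = (0,1)ⁿ` with respect to `L¹(Ω)` convergence. -/
def CPWLDenseInEnergy (n : ℕ) : Prop :=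
  ∀ f : Eu n → ℝ, LocallyIntegrableOn f (cube n) → htv 1 f (cube n) < ⊤ →
    ∃ g : ℕ → Eu n → ℝ, (∀ k, IsCPWL (cube n) (g k)) ∧
      Tendsto (fun k => eLpNorm (g k - f) 1 (cubeMeasure n)) atTop (𝓝 0) ∧
      Tendsto (fun k => htv 1 (g k) (cube n)) atTop (𝓝 (htv 1 f (cube n)))

end HessianSchatten

end

/-! The proof combines Krein–Milman on finite-dimensional slices, a rigidity property of CPWL
functions, density in energy, and Milman's converse to Krein–Milman.

Compactness. A second order Poincaré inequality (`exists_affine_lintegral_le`) bounds the distance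
in `L¹` from `u` to the affine functions by its variation. It is proved by duality: a test function
with zero mass and zero first moments is a double divergence with a sup bound (`exists_eq_hdiv`).
Rescaled to a grid of side `1 / m`, it puts the sublevel sets within `C / m ^ 2` of a
finite-dimensional space. With lower semicontinuity the unit ball modulo affine functions is compact
(`isCompact_unitBall`).

Rigidity. Let `g` be CPWL of variation one and `g = t g₁ + s g₂` with `g₁`, `g₂` in the ball. No
variation is lost in the sum, so that of `g₁` is locally dominated by that of `g`
(`htv_combination_le`). Hence `g₁` is affine wherever `g` is, and its variation on balls of radius
`r` is of order `r ^ (n - 1)`, which together with the Poincaré inequality excludes jumps. So `g₁`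
is CPWL on the decomposition of `g` (`exists_isPiecewiseAffine_of_combination`). Consequently
nonzero extreme points of the slice of the ball by the functions on one decomposition are extreme in
the whole ball, and Krein–Milman in the slice writes every nonzero CPWL element as a limit of convex
combinations of CPWL extreme points.

Conclusion from density. If CPWL functions are dense in energy, the ball is the closed convex hull
of the CPWL extreme points, so Milman's theorem places every extreme point in their closure
(`extremePoints_unitBall_subset_closure`). A function extreme modulo affine functions is integrable
by the Poincaré inequality, and its class is extreme in the ball.

Density, proved for every `n` (`cpwlDenseInEnergy`). A smooth `f` is replaced by the maximum over
the cubes of a fine grid of `f` minus a steep penalty at the centre. Each competitor is a difference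
`A - B` of convex functions with `Δ(A + B)` close to the trace norm of `D²f` on its own cube, and
`A`, `B` are replaced by maxima of finitely many affine functions. For convex `k` the variation is
governed by `∫ k Δψ`, which is continuous under uniform convergence; this bounds the energy
(`htv_le_of_convex_split`). Dilation and mollification reduce the general case to the smooth one. -/

noncomputable section

namespace HessianSchatten

/-! ### Matrices of operator norm at most one. -/

theorem schattenNorm_top_le_one_iff {n : ℕ} (M : Matrix (Fin n) (Fin n) ℝ) :
    schattenNorm ⊤ M ≤ 1 ↔ ∀ v : Eu n, ‖Matrix.toEuclideanLin M v‖ ≤ ‖v‖ := by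
  have hn : Module.finrank ℝ (Eu n) = n := by simp
  set T := Matrix.toEuclideanLin M with hT
  have hs := T.isSymmetric_adjoint_comp_self
  set b := hs.eigenvectorBasis hn with hb
  have h1 : schattenNorm ⊤ M ≤ 1 ↔ ∀ i : Fin n, T.singularValues (i : ℕ) ≤ 1 := by
    unfold schattenNorm
    rw [PiLp.norm_toLp, pi_norm_le_iff_of_nonneg zero_le_one]
    simp only [Real.norm_eq_abs, ← hT]
    exact forall_congr' fun i => by rw [abs_of_nonneg (T.singularValues_nonneg _)]
  -- In an eigenbasis of `T* T`, whose eigenvalues are the squared singular values, both conditions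
  -- become bounds on these eigenvalues.
  have key : ∀ v : Eu n, ‖T v‖ ^ 2 = ∑ i, hs.eigenvalues hn i * (b.repr v i) ^ 2 := by
    intro v
    have e1 : ‖T v‖ ^ 2 = inner ℝ v ((LinearMap.adjoint T ∘ₗ T) v) := by
      rw [LinearMap.comp_apply, LinearMap.adjoint_inner_right, real_inner_self_eq_norm_sq]
    rw [e1, ← b.sum_inner_mul_inner]
    refine Finset.sum_congr rfl fun i _ => ?_
    have e2 := hs.eigenvectorBasis_apply_self_apply hn v i
    rw [OrthonormalBasis.repr_apply_apply] at e2
    rw [← hb] at e2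
    rw [e2, real_inner_comm]
    simp only [OrthonormalBasis.repr_apply_apply, RCLike.ofReal_real_eq_id, id]
    ring
  rw [h1]
  constructor
  · intro h v
    have : ‖T v‖ ^ 2 ≤ ‖v‖ ^ 2 := by
      rw [key, ← b.sum_sq_norm_inner_right v]
      refine Finset.sum_le_sum fun i _ => ?_
      have := T.sq_singularValues_fin hn i
      have h2 : hs.eigenvalues hn i ≤ 1 := by
        rw [← this]; exact pow_le_one₀ (T.singularValues_nonneg _) (h i)
      rw [OrthonormalBasis.repr_apply_apply, Real.norm_eq_abs, sq_abs]
      nlinarith [sq_nonneg (inner ℝ (b i) v)]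
    exact le_of_sq_le_sq this (norm_nonneg _)
  · intro h i
    have h3 := key (b i)
    have : ∀ j, b.repr (b i) j = if i = j then 1 else 0 := by
      intro j; rw [b.repr_self]; simp [eq_comm]
    simp only [this] at h3
    simp at h3
    have h4 := h (b i)
    rw [b.norm_eq_one] at h4
    have := T.sq_singularValues_fin hn i
    have h5 : T.singularValues i ^ 2 ≤ 1 ^ 2 := by
      rw [this]; change hs.eigenvalues hn i ≤ _
      rw [← h3]; exact pow_le_pow_left₀ (norm_nonneg _) h4 2
    exact le_of_sq_le_sq h5 zero_le_one

/-- The operator norm of `M`, acting on Euclidean space, is at most `1`. -/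
def OpLeOne {n : ℕ} (M : Matrix (Fin n) (Fin n) ℝ) : Prop :=
  ∀ v : Eu n, ‖Matrix.toEuclideanLin M v‖ ≤ ‖v‖

theorem OpLeOne.zero {n : ℕ} : OpLeOne (0 : Matrix (Fin n) (Fin n) ℝ) := by
  intro v; simp

theorem OpLeOne.smul {n : ℕ} {M : Matrix (Fin n) (Fin n) ℝ} (h : OpLeOne M) {c : ℝ}
    (hc : |c| ≤ 1) : OpLeOne (c • M) := by
  intro v
  rw [map_smul, LinearMap.smul_apply, norm_smul, Real.norm_eq_abs]
  exact (mul_le_of_le_one_left (norm_nonneg _) hc).trans (h v)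

theorem OpLeOne.neg {n : ℕ} {M : Matrix (Fin n) (Fin n) ℝ} (h : OpLeOne M) : OpLeOne (-M) := by
  have := h.smul (c := -1) (by simp)
  simpa using this

/-- Cauchy–Schwarz in each row bounds the operator norm by `n` times the largest entry. It turns the
entrywise bounds of `exists_eq_hdiv` into admissible test fields. -/
theorem opLeOne_of_entries {n : ℕ} {M : Matrix (Fin n) (Fin n) ℝ} {c : ℝ}
    (h : ∀ i j, |M i j| ≤ c) (hc : c * n ≤ 1) (hc0 : 0 ≤ c) : OpLeOne M := by
  intro v
  refine le_of_sq_le_sq ?_ (norm_nonneg _)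
  rw [EuclideanSpace.norm_sq_eq, EuclideanSpace.norm_sq_eq]
  have h1 : ∀ i, ‖Matrix.toEuclideanLin M v i‖ ^ 2 ≤ c ^ 2 * n * ∑ j, ‖v j‖ ^ 2 := by
    intro i
    have e : Matrix.toEuclideanLin M v i = ∑ j, M i j * v j := by
      simp [Matrix.toLpLin_apply, Matrix.mulVec, dotProduct]
    rw [e, Real.norm_eq_abs, sq_abs]
    have h2 : ∑ j, (M i j) ^ 2 ≤ c ^ 2 * n := by
      calc ∑ j, (M i j) ^ 2 ≤ ∑ _j : Fin n, c ^ 2 :=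
            Finset.sum_le_sum fun j _ => sq_le_sq' (abs_le.1 (h i j)).1 (abs_le.1 (h i j)).2
        _ = c ^ 2 * n := by simp; ring
    have h3 : ∑ j, ‖v j‖ ^ 2 = ∑ j, (v j) ^ 2 := by simp
    rw [h3]
    exact (Finset.sum_mul_sq_le_sq_mul_sq _ _ _).trans
      (mul_le_mul_of_nonneg_right h2 (Finset.sum_nonneg fun j _ => sq_nonneg _))
  calc ∑ i, ‖Matrix.toEuclideanLin M v i‖ ^ 2
      ≤ ∑ i : Fin n, c ^ 2 * n * ∑ j, ‖v j‖ ^ 2 := Finset.sum_le_sum fun i _ => h1 i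
    _ = (c * n) ^ 2 * ∑ j, ‖v j‖ ^ 2 := by simp; ring
    _ ≤ 1 * ∑ j, ‖v j‖ ^ 2 := by
        gcongr
        exact pow_le_one₀ (by positivity) hc
    _ = _ := one_mul _

/-! ### Calculus of partial derivatives. -/

theorem partialDeriv_contDiff {n : ℕ} (i : Fin n) {φ : Eu n → ℝ} (h : ContDiff ℝ ∞ φ) :
    ContDiff ℝ ∞ (partialDeriv i φ) :=
  (h.fderiv_right (m := ∞) (by simp)).clm_apply contDiff_const

theorem support_partialDeriv_subset {n : ℕ} (i : Fin n) (φ : Eu n → ℝ) :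
    Function.support (partialDeriv i φ) ⊆ tsupport φ := by
  intro x hx
  by_contra h
  apply hx
  have := notMem_tsupport_iff_eventuallyEq.1 h
  simp [partialDeriv, this.fderiv_eq]

theorem tsupport_partialDeriv_subset {n : ℕ} (i : Fin n) (φ : Eu n → ℝ) :
    tsupport (partialDeriv i φ) ⊆ tsupport φ :=
  closure_minimal (support_partialDeriv_subset i φ) (isClosed_tsupport _)

theorem hasCompactSupport_partialDeriv {n : ℕ} (i : Fin n) {φ : Eu n → ℝ}
    (h : HasCompactSupport φ) : HasCompactSupport (partialDeriv i φ) :=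
  h.mono' (support_partialDeriv_subset i φ)

theorem partialDeriv_add {n : ℕ} (i : Fin n) {φ ψ : Eu n → ℝ} (h : Differentiable ℝ φ)
    (h' : Differentiable ℝ ψ) :
    partialDeriv i (fun x => φ x + ψ x) = fun x => partialDeriv i φ x + partialDeriv i ψ x := by
  ext x; simp only [partialDeriv]; rw [fderiv_fun_add (h x) (h' x)]; rfl

theorem partialDeriv_sum {n : ℕ} (i : Fin n) {ι : Type*} (s : Finset ι) {φ : ι → Eu n → ℝ}
    (h : ∀ k ∈ s, Differentiable ℝ (φ k)) :
    partialDeriv i (fun x => ∑ k ∈ s, φ k x) = fun x => ∑ k ∈ s, partialDeriv i (φ k) x := by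
  ext x; simp only [partialDeriv]
  rw [fderiv_fun_sum fun k hk => h k hk x]
  simp

theorem partialDeriv_const_mul {n : ℕ} (i : Fin n) {φ : Eu n → ℝ} (h : Differentiable ℝ φ)
    (c : ℝ) : partialDeriv i (fun x => c * φ x) = fun x => c * partialDeriv i φ x := by
  ext x; simp only [partialDeriv]; rw [fderiv_const_mul (h x)]; rfl

theorem partialDeriv_mul {n : ℕ} (i : Fin n) {φ ψ : Eu n → ℝ} (h : Differentiable ℝ φ)
    (h' : Differentiable ℝ ψ) :
    partialDeriv i (fun x => φ x * ψ x) =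
      fun x => partialDeriv i φ x * ψ x + φ x * partialDeriv i ψ x := by
  ext x; simp only [partialDeriv]; rw [fderiv_fun_mul (h x) (h' x)]
  simp [smul_eq_mul]; ring

theorem partialDeriv_comp_homothety {n : ℕ} (i : Fin n) {φ : Eu n → ℝ} (h : Differentiable ℝ φ)
    (c : Eu n) (s : ℝ) :
    partialDeriv i (fun x => φ (c + s • x)) = fun x => s * partialDeriv i φ (c + s • x) := by
  ext x
  have h1 : HasFDerivAt (fun x : Eu n => c + s • x) (s • ContinuousLinearMap.id ℝ (Eu n)) x :=
    ((hasFDerivAt_id x).const_smul s).const_add c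
  have := ((h (c + s • x)).hasFDerivAt.comp x h1).fderiv
  simp only [partialDeriv]
  change fderiv ℝ (φ ∘ fun x => c + s • x) x _ = _
  rw [this]; simp

theorem integrable_mul_of_tsupport_subset {n : ℕ} {A : Set (Eu n)} {u φ : Eu n → ℝ}
    (hu : LocallyIntegrableOn u A) (hφ : Continuous φ) (hc : HasCompactSupport φ)
    (hA : tsupport φ ⊆ A) : Integrable (fun x => u x * φ x) := by
  have h1 : IntegrableOn (fun x => u x * φ x) (tsupport φ) :=
    (hu.integrableOn_compact_subset hA hc).mul_continuousOn hφ.continuousOn hc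
  refine (integrableOn_iff_integrable_of_support_subset ?_).1 h1
  intro x hx
  exact subset_tsupport _ fun h => hx (by simp [h])

theorem integral_mul_partialDeriv {n : ℕ} (i : Fin n) {u φ : Eu n → ℝ} (hu : ContDiff ℝ ∞ u)
    (hφ : ContDiff ℝ ∞ φ) (hc : HasCompactSupport φ) :
    ∫ x, u x * partialDeriv i φ x = - ∫ x, partialDeriv i u x * φ x := by
  apply integral_mul_fderiv_eq_neg_fderiv_mul_of_integrable
  · exact ((partialDeriv_contDiff i hu).continuous.mul hφ.continuous).integrable_of_hasCompactSupport
      hc.mul_left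
  · exact (hu.continuous.mul
      (partialDeriv_contDiff i hφ).continuous).integrable_of_hasCompactSupport
      (hasCompactSupport_partialDeriv i hc).mul_left
  · exact (hu.continuous.mul hφ.continuous).integrable_of_hasCompactSupport hc.mul_left
  · exact fun x _ => hu.differentiable (by simp) x
  · exact fun x _ => hφ.differentiable (by simp) x

/-! ### Test fields and their double divergence. -/

/-- Smooth compactly supported matrix fields in `A`, without a bound on their size. -/
structure IsSmoothField {n : ℕ} (A : Set (Eu n)) (F : Eu n → Matrix (Fin n) (Fin n) ℝ) : Prop where
  contDiff : ∀ i j, ContDiff ℝ ∞ (fun x => F x i j)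
  hasCompactSupport : ∀ i j, HasCompactSupport (fun x => F x i j)
  tsupport_subset : ∀ i j, tsupport (fun x => F x i j) ⊆ A

theorem isTestField_top_iff {n : ℕ} {A : Set (Eu n)} {F : Eu n → Matrix (Fin n) (Fin n) ℝ} :
    IsTestField ⊤ A F ↔ IsSmoothField A F ∧ ∀ x, OpLeOne (F x) :=
  ⟨fun h => ⟨⟨h.1, h.2, h.3⟩, fun x => (schattenNorm_top_le_one_iff _).1 (h.4 x)⟩,
    fun h => ⟨h.1.1, h.1.2, h.1.3, fun x => (schattenNorm_top_le_one_iff _).2 (h.2 x)⟩⟩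

/-- The double divergence `∑ᵢⱼ ∂ᵢ∂ⱼ Fᵢⱼ`. -/
def hdiv {n : ℕ} (F : Eu n → Matrix (Fin n) (Fin n) ℝ) (x : Eu n) : ℝ :=
  ∑ i, ∑ j, partialDeriv i (partialDeriv j fun y => F y i j) x

namespace IsSmoothField
variable {n : ℕ} {A B : Set (Eu n)} {F G : Eu n → Matrix (Fin n) (Fin n) ℝ}

theorem continuous_hdiv (h : IsSmoothField A F) : Continuous (hdiv F) :=
  continuous_finsetSum _ fun i _ => continuous_finsetSum _ fun j _ =>
    (partialDeriv_contDiff i (partialDeriv_contDiff j (h.contDiff i j))).continuous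

theorem support_hdiv_subset (F : Eu n → Matrix (Fin n) (Fin n) ℝ) :
    Function.support (hdiv F) ⊆ ⋃ i, ⋃ j, tsupport fun x => F x i j := by
  intro x hx
  by_contra hn
  simp only [Set.mem_iUnion, not_exists] at hn
  refine hx (Finset.sum_eq_zero fun i _ => Finset.sum_eq_zero fun j _ => ?_)
  by_contra h0
  exact hn i j (tsupport_partialDeriv_subset j _ (support_partialDeriv_subset i _ h0))

theorem tsupport_hdiv_subset' (F : Eu n → Matrix (Fin n) (Fin n) ℝ) :
    tsupport (hdiv F) ⊆ ⋃ i, ⋃ j, tsupport fun x => F x i j :=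
  closure_minimal (support_hdiv_subset F)
    (isClosed_iUnion_of_finite fun _ => isClosed_iUnion_of_finite fun _ => isClosed_tsupport _)

theorem tsupport_hdiv_subset (h : IsSmoothField A F) : tsupport (hdiv F) ⊆ A :=
  (tsupport_hdiv_subset' F).trans (Set.iUnion₂_subset h.tsupport_subset)

theorem hasCompactSupport_hdiv (h : IsSmoothField A F) : HasCompactSupport (hdiv F) :=
  IsCompact.of_isClosed_subset
    (isCompact_iUnion fun i => isCompact_iUnion fun j => h.hasCompactSupport i j)
    (isClosed_tsupport _) (tsupport_hdiv_subset' F)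

theorem integrable (h : IsSmoothField A F) {u : Eu n → ℝ} (hu : LocallyIntegrableOn u A) :
    Integrable fun x => u x * hdiv F x :=
  integrable_mul_of_tsupport_subset hu h.continuous_hdiv h.hasCompactSupport_hdiv
    h.tsupport_hdiv_subset

theorem differentiable (h : IsSmoothField A F) (i j : Fin n) :
    Differentiable ℝ fun x => F x i j := (h.contDiff i j).differentiable (by simp)

theorem differentiable' (h : IsSmoothField A F) (i j : Fin n) :
    Differentiable ℝ (partialDeriv j fun x => F x i j) :=
  (partialDeriv_contDiff j (h.contDiff i j)).differentiable (by simp)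

theorem mono (h : IsSmoothField A F) (hAB : A ⊆ B) : IsSmoothField B F :=
  ⟨h.1, h.2, fun i j => (h.3 i j).trans hAB⟩

theorem zero (A : Set (Eu n)) : IsSmoothField A (0 : Eu n → Matrix (Fin n) (Fin n) ℝ) :=
  ⟨fun _ _ => contDiff_const, fun _ _ => HasCompactSupport.zero, fun i j => by
    have : tsupport (fun x : Eu n => (0 : Eu n → Matrix (Fin n) (Fin n) ℝ) x i j) = ∅ := by
      rw [tsupport_eq_empty_iff]; rfl
    rw [this]; exact Set.empty_subset _⟩

theorem add (h : IsSmoothField A F) (h' : IsSmoothField A G) : IsSmoothField A (F + G) :=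
  ⟨fun i j => (h.1 i j).add (h'.1 i j), fun i j => (h.2 i j).add (h'.2 i j), fun i j =>
    (tsupport_add (fun x => F x i j) (fun x => G x i j)).trans
      (Set.union_subset (h.3 i j) (h'.3 i j))⟩

theorem const_smul (h : IsSmoothField A F) (c : ℝ) : IsSmoothField A (c • F) :=
  ⟨fun i j => contDiff_const.mul (h.1 i j), fun i j => (h.2 i j).mul_left, fun i j =>
    (tsupport_mul_subset_right (f := fun _ => c) (g := fun x => F x i j)).trans (h.3 i j)⟩

theorem sum {ι : Type*} (s : Finset ι) {F : ι → Eu n → Matrix (Fin n) (Fin n) ℝ}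
    (h : ∀ k ∈ s, IsSmoothField A (F k)) : IsSmoothField A (∑ k ∈ s, F k) := by
  classical
  induction s using Finset.induction_on with
  | empty => simpa using zero A
  | insert a s ha ih =>
    rw [Finset.sum_insert ha]
    exact (h a (by simp)).add (ih fun k hk => h k (by simp [hk]))

theorem hdiv_add (h : IsSmoothField A F) (h' : IsSmoothField B G) :
    hdiv (F + G) = fun x => hdiv F x + hdiv G x := by
  ext x
  simp only [hdiv, ← Finset.sum_add_distrib]
  refine Finset.sum_congr rfl fun i _ => Finset.sum_congr rfl fun j _ => ?_
  have := partialDeriv_add j (h.differentiable i j) (h'.differentiable i j)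
  change partialDeriv i (partialDeriv j fun y => F y i j + G y i j) x = _
  rw [this, partialDeriv_add i (h.differentiable' i j) (h'.differentiable' i j)]

theorem hdiv_smul (h : IsSmoothField A F) (c : ℝ) : hdiv (c • F) = fun x => c * hdiv F x := by
  ext x
  simp only [hdiv, Finset.mul_sum]
  refine Finset.sum_congr rfl fun i _ => Finset.sum_congr rfl fun j _ => ?_
  change partialDeriv i (partialDeriv j fun y => c * F y i j) x = _
  rw [partialDeriv_const_mul j (h.differentiable i j),
    partialDeriv_const_mul i (h.differentiable' i j)]

theorem hdiv_zero : hdiv (0 : Eu n → Matrix (Fin n) (Fin n) ℝ) = 0 := by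
  have := (zero (n := n) Set.univ).hdiv_smul 0
  ext x; simpa using congrFun this x

theorem hdiv_sum {ι : Type*} (s : Finset ι) {F : ι → Eu n → Matrix (Fin n) (Fin n) ℝ}
    (h : ∀ k ∈ s, IsSmoothField A (F k)) : hdiv (∑ k ∈ s, F k) = fun x => ∑ k ∈ s, hdiv (F k) x := by
  classical
  induction s using Finset.induction_on with
  | empty => simp [hdiv_zero]; rfl
  | insert a s ha ih =>
    rw [Finset.sum_insert ha, (h a (by simp)).hdiv_add (sum s fun k hk => h k (by simp [hk])),
      ih fun k hk => h k (by simp [hk])]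
    ext x; rw [Finset.sum_insert ha]

theorem smul_fun (h : IsSmoothField A F) {ψ : Eu n → ℝ} (hψ : ContDiff ℝ ∞ ψ) :
    IsSmoothField A (fun x => ψ x • F x) :=
  ⟨fun i j => hψ.mul (h.1 i j), fun i j => (h.2 i j).mul_left, fun i j =>
    (tsupport_mul_subset_right (f := ψ) (g := fun x => F x i j)).trans (h.3 i j)⟩

theorem of_tsupport {ψ : Eu n → ℝ} (hψ : ContDiff ℝ ∞ ψ) (hc : HasCompactSupport ψ)
    (hA : tsupport ψ ⊆ A) (hF : ∀ i j, ContDiff ℝ ∞ fun x => F x i j) :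
    IsSmoothField A (fun x => ψ x • F x) :=
  ⟨fun i j => hψ.mul (hF i j), fun _ _ => hc.mul_right, fun i j =>
    (tsupport_mul_subset_left (f := ψ) (g := fun x => F x i j)).trans hA⟩

theorem comp_homothety (h : IsSmoothField A F) (c : Eu n) {s : ℝ} (hs : s ≠ 0) :
    IsSmoothField ((fun x => c + s • x) ⁻¹' A) (fun x => F (c + s • x)) := by
  set T : Eu n ≃ₜ Eu n := (Homeomorph.smulOfNeZero s hs).trans (Homeomorph.addLeft c)
  have hT : ∀ x, T x = c + s • x := fun x => rfl
  refine ⟨fun i j => (h.1 i j).comp (contDiff_const.add (contDiff_id.const_smul s)),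
    fun i j => (h.2 i j).comp_homeomorph T, fun i j => ?_⟩
  change tsupport ((fun x => F x i j) ∘ T) ⊆ _
  rw [tsupport_comp_eq_preimage]
  exact Set.preimage_mono (h.3 i j)

theorem hdiv_comp_homothety (h : IsSmoothField A F) (c : Eu n) (s : ℝ) :
    hdiv (fun x => F (c + s • x)) = fun x => s ^ 2 * hdiv F (c + s • x) := by
  ext x
  simp only [hdiv, Finset.mul_sum]
  refine Finset.sum_congr rfl fun i _ => Finset.sum_congr rfl fun j _ => ?_
  rw [partialDeriv_comp_homothety j (h.differentiable i j),
    partialDeriv_const_mul i, partialDeriv_comp_homothety i (h.differentiable' i j)]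
  · ring
  · exact (h.differentiable' i j).comp
      ((differentiable_const c).add (differentiable_id.const_smul s))

end IsSmoothField

/-! ### Elementary properties of the variation. -/

section Basic
variable {n : ℕ} {A B : Set (Eu n)} {u v : Eu n → ℝ} {F : Eu n → Matrix (Fin n) (Fin n) ℝ}

/-- The support of `hdiv F` lies in `A`, so `A` can be dropped from the domain of integration and
integrals over different sets become comparable. -/
theorem setIntegral_eq_integral_mul_hdiv (hF : IsSmoothField A F) (u : Eu n → ℝ) :
    ∫ x in A, ∑ i, ∑ j, u x * partialDeriv i (partialDeriv j fun y => F y i j) x =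
      ∫ x, u x * hdiv F x := by
  have : ∀ x, ∑ i, ∑ j, u x * partialDeriv i (partialDeriv j fun y => F y i j) x =
      u x * hdiv F x := fun x => by simp [hdiv, Finset.mul_sum]
  simp only [this]
  refine setIntegral_eq_integral_of_forall_compl_eq_zero fun x hx => ?_
  rw [image_eq_zero_of_notMem_tsupport fun h => hx (hF.tsupport_hdiv_subset h), mul_zero]

theorem ofReal_integral_le_htv (hF : IsSmoothField A F) (h1 : ∀ x, OpLeOne (F x))
    (u : Eu n → ℝ) : ENNReal.ofReal (∫ x, u x * hdiv F x) ≤ htv 1 u A := by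
  rw [← setIntegral_eq_integral_mul_hdiv hF]
  have hc : ENNReal.conjExponent 1 = ⊤ := by
    simp [ENNReal.conjExponent]
  have : IsTestField (ENNReal.conjExponent 1) A F := by
    rw [hc]; exact isTestField_top_iff.2 ⟨hF, h1⟩
  exact le_iSup₂ (f := fun (F : Eu n → Matrix (Fin n) (Fin n) ℝ)
    (_ : IsTestField (ENNReal.conjExponent 1) A F) => ENNReal.ofReal
    (∫ x in A, ∑ i, ∑ j, u x * partialDeriv i (partialDeriv j fun y => F y i j) x)) F this

/-- With `ofReal_integral_le_htv` this replaces the definition of `htv` in all later arguments; the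
exponent conjugate to `1` is `⊤`, so admissibility is a bound on the operator norm. -/
theorem htv_le_of_forall {c : ℝ≥0∞} (h : ∀ F, IsSmoothField A F → (∀ x, OpLeOne (F x)) →
    ENNReal.ofReal (∫ x, u x * hdiv F x) ≤ c) : htv 1 u A ≤ c := by
  refine iSup₂_le fun F hF => ?_
  have hc : ENNReal.conjExponent 1 = ⊤ := by
    simp [ENNReal.conjExponent]
  rw [hc] at hF
  obtain ⟨h1, h2⟩ := isTestField_top_iff.1 hF
  rw [setIntegral_eq_integral_mul_hdiv h1]
  exact h F h1 h2

theorem integral_le_toReal_htv (hF : IsSmoothField A F) (h1 : ∀ x, OpLeOne (F x))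
    (hu : htv 1 u A ≠ ⊤) : ∫ x, u x * hdiv F x ≤ (htv 1 u A).toReal :=
  (ENNReal.ofReal_le_iff_le_toReal hu).1 (ofReal_integral_le_htv hF h1 u)

theorem htv_mono (u : Eu n → ℝ) (hAB : A ⊆ B) : htv 1 u A ≤ htv 1 u B :=
  htv_le_of_forall fun _ hF h1 => ofReal_integral_le_htv (hF.mono hAB) h1 u

theorem htv_congr_ae (h : u =ᵐ[volume.restrict A] v) : htv 1 u A = htv 1 v A := by
  unfold htv
  refine iSup_congr fun F => iSup_congr fun hF => ?_
  congr 1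
  refine integral_congr_ae ?_
  filter_upwards [h] with x hx
  rw [hx]

theorem htv_add_le (hu : LocallyIntegrableOn u A) (hv : LocallyIntegrableOn v A) :
    htv 1 (fun x => u x + v x) A ≤ htv 1 u A + htv 1 v A := by
  refine htv_le_of_forall fun F hF h1 => ?_
  simp only [add_mul]
  rw [integral_add (hF.integrable hu) (hF.integrable hv)]
  exact ENNReal.ofReal_add_le.trans
    (add_le_add (ofReal_integral_le_htv hF h1 u) (ofReal_integral_le_htv hF h1 v))

theorem htv_const_mul_le (c : ℝ) : htv 1 (fun x => c * u x) A ≤ ENNReal.ofReal |c| * htv 1 u A := by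
  refine htv_le_of_forall fun F hF h1 => ?_
  rcases le_total 0 c with hc | hc
  · simp only [mul_assoc]
    rw [integral_const_mul, ENNReal.ofReal_mul hc, abs_of_nonneg hc]
    exact mul_le_mul_right (ofReal_integral_le_htv hF h1 u) _
  -- The sign of `c` is moved to the field, since `-F` is admissible together with `F`.
  · have h2 : ∀ x, c * u x * hdiv F x = |c| * (u x * hdiv (fun y => - F y) x) := by
      intro x
      have := congrFun (hF.hdiv_smul (-1)) x
      have e : (-1 : ℝ) • F = fun y => - F y := by ext y; simp
      rw [e] at this
      rw [this, abs_of_nonpos hc]; ring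
    simp only [h2]
    rw [integral_const_mul, ENNReal.ofReal_mul (abs_nonneg c)]
    have h3 : IsSmoothField A fun y => - F y := by
      have e : (-1 : ℝ) • F = fun y => - F y := by ext y; simp
      rw [← e]; exact hF.const_smul _
    exact mul_le_mul_right (ofReal_integral_le_htv h3 (fun x => (h1 x).neg) u) _

theorem integral_mul_partialDeriv_two {φ : Eu n → ℝ} (i j : Fin n) (hu : ContDiff ℝ ∞ u)
    (hφ : ContDiff ℝ ∞ φ) (hc : HasCompactSupport φ) :
    ∫ x, u x * partialDeriv i (partialDeriv j φ) x =
      ∫ x, partialDeriv j (partialDeriv i u) x * φ x := by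
  rw [integral_mul_partialDeriv i hu (partialDeriv_contDiff j hφ)
    (hasCompactSupport_partialDeriv j hc),
    integral_mul_partialDeriv j (partialDeriv_contDiff i hu) hφ hc, neg_neg]

theorem integral_mul_hdiv (hu : ContDiff ℝ ∞ u) (hF : IsSmoothField A F) :
    ∫ x, u x * hdiv F x = ∫ x, ∑ i, ∑ j, partialDeriv j (partialDeriv i u) x * F x i j := by
  simp only [hdiv, Finset.mul_sum]
  have h1 : ∀ i j, Integrable fun x => u x * partialDeriv i (partialDeriv j fun y => F y i j) x :=
    fun i j => (hu.continuous.mul (partialDeriv_contDiff i (partialDeriv_contDiff j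
      (hF.contDiff i j))).continuous).integrable_of_hasCompactSupport
      (hasCompactSupport_partialDeriv i (hasCompactSupport_partialDeriv j
        (hF.hasCompactSupport i j))).mul_left
  have h2 : ∀ i j, Integrable fun x => partialDeriv j (partialDeriv i u) x * F x i j :=
    fun i j => ((partialDeriv_contDiff j (partialDeriv_contDiff i hu)).continuous.mul
      (hF.contDiff i j).continuous).integrable_of_hasCompactSupport
      (hF.hasCompactSupport i j).mul_left
  rw [integral_finsetSum _ fun i _ => integrable_finsetSum _ fun j _ => h1 i j,
    integral_finsetSum _ fun i _ => integrable_finsetSum _ fun j _ => h2 i j]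
  refine Finset.sum_congr rfl fun i _ => ?_
  rw [integral_finsetSum _ fun j _ => h1 i j, integral_finsetSum _ fun j _ => h2 i j]
  exact Finset.sum_congr rfl fun j _ =>
    integral_mul_partialDeriv_two i j hu (hF.contDiff i j) (hF.hasCompactSupport i j)

theorem continuous_affineMap (a : Eu n →ᵃ[ℝ] ℝ) : Continuous a := a.continuous_of_finiteDimensional

theorem affineMap_eq (a : Eu n →ᵃ[ℝ] ℝ) (x : Eu n) : a x = a.linear x + a 0 := by
  have := a.map_vadd 0 x
  simpa using this

theorem contDiff_affineMap (a : Eu n →ᵃ[ℝ] ℝ) : ContDiff ℝ ∞ a := by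
  have : (a : Eu n → ℝ) = fun x => LinearMap.toContinuousLinearMap a.linear x + a 0 := by
    ext x; simp [affineMap_eq a x]
  rw [this]
  exact (ContinuousLinearMap.contDiff _).add contDiff_const

theorem partialDeriv_affineMap (i : Fin n) (a : Eu n →ᵃ[ℝ] ℝ) :
    partialDeriv i a = fun _ => a.linear (EuclideanSpace.single i 1) := by
  have : (a : Eu n → ℝ) = fun x => LinearMap.toContinuousLinearMap a.linear x + a 0 := by
    ext x; simp [affineMap_eq a x]
  ext x
  simp only [partialDeriv]
  rw [this, fderiv_add_const, ContinuousLinearMap.fderiv]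
  rfl

theorem partialDeriv_const (i : Fin n) (c : ℝ) : partialDeriv i (fun _ : Eu n => c) = 0 := by
  ext x; simp [partialDeriv]

/-- Two integrations by parts leave the Hessian of `a`, which is zero. This is why the variation
lives on the quotient by affine functions. -/
theorem integral_affineMap_mul_hdiv (a : Eu n →ᵃ[ℝ] ℝ) (hF : IsSmoothField A F) :
    ∫ x, a x * hdiv F x = 0 := by
  rw [integral_mul_hdiv (contDiff_affineMap a) hF]
  simp [partialDeriv_affineMap, partialDeriv_const]

theorem locallyIntegrableOn_affineMap (a : Eu n →ᵃ[ℝ] ℝ) (A : Set (Eu n)) :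
    LocallyIntegrableOn a A :=
  (continuous_affineMap a).locallyIntegrable.locallyIntegrableOn A

theorem htv_add_affineMap (hu : LocallyIntegrableOn u A) (a : Eu n →ᵃ[ℝ] ℝ) :
    htv 1 (fun x => u x + a x) A = htv 1 u A := by
  have h : ∀ F, IsSmoothField A F → ∫ x, (u x + a x) * hdiv F x = ∫ x, u x * hdiv F x := by
    intro F hF
    simp only [add_mul]
    rw [integral_add (hF.integrable hu) (hF.integrable (locallyIntegrableOn_affineMap a A)),
      integral_affineMap_mul_hdiv a hF, add_zero]
  refine le_antisymm (htv_le_of_forall fun F hF h1 => ?_) (htv_le_of_forall fun F hF h1 => ?_)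
  · rw [h F hF]; exact ofReal_integral_le_htv hF h1 u
  · rw [← h F hF]; exact ofReal_integral_le_htv hF h1 _

theorem htv_affineMap (a : Eu n →ᵃ[ℝ] ℝ) (A : Set (Eu n)) : htv 1 a A = 0 := by
  refine le_antisymm (htv_le_of_forall fun F hF h1 => ?_) zero_le
  rw [integral_affineMap_mul_hdiv a hF]; simp

theorem IsSmoothField.exists_bound (hF : IsSmoothField A F) : ∃ C : ℝ, 0 < C ∧ ∀ x, |hdiv F x| ≤ C := by
  obtain ⟨C, hC⟩ := hF.hasCompactSupport_hdiv.exists_bound_of_continuous hF.continuous_hdiv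
  exact ⟨max C 1, by positivity, fun x => (hC x).trans (le_max_left _ _)⟩

/-- Lower semicontinuity of the Hessian–Schatten variation under `L¹` convergence. -/
theorem htv_le_liminf {ι : Type*} {l : Filter ι} {w : ι → Eu n → ℝ}
    (hw : ∀ k, LocallyIntegrableOn (w k) A) (hu : LocallyIntegrableOn u A)
    (h : Tendsto (fun k => eLpNorm (w k - u) 1 (volume.restrict A)) l (𝓝 0)) :
    htv 1 u A ≤ liminf (fun k => htv 1 (w k) A) l := by
  refine htv_le_of_forall fun F hF h1 => ?_
  obtain ⟨C, hC0, hC⟩ := hF.exists_bound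
  -- For a fixed field the pairing is `L¹`-continuous because `hdiv F` is bounded; a supremum of
  -- continuous functionals is lower semicontinuous.
  have hle : ∀ k, ENNReal.ofReal (∫ x, u x * hdiv F x) ≤
      htv 1 (w k) A + ENNReal.ofReal C * eLpNorm (w k - u) 1 (volume.restrict A) := by
    intro k
    have e : ∫ x, u x * hdiv F x =
        (∫ x, w k x * hdiv F x) + ∫ x, (u x - w k x) * hdiv F x := by
      have h2 : Integrable fun x => (u x - w k x) * hdiv F x := hF.integrable (hu.sub (hw k))
      rw [← integral_add (hF.integrable (hw k)) h2]
      congr 1; ext x; ring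
    rw [e]
    refine ENNReal.ofReal_add_le.trans (add_le_add (ofReal_integral_le_htv hF h1 _) ?_)
    have e2 : ∫ x, (u x - w k x) * hdiv F x = ∫ x in A, (u x - w k x) * hdiv F x := by
      refine (setIntegral_eq_integral_of_forall_compl_eq_zero fun x hx => ?_).symm
      rw [image_eq_zero_of_notMem_tsupport fun h => hx (hF.tsupport_hdiv_subset h), mul_zero]
    rw [e2]
    refine (ENNReal.ofReal_le_ofReal (le_abs_self _)).trans ?_
    rw [← Real.norm_eq_abs, ofReal_norm]
    refine (enorm_integral_le_lintegral_enorm _).trans ?_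
    rw [eLpNorm_one_eq_lintegral_enorm, ← lintegral_const_mul' _ _ ENNReal.ofReal_ne_top]
    refine lintegral_mono fun x => ?_
    rw [enorm_mul, mul_comm]
    refine mul_le_mul' ?_ ?_
    · rw [← ofReal_norm]; exact ENNReal.ofReal_le_ofReal (hC x)
    · rw [Pi.sub_apply, ← enorm_neg, neg_sub]
  have h0 : Tendsto (fun k => ENNReal.ofReal C * eLpNorm (w k - u) 1 (volume.restrict A)) l (𝓝 0) := by
    simpa using ENNReal.Tendsto.const_mul h (Or.inr ENNReal.ofReal_ne_top)
  rcases l.eq_or_neBot with rfl | hl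
  · simp
  refine ENNReal.le_of_forall_pos_le_add fun ε hε hfin => ?_
  have hev : ∀ᶠ k in l, ENNReal.ofReal C * eLpNorm (w k - u) 1 (volume.restrict A) ≤ ε :=
    (h0.eventually (ge_mem_nhds (by simpa using hε)))
  have : ENNReal.ofReal (∫ x, u x * hdiv F x) - ε ≤ liminf (fun k => htv 1 (w k) A) l := by
    refine le_liminf_of_le (by isBoundedDefault) ?_
    filter_upwards [hev] with k hk
    rw [tsub_le_iff_right]
    exact (hle k).trans (add_le_add le_rfl hk)
  rwa [tsub_le_iff_right] at this

/-- Superadditivity over disjoint sets. -/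
theorem htv_add_htv_le {C : Set (Eu n)} (hAB : Disjoint A B) (hA : A ⊆ C) (hB : B ⊆ C)
    (hu : LocallyIntegrableOn u C) : htv 1 u A + htv 1 u B ≤ htv 1 u C := by
  by_cases hfin : htv 1 u C = ⊤
  · simp [hfin]
  -- The two supports are disjoint, so at each point at most one of `F`, `G` is nonzero and `F + G`
  -- is again admissible.
  have key : ∀ F, IsSmoothField A F → (∀ x, OpLeOne (F x)) → ∀ G, IsSmoothField B G →
      (∀ x, OpLeOne (G x)) → (∫ x, u x * hdiv F x) + ∫ x, u x * hdiv G x ≤ (htv 1 u C).toReal := by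
    intro F hF hF1 G hG hG1
    have e : (∫ x, u x * hdiv F x) + ∫ x, u x * hdiv G x = ∫ x, u x * hdiv (F + G) x := by
      rw [← integral_add ((hF.mono hA).integrable hu) ((hG.mono hB).integrable hu),
        hF.hdiv_add hG]
      congr 1; ext x; ring
    rw [e]
    refine integral_le_toReal_htv ((hF.mono hA).add (hG.mono hB)) (fun x => ?_) hfin
    by_cases hx : x ∈ A
    · have : G x = 0 := by
        ext i j
        exact image_eq_zero_of_notMem_tsupport (f := fun y => G y i j)
          fun h => hAB.le_bot ⟨hx, hG.3 i j h⟩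
      rw [Pi.add_apply, this, add_zero]; exact hF1 x
    · have : F x = 0 := by
        ext i j
        exact image_eq_zero_of_notMem_tsupport (f := fun y => F y i j) fun h => hx (hF.3 i j h)
      rw [Pi.add_apply, this, zero_add]; exact hG1 x
  have hAf : htv 1 u A ≠ ⊤ := ne_top_of_le_ne_top hfin (htv_mono u hA)
  have hBf : htv 1 u B ≠ ⊤ := ne_top_of_le_ne_top hfin (htv_mono u hB)
  -- The supremum is taken over `G` with `F` fixed, and then over `F`.
  have step : ∀ F, IsSmoothField A F → (∀ x, OpLeOne (F x)) →
      htv 1 u B ≤ ENNReal.ofReal ((htv 1 u C).toReal - ∫ x, u x * hdiv F x) := fun F hF hF1 =>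
    htv_le_of_forall fun G hG hG1 =>
      ENNReal.ofReal_le_ofReal (by linarith [key F hF hF1 G hG hG1])
  have hB' : ∀ F, IsSmoothField A F → (∀ x, OpLeOne (F x)) →
      ∫ x, u x * hdiv F x ≤ (htv 1 u C).toReal - (htv 1 u B).toReal := by
    intro F hF hF1
    have h0 := key F hF hF1 0 (IsSmoothField.zero B) fun x => OpLeOne.zero
    simp only [IsSmoothField.hdiv_zero, Pi.zero_apply, mul_zero, integral_zero, add_zero] at h0
    have := ENNReal.toReal_mono ENNReal.ofReal_ne_top (step F hF hF1)
    rw [ENNReal.toReal_ofReal (by linarith)] at this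
    linarith
  have hfinal : htv 1 u A ≤ ENNReal.ofReal ((htv 1 u C).toReal - (htv 1 u B).toReal) :=
    htv_le_of_forall fun F hF hF1 => ENNReal.ofReal_le_ofReal (hB' F hF hF1)
  have h5 : (htv 1 u B).toReal ≤ (htv 1 u C).toReal := ENNReal.toReal_mono hfin (htv_mono u hB)
  calc htv 1 u A + htv 1 u B ≤ ENNReal.ofReal ((htv 1 u C).toReal - (htv 1 u B).toReal) +
        ENNReal.ofReal (htv 1 u B).toReal := by
        rw [ENNReal.ofReal_toReal hBf]; exact add_le_add hfinal le_rfl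
    _ = htv 1 u C := by
        rw [← ENNReal.ofReal_add (by linarith) ENNReal.toReal_nonneg, sub_add_cancel,
          ENNReal.ofReal_toReal hfin]

theorem sum_htv_le {ι : Type*} (s : Finset ι) {U : ι → Set (Eu n)}
    (hd : ∀ k ∈ s, ∀ l ∈ s, k ≠ l → Disjoint (U k) (U l)) (hU : ∀ k ∈ s, U k ⊆ A)
    (hu : LocallyIntegrableOn u A) : ∑ k ∈ s, htv 1 u (U k) ≤ htv 1 u A := by
  classical
  have : ∑ k ∈ s, htv 1 u (U k) ≤ htv 1 u (⋃ k ∈ s, U k) := by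
    induction s using Finset.induction_on with
    | empty => simp
    | insert a s ha ih =>
      rw [Finset.sum_insert ha]
      have ih' := ih (fun k hk l hl => hd k (by simp [hk]) l (by simp [hl]))
        (fun k hk => hU k (by simp [hk]))
      refine (add_le_add le_rfl ih').trans ?_
      refine htv_add_htv_le ?_ ?_ ?_ (hu.mono_set (Set.iUnion₂_subset hU))
      · rw [Set.disjoint_iUnion₂_right]
        exact fun k hk => hd a (by simp) k (by simp [hk]) (by rintro rfl; exact ha hk)
      · exact Set.subset_iUnion₂_of_subset a (by simp) le_rfl
      · exact Set.biUnion_subset_biUnion_left fun k hk => by simp [hk]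
  exact this.trans (htv_mono u (Set.iUnion₂_subset hU))

theorem integral_comp_homothety (g : Eu n → ℝ) (c : Eu n) {s : ℝ} (hs : 0 < s) :
    ∫ x, g (c + s • x) = (s ^ n)⁻¹ * ∫ x, g x := by
  have := Measure.integral_comp_smul (volume : Measure (Eu n)) (fun x => g (c + x)) s
  rw [this, integral_add_left_eq_self g c]
  simp [abs_of_pos hs]

/-- Two derivatives give `s ^ 2` and the change of variables divides by `s ^ n`; the rescaled field
keeps its pointwise bound and stays admissible. -/
theorem htv_comp_homothety_le (u : Eu n → ℝ) (A : Set (Eu n)) (c : Eu n) {s : ℝ} (hs : 0 < s) :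
    htv 1 (fun x => u (c + s • x)) ((fun x => c + s • x) ⁻¹' A) ≤
      ENNReal.ofReal (s ^ 2 / s ^ n) * htv 1 u A := by
  refine htv_le_of_forall fun F hF h1 => ?_
  set G : Eu n → Matrix (Fin n) (Fin n) ℝ := fun x => F (-(s⁻¹ • c) + s⁻¹ • x) with hG
  have hGF : ∀ x, G (c + s • x) = F x := by
    intro x; simp only [hG]; congr 1
    rw [smul_add, smul_smul, inv_mul_cancel₀ hs.ne']; simp
  have hGs : IsSmoothField A G := by
    have := hF.comp_homothety (-(s⁻¹ • c)) (s := s⁻¹) (inv_ne_zero hs.ne')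
    have e : (fun x : Eu n => -(s⁻¹ • c) + s⁻¹ • x) ⁻¹' ((fun x => c + s • x) ⁻¹' A) = A := by
      ext x
      simp only [Set.mem_preimage, smul_add, smul_neg, smul_smul, mul_inv_cancel₀ hs.ne']
      simp
    rwa [e] at this
  have hd : hdiv F = fun x => s ^ 2 * hdiv G (c + s • x) := by
    rw [← hGs.hdiv_comp_homothety c s]; congr 1; ext x; rw [hGF]
  have : ∫ x, u (c + s • x) * hdiv F x = s ^ 2 / s ^ n * ∫ x, u x * hdiv G x := by
    rw [hd]
    have := integral_comp_homothety (fun x => s ^ 2 * (u x * hdiv G x)) c hs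
    calc _ = ∫ x, s ^ 2 * (u (c + s • x) * hdiv G (c + s • x)) := by congr 1; ext x; ring
      _ = _ := by rw [this, integral_const_mul]; ring
  rw [this, ENNReal.ofReal_mul (by positivity)]
  exact mul_le_mul_right (ofReal_integral_le_htv hGs (fun x => h1 _) u) _

end Basic

/-! ### Solving a double divergence equation with sup bounds. -/

section Bogovskii
variable {n : ℕ}

/-- The `i`-th standard basis vector. -/
abbrev stdVec (i : Fin n) : Eu n := EuclideanSpace.single i 1

/-- `φ` vanishes off the closed box `[α, 1 - α]ⁿ`. -/
def ZeroOff (α : ℝ) (φ : Eu n → ℝ) : Prop :=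
  ∀ (x : Eu n) (i : Fin n), (x i < α ∨ 1 - α < x i) → φ x = 0

/-- The closed box `[α, 1 - α]ⁿ`. -/
def box (n : ℕ) (α : ℝ) : Set (Eu n) := {x | ∀ i, α ≤ x i ∧ x i ≤ 1 - α}

theorem isClosed_box (α : ℝ) : IsClosed (box n α) := by
  have : box n α = ⋂ i : Fin n, {x : Eu n | α ≤ x i ∧ x i ≤ 1 - α} := by
    ext x; simp [box]
  rw [this]
  refine isClosed_iInter fun i => ?_
  have hc : Continuous fun x : Eu n => x i := by fun_prop
  exact (isClosed_le continuous_const hc).inter (isClosed_le hc continuous_const)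

theorem norm_le_of_abs_le {x : Eu n} {M : ℝ} (h : ∀ i, |x i| ≤ M) : ‖x‖ ≤ √n * M := by
  rcases Nat.eq_zero_or_pos n with rfl | hn
  · have : x = 0 := Subsingleton.elim _ _
    simp [this]
  have hM : 0 ≤ M := (abs_nonneg _).trans (h ⟨0, hn⟩)
  refine le_of_sq_le_sq ?_ (by positivity)
  rw [EuclideanSpace.norm_sq_eq, mul_pow, Real.sq_sqrt (by positivity)]
  calc ∑ i, ‖x i‖ ^ 2 ≤ ∑ _i : Fin n, M ^ 2 :=
        Finset.sum_le_sum fun i _ => pow_le_pow_left₀ (norm_nonneg _) (h i) 2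
    _ = n * M ^ 2 := by simp

theorem isCompact_box {α : ℝ} (hα : 0 ≤ α) : IsCompact (box n α) := by
  refine Metric.isCompact_of_isClosed_isBounded (isClosed_box α) ?_
  refine (Metric.isBounded_iff_subset_closedBall 0).2 ⟨√n * 1, fun x hx => ?_⟩
  rw [mem_closedBall_zero_iff]
  refine norm_le_of_abs_le fun i => ?_
  obtain ⟨h1, h2⟩ := hx i
  rw [abs_le]; constructor <;> linarith

theorem box_subset_cube {α : ℝ} (hα : 0 < α) : box n α ⊆ cube n := fun x hx i =>
  ⟨hα.trans_le (hx i).1, by linarith [(hx i).2]⟩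

namespace ZeroOff
variable {α : ℝ} {φ ψ : Eu n → ℝ}

theorem tsupport_subset (h : ZeroOff α φ) : tsupport φ ⊆ box n α := by
  refine closure_minimal (fun x hx => ?_) (isClosed_box α)
  intro i
  by_contra hc
  refine hx (h x i ?_)
  by_contra h2
  push Not at h2
  exact hc ⟨h2.1, h2.2⟩

theorem hasCompactSupport (h : ZeroOff α φ) (hα : 0 ≤ α) : HasCompactSupport φ :=
  (isCompact_box hα).of_isClosed_subset (isClosed_tsupport _) h.tsupport_subset

theorem sub (h : ZeroOff α φ) (h' : ZeroOff α ψ) : ZeroOff α fun x => φ x - ψ x :=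
  fun x i hx => by simp only [h x i hx, h' x i hx, sub_zero]

/-- The line through `x` in direction `i` meets the unit box for `t` in an interval of length one,
so the bound involves no constant depending on `α`. -/
theorem norm_fiber_le (h : ZeroOff α φ) (hα : 0 ≤ α) {M : ℝ} (hM : ∀ x, |φ x| ≤ M) {f : ℝ → ℝ}
    (hf : ∀ t, |f t| ≤ 1) (i : Fin n) (x : Eu n) :
    |∫ t, f t * φ (x - t • stdVec i)| ≤ M := by
  have hM0 : 0 ≤ M := (abs_nonneg _).trans (hM 0)
  have e : ∫ t, f t * φ (x - t • stdVec i) =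
      ∫ t in Set.Icc (x i - 1) (x i), f t * φ (x - t • stdVec i) := by
    refine (setIntegral_eq_integral_of_forall_compl_eq_zero fun t ht => ?_).symm
    rw [h _ i ?_, mul_zero]
    by_contra hc
    push Not at hc
    simp at hc
    exact ht ⟨by linarith, by linarith⟩
  rw [e, ← Real.norm_eq_abs]
  have := norm_setIntegral_le_of_norm_le_const (μ := volume) (s := Set.Icc (x i - 1) (x i))
    (f := fun t => f t * φ (x - t • stdVec i)) (C := M) (by simp) (fun t _ => by
      rw [Real.norm_eq_abs, abs_mul]
      calc |f t| * |φ (x - t • stdVec i)| ≤ 1 * M :=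
            mul_le_mul (hf t) (hM _) (abs_nonneg _) zero_le_one
        _ = M := one_mul M)
  simpa using this

end ZeroOff

/-- An integral along lines is a one-dimensional convolution with parameter `x`, evaluated at `0`.
For bounded parameters the smooth factor is supported in a fixed interval, which gives smoothness on
every ball. -/
theorem contDiff_fiberIntegral {φ : Eu n → ℝ} (hφ : ContDiff ℝ ∞ φ) (hc : HasCompactSupport φ)
    {f : ℝ → ℝ} (hf : LocallyIntegrable f) (i : Fin n) :
    ContDiff ℝ ∞ fun x => ∫ t, f t * φ (x - t • stdVec i) := by
  obtain ⟨R, hR⟩ := hc.isCompact.isBounded.subset_closedBall 0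
  have hloc : ∀ r : ℝ, ContDiffOn ℝ ∞ (fun x => ∫ t, f t * φ (x - t • stdVec i))
      (Metric.ball 0 r) := by
    intro r
    have := contDiffOn_convolution_right_with_param_comp (μ := (volume : Measure ℝ)) (n := ⊤)
      (ContinuousLinearMap.mul ℝ ℝ) (s := Metric.ball (0 : Eu n) r) (v := fun _ => (0 : ℝ))
      contDiffOn_const (f := f) (g := fun p u => φ (p + u • stdVec i))
      (k := Set.Icc (-(R + r)) (R + r)) Metric.isOpen_ball isCompact_Icc ?_ hf ?_
    · refine this.congr fun x _ => ?_
      simp only [convolution, ContinuousLinearMap.mul_apply', zero_sub, neg_smul,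
        sub_eq_add_neg x, zero_sub]
    · intro p u hp hu
      by_contra h0
      apply hu
      have h1 : p + u • stdVec i ∈ Metric.closedBall (0 : Eu n) R := hR (subset_tsupport _ h0)
      rw [mem_closedBall_zero_iff] at h1
      rw [mem_ball_zero_iff] at hp
      have h2 : |u| = ‖u • stdVec i‖ := by simp [norm_smul]
      have h3 : ‖u • stdVec i‖ ≤ ‖p + u • stdVec i‖ + ‖p‖ := by
        have := norm_sub_le (p + u • stdVec i) p
        rwa [add_sub_cancel_left] at this
      rw [Set.mem_Icc, ← abs_le, h2]; linarith
    · refine ContDiff.contDiffOn ?_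
      exact hφ.comp (contDiff_fst.add (contDiff_snd.smul contDiff_const))
  rw [contDiff_iff_contDiffAt]
  intro x
  exact (hloc (‖x‖ + 1)).contDiffAt (Metric.isOpen_ball.mem_nhds (by simp))

theorem continuous_fiber {φ : Eu n → ℝ} (hφ : Continuous φ) (x : Eu n) (i : Fin n) :
    Continuous fun t : ℝ => φ (x - t • stdVec i) :=
  hφ.comp (continuous_const.sub (continuous_id.smul continuous_const))

theorem integrable_fiber {φ : Eu n → ℝ} (hφ : Continuous φ) (hc : HasCompactSupport φ) (x : Eu n)
    (i : Fin n) : Integrable fun t : ℝ => φ (x - t • stdVec i) := by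
  refine (continuous_fiber hφ x i).integrable_of_hasCompactSupport ?_
  obtain ⟨R, hR⟩ := hc.isCompact.isBounded.subset_closedBall 0
  refine HasCompactSupport.intro (K := Set.Icc (-(R + ‖x‖)) (R + ‖x‖)) isCompact_Icc ?_
  intro u hu
  by_contra h0
  apply hu
  have h1 := hR (subset_tsupport _ h0)
  rw [mem_closedBall_zero_iff] at h1
  have h2 : |u| = ‖u • stdVec i‖ := by simp [norm_smul]
  have h3 : ‖u • stdVec i‖ ≤ ‖x - u • stdVec i‖ + ‖x‖ := by
    have := norm_sub_le x (x - u • stdVec i)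
    rw [sub_sub_cancel] at this; linarith
  rw [Set.mem_Icc, ← abs_le, h2]; linarith

/-- The half-line integral is the primitive of `φ` from `-∞` along the line, so this is the
fundamental theorem of calculus. -/
theorem partialDeriv_halfline_integral {φ : Eu n → ℝ} (hφ : ContDiff ℝ ∞ φ)
    (hc : HasCompactSupport φ) (i : Fin n) (x : Eu n) :
    partialDeriv i (fun x => ∫ t, (Set.Ici (0 : ℝ)).indicator 1 t * φ (x - t • stdVec i)) x =
      φ x := by
  set H : Eu n → ℝ := fun x => ∫ t, (Set.Ici (0 : ℝ)).indicator 1 t * φ (x - t • stdVec i) with hH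
  have hloc : LocallyIntegrable ((Set.Ici (0 : ℝ)).indicator (1 : ℝ → ℝ)) :=
    (locallyIntegrable_const (1 : ℝ)).indicator measurableSet_Ici
  have hdiff : DifferentiableAt ℝ H x :=
    (contDiff_fiberIntegral hφ hc hloc i).differentiable (by simp) x
  have h1 : HasDerivAt (fun s : ℝ => H (x + s • stdVec i)) (partialDeriv i H x) 0 := by
    have h2 : HasDerivAt (fun s : ℝ => x + s • stdVec i) (stdVec i) 0 := by
      have := ((hasDerivAt_id (0 : ℝ)).smul_const (stdVec i)).const_add x
      simpa using this
    have h3 : HasFDerivAt H (fderiv ℝ H x) (x + (0 : ℝ) • stdVec i) := by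
      simpa using hdiff.hasFDerivAt
    exact h3.comp_hasDerivAt 0 h2
  set g : ℝ → ℝ := fun u => φ (x + u • stdVec i)
  have hgc : Continuous g := hφ.continuous.comp (by fun_prop)
  have hgi : Integrable g := by
    have := (integrable_fiber hφ.continuous hc x i).comp_neg
    simpa [g] using this
  have h4 : ∀ s, H (x + s • stdVec i) = ∫ u in Set.Iic s, g u := by
    intro s
    have e1 : H (x + s • stdVec i) = ∫ t, (Set.Iic s).indicator g (s - t) := by
      simp only [hH]
      congr 1; ext t
      by_cases ht : 0 ≤ t
      · rw [Set.indicator_of_mem (by simpa using ht), Set.indicator_of_mem (by simpa using ht)]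
        simp only [Pi.one_apply, one_mul, g, sub_smul]
        congr 1; abel
      · rw [Set.indicator_of_notMem (by simpa using ht),
          Set.indicator_of_notMem (by simpa using ht), zero_mul]
    rw [e1, integral_sub_left_eq_self (fun u => (Set.Iic s).indicator g u) volume s,
      integral_indicator measurableSet_Iic]
  have h5 : HasDerivAt (fun s : ℝ => ∫ u in Set.Iic s, g u) (g 0) 0 := by
    have e : (fun s : ℝ => ∫ u in Set.Iic s, g u) =
        fun s => (∫ u in Set.Iic (0 : ℝ), g u) + ∫ u in (0 : ℝ)..s, g u := by
      ext s
      rw [← intervalIntegral.integral_Iic_sub_Iic hgi.integrableOn hgi.integrableOn]; ring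
    rw [e]
    exact (intervalIntegral.integral_hasDerivAt_right (hgc.intervalIntegrable _ _)
      (hgc.stronglyMeasurableAtFilter _ _) hgc.continuousAt).const_add _
  have h6 : (fun s : ℝ => H (x + s • stdVec i)) = fun s : ℝ => ∫ u in Set.Iic s, g u := funext h4
  rw [h6] at h1
  rw [h1.unique h5]; simp [g]

/-- A normalized bump function on `(0,1)`. -/
theorem exists_unit_bump : ∃ η : ℝ → ℝ, ContDiff ℝ ∞ η ∧ (∀ t, 0 ≤ η t) ∧
    (∀ t, t < 1 / 4 ∨ 3 / 4 < t → η t = 0) ∧ ∫ t, η t = 1 ∧ (0 < η (1 / 2)) ∧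
    ∃ C : ℝ, 1 ≤ C ∧ ∀ t, η t ≤ C := by
  let b : ContDiffBump (1 / 2 : ℝ) := ⟨1 / 8, 1 / 4, by norm_num, by norm_num⟩
  refine ⟨b.normed volume, b.contDiff_normed, fun t => b.nonneg_normed t, fun t ht => ?_,
    b.integral_normed, ?_, ?_⟩
  · by_contra h0
    have h1 : t ∈ Function.support (b.normed volume) := h0
    rw [b.support_normed_eq, Metric.mem_ball, Real.dist_eq, abs_lt] at h1
    have : b.rOut = 1 / 4 := rfl
    rw [this] at h1
    rcases ht with ht | ht <;> linarith [h1.1, h1.2]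
  · have h1 : (1 / 2 : ℝ) ∈ Function.support (b.normed volume) := by
      rw [b.support_normed_eq]; exact Metric.mem_ball_self b.rOut_pos
    exact lt_of_le_of_ne (b.nonneg_normed _) (Ne.symm h1)
  · obtain ⟨C, hC⟩ := b.hasCompactSupport_normed.exists_bound_of_continuous
      (b.contDiff_normed (μ := volume) (n := 0)).continuous
    exact ⟨max C 1, le_max_right _ _, fun t => (le_abs_self _).trans ((hC t).trans (le_max_left _ _))⟩

/-- In the `i`-th variable, `φ` is a multiple of `η`. -/
def ProfileIn (η : ℝ → ℝ) (i : Fin n) (φ : Eu n → ℝ) : Prop :=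
  ∀ (x : Eu n) (t : ℝ), η (x i) * φ (x + t • stdVec i) = η (x i + t) * φ x

theorem stdVec_self (i : Fin n) : (stdVec i : Eu n) i = 1 := by simp
theorem stdVec_ne {i j : Fin n} (h : j ≠ i) : (stdVec i : Eu n) j = 0 := by simp [h]

/-- On each line in direction `i`, `φ` is replaced by its line integral times `η`. The difference
has zero line integrals, so its primitive along the lines still vanishes off the box. The last
clause keeps the profiles acquired in earlier variables. -/
theorem exists_partialDeriv_add_profile {η : ℝ → ℝ} (hη : ContDiff ℝ ∞ η)
    (hη0 : ∀ t, t < 1 / 4 ∨ 3 / 4 < t → η t = 0) (hηi : ∫ t, η t = 1) (hηn : ∀ t, 0 ≤ η t)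
    {C : ℝ} (hC : ∀ t, η t ≤ C) (i : Fin n) {α : ℝ} (hα : 0 ≤ α) (hα' : α ≤ 1 / 4)
    {φ : Eu n → ℝ} (hφ : ContDiff ℝ ∞ φ) (h0 : ZeroOff α φ) {M : ℝ} (hM : ∀ x, |φ x| ≤ M) :
    ∃ φ' H : Eu n → ℝ, ContDiff ℝ ∞ φ' ∧ ContDiff ℝ ∞ H ∧ ZeroOff α φ' ∧ ZeroOff α H ∧
      (∀ x, |φ' x| ≤ C * M) ∧ (∀ x, |H x| ≤ (1 + C) * M) ∧
      (∀ x, φ x = φ' x + partialDeriv i H x) ∧ ProfileIn η i φ' ∧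
      ∀ j, ProfileIn η j φ → ProfileIn η j φ' := by
  have hM0 : 0 ≤ M := (abs_nonneg _).trans (hM 0)
  have hC0 : 0 ≤ C := (hηn 0).trans (hC 0)
  have hcs := h0.hasCompactSupport hα
  set I : Eu n → ℝ := fun x => ∫ t : ℝ, (1 : ℝ) * φ (x - t • stdVec i) with hI
  have hIs : ContDiff ℝ ∞ I := contDiff_fiberIntegral hφ hcs (locallyIntegrable_const (1 : ℝ)) i
  have hIM : ∀ x, |I x| ≤ M := fun x => h0.norm_fiber_le hα hM (f := fun _ => 1) (by simp) i x
  have hIt : ∀ (x : Eu n) (s : ℝ), I (x + s • stdVec i) = I x := by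
    intro x s
    simp only [hI, one_mul]
    rw [← integral_add_right_eq_self (fun t => φ (x + s • stdVec i - t • stdVec i)) s]
    congr 1; ext t; congr 1; rw [add_smul]; abel
  have hI0 : ∀ (x : Eu n) (j : Fin n), j ≠ i → (x j < α ∨ 1 - α < x j) → I x = 0 := by
    intro x j hj hx
    simp only [hI]
    refine integral_eq_zero_of_ae (Eventually.of_forall fun t => ?_)
    simp only [Pi.zero_apply, one_mul]
    refine h0 _ j ?_
    simpa [hj] using hx
  set φ' : Eu n → ℝ := fun x => η (x i) * I x with hφ'
  have hφ's : ContDiff ℝ ∞ φ' := by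
    refine ContDiff.mul (hη.comp ?_) hIs
    exact (EuclideanSpace.proj (𝕜 := ℝ) i).contDiff
  have hφ'0 : ZeroOff α φ' := by
    intro x j hx
    by_cases hj : j = i
    · subst hj
      simp only [hφ']
      rw [hη0 _ (hx.imp (fun h => by linarith) fun h => by linarith), zero_mul]
    · simp only [hφ']; rw [hI0 x j hj hx, mul_zero]
  have hφ'M : ∀ x, |φ' x| ≤ C * M := by
    intro x
    simp only [hφ', abs_mul, abs_of_nonneg (hηn _)]
    exact mul_le_mul (hC _) (hIM x) (abs_nonneg _) hC0
  set ζ : Eu n → ℝ := fun x => φ x - φ' x with hζ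
  have hζs : ContDiff ℝ ∞ ζ := hφ.sub hφ's
  have hζ0 : ZeroOff α ζ := h0.sub hφ'0
  have hζM : ∀ x, |ζ x| ≤ (1 + C) * M := by
    intro x
    calc |ζ x| ≤ |φ x| + |φ' x| := abs_sub _ _
      _ ≤ M + C * M := add_le_add (hM x) (hφ'M x)
      _ = _ := by ring
  have hζc := hζ0.hasCompactSupport hα
  have hloc : LocallyIntegrable ((Set.Ici (0 : ℝ)).indicator (1 : ℝ → ℝ)) :=
    (locallyIntegrable_const (1 : ℝ)).indicator measurableSet_Ici
  set H : Eu n → ℝ := fun x => ∫ t, (Set.Ici (0 : ℝ)).indicator 1 t * ζ (x - t • stdVec i) with hH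
  refine ⟨φ', H, hφ's, contDiff_fiberIntegral hζs hζc hloc i, hφ'0, ?_, hφ'M, ?_, ?_, ?_, ?_⟩
  · intro x j hx
    by_cases hj : j = i
    · subst hj
      rcases hx with hx | hx
      · simp only [hH]
        refine integral_eq_zero_of_ae (Eventually.of_forall fun t => ?_)
        by_cases ht : 0 ≤ t
        · have : ζ (x - t • stdVec j) = 0 := hζ0 _ j (Or.inl (by simp; linarith))
          simp [this]
        · simp [Set.indicator, ht]
      -- Beyond the far face of the box the half-line integral of `ζ` is its full line integral,
      -- which vanishes because `η` has integral one.
      · have e1 : H x = ∫ t : ℝ, ζ (x - t • stdVec j) := by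
          simp only [hH]
          congr 1; ext t
          by_cases ht : 0 ≤ t
          · rw [Set.indicator_of_mem (by simpa using ht)]; simp
          · have : ζ (x - t • stdVec j) = 0 := hζ0 _ j (Or.inr (by simp; linarith))
            simp [this]
        rw [e1]
        simp only [hζ]
        rw [integral_sub (integrable_fiber hφ.continuous hcs x j)
          (integrable_fiber hφ's.continuous (hφ'0.hasCompactSupport hα) x j)]
        have e2 : ∀ t : ℝ, φ' (x - t • stdVec j) = η (x j - t) * I x := by
          intro t
          have := hIt x (-t)
          rw [neg_smul, ← sub_eq_add_neg] at this
          simp only [hφ', this]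
          simp
        simp only [e2]
        rw [integral_mul_const, integral_sub_left_eq_self η volume (x j), hηi, one_mul]
        simp [hI]
    · simp only [hH]
      refine integral_eq_zero_of_ae (Eventually.of_forall fun t => ?_)
      have : ζ (x - t • stdVec i) = 0 := hζ0 _ j (by simpa [hj] using hx)
      simp [this]
  · refine fun x => hζ0.norm_fiber_le hα hζM (fun t => ?_) i x
    by_cases ht : t ∈ Set.Ici (0 : ℝ) <;> simp [ht]
  · intro x
    rw [partialDeriv_halfline_integral hζs hζc i x]; simp [hζ]
  · intro x t
    simp only [hφ', hIt, PiLp.add_apply, PiLp.smul_apply, stdVec_self, smul_eq_mul, mul_one]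
    ring
  · intro j hj x t
    by_cases hji : j = i
    · subst hji
      simp only [hφ', hIt, PiLp.add_apply, PiLp.smul_apply, stdVec_self, smul_eq_mul, mul_one]
      ring
    · have e : η (x j) * I (x + t • stdVec j) = η (x j + t) * I x := by
        simp only [hI]
        rw [← integral_const_mul, ← integral_const_mul]
        congr 1; ext s
        have := hj (x - s • stdVec i) t
        simp only [PiLp.sub_apply, PiLp.smul_apply, stdVec_ne hji, smul_zero, sub_zero] at this
        rw [one_mul, one_mul, ← this]; congr 2; abel
      have hij : i ≠ j := fun h => hji h.symm
      simp only [hφ', PiLp.add_apply, PiLp.smul_apply, stdVec_ne hij, smul_zero, add_zero]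
      linear_combination η (x i) * e

/-- One variable is treated at a time. The constant must not depend on `α`, because the box will
depend on the support of an arbitrary test function. -/
theorem exists_partialDeriv_sum_add_profile {η : ℝ → ℝ} (hη : ContDiff ℝ ∞ η)
    (hη0 : ∀ t, t < 1 / 4 ∨ 3 / 4 < t → η t = 0) (hηi : ∫ t, η t = 1) (hηn : ∀ t, 0 ≤ η t)
    {K : ℝ} (hK : ∀ t, η t ≤ K) (s : Finset (Fin n)) :
    ∃ C : ℝ, 0 ≤ C ∧ ∀ (α : ℝ), 0 ≤ α → α ≤ 1 / 4 → ∀ (φ : Eu n → ℝ) (M : ℝ), ContDiff ℝ ∞ φ →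
      ZeroOff α φ → (∀ x, |φ x| ≤ M) → ∃ (φ' : Eu n → ℝ) (G : Fin n → Eu n → ℝ),
        ContDiff ℝ ∞ φ' ∧ ZeroOff α φ' ∧ (∀ x, |φ' x| ≤ C * M) ∧ (∀ i, ContDiff ℝ ∞ (G i)) ∧
        (∀ i, ZeroOff α (G i)) ∧ (∀ i x, |G i x| ≤ C * M) ∧
        (∀ x, φ x = φ' x + ∑ i ∈ s, partialDeriv i (G i) x) ∧ ∀ i ∈ s, ProfileIn η i φ' := by
  have hK0 : 0 ≤ K := (hηn 0).trans (hK 0)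
  classical
  induction s using Finset.induction_on with
  | empty =>
    refine ⟨1, zero_le_one, fun α _ _ φ M hφ h0 hM => ⟨φ, fun _ _ => 0, hφ, h0, ?_, ?_, ?_, ?_, ?_, ?_⟩⟩
    · simpa using hM
    · exact fun i => contDiff_const
    · exact fun i x j _ => rfl
    · intro i x; simpa using (abs_nonneg _).trans (hM 0)
    · simp
    · simp
  | insert a s ha ih =>
    obtain ⟨C, hC0, hC⟩ := ih
    refine ⟨max C ((1 + K) * C), le_max_of_le_left hC0, fun α h1 h2 φ M hφ h0 hM => ?_⟩
    have hM0 : 0 ≤ M := (abs_nonneg _).trans (hM 0)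
    obtain ⟨ψ, G, hψ, hψ0, hψM, hG, hG0, hGM, hdec, hprof⟩ := hC α h1 h2 φ M hφ h0 hM
    obtain ⟨φ', H, k1, k2, k3, k4, k5, k6, k7, k8, k9⟩ :=
      exists_partialDeriv_add_profile hη hη0 hηi hηn hK a h1 h2 hψ hψ0 hψM
    have hb1 : K * (C * M) ≤ max C ((1 + K) * C) * M := by
      calc K * (C * M) ≤ (1 + K) * C * M := by nlinarith [mul_nonneg hC0 hM0]
        _ ≤ _ := by gcongr; exact le_max_right _ _
    have hb2 : (1 + K) * (C * M) ≤ max C ((1 + K) * C) * M := by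
      calc (1 + K) * (C * M) = (1 + K) * C * M := by ring
        _ ≤ _ := by gcongr; exact le_max_right _ _
    have hb3 : C * M ≤ max C ((1 + K) * C) * M := by gcongr; exact le_max_left _ _
    refine ⟨φ', Function.update G a H, k1, k3, fun x => (k5 x).trans hb1, ?_, ?_, ?_, ?_, ?_⟩
    · intro i
      rcases eq_or_ne i a with rfl | hi
      · simpa using k2
      · simpa [hi] using hG i
    · intro i
      rcases eq_or_ne i a with rfl | hi
      · simpa using k4
      · simpa [hi] using hG0 i
    · intro i x
      rcases eq_or_ne i a with rfl | hi
      · simpa using (k6 x).trans hb2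
      · simpa [hi] using (hGM i x).trans hb3
    · intro x
      rw [Finset.sum_insert ha, hdec x, k7 x, Function.update_self, add_assoc]
      congr 2
      refine Finset.sum_congr rfl fun i hi => ?_
      rw [Function.update_of_ne (by rintro rfl; exact ha hi)]
    · intro i hi
      rcases Finset.mem_insert.1 hi with rfl | hi
      · exact k8
      · exact k9 i (hprof i hi)

theorem integral_partialDeriv_eq_zero {φ : Eu n → ℝ} (hφ : ContDiff ℝ ∞ φ)
    (hc : HasCompactSupport φ) (i : Fin n) : ∫ x, partialDeriv i φ x = 0 := by
  have := integral_mul_partialDeriv i (u := fun _ => (1 : ℝ)) contDiff_const hφ hc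
  simpa [partialDeriv_const] using this

/-- Moving the coordinates of `x` one after the other to those of the centre `y` shows that `φ` is a
multiple of the product of the `η (x i)`. That product has positive integral, so zero mean forces
the multiple to vanish. -/
theorem eq_zero_of_profileIn {η : ℝ → ℝ} (hη : Continuous η) (hηn : ∀ t, 0 ≤ η t)
    (hη1 : 0 < η (1 / 2)) (hη0 : ∀ t, t < 1 / 4 ∨ 3 / 4 < t → η t = 0) {φ : Eu n → ℝ}
    (hp : ∀ i, ProfileIn η i φ) (hi : ∫ x, φ x = 0) (x : Eu n) : φ x = 0 := by
  classical
  set y : Eu n := WithLp.toLp 2 fun _ => (1 / 2 : ℝ) with hy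
  have hyi : ∀ i, y i = 1 / 2 := fun i => rfl
  have key : ∀ (x : Eu n) (s : Finset (Fin n)), (∏ i ∈ s, η (x i)) *
      φ (x + ∑ i ∈ s, (y i - x i) • stdVec i) = (∏ i ∈ s, η (y i)) * φ x := by
    intro x s
    induction s using Finset.induction_on with
    | empty => simp
    | insert a s ha ih =>
      have hcoord : (x + ∑ i ∈ s, (y i - x i) • stdVec i : Eu n) a = x a := by
        rw [PiLp.add_apply, WithLp.ofLp_sum, Finset.sum_apply, Finset.sum_eq_zero, add_zero]
        intro i hi
        have : a ≠ i := by rintro rfl; exact ha hi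
        simp [this]
      have h1 := hp a (x + ∑ i ∈ s, (y i - x i) • stdVec i) (y a - x a)
      rw [hcoord, add_sub_cancel] at h1
      rw [Finset.prod_insert ha, Finset.prod_insert ha, Finset.sum_insert ha,
        show x + ((y a - x a) • stdVec a + ∑ i ∈ s, (y i - x i) • stdVec i) =
          x + ∑ i ∈ s, (y i - x i) • stdVec i + (y a - x a) • stdVec a by abel]
      calc _ = (∏ i ∈ s, η (x i)) * (η (x a) * φ (x + ∑ i ∈ s, (y i - x i) • stdVec i +
            (y a - x a) • stdVec a)) := by ring
        _ = η (y a) * ((∏ i ∈ s, η (x i)) * φ (x + ∑ i ∈ s, (y i - x i) • stdVec i)) := by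
            rw [h1]; ring
        _ = _ := by rw [ih]; ring
  set P : Eu n → ℝ := fun x => ∏ i, η (x i) with hP
  have hPy : 0 < P y := Finset.prod_pos fun i _ => by rw [hyi]; exact hη1
  have hfull : ∀ x, P x * φ y = P y * φ x := by
    intro x
    have := key x Finset.univ
    have e : x + ∑ i, (y i - x i) • stdVec i = y := by
      ext j
      rw [PiLp.add_apply, WithLp.ofLp_sum, Finset.sum_apply]
      rw [Finset.sum_eq_single j]
      · simp
      · intro i _ hij; simp [hij.symm]
      · simp
    rwa [e] at this
  have hPpos : 0 < ∫ x, P x := by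
    have hPc : Continuous P := continuous_finsetProd _ fun i _ => hη.comp (by fun_prop)
    have hz : ZeroOff (1 / 4) P := by
      intro x i hx
      refine Finset.prod_eq_zero (Finset.mem_univ i) (hη0 _ (hx.imp id fun h => by linarith))
    exact hPc.integral_pos_of_hasCompactSupport_nonneg_nonzero
      (hz.hasCompactSupport (by norm_num)) (fun x => Finset.prod_nonneg fun i _ => hηn _)
      (x := y) hPy.ne'
  have h1 : (∫ x, P x) * φ y = 0 := by
    rw [← integral_mul_const]
    simp only [hfull]
    rw [integral_const_mul, hi, mul_zero]
  have h2 : φ y = 0 := (mul_eq_zero.1 h1).resolve_left hPpos.ne'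
  have h3 := hfull x
  rw [h2, mul_zero] at h3
  exact (mul_eq_zero.1 h3.symm).resolve_left hPy.ne'

/-- After all variables are treated the remainder has profile `η` in each of them. It has zero mean,
as derivatives integrate to zero, and hence vanishes. -/
theorem exists_eq_sum_partialDeriv (n : ℕ) : ∃ C : ℝ, 0 ≤ C ∧ ∀ (α : ℝ), 0 < α → α ≤ 1 / 4 →
    ∀ (φ : Eu n → ℝ) (M : ℝ), ContDiff ℝ ∞ φ → ZeroOff α φ → (∀ x, |φ x| ≤ M) → ∫ x, φ x = 0 →
      ∃ G : Fin n → Eu n → ℝ, (∀ i, ContDiff ℝ ∞ (G i)) ∧ (∀ i, ZeroOff α (G i)) ∧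
        (∀ i x, |G i x| ≤ C * M) ∧ ∀ x, φ x = ∑ i, partialDeriv i (G i) x := by
  obtain ⟨η, hη, hηn, hη0, hηi, hη1, K, -, hK⟩ := exists_unit_bump
  obtain ⟨C, hC0, hC⟩ := exists_partialDeriv_sum_add_profile (n := n) hη hη0 hηi hηn hK Finset.univ
  refine ⟨C, hC0, fun α h1 h2 φ M hφ h0 hM hint => ?_⟩
  obtain ⟨φ', G, k1, k2, -, k4, k5, k6, k7, k8⟩ := hC α h1.le h2 φ M hφ h0 hM
  have hz : ∀ x, φ' x = 0 := by
    refine eq_zero_of_profileIn hη.continuous hηn hη1 hη0 (fun i => k8 i (Finset.mem_univ i)) ?_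
    have e : ∀ x, φ' x = φ x - ∑ i, partialDeriv i (G i) x := fun x => by rw [k7 x]; ring
    have hi : ∀ i, Integrable (partialDeriv i (G i)) := fun i =>
      (partialDeriv_contDiff i (k4 i)).continuous.integrable_of_hasCompactSupport
        (hasCompactSupport_partialDeriv i ((k5 i).hasCompactSupport h1.le))
    simp only [e]
    rw [integral_sub (hφ.continuous.integrable_of_hasCompactSupport (h0.hasCompactSupport h1.le))
      (integrable_finsetSum _ fun i _ => hi i), hint, integral_finsetSum _ fun i _ => hi i]
    simp [integral_partialDeriv_eq_zero (k4 _) ((k5 _).hasCompactSupport h1.le)]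
  exact ⟨G, k4, k5, k6, fun x => by rw [k7 x, hz x, zero_add]⟩

theorem contDiff_coord (j : Fin n) : ContDiff ℝ ∞ fun x : Eu n => x j :=
  (EuclideanSpace.proj (𝕜 := ℝ) j).contDiff

theorem partialDeriv_coord (i j : Fin n) :
    partialDeriv i (fun x : Eu n => x j) = fun _ => if i = j then 1 else 0 := by
  ext x
  have : (fun x : Eu n => x j) = (EuclideanSpace.proj (𝕜 := ℝ) j : Eu n →L[ℝ] ℝ) := rfl
  simp only [partialDeriv]
  rw [this, ContinuousLinearMap.fderiv]
  simp [eq_comm]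

/-- A bump function orthogonal to affine functions is a double divergence, with bounds. -/
theorem exists_eq_hdiv (n : ℕ) : ∃ C : ℝ, 0 ≤ C ∧ ∀ (α : ℝ), 0 < α → α ≤ 1 / 4 →
    ∀ (φ : Eu n → ℝ) (M : ℝ), ContDiff ℝ ∞ φ → ZeroOff α φ → (∀ x, |φ x| ≤ M) → ∫ x, φ x = 0 →
      (∀ j, ∫ x, x j * φ x = 0) →
      ∃ F : Eu n → Matrix (Fin n) (Fin n) ℝ, IsSmoothField (box n α) F ∧
        (∀ x i j, |F x i j| ≤ C * M) ∧ ∀ x, φ x = hdiv F x := by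
  obtain ⟨C, hC0, hC⟩ := exists_eq_sum_partialDeriv n
  refine ⟨C * C, by positivity, fun α h1 h2 φ M hφ h0 hM hint hmom => ?_⟩
  obtain ⟨G, k1, k2, k3, k4⟩ := hC α h1 h2 φ M hφ h0 hM hint
  have hGc : ∀ i, HasCompactSupport (G i) := fun i => (k2 i).hasCompactSupport h1.le
  -- The first moment of `φ` in direction `j` is `-∫ G j` after integration by parts. Its vanishing
  -- allows the divergence equation to be solved again for each `G j`.
  have hG0 : ∀ j, ∫ x, G j x = 0 := by
    intro j
    have h3 := hmom j
    simp only [k4, Finset.mul_sum] at h3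
    have hi : ∀ i, Integrable fun x : Eu n => x j * partialDeriv i (G i) x := fun i =>
      ((contDiff_coord j).continuous.mul
        (partialDeriv_contDiff i (k1 i)).continuous).integrable_of_hasCompactSupport
        (hasCompactSupport_partialDeriv i (hGc i)).mul_left
    rw [integral_finsetSum _ fun i _ => hi i] at h3
    have h4 : ∀ i, ∫ x : Eu n, x j * partialDeriv i (G i) x = if i = j then - ∫ x, G j x else 0 := by
      intro i
      rw [integral_mul_partialDeriv i (contDiff_coord j) (k1 i) (hGc i), partialDeriv_coord]
      by_cases hij : i = j
      · subst hij; simp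
      · simp [hij]
    simp only [h4] at h3
    simpa using h3
  choose F l1 l2 l3 l4 using fun i => hC α h1 h2 (G i) (C * M) (k1 i) (k2 i) (k3 i) (hG0 i)
  refine ⟨fun x => Matrix.of fun i j => F i j x, ⟨fun i j => l1 i j, fun i j =>
    (l2 i j).hasCompactSupport h1.le, fun i j => (l2 i j).tsupport_subset⟩, ?_, ?_⟩
  · intro x i j
    exact (l3 i j x).trans (by rw [mul_assoc])
  · intro x
    rw [k4 x]
    simp only [hdiv, Matrix.of_apply]
    refine Finset.sum_congr rfl fun i _ => ?_
    have e : G i = fun x => ∑ j, partialDeriv j (F i j) x := funext (l4 i)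
    rw [e, partialDeriv_sum i Finset.univ fun j _ =>
      (partialDeriv_contDiff j (l1 i j)).differentiable (by simp)]

end Bogovskii

/-! ### The second order Poincaré inequality, by duality. -/

section Poincare
variable {n : ℕ}

theorem exists_smooth_cutoff {K U : Set (Eu n)} (hK : IsCompact K) (hU : IsOpen U) (hKU : K ⊆ U) :
    ∃ χ : Eu n → ℝ, ContDiff ℝ ∞ χ ∧ HasCompactSupport χ ∧ tsupport χ ⊆ U ∧
      (∀ x, 0 ≤ χ x ∧ χ x ≤ 1) ∧ ∀ x ∈ K, χ x = 1 := by
  obtain ⟨L, hL, hKL, hLU⟩ := exists_compact_between hK hU hKU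
  obtain ⟨f, hf1, hf0, hf⟩ := exists_contMDiffMap_one_nhds_of_subset_interior
    (modelWithCornersSelf ℝ (Eu n)) (n := ⊤) hK.isClosed hKL
  have hts : tsupport f ⊆ L := closure_minimal (fun x hx => by
    by_contra h; exact hx (hf0 x h)) hL.isClosed
  exact ⟨f, f.contMDiff.contDiff, hL.of_isClosed_subset (isClosed_tsupport _) hts,
    hts.trans hLU, fun x => hf x, fun x hx => hf1.self_of_nhdsSet x hx⟩

/-- The `L¹` norm on compact subsets is controlled by duality with smooth test functions. -/
theorem setLIntegral_enorm_le_of_forall_test {A : Set (Eu n)} (hA : IsOpen A) {w : Eu n → ℝ}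
    (hw : LocallyIntegrableOn w A) {C : ℝ}
    (h : ∀ φ : Eu n → ℝ, ContDiff ℝ ∞ φ → HasCompactSupport φ → tsupport φ ⊆ A →
      (∀ x, |φ x| ≤ 1) → ∫ x, w x * φ x ≤ C) {K : Set (Eu n)} (hK : IsCompact K) (hKA : K ⊆ A) :
    ∫⁻ x in K, ‖w x‖ₑ ≤ ENNReal.ofReal C := by
  obtain ⟨χ, hχ, hχc, hχA, hχ01, hχ1⟩ := exists_smooth_cutoff hK hA hKA
  set K' := tsupport χ
  have hK'm : MeasurableSet K' := (isClosed_tsupport χ).measurableSet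
  set w1 : Eu n → ℝ := K'.indicator w with hw1
  have hw1i : Integrable w1 := (hw.integrableOn_compact_subset hχA hχc).integrable_indicator hK'm
  -- The sign of `w1`, equal to `0` where `w1` vanishes since division by zero gives zero.
  set s : Eu n → ℝ := fun x => w1 x / |w1 x| with hs
  have hs1 : ∀ x, ‖s x‖ ≤ 1 := by
    intro x
    simp only [hs, Real.norm_eq_abs, abs_div, abs_abs]
    exact div_self_le_one _
  have hsm : AEStronglyMeasurable s := by
    have := hw1i.aestronglyMeasurable.aemeasurable
    exact (this.div this.abs).aestronglyMeasurable
  have hs0 : ∀ x ∉ K', s x = 0 := fun x hx => by simp [hs, hw1, hx]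
  have hsi : Integrable s := by
    have h1 : IntegrableOn s K' := by
      refine Measure.integrableOn_of_bounded (M := 1) hχc.measure_lt_top.ne hsm ?_
      exact Eventually.of_forall hs1
    refine (integrableOn_iff_integrable_of_support_subset ?_).1 h1
    intro x hx; by_contra h2; exact hx (hs0 x h2)
  have hmem : MemLp s 1 := memLp_one_iff_integrable.2 hsi
  have hpos : ∀ k : ℕ, (0 : ℝ) < 1 / ((k : ℝ) + 1) := fun k => by positivity
  choose g hgc hgs hg using fun k : ℕ =>
    hmem.exist_eLpNorm_sub_le ENNReal.one_ne_top le_rfl (hpos k)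
  have htend : Tendsto (fun k => eLpNorm (g k - s) 1 volume) atTop (𝓝 0) := by
    have h0 : Tendsto (fun k : ℕ => ENNReal.ofReal (1 / ((k : ℝ) + 1))) atTop (𝓝 0) := by
      have := ENNReal.tendsto_ofReal (tendsto_one_div_add_atTop_nhds_zero_nat (𝕜 := ℝ))
      simpa using this
    refine tendsto_of_tendsto_of_tendsto_of_le_of_le tendsto_const_nhds h0 (fun _ => zero_le) ?_
    intro k
    exact (eLpNorm_sub_comm _ _ _ _).trans_le (hg k)
  have hmeas : TendstoInMeasure volume g atTop s :=
    tendstoInMeasure_of_tendsto_eLpNorm one_ne_zero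
      (fun k => (hgs k).continuous.aestronglyMeasurable) hsm htend
  obtain ⟨ns, -, hns⟩ := hmeas.exists_seq_tendsto_ae
  -- The smooth function `sin (π / 2 * ·)` fixes `-1`, `0`, `1` and has values in `[-1, 1]`, so it
  -- truncates the approximations of the sign without changing their limit.
  set φ : ℕ → Eu n → ℝ := fun k x => χ x * Real.sin (Real.pi / 2 * g (ns k) x) with hφ
  have hφs : ∀ k, ContDiff ℝ ∞ (φ k) := fun k =>
    hχ.mul (Real.contDiff_sin.comp (contDiff_const.mul (hgs _)))
  have hφb : ∀ k x, |φ k x| ≤ 1 := by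
    intro k x
    rw [hφ, abs_mul]
    exact mul_le_one₀ (by rw [abs_of_nonneg (hχ01 x).1]; exact (hχ01 x).2) (abs_nonneg _)
      (Real.abs_sin_le_one _)
  have hφt : ∀ k, tsupport (φ k) ⊆ K' := fun k =>
    tsupport_mul_subset_left (f := χ) (g := fun x => Real.sin (Real.pi / 2 * g (ns k) x))
  have hle : ∀ k, ∫ x, w1 x * φ k x ≤ C := by
    intro k
    have e : ∀ x, w1 x * φ k x = w x * φ k x := by
      intro x
      by_cases hx : x ∈ K'
      · simp [hw1, hx]
      · rw [image_eq_zero_of_notMem_tsupport fun h => hx (hφt k h)]; simp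
    simp only [e]
    exact h _ (hφs k) (hχc.mul_right) ((hφt k).trans hχA) (hφb k)
  have hlim : Tendsto (fun k => ∫ x, w1 x * φ k x) atTop (𝓝 (∫ x, χ x * |w1 x|)) := by
    refine tendsto_integral_of_dominated_convergence (fun x => |w1 x|)
      (fun k => hw1i.aestronglyMeasurable.mul (hφs k).continuous.aestronglyMeasurable)
      hw1i.abs (fun k => Eventually.of_forall fun x => ?_) ?_
    · rw [Real.norm_eq_abs, abs_mul]
      exact mul_le_of_le_one_right (abs_nonneg _) (hφb k x)
    · filter_upwards [hns] with x hx
      have h1 : Tendsto (fun k => w1 x * φ k x) atTop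
          (𝓝 (w1 x * (χ x * Real.sin (Real.pi / 2 * s x)))) :=
        (((Real.continuous_sin.tendsto _).comp (hx.const_mul (Real.pi / 2))).const_mul
          (χ x)).const_mul (w1 x)
      have h2 : w1 x * (χ x * Real.sin (Real.pi / 2 * s x)) = χ x * |w1 x| := by
        rcases lt_trichotomy (w1 x) 0 with h0 | h0 | h0
        · have : s x = -1 := by simp only [hs]; rw [abs_of_neg h0, div_neg, div_self h0.ne]
          rw [this, abs_of_neg h0, mul_neg, mul_one, Real.sin_neg, Real.sin_pi_div_two]; ring
        · simp [h0]
        · have : s x = 1 := by simp only [hs]; rw [abs_of_pos h0, div_self h0.ne']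
          rw [this, abs_of_pos h0, mul_one, Real.sin_pi_div_two]; ring
      rwa [h2] at h1
  have hfin : ∫ x, χ x * |w1 x| ≤ C := le_of_tendsto' hlim hle
  have hint : Integrable fun x => χ x * |w1 x| := by
    refine hw1i.abs.mono' (hχ.continuous.aestronglyMeasurable.mul hw1i.abs.aestronglyMeasurable) ?_
    refine Eventually.of_forall fun x => ?_
    rw [Real.norm_eq_abs, abs_mul, abs_abs, abs_of_nonneg (hχ01 x).1]
    exact mul_le_of_le_one_left (abs_nonneg _) (hχ01 x).2
  calc ∫⁻ x in K, ‖w x‖ₑ ≤ ∫⁻ x in K, ENNReal.ofReal (χ x * |w1 x|) := by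
        refine setLIntegral_mono' hK.measurableSet fun x hx => ?_
        have hxK' : x ∈ K' := subset_tsupport _ (by simp [hχ1 x hx])
        rw [hχ1 x hx, one_mul, hw1, Set.indicator_of_mem hxK', ← Real.norm_eq_abs, ofReal_norm]
    _ ≤ ∫⁻ x, ENNReal.ofReal (χ x * |w1 x|) := setLIntegral_le_lintegral _ _
    _ = ENNReal.ofReal (∫ x, χ x * |w1 x|) :=
        (ofReal_integral_eq_lintegral_ofReal hint
          (Eventually.of_forall fun x => mul_nonneg (hχ01 x).1 (abs_nonneg _))).symm
    _ ≤ ENNReal.ofReal C := ENNReal.ofReal_le_ofReal hfin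

theorem isOpen_cube (n : ℕ) : IsOpen (cube n) := by
  have : cube n = ⋂ i : Fin n, {x : Eu n | 0 < x i ∧ x i < 1} := by
    ext x; simp [cube]
  rw [this]
  refine isOpen_iInter_of_finite fun i => ?_
  have hc : Continuous fun x : Eu n => x i := by fun_prop
  exact (isOpen_lt continuous_const hc).inter (isOpen_lt hc continuous_const)

theorem exists_box_of_isCompact {K : Set (Eu n)} (hK : IsCompact K) (hKc : K ⊆ cube n) :
    ∃ α : ℝ, 0 < α ∧ α ≤ 1 / 4 ∧ K ⊆ box n α := by
  set V : ℕ → Set (Eu n) := fun k => {x | ∀ i, 1 / ((k : ℝ) + 4) < x i ∧ x i < 1 - 1 / ((k : ℝ) + 4)}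
  have hVo : ∀ k, IsOpen (V k) := by
    intro k
    have : V k = ⋂ i : Fin n, {x : Eu n | 1 / ((k : ℝ) + 4) < x i ∧ x i < 1 - 1 / ((k : ℝ) + 4)} := by
      ext x; simp [V]
    rw [this]
    refine isOpen_iInter_of_finite fun i => ?_
    have hc : Continuous fun x : Eu n => x i := by fun_prop
    exact (isOpen_lt continuous_const hc).inter (isOpen_lt hc continuous_const)
  have hmono : Monotone V := by
    intro k l hkl x hx i
    have h1 : 1 / ((l : ℝ) + 4) ≤ 1 / ((k : ℝ) + 4) := by
      have : (k : ℝ) ≤ l := by exact_mod_cast hkl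
      gcongr
    exact ⟨h1.trans_lt (hx i).1, by linarith [(hx i).2]⟩
  have hcov : K ⊆ ⋃ k, V k := by
    intro x hx
    have h1 : ∀ i, ∀ᶠ k : ℕ in atTop, 1 / ((k : ℝ) + 4) < x i ∧ x i < 1 - 1 / ((k : ℝ) + 4) := by
      intro i
      have ht : Tendsto (fun k : ℕ => 1 / ((k : ℝ) + 4)) atTop (𝓝 0) := by
        refine tendsto_const_nhds.div_atTop ?_
        exact tendsto_atTop_add_const_right _ _ tendsto_natCast_atTop_atTop
      have h2 := hKc hx i
      have h3 := ht.eventually (gt_mem_nhds h2.1)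
      have h4 := ht.eventually (gt_mem_nhds (show (0 : ℝ) < 1 - x i by linarith [h2.2]))
      filter_upwards [h3, h4] with k hk hk'
      exact ⟨hk, by linarith⟩
    obtain ⟨k, hk⟩ := (eventually_all.2 h1).exists
    exact Set.mem_iUnion.2 ⟨k, hk⟩
  obtain ⟨k, hk⟩ := hK.elim_directed_cover V hVo hcov hmono.directed_le
  refine ⟨1 / ((k : ℝ) + 4), by positivity, ?_, fun x hx i => ⟨(hk hx i).1.le, (hk hx i).2.le⟩⟩
  have : (0 : ℝ) ≤ k := by positivity
  gcongr; linarith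

theorem zeroOff_of_tsupport_subset {φ : Eu n → ℝ} {α : ℝ} (h : tsupport φ ⊆ box n α) :
    ZeroOff α φ := by
  intro x i hx
  refine image_eq_zero_of_notMem_tsupport fun h1 => ?_
  have := h h1 i
  rcases hx with hx | hx <;> linarith [this.1, this.2]

theorem exists_centered_bump (n : ℕ) : ∃ θ : Eu n → ℝ, ContDiff ℝ ∞ θ ∧ ZeroOff (1 / 4) θ ∧
    ∫ x, θ x = 1 := by
  let b : ContDiffBump (WithLp.toLp 2 fun _ => (1 / 2 : ℝ) : Eu n) :=
    ⟨1 / 8, 1 / 4, by norm_num, by norm_num⟩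
  refine ⟨b.normed volume, b.contDiff_normed, fun x i hx => ?_, b.integral_normed⟩
  by_contra h0
  have h1 : x ∈ Function.support (b.normed volume) := h0
  rw [b.support_normed_eq, Metric.mem_ball, dist_eq_norm] at h1
  have h2 := PiLp.norm_apply_le (x - WithLp.toLp 2 fun _ => (1 / 2 : ℝ)) i
  have h3 : b.rOut = 1 / 4 := rfl
  rw [h3] at h1
  have h4 := h2.trans_lt h1
  rw [PiLp.sub_apply, Real.norm_eq_abs, abs_lt] at h4
  simp only at h4
  rcases hx with hx | hx <;> linarith [h4.1, h4.2]

theorem ZeroOff.abs_integral_le {φ : Eu n → ℝ} {α M : ℝ} (h : ZeroOff α φ) (hα : 0 ≤ α)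
    (hM : ∀ x, |φ x| ≤ M) : |∫ x, φ x| ≤ M * (volume (box n 0)).toReal := by
  have e : ∫ x, φ x = ∫ x in box n 0, φ x := by
    refine (setIntegral_eq_integral_of_forall_compl_eq_zero fun x hx => ?_).symm
    refine image_eq_zero_of_notMem_tsupport fun h1 => hx ?_
    intro i
    have := h.tsupport_subset h1 i
    exact ⟨by linarith [this.1], by linarith [this.2]⟩
  rw [e, ← Real.norm_eq_abs]
  exact norm_setIntegral_le_of_norm_le_const (isCompact_box le_rfl).measure_lt_top
    fun x _ => hM x

theorem integrable_of_zeroOff {φ : Eu n → ℝ} {α : ℝ} (h : ZeroOff α φ) (hα : 0 ≤ α)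
    (hφ : Continuous φ) : Integrable φ :=
  hφ.integrable_of_hasCompactSupport (h.hasCompactSupport hα)

theorem ZeroOff.mono {φ : Eu n → ℝ} {α β : ℝ} (h : ZeroOff α φ) (hβ : β ≤ α) : ZeroOff β φ :=
  fun x i hx => h x i (hx.imp (fun h => h.trans_le hβ) fun h => by linarith)

theorem ZeroOff.partialDeriv {φ : Eu n → ℝ} {α : ℝ} (h : ZeroOff α φ) (i : Fin n) :
    ZeroOff α (partialDeriv i φ) :=
  zeroOff_of_tsupport_subset ((tsupport_partialDeriv_subset i φ).trans h.tsupport_subset)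

theorem ZeroOff.mul_left {φ : Eu n → ℝ} {α : ℝ} (h : ZeroOff α φ) (f : Eu n → ℝ) :
    ZeroOff α fun x => f x * φ x :=
  fun x i hx => by simp only [h x i hx, mul_zero]

theorem exists_affineMap_eq (c : ℝ) (p : Fin n → ℝ) :
    ∃ a : Eu n →ᵃ[ℝ] ℝ, ∀ x, a x = c + ∑ j, p j * x j := by
  refine ⟨(∑ j, p j • (EuclideanSpace.proj (𝕜 := ℝ) j : Eu n →L[ℝ] ℝ).toLinearMap).toAffineMap +
    AffineMap.const ℝ (Eu n) c, fun x => ?_⟩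
  simp [add_comm]

/-- The test function `φ` is corrected by `θ` and its first derivatives to `φ'`, which has zero mass
and zero first moments and is therefore a bounded double divergence. The affine map is chosen so
that `u - a` is orthogonal to the corrections, so that pairing it with `φ` amounts to pairing `u`
with `φ'`. -/
theorem exists_affine_pairing_le (n : ℕ) : ∃ C : ℝ, 0 ≤ C ∧ ∀ u : Eu n → ℝ,
    LocallyIntegrableOn u (cube n) → htv 1 u (cube n) ≠ ⊤ → ∃ a : Eu n →ᵃ[ℝ] ℝ,
      ∀ φ : Eu n → ℝ, ContDiff ℝ ∞ φ → HasCompactSupport φ → tsupport φ ⊆ cube n →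
        (∀ x, |φ x| ≤ 1) → ∫ x, (u x - a x) * φ x ≤ C * (htv 1 u (cube n)).toReal := by
  obtain ⟨C1, hC1, hdivC⟩ := exists_eq_hdiv n
  obtain ⟨θ, hθ, hθ0, hθi⟩ := exists_centered_bump n
  have hq : (0 : ℝ) ≤ 1 / 4 := by norm_num
  set V := (volume (box n 0)).toReal
  have hV : 0 ≤ V := ENNReal.toReal_nonneg
  set m : Fin n → ℝ := fun j => ∫ x, x j * θ x with hm
  obtain ⟨B, hB⟩ := (hθ0.hasCompactSupport hq).exists_bound_of_continuous hθ.continuous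
  have hB0 : 0 ≤ B := (norm_nonneg _).trans (hB 0)
  have hdθ := fun j => partialDeriv_contDiff j hθ
  choose D hD using fun j => (hasCompactSupport_partialDeriv j
    (hθ0.hasCompactSupport hq)).exists_bound_of_continuous (hdθ j).continuous
  have hD0 : ∀ j, 0 ≤ D j := fun j => (norm_nonneg _).trans (hD j 0)
  -- A bound for `|φ'|`: the coefficient of `θ` is at most `V` and that of its `j`-th derivative at
  -- most `(1 + |m j|) * V`.
  set M := 1 + V * B + ∑ j, (1 + |m j|) * V * D j with hM
  have hM0 : 0 ≤ M := by
    have : 0 ≤ ∑ j, (1 + |m j|) * V * D j := Finset.sum_nonneg fun j _ => by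
      have := hD0 j; positivity
    positivity
  -- The entries of the field are at most `C1 * M`, whence the factor `n` for the operator norm;
  -- adding `1` allows division by the constant.
  refine ⟨C1 * M * n + 1, by positivity, fun u hu hfin => ?_⟩
  -- The slopes make `u - a` orthogonal to the derivatives of `θ`, and the constant term makes it
  -- orthogonal to `θ`.
  obtain ⟨a, ha⟩ := exists_affineMap_eq
    ((∫ x, u x * θ x) - ∑ j, (-∫ x, u x * partialDeriv j θ x) * m j)
    (fun j => -∫ x, u x * partialDeriv j θ x)
  refine ⟨a, fun φ hφ hφc hφt hφ1 => ?_⟩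
  obtain ⟨α, hα, hα4, hK⟩ := exists_box_of_isCompact hφc hφt
  have hφ0 := zeroOff_of_tsupport_subset hK
  have hθα : ZeroOff α θ := hθ0.mono hα4
  have hdα : ∀ j, ZeroOff α (partialDeriv j θ) := fun j => hθα.partialDeriv j
  have hint : ∀ {ψ : Eu n → ℝ}, ContDiff ℝ ∞ ψ → ZeroOff α ψ → Integrable ψ :=
    fun hψ h0 => integrable_of_zeroOff h0 hα.le hψ.continuous
  have hintc : ∀ {ψ : Eu n → ℝ} (j : Fin n), ContDiff ℝ ∞ ψ → ZeroOff α ψ →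
      Integrable fun x => x j * ψ x :=
    fun j hψ h0 => hint ((contDiff_coord j).mul hψ) (h0.mul_left _)
  have hintu : ∀ {ψ : Eu n → ℝ}, ContDiff ℝ ∞ ψ → ZeroOff α ψ → Integrable fun x => u x * ψ x :=
    fun hψ h0 => integrable_mul_of_tsupport_subset hu hψ.continuous (h0.hasCompactSupport hα.le)
      (h0.tsupport_subset.trans (box_subset_cube hα))
  have hdint : ∀ j, ∫ x, partialDeriv j θ x = 0 := fun j =>
    integral_partialDeriv_eq_zero hθ (hθ0.hasCompactSupport hq) j
  have hdmom : ∀ j k, ∫ x : Eu n, x k * partialDeriv j θ x = if j = k then -1 else 0 := by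
    intro j k
    rw [integral_mul_partialDeriv j (contDiff_coord k) hθ (hθ0.hasCompactSupport hq),
      partialDeriv_coord]
    by_cases h : j = k <;> simp [h, hθi]
  set c0 := ∫ x, φ x
  set c : Fin n → ℝ := fun j => (∫ x, x j * φ x) - m j * c0 with hc
  set φ' : Eu n → ℝ := fun x => φ x - c0 * θ x + ∑ j, c j * partialDeriv j θ x with hφ'
  have hφ's : ContDiff ℝ ∞ φ' :=
    (hφ.sub (contDiff_const.mul hθ)).add (ContDiff.sum fun j _ => contDiff_const.mul (hdθ j))
  have hφ'0 : ZeroOff α φ' := by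
    intro x i hx
    simp only [hφ', hφ0 x i hx, hθα x i hx, hdα _ x i hx]; simp
  -- pairing against a function `g` with all the required integrability
  have pair : ∀ g : Eu n → ℝ, (∀ {ψ : Eu n → ℝ}, ContDiff ℝ ∞ ψ → ZeroOff α ψ →
      Integrable fun x => g x * ψ x) → ∫ x, g x * φ' x = (∫ x, g x * φ x) -
        c0 * (∫ x, g x * θ x) + ∑ j, c j * ∫ x, g x * partialDeriv j θ x := by
    intro g hg
    have e : ∀ x, g x * φ' x = g x * φ x - c0 * (g x * θ x) +
        ∑ j, c j * (g x * partialDeriv j θ x) := by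
      intro x
      simp only [hφ', mul_add, mul_sub, Finset.mul_sum]
      congr 1
      · ring
      · exact Finset.sum_congr rfl fun j _ => by ring
    simp only [e]
    have i1 : Integrable fun x => g x * φ x - c0 * (g x * θ x) :=
      (hg hφ hφ0).sub ((hg hθ hθα).const_mul _)
    rw [integral_add i1
      (integrable_finsetSum _ fun j _ => (hg (hdθ j) (hdα j)).const_mul _),
      integral_sub (hg hφ hφ0) ((hg hθ hθα).const_mul _), integral_const_mul,
      integral_finsetSum _ fun j _ => (hg (hdθ j) (hdα j)).const_mul _]
    simp only [integral_const_mul]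
  have h1 : ∫ x, φ' x = 0 := by
    have := pair (fun _ => 1) (fun hψ h0 => by simpa using hint hψ h0)
    simp only [one_mul] at this
    rw [this, hθi]; simp [hdint, c0]
  have h2 : ∀ k, ∫ x : Eu n, x k * φ' x = 0 := by
    intro k
    rw [pair (fun x => x k) (fun hψ h0 => hintc k hψ h0)]
    simp only [hdmom]
    simp [hc, hm]; ring
  have hc0 : |c0| ≤ V := by simpa using hφ0.abs_integral_le hα.le hφ1
  have hcj : ∀ j, |c j| ≤ (1 + |m j|) * V := by
    intro j
    have e : c j = ∫ x : Eu n, (x j - m j) * φ x := by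
      simp only [hc, sub_mul]
      rw [integral_sub (hintc j hφ hφ0) ((hint hφ hφ0).const_mul _), integral_const_mul]
    rw [e]
    refine (hφ0.mul_left _).abs_integral_le hα.le fun x => ?_
    by_cases hx : x ∈ tsupport φ
    · have hxb := hK hx j
      rw [abs_mul]
      calc |x j - m j| * |φ x| ≤ (1 + |m j|) * 1 := by
            refine mul_le_mul ?_ (hφ1 x) (abs_nonneg _) (by positivity)
            refine (abs_sub _ _).trans (add_le_add ?_ le_rfl)
            rw [abs_of_nonneg (hα.le.trans hxb.1)]; linarith [hxb.2]
        _ = _ := mul_one _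
    · rw [image_eq_zero_of_notMem_tsupport hx, mul_zero, abs_zero]; positivity
  have hφ'M : ∀ x, |φ' x| ≤ M := by
    intro x
    refine (abs_add_le _ _).trans (add_le_add ((abs_sub _ _).trans (add_le_add (hφ1 x) ?_)) ?_)
    · rw [abs_mul]; exact mul_le_mul hc0 (hB x) (abs_nonneg _) hV
    · refine (Finset.abs_sum_le_sum_abs _ _).trans (Finset.sum_le_sum fun j _ => ?_)
      rw [abs_mul]; exact mul_le_mul (hcj j) (hD j x) (abs_nonneg _) (by positivity)
  obtain ⟨F, hF, hFb, hFd⟩ := hdivC α hα hα4 φ' M hφ's hφ'0 hφ'M h1 h2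
  -- the affine part does not see `φ'`
  have hua : ∀ {ψ : Eu n → ℝ}, ContDiff ℝ ∞ ψ → ZeroOff α ψ →
      ∫ x, (u x - a x) * ψ x = (∫ x, u x * ψ x) - (a 0 * (∫ x, ψ x) +
        ∑ j, (-∫ x, u x * partialDeriv j θ x) * ∫ x, x j * ψ x) := by
    intro ψ hψ h0
    have e : ∀ x, (u x - a x) * ψ x = u x * ψ x - (a 0 * ψ x +
        ∑ j, (-∫ x, u x * partialDeriv j θ x) * (x j * ψ x)) := by
      intro x
      rw [ha x, ha 0]
      simp only [sub_mul, add_mul, Finset.sum_mul]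
      simp [mul_assoc]
    simp only [e]
    have i1 : Integrable fun x => a 0 * ψ x +
        ∑ j, (-∫ (x : Eu n), u x * partialDeriv j θ x) * (x j * ψ x) :=
      ((hint hψ h0).const_mul _).add
        (integrable_finsetSum _ fun j _ => (hintc j hψ h0).const_mul _)
    rw [integral_sub (hintu hψ h0) i1, integral_add ((hint hψ h0).const_mul _)
      (integrable_finsetSum _ fun j _ => (hintc j hψ h0).const_mul _), integral_const_mul,
      integral_finsetSum _ fun j _ => (hintc j hψ h0).const_mul _]
    simp only [integral_const_mul]
  have hintua : ∀ {ψ : Eu n → ℝ}, ContDiff ℝ ∞ ψ → ZeroOff α ψ →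
      Integrable fun x => (u x - a x) * ψ x := by
    intro ψ hψ h0
    have h3 : LocallyIntegrableOn (fun x => u x - a x) (cube n) :=
      hu.sub (locallyIntegrableOn_affineMap a _)
    exact integrable_mul_of_tsupport_subset h3 hψ.continuous (h0.hasCompactSupport hα.le)
      (h0.tsupport_subset.trans (box_subset_cube hα))
  have hz1 : ∫ x, (u x - a x) * θ x = 0 := by
    rw [hua hθ hθα, hθi, ha 0]; simp [hm]
  have hz2 : ∀ j, ∫ x, (u x - a x) * partialDeriv j θ x = 0 := by
    intro j
    rw [hua (hdθ j) (hdα j), hdint]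
    simp only [hdmom]
    simp
  have hkey : ∫ x, (u x - a x) * φ x = ∫ x, u x * φ' x := by
    have e1 := pair (fun x => u x - a x) hintua
    rw [hz1] at e1
    simp only [hz2] at e1
    have e2 := hua hφ's hφ'0
    rw [h1] at e2
    simp only [h2] at e2
    simp only [mul_zero, sub_zero, Finset.sum_const_zero, add_zero] at e1 e2
    rw [← e1, e2]
  rw [hkey]
  have hK0 : 0 < C1 * M * n + 1 := by positivity
  set k := C1 * M * n + 1
  have hFs : IsSmoothField (cube n) (k⁻¹ • F) := (hF.mono (box_subset_cube hα)).const_smul _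
  have hop : ∀ x, OpLeOne ((k⁻¹ • F) x) := by
    intro x
    refine opLeOne_of_entries (c := k⁻¹ * (C1 * M)) (fun i j => ?_) ?_ (by positivity)
    · simp only [Pi.smul_apply, Matrix.smul_apply, smul_eq_mul, abs_mul]
      rw [abs_of_pos (inv_pos.2 hK0)]
      exact mul_le_mul_of_nonneg_left (hFb x i j) (by positivity)
    · rw [mul_assoc, inv_mul_le_iff₀ hK0]; simp [k]
  have hfinal := integral_le_toReal_htv hFs hop hfin
  have e3 : ∫ x, u x * φ' x = k * ∫ x, u x * hdiv (k⁻¹ • F) x := by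
    rw [← integral_const_mul, hF.hdiv_smul]
    congr 1; ext x
    rw [hFd x]; field_simp
  rw [e3]
  exact mul_le_mul_of_nonneg_left hfinal hK0.le

theorem lintegral_cube_le_of_box {f : Eu n → ℝ≥0∞} {c : ℝ≥0∞}
    (h : ∀ K : Set (Eu n), IsCompact K → K ⊆ cube n → ∫⁻ x in K, f x ≤ c) :
    ∫⁻ x in cube n, f x ≤ c := by
  have hc : cube n = ⋃ k : ℕ, box n (1 / ((k : ℝ) + 4)) := by
    ext x
    rw [Set.mem_iUnion]
    constructor
    · intro hx
      have h1 : ∀ i, ∀ᶠ k : ℕ in atTop, 1 / ((k : ℝ) + 4) ≤ x i ∧ x i ≤ 1 - 1 / ((k : ℝ) + 4) := by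
        intro i
        have ht : Tendsto (fun k : ℕ => 1 / ((k : ℝ) + 4)) atTop (𝓝 0) := by
          refine tendsto_const_nhds.div_atTop ?_
          exact tendsto_atTop_add_const_right _ _ tendsto_natCast_atTop_atTop
        have h3 := ht.eventually (gt_mem_nhds (hx i).1)
        have h4 := ht.eventually (gt_mem_nhds (show (0 : ℝ) < 1 - x i by linarith [(hx i).2]))
        filter_upwards [h3, h4] with k hk hk'
        exact ⟨hk.le, by linarith⟩
      exact (eventually_all.2 h1).exists
    · rintro ⟨k, hk⟩
      exact box_subset_cube (by positivity) hk
  have hmono : Monotone fun k : ℕ => box n (1 / ((k : ℝ) + 4)) := by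
    intro k l hkl x hx i
    have h1 : 1 / ((l : ℝ) + 4) ≤ 1 / ((k : ℝ) + 4) := by
      have : (k : ℝ) ≤ l := by exact_mod_cast hkl
      gcongr
    exact ⟨h1.trans (hx i).1, by linarith [(hx i).2]⟩
  rw [hc, setLIntegral_iUnion_of_directed _ hmono.directed_le]
  exact iSup_le fun k => h _ (isCompact_box (by positivity)) (box_subset_cube (by positivity))

/-- Second order Poincaré inequality on the unit cube. -/
theorem exists_affine_lintegral_le (n : ℕ) : ∃ C : ℝ, 0 ≤ C ∧ ∀ u : Eu n → ℝ,
    LocallyIntegrableOn u (cube n) → htv 1 u (cube n) ≠ ⊤ → ∃ a : Eu n →ᵃ[ℝ] ℝ,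
      ∫⁻ x in cube n, ‖u x - a x‖ₑ ≤ ENNReal.ofReal C * htv 1 u (cube n) := by
  obtain ⟨C, hC, h⟩ := exists_affine_pairing_le n
  refine ⟨C, hC, fun u hu hfin => ?_⟩
  obtain ⟨a, ha⟩ := h u hu hfin
  refine ⟨a, lintegral_cube_le_of_box fun K hK hKc => ?_⟩
  have h3 : LocallyIntegrableOn (fun x => u x - a x) (cube n) :=
    hu.sub (locallyIntegrableOn_affineMap a _)
  refine (setLIntegral_enorm_le_of_forall_test (isOpen_cube n) h3 ha hK hKc).trans_eq ?_
  rw [ENNReal.ofReal_mul hC, ENNReal.ofReal_toReal hfin]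

/-- The open cube with corner `c` and side `r`. -/
def cubeAt (c : Eu n) (r : ℝ) : Set (Eu n) := {x | ∀ i, c i < x i ∧ x i < c i + r}

theorem preimage_cubeAt (c : Eu n) {r : ℝ} (hr : 0 < r) :
    (fun x => c + r • x) ⁻¹' cubeAt c r = cube n := by
  ext x
  simp only [Set.mem_preimage, cubeAt, cube, Set.mem_ofPred_eq, PiLp.add_apply, PiLp.smul_apply,
    smul_eq_mul]
  refine forall_congr' fun i => and_congr ?_ ?_
  · constructor
    · intro h; by_contra h2; nlinarith
    · intro h; nlinarith
  · constructor
    · intro h; by_contra h2; nlinarith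
    · intro h; nlinarith

end Poincare

/-! ### Rescaling the Poincaré inequality to cubes of any size. -/

section Scaling
variable {n : ℕ}

/-- The homothety `x ↦ c + s x`, as a homeomorphism. -/
def homothetyHomeo (c : Eu n) {s : ℝ} (hs : s ≠ 0) : Eu n ≃ₜ Eu n :=
  (Homeomorph.smulOfNeZero s hs).trans (Homeomorph.addLeft c)

theorem map_homothetyHomeo (c : Eu n) {s : ℝ} (hs : 0 < s) :
    Measure.map (homothetyHomeo c hs.ne') volume = ENNReal.ofReal (s ^ n)⁻¹ • volume := by
  have e : (homothetyHomeo c hs.ne' : Eu n → Eu n) = (fun x => c + x) ∘ fun x => s • x := rfl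
  rw [e, ← Measure.map_map (by fun_prop) (by fun_prop), Measure.map_addHaar_smul _ hs.ne',
    Measure.map_smul, map_add_left_eq_self]
  simp [abs_of_pos hs]

theorem setLIntegral_homothety (f : Eu n → ℝ≥0∞) (A : Set (Eu n)) (c : Eu n) {s : ℝ} (hs : 0 < s) :
    ∫⁻ x in (fun x => c + s • x) ⁻¹' A, f (c + s • x) =
      ENNReal.ofReal (s ^ n)⁻¹ * ∫⁻ x in A, f x := by
  have hm : MeasurableEmbedding (homothetyHomeo c hs.ne') :=
    (homothetyHomeo c hs.ne').measurableEmbedding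
  have h1 := hm.lintegral_map (μ := volume.restrict (homothetyHomeo c hs.ne' ⁻¹' A)) f
  rw [← hm.restrict_map, map_homothetyHomeo c hs, Measure.restrict_smul,
    lintegral_smul_measure] at h1
  exact h1.symm

theorem locallyIntegrableOn_comp_homothety {u : Eu n → ℝ} {A : Set (Eu n)} (hA : IsOpen A)
    (hu : LocallyIntegrableOn u A) (c : Eu n) {s : ℝ} (hs : 0 < s) :
    LocallyIntegrableOn (fun x => u (c + s • x)) ((fun x => c + s • x) ⁻¹' A) := by
  have hA' : IsOpen ((fun x : Eu n => c + s • x) ⁻¹' A) := hA.preimage (by fun_prop)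
  rw [locallyIntegrableOn_iff hA'.isLocallyClosed]
  intro K hK hKc
  set T := homothetyHomeo c hs.ne'
  have hm : MeasurableEmbedding T := T.measurableEmbedding
  have h1 : IntegrableOn u (T '' K) := by
    refine hu.integrableOn_compact_subset ?_ (hKc.image T.continuous)
    rintro _ ⟨x, hx, rfl⟩; exact hK hx
  have h2 : IntegrableOn u (T '' K) (Measure.map T volume) := by
    rw [map_homothetyHomeo c hs, IntegrableOn, Measure.restrict_smul]
    exact h1.smul_measure ENNReal.ofReal_ne_top
  rw [hm.integrableOn_map_iff] at h2
  rwa [T.injective.preimage_image] at h2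

theorem isOpen_cubeAt (c : Eu n) (r : ℝ) : IsOpen (cubeAt c r) := by
  have : cubeAt c r = ⋂ i : Fin n, {x : Eu n | c i < x i ∧ x i < c i + r} := by
    ext x; simp [cubeAt]
  rw [this]
  refine isOpen_iInter_of_finite fun i => ?_
  have hc : Continuous fun x : Eu n => x i := by fun_prop
  exact (isOpen_lt continuous_const hc).inter (isOpen_lt hc continuous_const)

/-- Second order Poincaré inequality on cubes. -/
theorem exists_affine_lintegral_cubeAt_le (n : ℕ) : ∃ C : ℝ, 0 ≤ C ∧ ∀ (c : Eu n) (r : ℝ), 0 < r →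
    ∀ u : Eu n → ℝ, LocallyIntegrableOn u (cubeAt c r) → htv 1 u (cubeAt c r) ≠ ⊤ →
      ∃ a : Eu n →ᵃ[ℝ] ℝ,
        ∫⁻ x in cubeAt c r, ‖u x - a x‖ₑ ≤ ENNReal.ofReal (C * r ^ 2) * htv 1 u (cubeAt c r) := by
  obtain ⟨C, hC, h⟩ := exists_affine_lintegral_le n
  refine ⟨C, hC, fun c r hr u hu hfin => ?_⟩
  have h1 := locallyIntegrableOn_comp_homothety (isOpen_cubeAt c r) hu c hr
  have h2 := htv_comp_homothety_le u (cubeAt c r) c hr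
  rw [preimage_cubeAt c hr] at h1 h2
  obtain ⟨a, ha⟩ := h _ h1 (ne_top_of_le_ne_top (ENNReal.mul_ne_top ENNReal.ofReal_ne_top hfin) h2)
  set S : Eu n →ᵃ[ℝ] Eu n := r⁻¹ • (AffineMap.id ℝ (Eu n) - AffineMap.const ℝ (Eu n) c) with hS
  have hST : ∀ x, S (c + r • x) = x := by
    intro x; simp [hS, smul_smul, hr.ne']
  refine ⟨a.comp S, ?_⟩
  have h3 := setLIntegral_homothety (fun x => ‖u x - a (S x)‖ₑ) (cubeAt c r) c hr
  rw [preimage_cubeAt c hr] at h3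
  simp only [hST] at h3
  have h4 : ENNReal.ofReal (r ^ n) * ENNReal.ofReal (r ^ n)⁻¹ = 1 := by
    rw [← ENNReal.ofReal_mul (by positivity), mul_inv_cancel₀ (by positivity), ENNReal.ofReal_one]
  -- The volume factor `r ^ n` meets the factor `r ^ 2 / r ^ n` of the variation, and `r ^ 2`
  -- remains.
  calc ∫⁻ x in cubeAt c r, ‖u x - (a.comp S) x‖ₑ
      = ENNReal.ofReal (r ^ n) * ∫⁻ x in cube n, ‖u (c + r • x) - a x‖ₑ := by
        rw [h3, ← mul_assoc, h4, one_mul]; rfl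
    _ ≤ ENNReal.ofReal (r ^ n) * (ENNReal.ofReal C *
          (ENNReal.ofReal (r ^ 2 / r ^ n) * htv 1 u (cubeAt c r))) := by
        gcongr; exact ha.trans (by gcongr)
    _ = _ := by
        rw [← mul_assoc, ← mul_assoc, ← ENNReal.ofReal_mul (by positivity),
          ← ENNReal.ofReal_mul (by positivity)]
        congr 2; field_simp

theorem volume_affineMap_eq_zero {a : Eu n →ᵃ[ℝ] ℝ} (ha : ∃ x, a x ≠ 0) :
    volume {x | a x = 0} = 0 := by
  set s : AffineSubspace ℝ (Eu n) := (AffineSubspace.mk' (0 : ℝ) ⊥).comap a with hs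
  have e : (s : Set (Eu n)) = {x | a x = 0} := by
    ext x; simp [hs]
  rw [← e]
  refine Measure.addHaar_affineSubspace _ _ fun htop => ?_
  obtain ⟨x, hx⟩ := ha
  have : x ∈ (s : Set (Eu n)) := by rw [htop]; trivial
  rw [e] at this
  exact hx this

theorem exists_affineMap_coord (i : Fin n) (t : ℝ) :
    ∃ a : Eu n →ᵃ[ℝ] ℝ, ∀ x, a x = x i - t := by
  obtain ⟨a, ha⟩ := exists_affineMap_eq (n := n) (-t) (Pi.single i 1)
  refine ⟨a, fun x => ?_⟩
  rw [ha, Finset.sum_eq_single i] <;> simp +contextual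
  ring

theorem volume_coord_eq (i : Fin n) (t : ℝ) : volume {x : Eu n | x i = t} = 0 := by
  obtain ⟨a, ha⟩ := exists_affineMap_coord i t
  have : {x : Eu n | x i = t} = {x | a x = 0} := by
    ext x; simp [ha, sub_eq_zero]
  rw [this]
  refine volume_affineMap_eq_zero ⟨EuclideanSpace.single i (t + 1), ?_⟩
  rw [ha]; simp

end Scaling

/-! ### Compactness of the unit ball modulo affine functions. -/

section Compactness
variable {n : ℕ}

theorem cube_subset_box : cube n ⊆ box n 0 := fun x hx i => ⟨(hx i).1.le, by linarith [(hx i).2]⟩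

theorem volume_cube_lt_top : volume (cube n) < ⊤ :=
  (measure_mono cube_subset_box).trans_lt (isCompact_box le_rfl).measure_lt_top

instance : IsFiniteMeasure (cubeMeasure n) := ⟨by simpa using volume_cube_lt_top⟩

theorem memLp_of_continuous {g : Eu n → ℝ} (hg : Continuous g) : MemLp g 1 (cubeMeasure n) := by
  rw [memLp_one_iff_integrable]
  exact (hg.continuousOn.integrableOn_compact (isCompact_box le_rfl)).mono_set cube_subset_box

theorem memLp_affineMap (a : Eu n →ᵃ[ℝ] ℝ) : MemLp a 1 (cubeMeasure n) :=
  memLp_of_continuous (continuous_affineMap a)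

theorem locallyIntegrableOn_of_L1 (f : L1Cube n) : LocallyIntegrableOn f (cube n) := by
  have h := memLp_one_iff_integrable.1 (Lp.memLp f)
  exact IntegrableOn.locallyIntegrableOn h

/-- The span in `L¹` of the functions which are affine on each of the sets `Q k` and vanish
elsewhere. -/
def pieceSpan {ι : Type*} (Q : ι → Set (Eu n)) : Submodule ℝ (L1Cube n) :=
  Submodule.span ℝ {f | ∃ (k : ι) (j : Option (Fin n)),
    f =ᵐ[cubeMeasure n] (Q k).indicator fun x => j.elim 1 fun i => x i}

theorem memLp_indicator_affineMap {Q : Set (Eu n)} (hQ : MeasurableSet Q) (a : Eu n →ᵃ[ℝ] ℝ) :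
    MemLp (Q.indicator a) 1 (cubeMeasure n) := (memLp_affineMap a).indicator hQ

instance finiteDimensional_pieceSpan {ι : Type*} [Finite ι] (Q : ι → Set (Eu n)) :
    FiniteDimensional ℝ (pieceSpan Q) := by
  refine FiniteDimensional.span_of_finite ℝ ?_
  have : {f : L1Cube n | ∃ (k : ι) (j : Option (Fin n)),
      f =ᵐ[cubeMeasure n] (Q k).indicator fun x => j.elim 1 fun i => x i} =
      ⋃ k : ι, ⋃ j : Option (Fin n), {f : L1Cube n |
        f =ᵐ[cubeMeasure n] (Q k).indicator fun x => j.elim 1 fun i => x i} := by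
    ext f; simp
  rw [this]
  refine Set.finite_iUnion fun k => Set.finite_iUnion fun j => Set.Subsingleton.finite ?_
  intro f hf g hg
  rw [Set.mem_ofPred_eq] at hf hg
  exact Lp.ext (hf.trans hg.symm)

theorem mem_pieceSpan {ι : Type*} [Fintype ι] {Q : ι → Set (Eu n)} (hQ : ∀ k, MeasurableSet (Q k))
    (a : ι → Eu n →ᵃ[ℝ] ℝ) {f : L1Cube n}
    (hf : f =ᵐ[cubeMeasure n] fun x => ∑ k, (Q k).indicator (a k) x) : f ∈ pieceSpan Q := by
  have h1 : ∀ (k : ι) (j : Option (Fin n)), MemLp ((Q k).indicator fun x : Eu n =>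
      j.elim 1 fun i => x i) 1 (cubeMeasure n) := by
    intro k j
    refine MemLp.indicator (hQ k) (memLp_of_continuous ?_)
    cases j with
    | none => exact continuous_const
    | some i => simp only [Option.elim_some]; fun_prop
  -- The index `none` carries the constant term of the affine piece and `some i` its slope in
  -- direction `i`.
  have e : f = ∑ k, ∑ j : Option (Fin n),
      (j.elim (a k 0) fun i => (a k).linear (stdVec i)) • (h1 k j).toLp _ := by
    apply Lp.ext
    refine hf.trans ?_
    have h2 : ∀ᵐ x ∂cubeMeasure n, ∀ k j, (h1 k j).toLp _ x = ((Q k).indicator fun x : Eu n =>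
        j.elim 1 fun i => x i) x :=
      ae_all_iff.2 fun k => ae_all_iff.2 fun j => (h1 k j).coeFn_toLp
    have h3 := Lp.coeFn_finsetSum Finset.univ fun k => ∑ j : Option (Fin n),
      (j.elim (a k 0) fun i => (a k).linear (stdVec i)) • (h1 k j).toLp _
    have h4 : ∀ᵐ x ∂cubeMeasure n, ∀ k, (∑ j : Option (Fin n),
      (j.elim (a k 0) fun i => (a k).linear (stdVec i)) • (h1 k j).toLp _ : L1Cube n) x =
      ∑ j : Option (Fin n), ((j.elim (a k 0) fun i => (a k).linear (stdVec i)) •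
        (h1 k j).toLp _ : L1Cube n) x := by
      refine ae_all_iff.2 fun k => ?_
      filter_upwards [Lp.coeFn_finsetSum Finset.univ fun j : Option (Fin n) =>
        (j.elim (a k 0) fun i => (a k).linear (stdVec i)) • (h1 k j).toLp _] with x hx
      rw [hx]; simp
    have h5 : ∀ᵐ x ∂cubeMeasure n, ∀ k (j : Option (Fin n)),
        ((j.elim (a k 0) fun i => (a k).linear (stdVec i)) • (h1 k j).toLp _ : L1Cube n) x =
        (j.elim (a k 0) fun i => (a k).linear (stdVec i)) * (h1 k j).toLp _ x :=
      ae_all_iff.2 fun k => ae_all_iff.2 fun j => Lp.coeFn_smul _ _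
    filter_upwards [h2, h3, h4, h5] with x e2 e3 e4 e5
    rw [e3]
    simp only [Finset.sum_apply, e4, e5, e2]
    refine Finset.sum_congr rfl fun k _ => ?_
    rw [Fintype.sum_option]
    by_cases hx : x ∈ Q k
    · simp only [Set.indicator_of_mem hx, Option.elim_none, Option.elim_some, mul_one]
      rw [affineMap_eq]
      have hx' : x = ∑ i, x i • (stdVec i : Eu n) := by
        ext j
        rw [WithLp.ofLp_sum, Finset.sum_apply, Finset.sum_eq_single j] <;> simp +contextual
      conv_lhs => rw [hx', map_sum]
      simp only [map_smul, smul_eq_mul]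
      rw [add_comm]; congr 1
      exact Finset.sum_congr rfl fun i _ => mul_comm _ _
    · simp [hx]
  rw [e]
  refine Submodule.sum_mem _ fun k _ => Submodule.sum_mem _ fun j _ => Submodule.smul_mem _ _ ?_
  exact Submodule.subset_span ⟨k, j, (h1 k j).coeFn_toLp⟩

/-- The corner of the `k`-th subcube of side `1 / m`. -/
def corner {m : ℕ} (k : Fin n → Fin m) : Eu n := WithLp.toLp 2 fun i => ((k i : ℕ) : ℝ) / m

theorem corner_apply {m : ℕ} (k : Fin n → Fin m) (i : Fin n) : corner k i = ((k i : ℕ) : ℝ) / m := rfl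

theorem cubeAt_corner_subset {m : ℕ} (hm : 0 < m) (k : Fin n → Fin m) :
    cubeAt (corner k) (1 / (m : ℝ)) ⊆ cube n := by
  intro x hx i
  obtain ⟨h1, h2⟩ := hx i
  rw [corner_apply] at h1 h2
  have hm' : (0 : ℝ) < m := by exact_mod_cast hm
  refine ⟨lt_of_le_of_lt (by positivity) h1, h2.trans_le ?_⟩
  rw [← add_div, div_le_one hm']
  exact_mod_cast (k i).2

theorem disjoint_cubeAt_corner {m : ℕ} (hm : 0 < m) {k l : Fin n → Fin m} (hkl : k ≠ l) :
    Disjoint (cubeAt (corner k) (1 / (m : ℝ))) (cubeAt (corner l) (1 / (m : ℝ))) := by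
  rw [Set.disjoint_left]
  intro x hx hx'
  refine hkl (funext fun i => ?_)
  obtain ⟨h1, h2⟩ := hx i
  obtain ⟨h3, h4⟩ := hx' i
  rw [corner_apply] at h1 h2 h3 h4
  have hm' : (0 : ℝ) < m := by exact_mod_cast hm
  rw [← add_div, lt_div_iff₀ hm'] at h2 h4
  rw [div_lt_iff₀ hm'] at h1 h3
  have e1 : ((k i : ℕ) : ℝ) < (l i : ℕ) + 1 := by linarith
  have e2 : ((l i : ℕ) : ℝ) < (k i : ℕ) + 1 := by linarith
  norm_cast at e1 e2
  exact Fin.ext (by omega)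

theorem ae_mem_cubeAt_corner {m : ℕ} (hm : 0 < m) :
    ∀ᵐ x ∂cubeMeasure n, ∃ k : Fin n → Fin m, x ∈ cubeAt (corner k) (1 / (m : ℝ)) := by
  have hm' : (0 : ℝ) < m := by exact_mod_cast hm
  have h1 : ∀ᵐ x ∂cubeMeasure n, ∀ (i : Fin n) (j : ℕ), x i ≠ (j : ℝ) / m := by
    refine ae_restrict_of_ae (ae_all_iff.2 fun i => ae_all_iff.2 fun j => ?_)
    have := volume_coord_eq (n := n) i ((j : ℝ) / m)
    simpa [ae_iff] using this
  filter_upwards [h1, ae_restrict_mem (isOpen_cube n).measurableSet] with x hx hxc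
  have h2 : ∀ i, ⌊x i * m⌋₊ < m := by
    intro i
    rw [Nat.floor_lt (mul_nonneg (hxc i).1.le hm'.le)]
    exact mul_lt_of_lt_one_left hm' (hxc i).2
  refine ⟨fun i => ⟨⌊x i * m⌋₊, h2 i⟩, fun i => ?_⟩
  rw [corner_apply]
  have h3 := Nat.floor_le (mul_nonneg (hxc i).1.le hm'.le)
  have h4 := Nat.lt_floor_add_one (x i * m)
  refine ⟨lt_of_le_of_ne ?_ (hx i _).symm, ?_⟩
  · rw [div_le_iff₀ hm']; exact h3
  · rw [← add_div, lt_div_iff₀ hm']; exact h4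

/-- Functions in `L¹` with bounded Hessian–Schatten variation are uniformly close to a
finite-dimensional space. -/
theorem exists_mem_pieceSpan_norm_sub_le (n : ℕ) : ∃ C : ℝ, 0 ≤ C ∧ ∀ m : ℕ, 0 < m →
    ∀ f : L1Cube n, htv 1 f (cube n) ≤ 1 →
      ∃ g ∈ pieceSpan (fun k : Fin n → Fin m => cubeAt (corner k) (1 / (m : ℝ))),
        ‖f - g‖ ≤ C / m ^ 2 := by
  obtain ⟨C, hC, h⟩ := exists_affine_lintegral_cubeAt_le n
  refine ⟨C, hC, fun m hm f hf => ?_⟩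
  have hm' : (0 : ℝ) < m := by exact_mod_cast hm
  have hloc := locallyIntegrableOn_of_L1 f
  set Q := fun k : Fin n → Fin m => cubeAt (corner k) (1 / (m : ℝ)) with hQ
  have hQm : ∀ k, MeasurableSet (Q k) := fun k => (isOpen_cubeAt _ _).measurableSet
  have hQc : ∀ k, Q k ⊆ cube n := cubeAt_corner_subset hm
  have hfin : ∀ k, htv 1 f (Q k) ≠ ⊤ := fun k =>
    ne_top_of_le_ne_top ENNReal.one_ne_top ((htv_mono _ (hQc k)).trans hf)
  choose a ha using fun k => h (corner k) (1 / (m : ℝ)) (by positivity) f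
    (hloc.mono_set (hQc k)) (hfin k)
  have hmem : MemLp (fun x => ∑ k, (Q k).indicator (a k) x) 1 (cubeMeasure n) :=
    memLp_finsetSum _ fun k _ => memLp_indicator_affineMap (hQm k) (a k)
  refine ⟨hmem.toLp _, mem_pieceSpan hQm a hmem.coeFn_toLp, ?_⟩
  rw [Lp.norm_def]
  refine ENNReal.toReal_le_of_le_ofReal (by positivity) ?_
  have e1 : eLpNorm (f - hmem.toLp _ : L1Cube n) 1 (cubeMeasure n) =
      ∫⁻ x in cube n, ‖f x - ∑ k, (Q k).indicator (a k) x‖ₑ := by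
    rw [eLpNorm_one_eq_lintegral_enorm]
    refine lintegral_congr_ae ?_
    filter_upwards [Lp.coeFn_sub f (hmem.toLp _), hmem.coeFn_toLp] with x h1 h2
    rw [h1, Pi.sub_apply, h2]
  have e2 : (cube n : Set (Eu n)) =ᵐ[volume] ⋃ k ∈ (Finset.univ : Finset (Fin n → Fin m)), Q k := by
    have h1 := ae_mem_cubeAt_corner (n := n) hm
    rw [ae_restrict_iff' (isOpen_cube n).measurableSet] at h1
    filter_upwards [h1] with x hx
    refine propext ⟨fun hxc => ?_, fun hx' => ?_⟩
    · obtain ⟨k, hk⟩ := hx hxc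
      exact Set.mem_iUnion₂.2 ⟨k, Finset.mem_univ _, hk⟩
    · obtain ⟨k, -, hk⟩ := Set.mem_iUnion₂.1 hx'
      exact hQc k hk
  rw [e1, Measure.restrict_congr_set e2, lintegral_biUnion_finset
    (fun k _ l _ hkl => disjoint_cubeAt_corner hm hkl) (fun k _ => hQm k)]
  calc ∑ k, ∫⁻ x in Q k, ‖f x - ∑ l, (Q l).indicator (a l) x‖ₑ
      = ∑ k, ∫⁻ x in Q k, ‖f x - a k x‖ₑ := by
        refine Finset.sum_congr rfl fun k _ => setLIntegral_congr_fun (hQm k) fun x hx => ?_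
        rw [Finset.sum_eq_single k]
        · rw [Set.indicator_of_mem hx]
        · intro l _ hl
          rw [Set.indicator_of_notMem]
          exact fun hx' => Set.disjoint_left.1 (disjoint_cubeAt_corner hm hl) hx' hx
        · simp
    -- The gain `m ^ (-2)` is the same on each subcube, and by superadditivity the local variations
    -- add up to at most one, however many subcubes there are.
    _ ≤ ∑ k, ENNReal.ofReal (C * (1 / (m : ℝ)) ^ 2) * htv 1 f (Q k) :=
        Finset.sum_le_sum fun k _ => ha k
    _ = ENNReal.ofReal (C * (1 / (m : ℝ)) ^ 2) * ∑ k, htv 1 f (Q k) := by rw [Finset.mul_sum]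
    _ ≤ ENNReal.ofReal (C * (1 / (m : ℝ)) ^ 2) * 1 := by
        gcongr
        exact (sum_htv_le Finset.univ (fun k _ l _ hkl => disjoint_cubeAt_corner hm hkl)
          (fun k _ => hQc k) hloc).trans hf
    _ = ENNReal.ofReal (C / m ^ 2) := by rw [mul_one]; congr 1; field_simp

/-- Sublevel sets of the Hessian–Schatten variation which are bounded in `L¹`. -/
def boundedSublevel (n : ℕ) (R : ℝ) : Set (L1Cube n) := {f | ‖f‖ ≤ R ∧ htv 1 f (cube n) ≤ 1}

theorem isClosed_setOf_htv_le (n : ℕ) : IsClosed {f : L1Cube n | htv 1 f (cube n) ≤ 1} := by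
  refine IsSeqClosed.isClosed fun u f hu hf => ?_
  rw [Set.mem_ofPred_eq]
  refine (htv_le_liminf (fun k => locallyIntegrableOn_of_L1 (u k)) (locallyIntegrableOn_of_L1 f)
    ((Lp.tendsto_Lp_iff_tendsto_eLpNorm' _ _).1 hf)).trans ?_
  refine liminf_le_of_frequently_le' (Frequently.of_forall fun k => hu k)

/-- Closed by lower semicontinuity, and totally bounded because it lies within `ε / 2` of a bounded
subset of a finite-dimensional space. -/
theorem isCompact_boundedSublevel (n : ℕ) (R : ℝ) : IsCompact (boundedSublevel n R) := by
  have hclosed : IsClosed (boundedSublevel n R) :=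
    (isClosed_le continuous_norm continuous_const).inter (isClosed_setOf_htv_le n)
  refine TotallyBounded.isCompact_of_isClosed ?_ hclosed
  rw [Metric.totallyBounded_iff]
  intro ε hε
  obtain ⟨C, hC, h⟩ := exists_mem_pieceSpan_norm_sub_le n
  obtain ⟨m, hm⟩ := exists_nat_gt (max (C / (ε / 2)) 1)
  have hm1 : (1 : ℝ) < m := (le_max_right _ _).trans_lt hm
  have hm0 : 0 < m := by exact_mod_cast zero_lt_one.trans hm1
  have hCm : C / (m : ℝ) ^ 2 < ε / 2 := by
    rw [div_lt_iff₀ (by positivity)]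
    have h1 : C < m * (ε / 2) := by
      have := (le_max_left _ _).trans_lt hm
      rwa [div_lt_iff₀ (by positivity)] at this
    nlinarith
  set W := pieceSpan (fun k : Fin n → Fin m => cubeAt (corner k) (1 / (m : ℝ)))
  have : ProperSpace W := FiniteDimensional.proper ℝ W
  have hK : IsCompact ((↑) '' Metric.closedBall (0 : W) (R + ε / 2) : Set (L1Cube n)) :=
    (isCompact_closedBall _ _).image continuous_subtype_val
  obtain ⟨t, ht, htK⟩ := Metric.totallyBounded_iff.1 hK.totallyBounded (ε / 2) (by positivity)
  refine ⟨t, ht, fun f hf => ?_⟩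
  obtain ⟨g, hg, hfg⟩ := h m hm0 f hf.2
  have hgK : g ∈ ((↑) '' Metric.closedBall (0 : W) (R + ε / 2) : Set (L1Cube n)) := by
    refine ⟨⟨g, hg⟩, ?_, rfl⟩
    rw [mem_closedBall_zero_iff]
    change ‖g‖ ≤ _
    calc ‖g‖ ≤ ‖f‖ + ‖f - g‖ := by
          have := norm_sub_le f (f - g); rwa [sub_sub_cancel] at this
      _ ≤ _ := add_le_add hf.1 (hfg.trans hCm.le)
  obtain ⟨y, hy, hgy⟩ := Set.mem_iUnion₂.1 (htK hgK)
  refine Set.mem_iUnion₂.2 ⟨y, hy, ?_⟩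
  rw [Metric.mem_ball] at hgy ⊢
  calc dist f y ≤ dist f g + dist g y := dist_triangle _ _ _
    _ < ε / 2 + ε / 2 := by
        rw [dist_eq_norm]; exact add_lt_add (hfg.trans_lt hCm) hgy
    _ = ε := add_halves ε

theorem htv_congr_L1 {f : L1Cube n} {u : Eu n → ℝ} (h : f =ᵐ[cubeMeasure n] u) :
    htv 1 f (cube n) = htv 1 u (cube n) := htv_congr_ae h

theorem htv_add_of_mem_affineSubmodule (f : L1Cube n) {a : L1Cube n} (ha : a ∈ affineSubmodule n) :
    htv 1 (f + a : L1Cube n) (cube n) = htv 1 f (cube n) := by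
  obtain ⟨b, hb⟩ := ha
  rw [← htv_add_affineMap (locallyIntegrableOn_of_L1 f) b]
  refine htv_congr_L1 ?_
  filter_upwards [Lp.coeFn_add f a, hb] with x h1 h2
  rw [h1, Pi.add_apply, h2]

/-- By the Poincaré inequality each class has a representative of norm at most `C`, so the ball is
the image of a compact set even though its preimage is unbounded in the affine directions. -/
theorem unitBall_eq_image_boundedSublevel (n : ℕ) :
    ∃ R : ℝ, unitBall n = proj n '' boundedSublevel n R := by
  obtain ⟨C, hC, h⟩ := exists_affine_lintegral_le n
  refine ⟨C, Set.Subset.antisymm ?_ (Set.image_mono fun f hf => hf.2)⟩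
  rintro _ ⟨f, hf, rfl⟩
  rw [Set.mem_ofPred_eq] at hf
  obtain ⟨a, ha⟩ := h f (locallyIntegrableOn_of_L1 f) (ne_top_of_le_ne_top ENNReal.one_ne_top hf)
  set b : L1Cube n := (memLp_affineMap a).toLp _
  have hb : b ∈ affineSubmodule n := ⟨a, (memLp_affineMap a).coeFn_toLp⟩
  refine ⟨f + -b, ⟨?_, ?_⟩, ?_⟩
  · rw [← sub_eq_add_neg, Lp.norm_def]
    refine ENNReal.toReal_le_of_le_ofReal hC ?_
    rw [eLpNorm_one_eq_lintegral_enorm]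
    calc _ = ∫⁻ x in cube n, ‖f x - a x‖ₑ := by
          refine lintegral_congr_ae ?_
          filter_upwards [Lp.coeFn_sub f b, (memLp_affineMap a).coeFn_toLp] with x h1 h2
          rw [h1, Pi.sub_apply, h2]
      _ ≤ ENNReal.ofReal C * 1 := ha.trans (by gcongr)
      _ = _ := mul_one _
  · rw [htv_add_of_mem_affineSubmodule f (neg_mem hb)]; exact hf
  · rw [map_add, map_neg, (Submodule.Quotient.mk_eq_zero _).2 hb |> fun h => (h : proj n b = 0)]
    simp

theorem isCompact_unitBall (n : ℕ) : IsCompact (unitBall n) := by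
  obtain ⟨R, hR⟩ := unitBall_eq_image_boundedSublevel n
  rw [hR]
  exact (isCompact_boundedSublevel n R).image continuous_quot_mk

theorem htv_coe_add_le (f g : L1Cube n) :
    htv 1 (f + g : L1Cube n) (cube n) ≤ htv 1 f (cube n) + htv 1 g (cube n) := by
  refine le_of_eq_of_le (htv_congr_L1 (Lp.coeFn_add f g)) ?_
  exact htv_add_le (locallyIntegrableOn_of_L1 f) (locallyIntegrableOn_of_L1 g)

theorem htv_coe_smul_le (c : ℝ) (f : L1Cube n) :
    htv 1 (c • f : L1Cube n) (cube n) ≤ ENNReal.ofReal |c| * htv 1 f (cube n) := by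
  refine le_of_eq_of_le (htv_congr_L1 (Lp.coeFn_smul c f)) ?_
  exact htv_const_mul_le c

theorem convex_setOf_htv_le (n : ℕ) : Convex ℝ {f : L1Cube n | htv 1 f (cube n) ≤ 1} := by
  intro f hf g hg s t hs ht hst
  rw [Set.mem_ofPred_eq] at hf hg ⊢
  calc _ ≤ ENNReal.ofReal |s| * htv 1 f (cube n) + ENNReal.ofReal |t| * htv 1 g (cube n) :=
        (htv_coe_add_le _ _).trans (add_le_add (htv_coe_smul_le s f) (htv_coe_smul_le t g))
    _ ≤ ENNReal.ofReal |s| * 1 + ENNReal.ofReal |t| * 1 := by gcongr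
    _ = 1 := by
        rw [mul_one, mul_one, abs_of_nonneg hs, abs_of_nonneg ht, ← ENNReal.ofReal_add hs ht, hst,
          ENNReal.ofReal_one]

theorem convex_unitBall (n : ℕ) : Convex ℝ (unitBall n) :=
  (convex_setOf_htv_le n).linear_image (proj n)

instance finiteDimensional_affineSubmodule : FiniteDimensional ℝ (affineSubmodule n) := by
  refine Submodule.finiteDimensional_of_le (S₂ := pieceSpan fun _ : Unit => (Set.univ : Set (Eu n))) ?_
  rintro f ⟨a, ha⟩
  refine mem_pieceSpan (fun _ => MeasurableSet.univ) (fun _ => a) (ha.trans ?_)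
  simp only [Finset.univ_unique, Set.indicator_univ, Finset.sum_const, Finset.card_singleton,
    one_smul]
  rfl

/-- Closedness makes the quotient seminorm a norm, so that `L1ModAffine n` is Hausdorff. -/
instance isClosed_affineSubmodule : IsClosed (affineSubmodule n : Set (L1Cube n)) :=
  (affineSubmodule n).closed_of_finiteDimensional

end Compactness

/-! ### Localisation of the variation, and functions of zero variation. -/

section Local
variable {n : ℕ} {u : Eu n → ℝ}

/-- An approximate converse of superadditivity. The cutoff `χ` equals one on `K`, hence on the open
set `U'`, so the support of the part `(1 - χ) F` avoids `U'`; the room between `U'` and `U` is what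
the cutoff costs. -/
theorem htv_le_add_diff {K U U' C : Set (Eu n)} (hK : IsCompact K) (hU : IsOpen U) (hKU : K ⊆ U)
    (hU' : IsOpen U') (hUK : U' ⊆ K) (hUC : U ⊆ C) (hu : LocallyIntegrableOn u C) :
    htv 1 u C ≤ htv 1 u U + htv 1 u (C \ U') := by
  obtain ⟨χ, hχ, hχc, hχU, hχ01, hχ1⟩ := exists_smooth_cutoff hK hU hKU
  refine htv_le_of_forall fun F hF h1 => ?_
  have f1 : IsSmoothField U (fun x => χ x • F x) := .of_tsupport hχ hχc hχU hF.1
  have f2' : IsSmoothField C (fun x => (1 - χ x) • F x) := hF.smul_fun (contDiff_const.sub hχ)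
  have f2 : IsSmoothField (C \ U') (fun x => (1 - χ x) • F x) := by
    refine ⟨f2'.1, f2'.2, fun i j x hx => ⟨f2'.3 i j hx, fun hxU => ?_⟩⟩
    obtain ⟨y, hy, hyU⟩ := mem_closure_iff.1 hx U' hU' hxU
    exact hyU (by simp [hχ1 y (hUK hy)])
  have e : ∀ x, hdiv F x = hdiv (fun x => χ x • F x) x + hdiv (fun x => (1 - χ x) • F x) x := by
    intro x
    rw [← congrFun (f1.hdiv_add f2') x]
    congr 1
    ext y i j
    simp
    ring
  have i1 : Integrable fun x => u x * hdiv (fun x => χ x • F x) x :=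
    f1.integrable (hu.mono_set hUC)
  have i2 : Integrable fun x => u x * hdiv (fun x => (1 - χ x) • F x) x :=
    f2.integrable (hu.mono_set Set.sdiff_subset)
  have e2 : ∫ x, u x * hdiv F x = (∫ x, u x * hdiv (fun x => χ x • F x) x) +
      ∫ x, u x * hdiv (fun x => (1 - χ x) • F x) x := by
    rw [← integral_add i1 i2]
    simp only [e, mul_add]
  rw [e2]
  refine ENNReal.ofReal_add_le.trans (add_le_add (ofReal_integral_le_htv f1 (fun x => ?_) u)
    (ofReal_integral_le_htv f2 (fun x => ?_) u))
  · exact (h1 x).smul (by rw [abs_of_nonneg (hχ01 x).1]; exact (hχ01 x).2)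
  · exact (h1 x).smul (by
      rw [abs_of_nonneg (by linarith [(hχ01 x).2])]; linarith [(hχ01 x).1])

/-- If `g` is a convex combination of `g₁, g₂` without cancellation of the total variation, then
the variations of `g₁` and `g₂` are dominated by that of `g`. -/
theorem htv_combination_le {K U U' C : Set (Eu n)} (hK : IsCompact K) (hU : IsOpen U) (hKU : K ⊆ U)
    (hU' : IsOpen U') (hUK : U' ⊆ K) (hUC : U ⊆ C) {g g₁ g₂ : Eu n → ℝ}
    (hg₁ : LocallyIntegrableOn g₁ C) (hg₂ : LocallyIntegrableOn g₂ C)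
    (hg : LocallyIntegrableOn g C) {t s : ℝ}
    (ht : 0 ≤ t) (hs : 0 ≤ s) (hts : t + s = 1)
    (h : g =ᵐ[volume.restrict C] fun x => t * g₁ x + s * g₂ x) (h0 : 1 ≤ htv 1 g C)
    (h1 : htv 1 g₁ C ≤ 1) (h2 : htv 1 g₂ C ≤ 1) :
    ENNReal.ofReal t * htv 1 g₁ U' + ENNReal.ofReal s * htv 1 g₂ U' ≤ htv 1 g U := by
  have hUC' : U' ⊆ C := (hUK.trans hKU).trans hUC
  set D := C \ U'
  set X := ENNReal.ofReal t * htv 1 g₁ U' + ENNReal.ofReal s * htv 1 g₂ U'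
  set Y := ENNReal.ofReal t * htv 1 g₁ D + ENNReal.ofReal s * htv 1 g₂ D
  -- Superadditivity for `g₁` and `g₂` separately: each has at most one unit of variation to share
  -- between `U'` and `D`.
  have hXY : X + Y ≤ 1 := by
    have a1 : htv 1 g₁ U' + htv 1 g₁ D ≤ 1 :=
      (htv_add_htv_le Set.disjoint_sdiff_right hUC' Set.sdiff_subset hg₁).trans h1
    have a2 : htv 1 g₂ U' + htv 1 g₂ D ≤ 1 :=
      (htv_add_htv_le Set.disjoint_sdiff_right hUC' Set.sdiff_subset hg₂).trans h2
    calc X + Y = ENNReal.ofReal t * (htv 1 g₁ U' + htv 1 g₁ D) +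
          ENNReal.ofReal s * (htv 1 g₂ U' + htv 1 g₂ D) := by simp only [X, Y]; ring
      _ ≤ ENNReal.ofReal t * 1 + ENNReal.ofReal s * 1 := by gcongr
      _ = 1 := by rw [mul_one, mul_one, ← ENNReal.ofReal_add ht hs, hts, ENNReal.ofReal_one]
  have hgD : htv 1 g D ≤ Y := by
    rw [htv_congr_ae (ae_restrict_of_ae_restrict_of_subset Set.sdiff_subset h)]
    have l1 : LocallyIntegrableOn g₁ D := hg₁.mono_set Set.sdiff_subset
    have l2 : LocallyIntegrableOn g₂ D := hg₂.mono_set Set.sdiff_subset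
    refine (htv_add_le (u := fun x => t * g₁ x) (v := fun x => s * g₂ x) (l1.smul t)
      (l2.smul s)).trans (add_le_add ?_ ?_)
    · refine (htv_const_mul_le t).trans_eq ?_
      rw [abs_of_nonneg ht]
    · refine (htv_const_mul_le s).trans_eq ?_
      rw [abs_of_nonneg hs]
  have hfin : Y ≠ ⊤ := ne_top_of_le_ne_top ENNReal.one_ne_top (le_add_self.trans hXY)
  -- Now `X + Y ≤ 1 ≤ htv 1 g U + Y`, and the finite `Y` cancels.
  have := h0.trans (htv_le_add_diff hK hU hKU hU' hUK hUC hg)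
  exact ENNReal.le_of_add_le_add_right hfin (hXY.trans (this.trans (add_le_add le_rfl hgD)))

theorem affineMap_ext_of_ae_eq {a b : Eu n →ᵃ[ℝ] ℝ} {V : Set (Eu n)} (hV : IsOpen V)
    (hne : V.Nonempty) (h : a =ᵐ[volume.restrict V] b) : a = b := by
  by_contra hab
  have hex : ∃ x, (a - b) x ≠ 0 := by
    by_contra! hall
    exact hab (AffineMap.ext fun x => sub_eq_zero.1 (hall x))
  have h0 := volume_affineMap_eq_zero hex
  have h1 : ∀ᵐ x ∂volume.restrict V, False := by
    filter_upwards [h, ae_restrict_of_ae (measure_eq_zero_iff_ae_notMem.1 h0)] with x hx hx'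
    refine hx' ?_
    exact sub_eq_zero.2 hx
  have h2 : volume V = 0 := by simpa using h1
  exact (hV.measure_pos volume hne).ne' h2

theorem exists_cubeAt_subset {O : Set (Eu n)} (hO : IsOpen O) {x : Eu n} (hx : x ∈ O) :
    ∃ (c : Eu n) (r : ℝ), 0 < r ∧ x ∈ cubeAt c r ∧ cubeAt c r ⊆ O := by
  have h1 : (WithLp.ofLp : Eu n → Fin n → ℝ) '' O ∈ 𝓝 (WithLp.ofLp x) := by
    have := (PiLp.homeomorph 2 (fun _ : Fin n => ℝ)).isOpenMap O hO
    exact this.mem_nhds ⟨x, hx, rfl⟩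
  obtain ⟨ε, hε, hb⟩ := Metric.mem_nhds_iff.1 h1
  refine ⟨WithLp.toLp 2 fun i => x i - ε / 2, ε, hε, fun i => ?_, fun y hy => ?_⟩
  · constructor <;> simp <;> linarith
  · obtain ⟨z, hz, hzy⟩ := hb (show WithLp.ofLp y ∈ Metric.ball (WithLp.ofLp x) ε by
      rw [Metric.mem_ball, dist_pi_lt_iff hε]
      intro i
      obtain ⟨h3, h4⟩ := hy i
      simp only at h3 h4
      rw [Real.dist_eq, abs_lt]
      constructor <;> linarith)
    have : z = y := WithLp.ofLp_injective 2 hzy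
    exact this ▸ hz

theorem ae_restrict_of_locally {O : Set (Eu n)} (hO : MeasurableSet O) {p : Eu n → Prop}
    (h : ∀ x ∈ O, ∃ V, IsOpen V ∧ x ∈ V ∧ ∀ᵐ y ∂volume.restrict V, p y) :
    ∀ᵐ y ∂volume.restrict O, p y := by
  rw [ae_restrict_iff' hO]
  have : volume {x | x ∈ O ∧ ¬ p x} = 0 := by
    refine measure_null_of_locally_null _ fun x hx => ?_
    obtain ⟨V, hV, hxV, hp⟩ := h x hx.1
    rw [ae_restrict_iff' hV.measurableSet] at hp
    refine ⟨_, inter_mem_nhdsWithin _ (hV.mem_nhds hxV), ?_⟩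
    refine measure_mono_null ?_ hp
    rintro y ⟨⟨_, hy⟩, hyV⟩ hc
    exact hy (hc hyV)
  rw [ae_iff]
  convert this using 2
  ext x; simp

/-- A function whose Hessian–Schatten variation vanishes locally on a connected open set is
affine. -/
theorem exists_affine_of_locally_htv_eq_zero {O : Set (Eu n)} (hO : IsOpen O)
    (hc : IsPreconnected O) (hu : LocallyIntegrableOn u O)
    (h : ∀ x ∈ O, ∃ V, IsOpen V ∧ x ∈ V ∧ V ⊆ O ∧ htv 1 u V = 0) :
    ∃ a : Eu n →ᵃ[ℝ] ℝ, u =ᵐ[volume.restrict O] a := by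
  obtain ⟨C, hC, hP⟩ := exists_affine_lintegral_cubeAt_le n
  have key : ∀ x ∈ O, ∃ (V : Set (Eu n)) (a : Eu n →ᵃ[ℝ] ℝ), IsOpen V ∧ x ∈ V ∧ V ⊆ O ∧
      u =ᵐ[volume.restrict V] a := by
    intro x hx
    obtain ⟨W, hW, hxW, hWO, h0⟩ := h x hx
    obtain ⟨c, r, hr, hxc, hcW⟩ := exists_cubeAt_subset hW hxW
    have hz : htv 1 u (cubeAt c r) = 0 := le_antisymm ((htv_mono u hcW).trans h0.le) zero_le
    have hl : LocallyIntegrableOn u (cubeAt c r) := hu.mono_set (hcW.trans hWO)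
    obtain ⟨a, ha⟩ := hP c r hr u hl (by simp [hz])
    refine ⟨cubeAt c r, a, isOpen_cubeAt c r, hxc, hcW.trans hWO, ?_⟩
    -- With zero variation the Poincaré inequality says that `u` equals an affine function almost
    -- everywhere on a small cube.
    rw [hz, mul_zero] at ha
    have hm : AEMeasurable (fun x => ‖u x - a x‖ₑ) (volume.restrict (cubeAt c r)) :=
      (hl.aestronglyMeasurable.sub
        (continuous_affineMap a).aestronglyMeasurable).enorm
    have := (lintegral_eq_zero_iff' hm).1 (le_antisymm ha zero_le)
    filter_upwards [this] with y hy
    simpa [sub_eq_zero] using hy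
  choose! V a hV hxV hVO hua using key
  rcases O.eq_empty_or_nonempty with rfl | ⟨x₀, hx₀⟩
  · exact ⟨0, by simp [Filter.EventuallyEq]⟩
  have hconst : ∀ x ∈ O, ∀ y ∈ V x, a y = a x := by
    intro x hx y hy
    have hyO := hVO x hx hy
    refine affineMap_ext_of_ae_eq ((hV x hx).inter (hV y hyO)) ⟨y, hy, hxV y hyO⟩ ?_
    filter_upwards [ae_restrict_of_ae_restrict_of_subset Set.inter_subset_left (hua x hx),
      ae_restrict_of_ae_restrict_of_subset Set.inter_subset_right (hua y hyO)] with z h1 h2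
    rw [← h1, ← h2]
  -- The local affine map is locally constant in `x`, hence constant by connectedness.
  have hall : ∀ x ∈ O, a x = a x₀ := by
    have hS : O ⊆ ⋃ x ∈ {x ∈ O | a x = a x₀}, V x := by
      refine hc.subset_left_of_subset_union (v := ⋃ x ∈ {x ∈ O | a x ≠ a x₀}, V x)
        (isOpen_biUnion fun x hx => hV x hx.1)
        (isOpen_biUnion fun x hx => hV x hx.1) ?_ ?_ ?_
      · rw [Set.disjoint_left]
        intro y hy hy'
        obtain ⟨x, hx, hyx⟩ := Set.mem_iUnion₂.1 hy
        obtain ⟨x', hx', hyx'⟩ := Set.mem_iUnion₂.1 hy'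
        exact hx'.2 ((hconst x' hx'.1 y hyx').symm.trans ((hconst x hx.1 y hyx).trans hx.2))
      · intro x hx
        by_cases hxe : a x = a x₀
        · exact Or.inl (Set.mem_iUnion₂.2 ⟨x, ⟨hx, hxe⟩, hxV x hx⟩)
        · exact Or.inr (Set.mem_iUnion₂.2 ⟨x, ⟨hx, hxe⟩, hxV x hx⟩)
      · exact ⟨x₀, hx₀, Set.mem_iUnion₂.2 ⟨x₀, ⟨hx₀, rfl⟩, hxV x₀ hx₀⟩⟩
    intro x hx
    obtain ⟨y, hy, hxy⟩ := Set.mem_iUnion₂.1 (hS hx)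
    exact (hconst y hy.1 x hxy).trans hy.2
  refine ⟨a x₀, ae_restrict_of_locally hO.measurableSet fun x hx =>
    ⟨V x, hV x hx, hxV x hx, ?_⟩⟩
  rw [← hall x hx]
  exact hua x hx

end Local

/-! ### Balls of the supremum norm, and mean values of affine functions. -/

section SupBall
variable {n : ℕ}

/-- The open ball of the supremum norm. -/
def supBall (x : Eu n) (ρ : ℝ) : Set (Eu n) := {y | ∀ i, |y i - x i| < ρ}

theorem supBall_eq_cubeAt (x : Eu n) (ρ : ℝ) :
    supBall x ρ = cubeAt (WithLp.toLp 2 fun i => x i - ρ) (2 * ρ) := by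
  ext y
  refine forall_congr' fun i => ?_
  rw [abs_lt]
  constructor <;> rintro ⟨h1, h2⟩ <;> constructor <;> simp at * <;> linarith

theorem isOpen_supBall (x : Eu n) (ρ : ℝ) : IsOpen (supBall x ρ) := by
  rw [supBall_eq_cubeAt]; exact isOpen_cubeAt _ _

theorem mem_supBall_self (x : Eu n) {ρ : ℝ} (hρ : 0 < ρ) : x ∈ supBall x ρ := fun i => by
  simpa using hρ

theorem supBall_mono (x : Eu n) {ρ σ : ℝ} (h : ρ ≤ σ) : supBall x ρ ⊆ supBall x σ :=
  fun _ hy i => (hy i).trans_le h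

theorem isCompact_closed_supBall (x : Eu n) (ρ : ℝ) : IsCompact {y : Eu n | ∀ i, |y i - x i| ≤ ρ} := by
  have h : {y : Eu n | ∀ i, |y i - x i| ≤ ρ} =
      (PiLp.homeomorph 2 (fun _ : Fin n => ℝ)) ⁻¹' (Set.univ.pi fun i => Metric.closedBall (x i) ρ) := by
    ext y
    simp [Real.dist_eq, Set.mem_pi]
    rfl
  rw [h, Homeomorph.isCompact_preimage]
  exact isCompact_univ_pi fun i => isCompact_closedBall _ _

theorem exists_supBall_subset {O : Set (Eu n)} (hO : IsOpen O) {x : Eu n} (hx : x ∈ O) :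
    ∃ ρ : ℝ, 0 < ρ ∧ supBall x ρ ⊆ O := by
  obtain ⟨c, r, hr, hxc, hcO⟩ := exists_cubeAt_subset hO hx
  have : ∃ ρ : ℝ, 0 < ρ ∧ ∀ i, c i + ρ ≤ x i ∧ x i + ρ ≤ c i + r := by
    have h : ∀ i, ∃ ρ : ℝ, 0 < ρ ∧ c i + ρ ≤ x i ∧ x i + ρ ≤ c i + r := fun i =>
      ⟨min (x i - c i) (c i + r - x i), lt_min (by linarith [(hxc i).1]) (by linarith [(hxc i).2]),
        by linarith [min_le_left (x i - c i) (c i + r - x i)],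
        by linarith [min_le_right (x i - c i) (c i + r - x i)]⟩
    choose ρ h0 h1 h2 using h
    rcases isEmpty_or_nonempty (Fin n) with he | he
    · exact ⟨1, one_pos, fun i => he.elim i⟩
    · obtain ⟨j, hj⟩ := Finite.exists_min ρ
      exact ⟨ρ j, h0 j, fun i => ⟨by linarith [hj i, h1 i], by linarith [hj i, h2 i]⟩⟩
  obtain ⟨ρ, hρ, h⟩ := this
  refine ⟨ρ, hρ, fun y hy => hcO fun i => ?_⟩
  have h1 := abs_lt.1 (hy i)
  constructor <;> linarith [h i]

theorem convex_cube : Convex ℝ (cube n) := by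
  intro x hx y hy a b ha hb hab i
  simp only [PiLp.add_apply, PiLp.smul_apply, smul_eq_mul]
  rcases eq_or_lt_of_le ha with rfl | ha
  · have : b = 1 := by linarith
    subst this; simpa using hy i
  · constructor
    · nlinarith [mul_pos ha (hx i).1, mul_nonneg hb (hy i).1.le]
    · nlinarith [mul_lt_mul_of_pos_left (hx i).2 ha, mul_le_mul_of_nonneg_left (hy i).2.le hb]

/-- The reflection `x ↦ 2 c - x` preserves the ball and `2 a c = a x + a (2 c - x)`; integrating the
triangle inequality gives the estimate. -/
theorem enorm_mul_volume_ball_le (a : Eu n →ᵃ[ℝ] ℝ) (c : Eu n) (r : ℝ) :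
    ‖a c‖ₑ * volume (Metric.ball c r) ≤ ∫⁻ x in Metric.ball c r, ‖a x‖ₑ := by
  have hm : Measurable fun x => ‖a x‖ₑ := (continuous_affineMap a).measurable.enorm
  have hp := Measure.measurePreserving_sub_left (volume : Measure (Eu n)) (c + c)
  have h1 : ∫⁻ x in Metric.ball c r, ‖a (c + c - x)‖ₑ = ∫⁻ x in Metric.ball c r, ‖a x‖ₑ := by
    rw [← hp.setLIntegral_comp_preimage measurableSet_ball hm]
    congr 2
    ext x
    simp only [Set.mem_preimage, Metric.mem_ball, dist_eq_norm]
    rw [show c + c - x - c = -(x - c) by abel, norm_neg]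
  have h2 : 2 * (‖a c‖ₑ * volume (Metric.ball c r)) ≤ 2 * ∫⁻ x in Metric.ball c r, ‖a x‖ₑ := by
    calc 2 * (‖a c‖ₑ * volume (Metric.ball c r)) = ∫⁻ _ in Metric.ball c r, 2 * ‖a c‖ₑ := by
          rw [setLIntegral_const, mul_assoc]
      _ ≤ ∫⁻ x in Metric.ball c r, (‖a x‖ₑ + ‖a (c + c - x)‖ₑ) := by
          refine lintegral_mono fun x => ?_
          have e : (2 : ℝ) * a c = a x + a (c + c - x) := by
            rw [affineMap_eq a c, affineMap_eq a x, affineMap_eq a (c + c - x)]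
            simp
            ring
          calc 2 * ‖a c‖ₑ = ‖(2 : ℝ) * a c‖ₑ := by
                rw [enorm_mul]; congr 1
                simp [Real.enorm_eq_ofReal_abs]
            _ ≤ _ := by rw [e]; exact enorm_add_le _ _
      _ = _ := by rw [lintegral_add_left hm, h1, two_mul]
  exact (ENNReal.mul_le_mul_iff_right (by simp) (by simp)).1 h2

end SupBall

/-! ### Polytopal decompositions and local homogeneity of CPWL functions. -/

section Decomposition
variable {n : ℕ} {𝒯 : Set (Set (Eu n))}

theorem IsPolytope.convex {P : Set (Eu n)} (h : IsPolytope P) : Convex ℝ P := by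
  obtain ⟨⟨s, rfl⟩, -⟩ := h; exact convex_convexHull _ _

theorem IsPolytope.isCompact {P : Set (Eu n)} (h : IsPolytope P) : IsCompact P := by
  obtain ⟨⟨s, rfl⟩, -⟩ := h; exact s.finite_toSet.isCompact_convexHull ℝ

theorem IsPolytopalDecomposition.exists_mem (h : IsPolytopalDecomposition 𝒯) (x : Eu n) :
    ∃ P ∈ 𝒯, x ∈ P := by
  have : x ∈ ⋃₀ 𝒯 := h.covers ▸ Set.mem_univ x
  exact this

theorem IsPolytopalDecomposition.finite_inter_cube (h : IsPolytopalDecomposition 𝒯) :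
    {P ∈ 𝒯 | (P ∩ cube n).Nonempty}.Finite := by
  obtain ⟨R, hR⟩ := ((isCompact_box (n := n) (α := 0) le_rfl).isBounded.subset
    cube_subset_box).subset_ball (0 : Eu n)
  exact (h.locallyFinite 0 R).subset fun P hP =>
    ⟨hP.1, hP.2.mono (Set.inter_subset_inter_right _ hR)⟩

/-- The polytopes that meet the unit ball around `x` but miss `x` are finitely many compact sets, so
`x` has a neighbourhood which avoids them all. -/
theorem IsPolytopalDecomposition.eventually_mem (h : IsPolytopalDecomposition 𝒯) (x : Eu n) :
    ∀ᶠ y in 𝓝 x, ∀ P ∈ 𝒯, y ∈ P → x ∈ P := by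
  have hfin : {P ∈ 𝒯 | (P ∩ Metric.ball x 1).Nonempty ∧ x ∉ P}.Finite :=
    (h.locallyFinite x 1).subset fun P hP => ⟨hP.1, hP.2.1⟩
  have hcl : IsClosed (⋃ P ∈ {P ∈ 𝒯 | (P ∩ Metric.ball x 1).Nonempty ∧ x ∉ P}, P) :=
    hfin.isClosed_biUnion fun P hP => (h.isPolytope P hP.1).isCompact.isClosed
  filter_upwards [hcl.isOpen_compl.mem_nhds (by simp), Metric.ball_mem_nhds x one_pos] with y hy hyb
    P hP hyP
  by_contra hx
  exact hy (Set.mem_iUnion₂.2 ⟨P, ⟨hP, ⟨y, hyP, hyb⟩, hx⟩, hyP⟩)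

theorem IsPolytopalDecomposition.ae_mem_interior (h : IsPolytopalDecomposition 𝒯) :
    ∀ᵐ x ∂cubeMeasure n, ∃ P ∈ {P ∈ 𝒯 | (P ∩ cube n).Nonempty}, x ∈ interior P := by
  have h1 : ∀ᵐ x ∂cubeMeasure n, ∀ P ∈ {P ∈ 𝒯 | (P ∩ cube n).Nonempty}, x ∉ frontier P := by
    rw [ae_ball_iff h.finite_inter_cube.countable]
    intro P hP
    exact ae_restrict_of_ae (measure_eq_zero_iff_ae_notMem.1
      ((h.isPolytope P hP.1).convex.addHaar_frontier volume))
  filter_upwards [h1, ae_restrict_mem (isOpen_cube n).measurableSet] with x hx hxc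
  obtain ⟨P, hP, hxP⟩ := h.exists_mem x
  refine ⟨P, ⟨hP, x, hxP, hxc⟩, ?_⟩
  by_contra hi
  refine hx P ⟨hP, x, hxP, hxc⟩ ?_
  exact ⟨subset_closure hxP, hi⟩

/-- Continuous functions on the cube which are affine on each piece of the decomposition `𝒯`. -/
def IsPiecewiseAffine (𝒯 : Set (Set (Eu n))) (g : Eu n → ℝ) : Prop :=
  ContinuousOn g (cube n) ∧ ∀ P ∈ 𝒯, ∃ a : Eu n →ᵃ[ℝ] ℝ, ∀ x ∈ P ∩ cube n, g x = a x

variable {g : Eu n → ℝ}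

/-- A point `y` near `x` lies in a polytope which also contains `x`, and by convexity the segment
between them stays in that polytope. Thus `g - g x` is positively homogeneous about `x`. -/
theorem IsPiecewiseAffine.exists_homogeneous (h : IsPolytopalDecomposition 𝒯)
    (hg : IsPiecewiseAffine 𝒯 g) {x : Eu n} (hx : x ∈ cube n) :
    ∃ ρ : ℝ, 0 < ρ ∧ supBall x ρ ⊆ cube n ∧ ∀ y ∈ supBall x ρ, ∀ s : ℝ, 0 ≤ s → s ≤ 1 →
      g (x + s • (y - x)) = s * g y + (1 - s) * g x := by
  obtain ⟨O, hO, hOo, hxO⟩ := eventually_nhds_iff.1 (h.eventually_mem x)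
  obtain ⟨ρ, hρ, hs⟩ := exists_supBall_subset (hOo.inter (isOpen_cube n)) ⟨hxO, hx⟩
  refine ⟨ρ, hρ, fun y hy => (hs hy).2, fun y hy s hs0 hs1 => ?_⟩
  obtain ⟨P, hP, hyP⟩ := h.exists_mem y
  have hxP := hO y (hs hy).1 P hP hyP
  obtain ⟨a, ha⟩ := hg.2 P hP
  have e : x + s • (y - x) = (1 - s) • x + s • y := by
    rw [smul_sub, sub_smul, one_smul]; abel
  rw [e, ha y ⟨hyP, (hs hy).2⟩, ha x ⟨hxP, hx⟩, ha]
  · rw [affineMap_eq a ((1 - s) • x + s • y), affineMap_eq a x, affineMap_eq a y]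
    simp
    ring
  · exact ⟨(h.isPolytope P hP).convex hxP hyP (by linarith) hs0 (by ring),
      convex_cube hx (hs hy).2 (by linarith) hs0 (by ring)⟩

theorem IsPiecewiseAffine.locallyIntegrableOn (hg : IsPiecewiseAffine 𝒯 g) :
    LocallyIntegrableOn g (cube n) :=
  hg.1.locallyIntegrableOn (isOpen_cube n).measurableSet

/-- Near an interior point the variation of a piecewise affine function on cubes of size `s` is of
order `s ^ (n - 1)`. -/
theorem IsPiecewiseAffine.htv_supBall_le (h : IsPolytopalDecomposition 𝒯)
    (hg : IsPiecewiseAffine 𝒯 g) {x : Eu n} (hx : x ∈ cube n) :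
    ∃ ρ : ℝ, 0 < ρ ∧ supBall x ρ ⊆ cube n ∧ ∀ s : ℝ, 0 < s → s ≤ 1 →
      htv 1 g (supBall x (s * ρ)) ≤ ENNReal.ofReal (s ^ n / s) * htv 1 g (cube n) := by
  obtain ⟨ρ, hρ, hsub, hom⟩ := hg.exists_homogeneous h hx
  refine ⟨ρ, hρ, hsub, fun s hs0 hs1 => ?_⟩
  have hsi : 0 < s⁻¹ := inv_pos.2 hs0
  set c : Eu n := x - s⁻¹ • x with hc
  have hpre : (fun y => c + s⁻¹ • y) ⁻¹' supBall x ρ = supBall x (s * ρ) := by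
    ext y
    refine forall_congr' fun i => ?_
    have : (c + s⁻¹ • y) i - x i = s⁻¹ * (y i - x i) := by
      simp [hc]; ring
    rw [this, abs_mul, abs_of_pos hsi, inv_mul_lt_iff₀ hs0]
  have hl : LocallyIntegrableOn g (supBall x ρ) := hg.locallyIntegrableOn.mono_set hsub
  have e : Set.EqOn g (fun y => s * g (c + s⁻¹ • y) + (1 - s) * g x) (supBall x (s * ρ)) := by
    intro y hy
    rw [← hpre] at hy
    have := hom _ hy s hs0.le hs1
    simp only
    rw [← this]
    congr 1
    rw [hc, smul_sub, smul_add, smul_sub, smul_smul, smul_smul, mul_inv_cancel₀ hs0.ne']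
    simp only [one_smul]
    abel
  obtain ⟨a, ha⟩ := exists_affineMap_eq (n := n) ((1 - s) * g x) 0
  have e2 : htv 1 g (supBall x (s * ρ)) = htv 1 (fun y => s * g (c + s⁻¹ • y)) (supBall x (s * ρ)) := by
    have hl2 : LocallyIntegrableOn (fun y => s * g (c + s⁻¹ • y)) (supBall x (s * ρ)) := by
      have := locallyIntegrableOn_comp_homothety (isOpen_supBall x ρ) hl c hsi
      rw [hpre] at this
      exact this.smul s
    rw [← htv_add_affineMap hl2 a]
    refine htv_congr_ae ?_
    filter_upwards [ae_restrict_mem (isOpen_supBall x (s * ρ)).measurableSet] with y hy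
    rw [e hy, ha]
    simp
  rw [e2]
  refine (htv_const_mul_le s).trans ?_
  have h3 := htv_comp_homothety_le g (supBall x ρ) c hsi
  rw [hpre] at h3
  -- The factors `s` from homogeneity, `s⁻¹ ^ 2` from the Hessian and `s ^ n` from the volume
  -- combine to `s ^ n / s`, which stands for `s ^ (n - 1)` without subtraction of natural numbers.
  calc ENNReal.ofReal |s| * htv 1 (fun y => g (c + s⁻¹ • y)) (supBall x (s * ρ))
      ≤ ENNReal.ofReal s * (ENNReal.ofReal (s⁻¹ ^ 2 / s⁻¹ ^ n) * htv 1 g (cube n)) := by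
        rw [abs_of_pos hs0]
        gcongr
        exact h3.trans (mul_le_mul_right (htv_mono g hsub) _)
    _ = ENNReal.ofReal (s ^ n / s) * htv 1 g (cube n) := by
        rw [← mul_assoc, ← ENNReal.ofReal_mul hs0.le]
        congr 2
        rw [inv_pow, inv_pow]
        field_simp

end Decomposition

/-! ### Rigidity: summands of CPWL functions without cancellation are CPWL. -/

section Rigidity
variable {n : ℕ} {𝒯 : Set (Set (Eu n))} {g g₁ g₂ : Eu n → ℝ} {t s : ℝ}

/-- The bound of order `r ^ (n - 1)` passes from `g` to `g₁` because nothing cancels, at the price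
of `1 / t` and of halving the radius. The Poincaré inequality contributes two more powers of `r`, so
the mean distance from `g₁` to an affine function is of order `r`. -/
theorem exists_affine_lintegral_supBall_le (h : IsPolytopalDecomposition 𝒯)
    (hg : IsPiecewiseAffine 𝒯 g) (hg1 : htv 1 g (cube n) = 1)
    (hg₁ : LocallyIntegrableOn g₁ (cube n)) (hg₂ : LocallyIntegrableOn g₂ (cube n))
    (ht : 0 < t) (hs : 0 ≤ s) (hts : t + s = 1)
    (hgg : g =ᵐ[cubeMeasure n] fun x => t * g₁ x + s * g₂ x)
    (h1 : htv 1 g₁ (cube n) ≤ 1) (h2 : htv 1 g₂ (cube n) ≤ 1) {x : Eu n} (hx : x ∈ cube n) :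
    ∃ (ρ C : ℝ) (ℓ : ℝ → Eu n →ᵃ[ℝ] ℝ), 0 < ρ ∧ 0 ≤ C ∧ supBall x ρ ⊆ cube n ∧
      ∀ r : ℝ, 0 < r → r ≤ 1 →
        ∫⁻ y in supBall x (r * ρ), ‖g₁ y - ℓ r y‖ₑ ≤ ENNReal.ofReal (C * (r ^ n * r)) := by
  obtain ⟨ρ, hρ, hsub, hle⟩ := hg.htv_supBall_le h hx
  obtain ⟨C, hC, hP⟩ := exists_affine_lintegral_cubeAt_le n
  have key : ∀ r : ℝ, ∃ ℓ : Eu n →ᵃ[ℝ] ℝ, 0 < r → r ≤ 1 →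
      ∫⁻ y in supBall x (r * (ρ / 2)), ‖g₁ y - ℓ y‖ₑ ≤
        ENNReal.ofReal (C * ρ ^ 2 / t * (r ^ n * r)) := by
    intro r
    by_cases hr : 0 < r ∧ r ≤ 1
    swap
    · exact ⟨0, fun h1 h2 => (hr ⟨h1, h2⟩).elim⟩
    obtain ⟨hr0, hr1⟩ := hr
    have hlt : r * (ρ / 2) < r * ρ := by nlinarith [mul_pos hr0 hρ]
    have hUC : supBall x (r * ρ) ⊆ cube n := (supBall_mono x (by nlinarith)).trans hsub
    have d := htv_combination_le (isCompact_closed_supBall x (r * (ρ / 2)))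
      (isOpen_supBall x (r * ρ)) (fun y hy i => (hy i).trans_lt hlt)
      (isOpen_supBall x (r * (ρ / 2))) (fun y hy i => (hy i).le) hUC hg₁ hg₂ hg.locallyIntegrableOn
      ht.le hs hts hgg hg1.ge h1 h2
    have d2 : htv 1 g₁ (supBall x (r * (ρ / 2))) ≤ ENNReal.ofReal (r ^ n / r / t) := by
      have d3 := (le_self_add.trans d).trans (hle r hr0 hr1)
      rw [hg1, mul_one] at d3
      calc htv 1 g₁ (supBall x (r * (ρ / 2)))
          = ENNReal.ofReal t⁻¹ * (ENNReal.ofReal t * htv 1 g₁ (supBall x (r * (ρ / 2)))) := by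
            rw [← mul_assoc, ← ENNReal.ofReal_mul (by positivity), inv_mul_cancel₀ ht.ne']; simp
        _ ≤ ENNReal.ofReal t⁻¹ * ENNReal.ofReal (r ^ n / r) := by gcongr
        _ = _ := by
            rw [← ENNReal.ofReal_mul (by positivity)]; congr 1; field_simp
    rw [supBall_eq_cubeAt] at d2 ⊢
    obtain ⟨a, ha⟩ := hP (WithLp.toLp 2 fun i => x i - r * (ρ / 2)) (2 * (r * (ρ / 2)))
      (by positivity) g₁ (by
        rw [← supBall_eq_cubeAt]
        exact hg₁.mono_set ((supBall_mono x hlt.le).trans hUC))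
      (ne_top_of_le_ne_top ENNReal.ofReal_ne_top d2)
    refine ⟨a, fun _ _ => ha.trans ((mul_le_mul_right d2 _).trans_eq ?_)⟩
    rw [← ENNReal.ofReal_mul (by positivity)]
    congr 1
    field_simp
  choose ℓ hℓ using key
  exact ⟨ρ / 2, C * ρ ^ 2 / t, ℓ, by positivity, by positivity,
    (supBall_mono x (by linarith)).trans hsub, hℓ⟩

/-- The affine approximations at `x` converge at `x` to the value of each of the affine pieces. -/
theorem exists_abs_sub_le_of_lintegral_le {P : Set (Eu n)} (hP : Convex ℝ P)
    (hPi : (interior P).Nonempty) {x : Eu n} (hxP : x ∈ P) {a : Eu n →ᵃ[ℝ] ℝ}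
    (ha : g₁ =ᵐ[volume.restrict (interior P ∩ cube n)] a) {ρ C : ℝ} {ℓ : ℝ → Eu n →ᵃ[ℝ] ℝ}
    (hρ : 0 < ρ) (hC : 0 ≤ C) (hsub : supBall x ρ ⊆ cube n)
    (hℓ : ∀ r : ℝ, 0 < r → r ≤ 1 →
        ∫⁻ y in supBall x (r * ρ), ‖g₁ y - ℓ r y‖ₑ ≤ ENNReal.ofReal (C * (r ^ n * r))) :
    ∃ C' : ℝ, ∀ r : ℝ, 0 < r → r ≤ 1 → |a x - ℓ r x| ≤ C' * r := by
  obtain ⟨z, hz⟩ : (interior P ∩ supBall x ρ).Nonempty := by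
    have : x ∈ closure (interior P) :=
      hP.closure_interior_eq_closure_of_nonempty_interior hPi ▸ subset_closure hxP
    obtain ⟨z, hz1, hz2⟩ := mem_closure_iff.1 this _ (isOpen_supBall x ρ) (mem_supBall_self x hρ)
    exact ⟨z, hz2, hz1⟩
  obtain ⟨ε, hε, hball⟩ := Metric.isOpen_iff.1 (isOpen_interior.inter (isOpen_supBall x ρ)) z hz
  -- A ball in the interior of `P`, shrunk towards `x ∈ P` by the factor `σ`, stays in the interior
  -- by convexity. It gives a set of volume of order `σ ^ n` near `x` on which `g₁` is `a`.
  have hsm : ∀ σ : ℝ, 0 < σ → σ ≤ 1 →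
      Metric.ball (x + σ • (z - x)) (σ * ε) ⊆ interior P ∩ supBall x (σ * ρ) := by
    intro σ hσ0 hσ1 y hy
    set w := x + σ⁻¹ • (y - x) with hw
    have hwy : y = x + σ • (w - x) := by
      rw [hw, add_sub_cancel_left, smul_smul, mul_inv_cancel₀ hσ0.ne']; simp
    have hwz : w ∈ Metric.ball z ε := by
      rw [Metric.mem_ball, dist_eq_norm] at hy ⊢
      have : y - (x + σ • (z - x)) = σ • (w - z) := by
        rw [hwy]; simp only [smul_sub]; abel
      rw [this, norm_smul, Real.norm_eq_abs, abs_of_pos hσ0] at hy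
      exact lt_of_mul_lt_mul_left hy hσ0.le
    obtain ⟨hw1, hw2⟩ := hball hwz
    constructor
    · rw [hwy]
      exact hP.add_smul_sub_mem_interior hxP hw1 ⟨hσ0, hσ1⟩
    · intro i
      have := hw2 i
      have e : y i - x i = σ * (w i - x i) := by
        rw [hwy]; simp
      rw [e, abs_mul, abs_of_pos hσ0]
      exact mul_lt_mul_of_pos_left this hσ0
  set κ : ℝ := (volume (Metric.ball (0 : Eu n) ε)).toReal with hκ
  have hκ0 : 0 < κ := ENNReal.toReal_pos (Metric.measure_ball_pos volume _ hε).ne'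
    measure_ball_lt_top.ne
  have hvol : ∀ (c : Eu n) (σ : ℝ), 0 < σ →
      volume (Metric.ball c (σ * ε)) = ENNReal.ofReal (σ ^ n * κ) := by
    intro c σ hσ
    rw [Measure.addHaar_ball_mul_of_pos _ _ hσ, ENNReal.ofReal_mul (by positivity), hκ,
      ENNReal.ofReal_toReal measure_ball_lt_top.ne]
    simp
  -- Dividing the `L¹` error of order `r ^ (n + 1)` by the volume of a ball controls `a - ℓ r` at
  -- its centre, by the mean value estimate for affine functions.
  have hmean : ∀ r σ : ℝ, 0 < σ → σ ≤ r → r ≤ 1 →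
      |a (x + σ • (z - x)) - ℓ r (x + σ • (z - x))| * (σ ^ n * κ) ≤ C * (r ^ n * r) := by
    intro r σ hσ hσr hr1
    have hr0 : 0 < r := hσ.trans_le hσr
    have hsm' := hsm σ hσ (hσr.trans hr1)
    have m1 := enorm_mul_volume_ball_le (a - ℓ r) (x + σ • (z - x)) (σ * ε)
    have m2 : ∫⁻ y in Metric.ball (x + σ • (z - x)) (σ * ε), ‖(a - ℓ r) y‖ₑ =
        ∫⁻ y in Metric.ball (x + σ • (z - x)) (σ * ε), ‖g₁ y - ℓ r y‖ₑ := by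
      refine lintegral_congr_ae ?_
      have : Metric.ball (x + σ • (z - x)) (σ * ε) ⊆ interior P ∩ cube n := fun y hy =>
        ⟨(hsm' hy).1, hsub (supBall_mono x (by nlinarith) (hsm' hy).2)⟩
      filter_upwards [ae_restrict_of_ae_restrict_of_subset this ha] with y hy
      rw [hy]; rfl
    have m3 : ∫⁻ y in Metric.ball (x + σ • (z - x)) (σ * ε), ‖g₁ y - ℓ r y‖ₑ ≤
        ENNReal.ofReal (C * (r ^ n * r)) :=
      (lintegral_mono_set fun y hy => supBall_mono x (by gcongr) (hsm' hy).2).trans (hℓ r hr0 hr1)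
    rw [m2, hvol _ _ hσ, Real.enorm_eq_ofReal_abs, ← ENNReal.ofReal_mul (abs_nonneg _)] at m1
    exact (ENNReal.ofReal_le_ofReal_iff (by positivity)).1 (m1.trans m3)
  refine ⟨(2 * (C * 2 ^ n / κ) + C / κ), fun r hr0 hr1 => ?_⟩
  have b1 := hmean r r hr0 le_rfl hr1
  have b2 := hmean r (r / 2) (by positivity) (by linarith) hr1
  set d₁ := a (x + r • (z - x)) - ℓ r (x + r • (z - x))
  set d₂ := a (x + (r / 2) • (z - x)) - ℓ r (x + (r / 2) • (z - x))
  -- An affine function at `x` is extrapolated from its values at parameters `r / 2` and `r` on a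
  -- segment starting at `x`.
  have e : a x - ℓ r x = 2 * d₂ - d₁ := by
    simp only [d₁, d₂]
    rw [affineMap_eq a (x + r • (z - x)), affineMap_eq a (x + (r / 2) • (z - x)),
      affineMap_eq (ℓ r) (x + r • (z - x)), affineMap_eq (ℓ r) (x + (r / 2) • (z - x)),
      affineMap_eq a x, affineMap_eq (ℓ r) x]
    simp only [map_add, map_smul, smul_eq_mul]
    ring
  have hrn : 0 < r ^ n := by positivity
  have c1 : |d₁| ≤ C / κ * r := by
    rw [div_mul_eq_mul_div, le_div_iff₀ hκ0]
    refine le_of_mul_le_mul_right ?_ hrn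
    linarith
  have c2 : |d₂| ≤ C * 2 ^ n / κ * r := by
    rw [div_mul_eq_mul_div, le_div_iff₀ hκ0]
    rw [div_pow] at b2
    have : |d₂| * (r ^ n / 2 ^ n * κ) * 2 ^ n ≤ C * (r ^ n * r) * 2 ^ n := by gcongr
    have e3 : |d₂| * (r ^ n / 2 ^ n * κ) * 2 ^ n = |d₂| * κ * r ^ n := by field_simp
    refine le_of_mul_le_mul_right ?_ hrn
    linarith
  rw [e]
  calc |2 * d₂ - d₁| ≤ |2 * d₂| + |d₁| := abs_sub _ _
    _ = 2 * |d₂| + |d₁| := by rw [abs_mul, abs_two]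
    _ ≤ _ := by linarith

/-- In a convex combination without cancellation of variation, the summands of a piecewise affine
function are piecewise affine on the same decomposition. -/
theorem exists_isPiecewiseAffine_of_combination (h : IsPolytopalDecomposition 𝒯)
    (hg : IsPiecewiseAffine 𝒯 g) (hg1 : htv 1 g (cube n) = 1)
    (hg₁ : LocallyIntegrableOn g₁ (cube n)) (hg₂ : LocallyIntegrableOn g₂ (cube n))
    (ht : 0 < t) (hs : 0 ≤ s) (hts : t + s = 1)
    (hgg : g =ᵐ[cubeMeasure n] fun x => t * g₁ x + s * g₂ x)
    (h1 : htv 1 g₁ (cube n) ≤ 1) (h2 : htv 1 g₂ (cube n) ≤ 1) :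
    ∃ u, IsPiecewiseAffine 𝒯 u ∧ g₁ =ᵐ[cubeMeasure n] u := by
  -- Inside a polytope `g` has no variation, so neither has `g₁`.
  have hA : ∀ P ∈ 𝒯, ∃ a : Eu n →ᵃ[ℝ] ℝ, g₁ =ᵐ[volume.restrict (interior P ∩ cube n)] a := by
    intro P hP
    have hO : IsOpen (interior P ∩ cube n) := isOpen_interior.inter (isOpen_cube n)
    refine exists_affine_of_locally_htv_eq_zero hO
      ((h.isPolytope P hP).convex.interior.inter convex_cube).isPreconnected
      (hg₁.mono_set Set.inter_subset_right) fun x hx => ?_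
    obtain ⟨ρ, hρ, hsub⟩ := exists_supBall_subset hO hx
    have hlt : ρ / 2 < ρ := by linarith
    have d := htv_combination_le (isCompact_closed_supBall x (ρ / 2))
      (isOpen_supBall x ρ) (fun y hy i => (hy i).trans_lt hlt)
      (isOpen_supBall x (ρ / 2)) (fun y hy i => (hy i).le) (hsub.trans Set.inter_subset_right)
      hg₁ hg₂ hg.locallyIntegrableOn ht.le hs hts hgg hg1.ge h1 h2
    obtain ⟨a, ha⟩ := hg.2 P hP
    have h0 : htv 1 g (supBall x ρ) = 0 := by
      rw [← htv_affineMap a (supBall x ρ)]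
      refine htv_congr_ae ?_
      filter_upwards [ae_restrict_mem (isOpen_supBall x ρ).measurableSet] with y hy
      exact ha y ⟨interior_subset (hsub hy).1, (hsub hy).2⟩
    refine ⟨supBall x (ρ / 2), isOpen_supBall _ _, mem_supBall_self x (by positivity),
      (supBall_mono x hlt.le).trans hsub, ?_⟩
    rw [h0, nonpos_iff_eq_zero, add_eq_zero, mul_eq_zero] at d
    exact d.1.resolve_left (by simpa using ht)
  choose! a ha using hA
  -- The affine pieces of any two polytopes through `x` are compared at `x` with the same number `ℓ
  -- r x`, and `r` tends to zero. A jump across a face is thus excluded.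
  have hval : ∀ x ∈ cube n, ∀ P ∈ 𝒯, ∀ Q ∈ 𝒯, x ∈ P → x ∈ Q → a P x = a Q x := by
    intro x hx P hP Q hQ hxP hxQ
    obtain ⟨ρ, C, ℓ, hρ, hC, hsub, hℓ⟩ := exists_affine_lintegral_supBall_le h hg hg1 hg₁ hg₂ ht hs
      hts hgg h1 h2 hx
    obtain ⟨C₁, hC₁⟩ := exists_abs_sub_le_of_lintegral_le (h.isPolytope P hP).convex
      (h.isPolytope P hP).2 hxP (ha P hP) hρ hC hsub hℓ
    obtain ⟨C₂, hC₂⟩ := exists_abs_sub_le_of_lintegral_le (h.isPolytope Q hQ).convex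
      (h.isPolytope Q hQ).2 hxQ (ha Q hQ) hρ hC hsub hℓ
    have hle : ∀ r : ℝ, 0 < r → r ≤ 1 → |a P x - a Q x| ≤ (C₁ + C₂) * r := by
      intro r hr0 hr1
      have := abs_sub (a P x - ℓ r x) (a Q x - ℓ r x)
      rw [sub_sub_sub_cancel_right] at this
      linarith [hC₁ r hr0 hr1, hC₂ r hr0 hr1]
    have hlim : Tendsto (fun r : ℝ => (C₁ + C₂) * r) (𝓝[>] 0) (𝓝 0) := by
      have : Tendsto (fun r : ℝ => (C₁ + C₂) * r) (𝓝 0) (𝓝 ((C₁ + C₂) * 0)) :=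
        (continuous_const.mul continuous_id).tendsto 0
      rw [mul_zero] at this
      exact this.mono_left nhdsWithin_le_nhds
    have : |a P x - a Q x| ≤ 0 := by
      refine ge_of_tendsto hlim ?_
      filter_upwards [Ioc_mem_nhdsGT (zero_lt_one (α := ℝ))] with r hr
      exact hle r hr.1 hr.2
    exact sub_eq_zero.1 (abs_nonpos_iff.1 this)
  choose p hp hxp using h.exists_mem
  have hu : ∀ x ∈ cube n, ∀ P ∈ 𝒯, x ∈ P → a (p x) x = a P x := fun x hx P hP hxP =>
    hval x hx _ (hp x) P hP (hxp x) hxP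
  refine ⟨fun x => a (p x) x, ⟨fun x hx => ?_, fun P hP => ⟨a P, fun x hx => hu x hx.2 P hP hx.1⟩⟩,
    ?_⟩
  · refine ContinuousAt.continuousWithinAt ?_
    have hfin : {P ∈ 𝒯 | (P ∩ cube n).Nonempty}.Finite := h.finite_inter_cube
    -- For `y` near `x` the polytope chosen for `y` contains `x`, so the increment of the function
    -- is one of the terms of this finite sum.
    have hlim : Tendsto (fun y => ∑ P ∈ hfin.toFinset, |a P y - a P x|) (𝓝 x) (𝓝 0) := by
      have : Continuous fun y => ∑ P ∈ hfin.toFinset, |a P y - a P x| :=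
        continuous_finsetSum _ fun P _ => ((continuous_affineMap (a P)).sub continuous_const).abs
      simpa using this.tendsto x
    rw [ContinuousAt, tendsto_iff_dist_tendsto_zero]
    refine squeeze_zero' (Eventually.of_forall fun _ => dist_nonneg) ?_ hlim
    filter_upwards [h.eventually_mem x, (isOpen_cube n).mem_nhds hx] with y hy hyc
    have hxy := hy (p y) (hp y) (hxp y)
    rw [Real.dist_eq, hu x hx (p y) (hp y) hxy]
    refine Finset.single_le_sum (f := fun P => |a P y - a P x|) (fun P _ => abs_nonneg _) ?_
    rw [Set.Finite.mem_toFinset]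
    exact ⟨hp y, y, hxp y, hyc⟩
  · have h3 : ∀ᵐ x ∂cubeMeasure n, ∀ P ∈ {P ∈ 𝒯 | (P ∩ cube n).Nonempty},
        x ∈ interior P → g₁ x = a P x := by
      rw [ae_ball_iff h.finite_inter_cube.countable]
      intro P hP
      have := ha P hP.1
      rw [Filter.EventuallyEq, ae_restrict_iff' (isOpen_interior.inter
        (isOpen_cube n)).measurableSet] at this
      rw [ae_restrict_iff' (isOpen_cube n).measurableSet]
      filter_upwards [this] with x hx hxc hxi
      exact hx ⟨hxi, hxc⟩
    filter_upwards [h3, h.ae_mem_interior, ae_restrict_mem (isOpen_cube n).measurableSet] with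
      x hx hxi hxc
    obtain ⟨P, hP, hxP⟩ := hxi
    rw [hx P hP hxP, hu x hxc P hP.1 (interior_subset hxP)]

end Rigidity

/-! ### Milman's converse to the Krein–Milman theorem. -/

section Milman
variable {X : Type*} [NormedAddCommGroup X] [NormedSpace ℝ X]

theorem isCompact_convexHull_union {A B : Set X} (hA : IsCompact A) (hB : IsCompact B)
    (hAc : Convex ℝ A) (hBc : Convex ℝ B) : IsCompact (convexHull ℝ (A ∪ B)) := by
  rcases A.eq_empty_or_nonempty with rfl | hA0
  · rwa [Set.empty_union, hBc.convexHull_eq]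
  rcases B.eq_empty_or_nonempty with rfl | hB0
  · rwa [Set.union_empty, hAc.convexHull_eq]
  rw [hAc.convexHull_union hBc hA0 hB0]
  have : convexJoin ℝ A B =
      (fun p : ℝ × X × X => (1 - p.1) • p.2.1 + p.1 • p.2.2) '' (Set.Icc 0 1 ×ˢ A ×ˢ B) := by
    ext x
    rw [mem_convexJoin]
    constructor
    · rintro ⟨a, ha, b, hb, hx⟩
      rw [segment_eq_image] at hx
      obtain ⟨θ, hθ, rfl⟩ := hx
      exact ⟨(θ, a, b), ⟨hθ, ha, hb⟩, rfl⟩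
    · rintro ⟨⟨θ, a, b⟩, ⟨hθ, ha, hb⟩, rfl⟩
      refine ⟨a, ha, b, hb, ?_⟩
      rw [segment_eq_image]
      exact ⟨θ, hθ, rfl⟩
  rw [this]
  exact (isCompact_Icc.prod (hA.prod hB)).image (by fun_prop)

theorem isCompact_convexHull_biUnion {ι : Type*} (s : Finset ι) (K : ι → Set X)
    (hK : ∀ i ∈ s, IsCompact (K i)) (hKc : ∀ i ∈ s, Convex ℝ (K i)) :
    IsCompact (convexHull ℝ (⋃ i ∈ s, K i)) := by
  classical
  induction s using Finset.induction_on with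
  | empty => simp
  | insert i s his ih =>
    rw [Finset.set_biUnion_insert, ← convexHull_convexHull_union_right]
    exact isCompact_convexHull_union (hK i (Finset.mem_insert_self _ _))
      (ih (fun j hj => hK j (Finset.mem_insert_of_mem hj))
        fun j hj => hKc j (Finset.mem_insert_of_mem hj))
      (hKc i (Finset.mem_insert_self _ _)) (convex_convexHull _ _)

/-- **Milman's converse** to the Krein–Milman theorem. -/
theorem extremePoints_subset_closure_of_subset_closure_convexHull {K E : Set X} (hK : IsCompact K)
    (hKc : Convex ℝ K) (hEK : E ⊆ K) (h : K ⊆ closure (convexHull ℝ E)) :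
    K.extremePoints ℝ ⊆ closure E := by
  intro e he
  by_contra hne
  obtain ⟨δ, hδ, hball⟩ := Metric.mem_nhds_iff.1 (isClosed_closure.isOpen_compl.mem_nhds hne)
  have hEc : IsCompact (closure E) :=
    hK.of_isClosed_subset isClosed_closure (closure_minimal hEK hK.isClosed)
  obtain ⟨s, hs, hcov⟩ := hEc.elim_nhds_subcover (fun y => Metric.ball y (δ / 2))
    fun y _ => Metric.ball_mem_nhds y (by positivity)
  -- If `e` is at distance at least `δ` from `closure E`, finitely many compact convex pieces of
  -- radius `δ / 2` centred in `closure E` carry all of `E`.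
  set L : X → Set X := fun y => closure (convexHull ℝ (Metric.ball y (δ / 2) ∩ E)) with hL
  have hLK : ∀ y, L y ⊆ K := fun y =>
    closure_minimal (convexHull_min (Set.inter_subset_right.trans hEK) hKc) hK.isClosed
  have hLb : ∀ y, L y ⊆ Metric.closedBall y (δ / 2) := fun y =>
    closure_minimal (convexHull_min (Set.inter_subset_left.trans Metric.ball_subset_closedBall)
      (convex_closedBall _ _)) Metric.isClosed_closedBall
  have hc := isCompact_convexHull_biUnion s L
    (fun y _ => hK.of_isClosed_subset isClosed_closure (hLK y))
    (fun y _ => (convex_convexHull ℝ _).closure)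
  -- The hull of finitely many compact convex sets is compact, so no closure is needed. An extreme
  -- point of a convex hull belongs to the generating set, hence to one of the pieces `L y`, which
  -- is too close to `closure E`.
  have hsub : K ⊆ convexHull ℝ (⋃ y ∈ s, L y) := by
    refine h.trans (closure_minimal (convexHull_mono fun x hx => ?_) hc.isClosed)
    obtain ⟨y, hy, hxy⟩ := Set.mem_iUnion₂.1 (hcov (subset_closure hx))
    exact Set.mem_iUnion₂.2 ⟨y, hy, subset_closure (subset_convexHull ℝ _ ⟨hxy, hx⟩)⟩
  have he' : e ∈ (convexHull ℝ (⋃ y ∈ s, L y)).extremePoints ℝ :=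
    inter_extremePoints_subset_extremePoints_of_subset
      (convexHull_min (Set.iUnion₂_subset fun y _ => hLK y) hKc) ⟨hsub he.1, he⟩
  obtain ⟨y, hy, hey⟩ := Set.mem_iUnion₂.1 (extremePoints_convexHull_subset he')
  have hd := Metric.mem_closedBall.1 (hLb y hey)
  exact hball (Metric.mem_ball.2 (by rw [dist_comm]; linarith) : y ∈ Metric.ball e δ) (hs y hy)

end Milman

/-! ### Extreme points of the slices and of the ball. -/

section Extreme
variable {n : ℕ} {𝒯 : Set (Set (Eu n))}

/-- The classes in `L¹` of the piecewise affine functions on the decomposition `𝒯`. -/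
def piecewiseAffineL1 (𝒯 : Set (Set (Eu n))) : Submodule ℝ (L1Cube n) where
  carrier := {f | ∃ u, IsPiecewiseAffine 𝒯 u ∧ f =ᵐ[cubeMeasure n] u}
  add_mem' := by
    rintro f g ⟨u, ⟨hu, hu'⟩, hfu⟩ ⟨v, ⟨hv, hv'⟩, hgv⟩
    refine ⟨u + v, ⟨hu.add hv, fun P hP => ?_⟩, ?_⟩
    · obtain ⟨a, ha⟩ := hu' P hP
      obtain ⟨b, hb⟩ := hv' P hP
      exact ⟨a + b, fun x hx => by rw [Pi.add_apply, ha x hx, hb x hx]; rfl⟩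
    · filter_upwards [Lp.coeFn_add f g, hfu, hgv] with x h h1 h2
      rw [h, Pi.add_apply, h1, h2]; rfl
  zero_mem' := ⟨0, ⟨continuousOn_const, fun P _ => ⟨0, fun _ _ => rfl⟩⟩, Lp.coeFn_zero _ _ _⟩
  smul_mem' := by
    rintro c f ⟨u, ⟨hu, hu'⟩, hfu⟩
    refine ⟨c • u, ⟨hu.const_smul c, fun P hP => ?_⟩, ?_⟩
    · obtain ⟨a, ha⟩ := hu' P hP
      exact ⟨c • a, fun x hx => by rw [Pi.smul_apply, ha x hx]; rfl⟩
    · filter_upwards [Lp.coeFn_smul c f, hfu] with x h h1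
      rw [h, Pi.smul_apply, h1]; rfl

theorem mem_piecewiseAffineL1 {f : L1Cube n} : f ∈ piecewiseAffineL1 𝒯 ↔
    ∃ u, IsPiecewiseAffine 𝒯 u ∧ f =ᵐ[cubeMeasure n] u := Iff.rfl

theorem mem_cpwlL1_iff {f : L1Cube n} : f ∈ cpwlL1 n ↔
    ∃ 𝒯, IsPolytopalDecomposition 𝒯 ∧ f ∈ piecewiseAffineL1 𝒯 := by
  constructor
  · rintro ⟨g, ⟨hg, 𝒯, h𝒯, ha⟩, hf⟩
    exact ⟨𝒯, h𝒯, g, ⟨hg, ha⟩, hf⟩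
  · rintro ⟨𝒯, h𝒯, g, ⟨hg, ha⟩, hf⟩
    exact ⟨g, ⟨hg, 𝒯, h𝒯, ha⟩, hf⟩

theorem IsPolytopalDecomposition.ae_eq_sum_indicator (h : IsPolytopalDecomposition 𝒯)
    {u : Eu n → ℝ} {a : Set (Eu n) → Eu n →ᵃ[ℝ] ℝ} (ha : ∀ P ∈ 𝒯, ∀ x ∈ P ∩ cube n, u x = a P x)
    {ι : Type*} [Fintype ι] (e : ι ≃ {P ∈ 𝒯 | (P ∩ cube n).Nonempty}) :
    u =ᵐ[cubeMeasure n] fun x => ∑ k, (interior (e k : Set (Eu n))).indicator (a (e k)) x := by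
  filter_upwards [h.ae_mem_interior, ae_restrict_mem (isOpen_cube n).measurableSet] with x hxi hxc
  obtain ⟨P, hP, hxP⟩ := hxi
  have hk : ((e (e.symm ⟨P, hP⟩) : Set (Eu n))) = P := by rw [Equiv.apply_symm_apply]
  rw [Finset.sum_eq_single (e.symm ⟨P, hP⟩)]
  · rw [hk, Set.indicator_of_mem hxP]
    exact ha P hP.1 x ⟨interior_subset hxP, hxc⟩
  · intro k _ hkne
    refine Set.indicator_of_notMem (fun hxQ => ?_) _
    have hne : P ≠ e k := fun he => hkne (by
      rw [Equiv.eq_symm_apply]; exact Subtype.ext he.symm)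
    exact (h.inter_subset P hP.1 _ (e k).2.1 hne
      ⟨interior_subset hxP, interior_subset hxQ⟩).1.2 hxP
  · intro hn; exact (hn (Finset.mem_univ _)).elim

/-- Only finitely many polytopes meet the cube, and their affine maps determine the class. The slice
of the ball is therefore closed, hence compact. -/
theorem IsPolytopalDecomposition.finiteDimensional_piecewiseAffineL1
    (h : IsPolytopalDecomposition 𝒯) : FiniteDimensional ℝ (piecewiseAffineL1 𝒯) := by
  obtain ⟨N, ⟨e⟩⟩ := h.finite_inter_cube.exists_equiv_fin
  refine Submodule.finiteDimensional_of_le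
    (S₂ := pieceSpan fun k : Fin N => interior (e.symm k : Set (Eu n))) fun f hf => ?_
  obtain ⟨u, hu, hf⟩ := mem_piecewiseAffineL1.1 hf
  have hu2 := hu.2
  choose! a ha using hu2
  exact mem_pieceSpan (fun k => isOpen_interior.measurableSet) (fun k => a (e.symm k))
    (hf.trans (h.ae_eq_sum_indicator ha e.symm))

theorem htv_eq_of_proj_eq {f g : L1Cube n} (h : proj n f = proj n g) :
    htv 1 f (cube n) = htv 1 g (cube n) := by
  have : f - g ∈ affineSubmodule n := by
    rwa [← Submodule.Quotient.mk_eq_zero, Submodule.Quotient.mk_sub, sub_eq_zero]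
  have := htv_add_of_mem_affineSubmodule g this
  rwa [add_sub_cancel] at this

theorem proj_mem_unitBall_iff {f : L1Cube n} : proj n f ∈ unitBall n ↔ htv 1 f (cube n) ≤ 1 := by
  constructor
  · rintro ⟨g, hg, hgf⟩
    rw [htv_eq_of_proj_eq hgf.symm]; exact hg
  · exact fun h => ⟨f, h, rfl⟩

/-- An identity modulo affine functions becomes an exact one once the affine error, divided by `t`,
is added to the first summand. -/
theorem exists_lift_combination {f f₁ f₂ : L1Cube n} {t s : ℝ} (ht : t ≠ 0)
    (h : t • proj n f₁ + s • proj n f₂ = proj n f) :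
    ∃ f₁', proj n f₁' = proj n f₁ ∧ t • f₁' + s • f₂ = f := by
  have hb : f - (t • f₁ + s • f₂) ∈ affineSubmodule n := by
    rw [← Submodule.Quotient.mk_eq_zero]
    change proj n _ = 0
    rw [map_sub, map_add, map_smul, map_smul, h, sub_self]
  refine ⟨f₁ + t⁻¹ • (f - (t • f₁ + s • f₂)), ?_, ?_⟩
  · rw [map_add, map_smul, show proj n (f - (t • f₁ + s • f₂)) = 0 from
      (Submodule.Quotient.mk_eq_zero _).2 hb]
    simp
  · rw [smul_add, smul_smul, mul_inv_cancel₀ ht, one_smul]; abel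

theorem coeFn_combination {f₁ f₂ f : L1Cube n} {t s : ℝ} (h : t • f₁ + s • f₂ = f) :
    f =ᵐ[cubeMeasure n] fun x => t * f₁ x + s * f₂ x := by
  rw [← h]
  filter_upwards [Lp.coeFn_add (t • f₁) (s • f₂), Lp.coeFn_smul t f₁, Lp.coeFn_smul s f₂] with
    x h1 h2 h3
  rw [h1, Pi.add_apply, h2, h3]; rfl

theorem mem_map_of_combination (h : IsPolytopalDecomposition 𝒯) {f : L1Cube n}
    (hf : f ∈ piecewiseAffineL1 𝒯) (hf1 : htv 1 f (cube n) = 1) {v₁ v₂ : L1ModAffine n}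
    (h₁ : v₁ ∈ unitBall n) (h₂ : v₂ ∈ unitBall n) {t s : ℝ} (ht : 0 < t) (hs : 0 ≤ s)
    (hts : t + s = 1) (he : t • v₁ + s • v₂ = proj n f) :
    v₁ ∈ (piecewiseAffineL1 𝒯).map (proj n) := by
  obtain ⟨f₁, hf₁, rfl⟩ := h₁
  obtain ⟨f₂, hf₂, rfl⟩ := h₂
  obtain ⟨f₁', hp, hc⟩ := exists_lift_combination ht.ne' he
  obtain ⟨u, hu, hfu⟩ := hf
  have hc' := (hfu.symm.trans (coeFn_combination hc))
  obtain ⟨w, hw, hfw⟩ := exists_isPiecewiseAffine_of_combination h hu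
    ((htv_congr_L1 hfu).symm.trans hf1) (locallyIntegrableOn_of_L1 f₁')
    (locallyIntegrableOn_of_L1 f₂) ht hs hts hc' ((htv_eq_of_proj_eq hp).trans_le hf₁) hf₂
  exact ⟨f₁', ⟨w, hw, hfw⟩, hp⟩

/-- The nonzero extreme points of the section of the unit ball by the piecewise affine functions
on a fixed decomposition are extreme points of the whole ball. -/
theorem mem_cpwlExtremePoints_of_mem_extremePoints (h : IsPolytopalDecomposition 𝒯)
    {v : L1ModAffine n}
    (hv : v ∈ (unitBall n ∩ (piecewiseAffineL1 𝒯).map (proj n)).extremePoints ℝ) (hv0 : v ≠ 0) :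
    v ∈ cpwlExtremePoints n := by
  obtain ⟨⟨hvB, f, hf, rfl⟩, hext⟩ := hv
  have hle := proj_mem_unitBall_iff.1 hvB
  -- An element of variation less than one lies strictly between `0` and a larger multiple of itself
  -- in the slice, so it can be extreme only if it is zero.
  have h1 : htv 1 f (cube n) = 1 := by
    by_contra hne
    have hlt : htv 1 f (cube n) < 1 := lt_of_le_of_ne hle hne
    set r := (htv 1 f (cube n)).toReal with hr
    have hfr : htv 1 f (cube n) = ENNReal.ofReal r := (ENNReal.ofReal_toReal hlt.ne_top).symm
    have hr0 : 0 ≤ r := ENNReal.toReal_nonneg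
    have hr1 : r < 1 := by
      rw [hfr, ← ENNReal.ofReal_one] at hlt
      exact (ENNReal.ofReal_lt_ofReal_iff one_pos).1 hlt
    -- A factor greater than one with `c * r ≤ 1`; this choice also covers `r = 0`.
    set c : ℝ := 2 / (1 + r) with hc
    have hc0 : 0 < c := by positivity
    have hc1 : 1 < c := by rw [hc, lt_div_iff₀ (by positivity)]; linarith
    have hcB : c • proj n f ∈ unitBall n := by
      rw [← map_smul, proj_mem_unitBall_iff]
      refine (htv_coe_smul_le c f).trans ?_
      rw [hfr, ← ENNReal.ofReal_mul (abs_nonneg _), abs_of_pos hc0, ← ENNReal.ofReal_one]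
      refine ENNReal.ofReal_le_ofReal ?_
      rw [hc, div_mul_eq_mul_div, div_le_one (by positivity)]; linarith
    have h0B : (0 : L1ModAffine n) ∈ unitBall n := by
      rw [← map_zero (proj n), proj_mem_unitBall_iff]
      refine (htv_congr_L1 (u := (0 : Eu n →ᵃ[ℝ] ℝ)) (Lp.coeFn_zero _ _ _)).trans_le ?_
      rw [htv_affineMap]; exact zero_le
    refine hv0 (hext ⟨h0B, zero_mem _⟩ ⟨hcB, Submodule.smul_mem _ _ ⟨f, hf, rfl⟩⟩
      ⟨1 - c⁻¹, c⁻¹, ?_, by positivity, by ring, ?_⟩).symm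
    · rw [sub_pos]; exact inv_lt_one_of_one_lt₀ hc1
    · rw [smul_zero, zero_add, smul_smul, inv_mul_cancel₀ hc0.ne', one_smul]
  refine ⟨⟨f, mem_cpwlL1_iff.2 ⟨𝒯, h, hf⟩, rfl⟩, hvB, fun v₁ hv₁ v₂ hv₂ hseg => ?_⟩
  have hseg' := hseg
  obtain ⟨t, s, ht, hs, hts, he⟩ := hseg
  -- Rigidity brings both endpoints of any segment in the ball through this point into the slice,
  -- where the point is extreme.
  have m1 := mem_map_of_combination h hf h1 hv₁ hv₂ ht hs.le hts he
  have m2 := mem_map_of_combination h hf h1 hv₂ hv₁ hs ht.le (by rw [add_comm]; exact hts)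
    (by rw [add_comm]; exact he)
  exact hext ⟨hv₁, m1⟩ ⟨hv₂, m2⟩ hseg'

/-- Krein–Milman in the compact slice. The slice contains `w` and `-w`, so `0` is not extreme in it
and all of its extreme points are extreme in the ball. -/
theorem mem_closure_convexHull_of_ne_zero (h : IsPolytopalDecomposition 𝒯)
    {w : L1ModAffine n} (hw : w ∈ unitBall n) (hwV : w ∈ (piecewiseAffineL1 𝒯).map (proj n))
    (hw0 : w ≠ 0) : w ∈ closure (convexHull ℝ (cpwlExtremePoints n)) := by
  have := h.finiteDimensional_piecewiseAffineL1
  have hcl : IsClosed ((piecewiseAffineL1 𝒯).map (proj n) : Set (L1ModAffine n)) :=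
    Submodule.closed_of_finiteDimensional _
  have hcomp := (isCompact_unitBall n).inter_right hcl
  have hconv : Convex ℝ (unitBall n ∩ (piecewiseAffineL1 𝒯).map (proj n)) :=
    (convex_unitBall n).inter (Submodule.convex _)
  have hKM := closure_convexHull_extremePoints hcomp hconv
  have hmem : w ∈ closure (convexHull ℝ
      ((unitBall n ∩ (piecewiseAffineL1 𝒯).map (proj n)).extremePoints ℝ)) := by
    rw [hKM]; exact ⟨hw, hwV⟩
  refine closure_mono (convexHull_mono fun v hv => ?_) hmem
  refine mem_cpwlExtremePoints_of_mem_extremePoints h hv ?_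
  rintro rfl
  have hneg : -w ∈ unitBall n := by
    obtain ⟨f, hf, rfl⟩ := hw
    rw [← map_neg, proj_mem_unitBall_iff, ← neg_one_smul ℝ f]
    refine (htv_coe_smul_le _ f).trans ?_
    simpa using hf
  refine hw0 (hv.2 ⟨hw, hwV⟩ ⟨hneg, neg_mem hwV⟩ ⟨1 / 2, 1 / 2, by norm_num, by norm_num,
    by norm_num, ?_⟩)
  simp

/-- Approximants in energy may have variation slightly above one; dividing by `max 1` of the
variation puts them in the ball, and these factors tend to one. -/
theorem unitBall_subset_closure_of_dense (hd : CPWLDenseInEnergy n) :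
    unitBall n ⊆ closure (proj n '' cpwlL1 n ∩ unitBall n) := by
  rintro _ ⟨f, hf, rfl⟩
  rw [Set.mem_ofPred_eq] at hf
  obtain ⟨g, hg, hgf, hgv⟩ := hd f (locallyIntegrableOn_of_L1 f) (hf.trans_lt (by simp))
  have hmeas : ∀ k, AEStronglyMeasurable (g k) (cubeMeasure n) := fun k =>
    (hg k).1.aestronglyMeasurable (isOpen_cube n).measurableSet
  have hmem : ∀ᶠ k in atTop, MemLp (g k) 1 (cubeMeasure n) := by
    filter_upwards [hgf.eventually (gt_mem_nhds ENNReal.zero_lt_top)] with k hk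
    have h1 : MemLp (g k - ⇑f) 1 (cubeMeasure n) :=
      ⟨(hmeas k).sub (Lp.aestronglyMeasurable f), hk⟩
    have := h1.add (Lp.memLp f)
    rwa [sub_add_cancel] at this
  classical
  -- The approximants are integrable only for large `k`; the value `0` at the other indices does not
  -- affect the limit.
  set G : ℕ → L1Cube n := fun k =>
    if hk : MemLp (g k) 1 (cubeMeasure n) then hk.toLp (g k) else 0 with hG
  have hGg : ∀ᶠ k in atTop, G k =ᵐ[cubeMeasure n] g k := by
    filter_upwards [hmem] with k hk
    simp only [hG, hk, dif_pos]
    exact hk.coeFn_toLp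
  have hGf : Tendsto G atTop (𝓝 f) := by
    rw [Lp.tendsto_Lp_iff_tendsto_eLpNorm']
    refine hgf.congr' ?_
    filter_upwards [hGg] with k hk
    exact (eLpNorm_congr_ae (hk.sub EventuallyEq.rfl)).symm
  set c : ℕ → ℝ := fun k => (max 1 (htv 1 (g k) (cube n))).toReal⁻¹ with hc
  have hclim : Tendsto c atTop (𝓝 1) := by
    have h1 : Tendsto (fun k => max 1 (htv 1 (g k) (cube n))) atTop (𝓝 1) := by
      have := (tendsto_const_nhds (x := (1 : ℝ≥0∞))).max hgv
      rwa [max_eq_left hf] at this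
    have h2 := ((ENNReal.tendsto_toReal ENNReal.one_ne_top).comp h1).inv₀ (by simp)
    simpa [hc, Function.comp_def] using h2
  have hlim : Tendsto (fun k => proj n (c k • G k)) atTop (𝓝 (proj n f)) := by
    have h1 : Tendsto (fun k => c k • G k) atTop (𝓝 ((1 : ℝ) • f)) := hclim.smul hGf
    rw [one_smul] at h1
    have hcont : Continuous (proj n) := continuous_quot_mk
    exact (hcont.tendsto f).comp h1
  refine mem_closure_of_tendsto hlim ?_
  filter_upwards [hGg, hgv.eventually (gt_mem_nhds (hf.trans_lt ENNReal.one_lt_top))] with k hk hfin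
  refine ⟨⟨c k • G k, ?_, rfl⟩, ?_⟩
  · obtain ⟨hgc, 𝒯, h𝒯, ha⟩ := hg k
    exact mem_cpwlL1_iff.2 ⟨𝒯, h𝒯, Submodule.smul_mem _ _ ⟨g k, ⟨hgc, ha⟩, hk⟩⟩
  · rw [proj_mem_unitBall_iff]
    refine (htv_coe_smul_le _ _).trans ?_
    rw [htv_congr_L1 hk]
    have hm : max 1 (htv 1 (g k) (cube n)) ≠ ⊤ := by
      simp [hfin.ne]
    have hm0 : 0 < (max 1 (htv 1 (g k) (cube n))).toReal :=
      ENNReal.toReal_pos (by simp) hm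
    calc ENNReal.ofReal |c k| * htv 1 (g k) (cube n)
        ≤ ENNReal.ofReal (c k) * max 1 (htv 1 (g k) (cube n)) := by
          rw [abs_of_nonneg (inv_nonneg.2 hm0.le)]
          gcongr
          exact le_max_right _ _
      _ = ENNReal.ofReal (c k * (max 1 (htv 1 (g k) (cube n))).toReal) := by
          rw [ENNReal.ofReal_mul (inv_nonneg.2 hm0.le), ENNReal.ofReal_toReal hm]
      _ ≤ 1 := by
          rw [hc, inv_mul_cancel₀ hm0.ne']; simp

/-- Every extreme point of the unit ball is a limit of CPWL extreme points, provided CPWL functions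
are dense in energy. -/
theorem extremePoints_unitBall_subset_closure (hd : CPWLDenseInEnergy n) :
    (unitBall n).extremePoints ℝ ⊆ closure (cpwlExtremePoints n) := by
  have hD := unitBall_subset_closure_of_dense hd
  -- If no nonzero CPWL class lies in the ball, density forces the ball to be `{0}`, and then `0` is
  -- itself a CPWL extreme point.
  by_cases hex : ∃ w ∈ proj n '' cpwlL1 n ∩ unitBall n, w ≠ 0
  · obtain ⟨w, ⟨⟨f, hf, rfl⟩, hwB⟩, hw0⟩ := hex
    refine extremePoints_subset_closure_of_subset_closure_convexHull (isCompact_unitBall n)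
      (convex_unitBall n) (fun v hv => hv.2.1) (hD.trans (closure_minimal ?_ isClosed_closure))
    rintro v ⟨⟨g, hg, rfl⟩, hvB⟩
    by_cases hv0 : proj n g = 0
    · obtain ⟨𝒯, h𝒯, hf𝒯⟩ := mem_cpwlL1_iff.1 hf
      have h1 := mem_closure_convexHull_of_ne_zero h𝒯 hwB ⟨f, hf𝒯, rfl⟩ hw0
      have hneg : -proj n f ∈ unitBall n := by
        rw [← map_neg, proj_mem_unitBall_iff, ← neg_one_smul ℝ f]
        refine (htv_coe_smul_le _ f).trans ?_
        simpa using proj_mem_unitBall_iff.1 hwB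
      have h2 := mem_closure_convexHull_of_ne_zero h𝒯 hneg (neg_mem ⟨f, hf𝒯, rfl⟩)
        (neg_ne_zero.2 hw0)
      have h3 := (convex_convexHull ℝ (cpwlExtremePoints n)).closure h1 h2
        (by norm_num : (0 : ℝ) ≤ 1 / 2) (by norm_num : (0 : ℝ) ≤ 1 / 2) (by norm_num)
      rw [hv0]
      simpa using h3
    · obtain ⟨𝒯, h𝒯, hg𝒯⟩ := mem_cpwlL1_iff.1 hg
      exact mem_closure_convexHull_of_ne_zero h𝒯 hvB ⟨g, hg𝒯, rfl⟩ hv0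
  · push Not at hex
    intro e he
    have hcl : proj n '' cpwlL1 n ∩ unitBall n ⊆ {0} := fun w hw => hex w hw
    have he0 : e = 0 := closure_minimal hcl isClosed_singleton (hD he.1)
    obtain ⟨w, hw⟩ := closure_nonempty_iff.1 ⟨e, hD he.1⟩
    have hw0 := hex w hw
    refine subset_closure ⟨?_, he⟩
    rw [he0, ← hw0]
    exact hw.1

/-- A function which is extreme modulo affine functions is integrable, and its class is an extreme
point of the unit ball. -/
theorem exists_L1_of_isExtremeModAffine {f : Eu n →ₘ[cubeMeasure n] ℝ}
    (hf : IsExtremeModAffine (locUnitBall n) f) :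
    ∃ h : L1Cube n, (h : Eu n →ₘ[cubeMeasure n] ℝ) = f ∧
      proj n h ∈ (unitBall n).extremePoints ℝ := by
  obtain ⟨⟨hfl, hf1⟩, hext⟩ := hf
  obtain ⟨C, hC, hP⟩ := exists_affine_lintegral_le n
  obtain ⟨a, ha⟩ := hP f hfl (hf1.trans_lt ENNReal.one_lt_top).ne
  have hmem : MemLp (fun x => f x - a x) 1 (cubeMeasure n) := by
    refine ⟨f.aestronglyMeasurable.sub (continuous_affineMap a).aestronglyMeasurable, ?_⟩
    rw [eLpNorm_one_eq_lintegral_enorm]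
    exact ha.trans_lt (ENNReal.mul_lt_top ENNReal.ofReal_lt_top (hf1.trans_lt ENNReal.one_lt_top))
  have hmemf : MemLp f 1 (cubeMeasure n) := by
    have := hmem.add (memLp_affineMap a)
    refine this.ae_eq (Eventually.of_forall fun x => ?_)
    simp
  set h : L1Cube n := hmemf.toLp f with hh
  have hhf : (h : Eu n →ₘ[cubeMeasure n] ℝ) = f := by
    apply AEEqFun.ext
    exact hmemf.coeFn_toLp
  have hhf1 : htv 1 h (cube n) ≤ 1 := (htv_congr_L1 hmemf.coeFn_toLp).trans_le hf1
  refine ⟨h, hhf, proj_mem_unitBall_iff.2 hhf1, ?_⟩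
  rintro _ ⟨f₁, hf₁, rfl⟩ _ ⟨f₂, hf₂, rfl⟩ ⟨t, s, ht, hs, hts, he⟩
  obtain ⟨f₁', hp, hc⟩ := exists_lift_combination ht.ne' he
  have k1 : (f₁' : Eu n →ₘ[cubeMeasure n] ℝ) ∈ locUnitBall n :=
    ⟨locallyIntegrableOn_of_L1 f₁', (htv_eq_of_proj_eq hp).trans_le hf₁⟩
  have k2 : (f₂ : Eu n →ₘ[cubeMeasure n] ℝ) ∈ locUnitBall n :=
    ⟨locallyIntegrableOn_of_L1 f₂, hf₂⟩
  obtain ⟨⟨b, hb⟩, -⟩ := hext _ k1 _ k2 ⟨t, s, ht, hs, hts, by rw [← hhf, ← hc]; rfl⟩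
  rw [← hp]
  refine (Submodule.Quotient.eq _).2 ⟨b, ?_⟩
  rw [← hhf] at hb
  exact hb

end Extreme

/-! ### Density in energy: second derivatives and convexity. -/

section Hessian
variable {n : ℕ}

/-- The Hessian quadratic form of `u` at `x`. -/
def hessForm (u : Eu n → ℝ) (x v : Eu n) : ℝ :=
  ∑ i, ∑ j, v i * v j * partialDeriv j (partialDeriv i u) x

/-- The Laplacian. -/
def lap (u : Eu n → ℝ) (x : Eu n) : ℝ := ∑ i, partialDeriv i (partialDeriv i u) x

theorem fderiv_eq_sum_partialDeriv (u : Eu n → ℝ) (x v : Eu n) :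
    fderiv ℝ u x v = ∑ i, v i * partialDeriv i u x := by
  have hv : v = ∑ i, v i • (EuclideanSpace.single i (1 : ℝ) : Eu n) := by
    ext j
    rw [WithLp.ofLp_sum, Finset.sum_apply, Finset.sum_eq_single j] <;> simp +contextual
  conv_lhs => rw [hv, map_sum]
  simp [partialDeriv]

theorem hasDerivAt_comp_line {u : Eu n → ℝ} (hu : ContDiff ℝ ∞ u) (x v : Eu n) (t : ℝ) :
    HasDerivAt (fun t : ℝ => u (x + t • v)) (∑ i, v i * partialDeriv i u (x + t • v)) t := by
  rw [← fderiv_eq_sum_partialDeriv]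
  have h1 : HasDerivAt (fun t : ℝ => x + t • v) v t := by
    simpa using ((hasDerivAt_id t).smul_const v).const_add x
  exact ((hu.differentiable (by simp)) (x + t • v)).hasFDerivAt.comp_hasDerivAt t h1

theorem hasDerivAt_deriv_comp_line {u : Eu n → ℝ} (hu : ContDiff ℝ ∞ u) (x v : Eu n) (t : ℝ) :
    HasDerivAt (fun t : ℝ => ∑ i, v i * partialDeriv i u (x + t • v))
      (hessForm u (x + t • v) v) t := by
  have h := HasDerivAt.fun_sum (u := Finset.univ) fun i (_ : i ∈ Finset.univ) =>
    (hasDerivAt_comp_line (partialDeriv_contDiff i hu) x v t).const_mul (v i)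
  refine h.congr_deriv ?_
  simp only [hessForm, Finset.mul_sum, mul_assoc]

theorem deriv_comp_line {u : Eu n → ℝ} (hu : ContDiff ℝ ∞ u) (x v : Eu n) :
    deriv (fun t : ℝ => u (x + t • v)) = fun t => ∑ i, v i * partialDeriv i u (x + t • v) :=
  funext fun t => (hasDerivAt_comp_line hu x v t).deriv

theorem convexOn_iff_comp_line {u : Eu n → ℝ} :
    ConvexOn ℝ Set.univ u ↔ ∀ x v, ConvexOn ℝ Set.univ fun t : ℝ => u (x + t • v) := by
  constructor
  · intro h x v
    refine ⟨convex_univ, fun s _ t _ a b ha hb hab => ?_⟩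
    have := h.2 (Set.mem_univ (x + s • v)) (Set.mem_univ (x + t • v)) ha hb hab
    refine le_of_eq_of_le (congrArg u ?_) this
    rw [smul_add, smul_add, smul_smul, smul_smul, add_add_add_comm, ← add_smul, hab, one_smul,
      ← add_smul]
    rfl
  · intro h
    refine ⟨convex_univ, fun x _ y _ a b ha hb hab => ?_⟩
    have := (h x (y - x)).2 (Set.mem_univ 0) (Set.mem_univ 1) ha hb hab
    simp only [zero_smul, add_zero, one_smul, smul_eq_mul, mul_zero, mul_one, zero_add,
      add_sub_cancel] at this
    refine le_of_eq_of_le (congrArg u ?_) this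
    rw [smul_sub, show a = 1 - b by linarith, sub_smul, one_smul]
    abel

theorem convexOn_of_hessForm_nonneg {u : Eu n → ℝ} (hu : ContDiff ℝ ∞ u)
    (h : ∀ x v, 0 ≤ hessForm u x v) : ConvexOn ℝ Set.univ u := by
  rw [convexOn_iff_comp_line]
  intro x v
  refine convexOn_univ_of_deriv2_nonneg (fun t => (hasDerivAt_comp_line hu x v t).differentiableAt)
    ?_ fun t => ?_
  · rw [deriv_comp_line hu]
    exact fun t => (hasDerivAt_deriv_comp_line hu x v t).differentiableAt
  · rw [Function.iterate_succ, Function.iterate_one, Function.comp_apply, deriv_comp_line hu,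
      (hasDerivAt_deriv_comp_line hu x v t).deriv]
    exact h _ _

theorem hessForm_nonneg_of_convexOn {u : Eu n → ℝ} (hu : ContDiff ℝ ∞ u)
    (h : ConvexOn ℝ Set.univ u) (x v : Eu n) : 0 ≤ hessForm u x v := by
  have h1 := (convexOn_iff_comp_line.1 h x v).monotoneOn_deriv
    fun t _ => (hasDerivAt_comp_line hu x v t).differentiableAt
  rw [deriv_comp_line hu, monotoneOn_univ] at h1
  have h2 := h1.deriv_nonneg (x := 0)
  rw [(hasDerivAt_deriv_comp_line hu x v 0).deriv] at h2
  simpa using h2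

theorem partialDeriv_comm {u : Eu n → ℝ} (hu : ContDiff ℝ ∞ u) (i j : Fin n) (x : Eu n) :
    partialDeriv i (partialDeriv j u) x = partialDeriv j (partialDeriv i u) x := by
  have hd : Differentiable ℝ (fderiv ℝ u) := (hu.fderiv_right (m := ∞) (by simp)).differentiable
    (by simp)
  have h : ∀ a b : Fin n, partialDeriv a (partialDeriv b u) x =
      fderiv ℝ (fderiv ℝ u) x (EuclideanSpace.single a 1) (EuclideanSpace.single b 1) := by
    intro a b
    change fderiv ℝ (fun y => fderiv ℝ u y (EuclideanSpace.single b 1)) x _ = _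
    rw [fderiv_clm_apply (hd x) (differentiableAt_const _)]
    simp
  rw [h, h]
  exact (hu.contDiffAt.isSymmSndFDerivAt (by simpa using ENat.LEInfty.out)).eq _ _

end Hessian

/-! ### Spectral decomposition and trace inequalities. -/

section Spectral
variable {n : ℕ}

/-- Spectral decomposition of a real symmetric matrix, in coordinates. -/
theorem exists_spectral {H : Matrix (Fin n) (Fin n) ℝ} (hH : ∀ i j, H i j = H j i) :
    ∃ (μ : Fin n → ℝ) (e : OrthonormalBasis (Fin n) ℝ (Eu n)),
      ∀ i j, H i j = ∑ a, μ a * (e a i * e a j) := by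
  have hA : H.IsHermitian := by
    ext i j; simp [hH i j]
  refine ⟨hA.eigenvalues, hA.eigenvectorBasis, fun i j => ?_⟩
  have h1 := congrFun (congrFun hA.spectral_theorem i) j
  rw [h1]
  simp [Matrix.mul_apply, Matrix.diagonal_apply, Unitary.conjStarAlgAut_apply,
    Matrix.IsHermitian.eigenvectorUnitary_apply]
  refine Finset.sum_congr rfl fun a _ => by ring

theorem sum_comm_three {ι : Type*} [Fintype ι] (X : ι → ι → ι → ℝ) :
    ∑ i, ∑ j, ∑ a, X i j a = ∑ a, ∑ i, ∑ j, X i j a := by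
  rw [Finset.sum_comm (f := fun a i => ∑ j, X i j a)]
  exact Finset.sum_congr rfl fun i _ => Finset.sum_comm

theorem sum_mul_basis (e : OrthonormalBasis (Fin n) ℝ (Eu n)) (a b : Fin n) :
    ∑ i, e a i * e b i = if a = b then 1 else 0 := by
  have := orthonormal_iff_ite.1 e.orthonormal a b
  rw [← this, PiLp.inner_apply]
  simp [mul_comm]

theorem sum_sq_sum_mul_basis (e : OrthonormalBasis (Fin n) ℝ (Eu n)) (v : Eu n) :
    ∑ a, (∑ i, e a i * v i) ^ 2 = ∑ i, v i ^ 2 := by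
  have := e.sum_sq_norm_inner_right v
  rw [EuclideanSpace.norm_sq_eq] at this
  simp only [Real.norm_eq_abs, sq_abs, PiLp.inner_apply] at this
  simpa [mul_comm] using this

theorem sum_mul_opLeOne_le {F : Matrix (Fin n) (Fin n) ℝ} (hF : OpLeOne F) (v : Eu n)
    (hv : ‖v‖ = 1) : ∑ i, ∑ j, v i * v j * F i j ≤ 1 := by
  have h1 : ∑ i, ∑ j, v i * v j * F i j = inner ℝ v (Matrix.toEuclideanLin F v) := by
    rw [PiLp.inner_apply]
    simp only [Matrix.toLpLin_apply, Matrix.mulVec, dotProduct]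
    refine Finset.sum_congr rfl fun i _ => ?_
    simp [Finset.sum_mul]
    refine Finset.sum_congr rfl fun j _ => by ring
  rw [h1]
  calc _ ≤ ‖v‖ * ‖Matrix.toEuclideanLin F v‖ := real_inner_le_norm _ _
    _ ≤ ‖v‖ * ‖v‖ := by gcongr; exact hF v
    _ = 1 := by rw [hv]; norm_num

/-- For a positive semidefinite `H` and `|F| ≤ 1` in operator norm, `tr (Hᵀ F) ≤ tr H`. -/
theorem sum_mul_le_trace {H F : Matrix (Fin n) (Fin n) ℝ} (hH : ∀ i j, H i j = H j i)
    (hpos : ∀ v : Eu n, 0 ≤ ∑ i, ∑ j, v i * v j * H i j) (hF : OpLeOne F) :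
    ∑ i, ∑ j, H i j * F i j ≤ ∑ i, H i i := by
  obtain ⟨μ, e, he⟩ := exists_spectral hH
  have hμ : ∀ a, 0 ≤ μ a := by
    intro a
    have h1 := hpos (e a)
    have h2 : ∑ i, ∑ j, e a i * e a j * H i j = μ a := by
      calc ∑ i, ∑ j, e a i * e a j * H i j
          = ∑ b, μ b * ((∑ i, e a i * e b i) * ∑ j, e a j * e b j) := by
            simp only [he, Finset.mul_sum, Finset.sum_mul]
            rw [sum_comm_three]
            refine Finset.sum_congr rfl fun b _ => Finset.sum_congr rfl fun i _ =>
              Finset.sum_congr rfl fun j _ => by ring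
        _ = μ a := by simp [sum_mul_basis]
    rwa [h2] at h1
  calc ∑ i, ∑ j, H i j * F i j = ∑ a, μ a * ∑ i, ∑ j, e a i * e a j * F i j := by
        simp only [he, Finset.mul_sum, Finset.sum_mul]
        rw [sum_comm_three]
        refine Finset.sum_congr rfl fun b _ => Finset.sum_congr rfl fun i _ =>
          Finset.sum_congr rfl fun j _ => by ring
    _ ≤ ∑ a, μ a * 1 := by
        gcongr with a _
        · exact hμ a
        · exact sum_mul_opLeOne_le hF _ (e.norm_eq_one a)
    _ = ∑ a, μ a * ∑ i, e a i * e a i := by simp [sum_mul_basis]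
    _ = ∑ i, H i i := by
        simp only [he, Finset.mul_sum]
        exact Finset.sum_comm

end Spectral

section SpectralSplit
variable {n : ℕ}

theorem sum_form_spectral (e : OrthonormalBasis (Fin n) ℝ (Eu n)) (w : Fin n → ℝ) (v : Eu n) :
    ∑ i, ∑ j, v i * v j * ∑ a, w a * (e a i * e a j) = ∑ a, w a * (∑ i, e a i * v i) ^ 2 := by
  simp only [sq, Finset.mul_sum, Finset.sum_mul]
  rw [sum_comm_three]
  refine Finset.sum_congr rfl fun a _ => ?_
  rw [Finset.sum_comm]
  exact Finset.sum_congr rfl fun i _ => Finset.sum_congr rfl fun j _ => by ring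

theorem OpLeOne.abs_le_one {M : Matrix (Fin n) (Fin n) ℝ} (h : OpLeOne M) (i j : Fin n) :
    |M i j| ≤ 1 := by
  have h1 := h (EuclideanSpace.single j 1)
  have h2 := PiLp.norm_apply_le (Matrix.toEuclideanLin M (EuclideanSpace.single j 1)) i
  have h3 : (Matrix.toEuclideanLin M (EuclideanSpace.single j 1)) i = M i j := by
    simp [Matrix.toLpLin_apply]
  rw [h3, Real.norm_eq_abs] at h2
  refine h2.trans (h1.trans ?_)
  simp

theorem opLeOne_spectral (e : OrthonormalBasis (Fin n) ℝ (Eu n)) (w : Fin n → ℝ)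
    (hw : ∀ a, w a ^ 2 ≤ 1) : OpLeOne (Matrix.of fun i j => ∑ a, w a * (e a i * e a j)) := by
  intro v
  set y := Matrix.toEuclideanLin (Matrix.of fun i j => ∑ a, w a * (e a i * e a j)) v with hy
  have hyi : ∀ i, y i = ∑ a, w a * (∑ j, e a j * v j) * e a i := by
    intro i
    simp only [hy, Matrix.toLpLin_apply, Matrix.mulVec, dotProduct, Matrix.of_apply,
      Finset.mul_sum, Finset.sum_mul]
    rw [Finset.sum_comm]
    exact Finset.sum_congr rfl fun a _ => Finset.sum_congr rfl fun j _ => by ring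
  have hc : ∀ b, ∑ i, e b i * y i = w b * ∑ j, e b j * v j := by
    intro b
    calc ∑ i, e b i * y i = ∑ a, w a * (∑ j, e a j * v j) * ∑ i, e b i * e a i := by
          simp only [hyi, Finset.mul_sum]
          rw [Finset.sum_comm]
          refine Finset.sum_congr rfl fun a _ => Finset.sum_congr rfl fun i _ => ?_
          ring
      _ = w b * ∑ j, e b j * v j := by simp [sum_mul_basis]
  rw [EuclideanSpace.norm_eq, EuclideanSpace.norm_eq]
  refine Real.sqrt_le_sqrt ?_
  simp only [Real.norm_eq_abs, sq_abs]
  rw [← sum_sq_sum_mul_basis e y, ← sum_sq_sum_mul_basis e v]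
  refine Finset.sum_le_sum fun b _ => ?_
  rw [hc, mul_pow]
  exact mul_le_of_le_one_left (sq_nonneg _) (hw b)

/-- The negative part `b` and the sign `E` of a symmetric matrix `H`. -/
theorem exists_negPart_sign {H : Matrix (Fin n) (Fin n) ℝ} (hH : ∀ i j, H i j = H j i) :
    ∃ b E : Matrix (Fin n) (Fin n) ℝ, (∀ i j, b i j = b j i) ∧
      (∀ v : Eu n, 0 ≤ ∑ i, ∑ j, v i * v j * b i j) ∧
      (∀ v : Eu n, 0 ≤ ∑ i, ∑ j, v i * v j * (H i j + b i j)) ∧ OpLeOne E ∧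
      ∑ i, ∑ j, H i j * E i j = ∑ i, H i i + 2 * ∑ i, b i i := by
  obtain ⟨μ, e, he⟩ := exists_spectral hH
  -- Here `μ a * s a = |μ a|`, so `E` is the field which realises the trace norm of `H`, and the
  -- trace norm equals the trace of `H` plus twice the trace of its negative part.
  set s : Fin n → ℝ := fun a => if 0 ≤ μ a then 1 else -1 with hs
  have hμ : ∀ a, μ a * s a = μ a + 2 * max (-μ a) 0 := by
    intro a
    by_cases h : 0 ≤ μ a
    · simp [hs, h]
    · push Not at h
      simp only [hs, not_le.2 h, if_false]
      rw [max_eq_left (by linarith)]; ring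
  refine ⟨Matrix.of fun i j => ∑ a, max (-μ a) 0 * (e a i * e a j),
    Matrix.of fun i j => ∑ a, s a * (e a i * e a j), fun i j => ?_, fun v => ?_, fun v => ?_,
    opLeOne_spectral e s fun a => ?_, ?_⟩
  · simp only [Matrix.of_apply]
    exact Finset.sum_congr rfl fun a _ => by ring
  · simp only [Matrix.of_apply]
    rw [sum_form_spectral]
    exact Finset.sum_nonneg fun a _ => mul_nonneg (le_max_right _ _) (sq_nonneg _)
  · simp only [Matrix.of_apply, he, ← Finset.sum_add_distrib, ← add_mul]
    rw [sum_form_spectral]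
    refine Finset.sum_nonneg fun a _ => mul_nonneg ?_ (sq_nonneg _)
    linarith [le_max_left (-μ a) 0]
  · simp only [hs]; split_ifs <;> norm_num
  · have h1 : ∑ i, ∑ j, H i j * (Matrix.of fun i j => ∑ a, s a * (e a i * e a j)) i j =
        ∑ a, μ a * s a := by
      calc _ = ∑ a, s a * ∑ i, ∑ j, e a i * e a j * H i j := by
            simp only [Matrix.of_apply, Finset.mul_sum]
            rw [sum_comm_three]
            exact Finset.sum_congr rfl fun a _ => Finset.sum_congr rfl fun i _ =>
              Finset.sum_congr rfl fun j _ => by ring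
        _ = ∑ a, μ a * s a := by
            refine Finset.sum_congr rfl fun a _ => ?_
            simp only [he]
            rw [sum_form_spectral]
            simp [sum_mul_basis, mul_comm]
    have h2 : ∀ w : Fin n → ℝ, ∑ i, ∑ a, w a * (e a i * e a i) = ∑ a, w a := by
      intro w
      rw [Finset.sum_comm]
      refine Finset.sum_congr rfl fun a _ => ?_
      rw [← Finset.mul_sum, sum_mul_basis]; simp
    rw [h1]
    simp only [Matrix.of_apply, he]
    rw [h2, h2, Finset.mul_sum, ← Finset.sum_add_distrib]
    exact Finset.sum_congr rfl fun a _ => hμ a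

end SpectralSplit

/-! ### Testing convex functions, and approximating them. -/

section Convex
variable {n : ℕ} {A : Set (Eu n)}

theorem integral_mul_le_add {k k' G : Eu n → ℝ} (hk : Continuous k) (hk' : Continuous k')
    (hG : Continuous G) (hGc : HasCompactSupport G) {ε : ℝ}
    (h : ∀ x ∈ tsupport G, |k x - k' x| ≤ ε) :
    ∫ x, k x * G x ≤ (∫ x, k' x * G x) + ε * ∫ x, |G x| := by
  have i1 : Integrable fun x => k x * G x :=
    (hk.mul hG).integrable_of_hasCompactSupport hGc.mul_left
  have i2 : Integrable fun x => k' x * G x :=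
    (hk'.mul hG).integrable_of_hasCompactSupport hGc.mul_left
  have i3 : Integrable fun x => ε * |G x| :=
    ((hG.integrable_of_hasCompactSupport hGc).abs).const_mul ε
  rw [← integral_const_mul, ← integral_add i2 i3]
  refine integral_mono i1 (i2.add i3) fun x => ?_
  simp only
  by_cases hx : x ∈ tsupport G
  · have h1 : (k x - k' x) * G x ≤ ε * |G x| := by
      refine (le_abs_self _).trans ?_
      rw [abs_mul]
      exact mul_le_mul_of_nonneg_right (h x hx) (abs_nonneg _)
    linarith
  · simp [image_eq_zero_of_notMem_tsupport hx]

theorem isSmoothField_smul_one {ψ : Eu n → ℝ} (hψ : ContDiff ℝ ∞ ψ) (hc : HasCompactSupport ψ)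
    (hA : tsupport ψ ⊆ A) : IsSmoothField A fun x => ψ x • (1 : Matrix (Fin n) (Fin n) ℝ) :=
  .of_tsupport hψ hc hA fun _ _ => contDiff_const

theorem integral_mul_hdiv_smul_one {u ψ : Eu n → ℝ} (hu : ContDiff ℝ ∞ u) (hψ : ContDiff ℝ ∞ ψ)
    (hc : HasCompactSupport ψ) :
    ∫ x, u x * hdiv (fun x => ψ x • (1 : Matrix (Fin n) (Fin n) ℝ)) x = ∫ x, ψ x * lap u x := by
  rw [integral_mul_hdiv hu (isSmoothField_smul_one hψ hc (Set.subset_univ _))]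
  refine integral_congr_ae (Eventually.of_forall fun x => ?_)
  simp only [lap, Finset.mul_sum]
  refine Finset.sum_congr rfl fun i _ => ?_
  rw [Finset.sum_eq_single i]
  · simp [mul_comm]
  · intro j _ hj
    simp [hj.symm]
  · simp

/-- After integration by parts the trace inequality for the positive semidefinite Hessian applies at
every point. -/
theorem integral_convex_mul_hdiv_le_of_contDiff {k ψ : Eu n → ℝ} (hk : ContDiff ℝ ∞ k)
    (hkc : ConvexOn ℝ Set.univ k) (hψ : ContDiff ℝ ∞ ψ) (hc : HasCompactSupport ψ)
    (hψ0 : ∀ x, 0 ≤ ψ x) {F : Eu n → Matrix (Fin n) (Fin n) ℝ}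
    (hF : ∀ i j, ContDiff ℝ ∞ fun x => F x i j) (h1 : ∀ x, OpLeOne (F x)) :
    ∫ x, k x * hdiv (fun x => ψ x • F x) x ≤
      ∫ x, k x * hdiv (fun x => ψ x • (1 : Matrix (Fin n) (Fin n) ℝ)) x := by
  have f1 : IsSmoothField Set.univ fun x => ψ x • F x := .of_tsupport hψ hc (Set.subset_univ _) hF
  have f2 : IsSmoothField Set.univ fun x => ψ x • (1 : Matrix (Fin n) (Fin n) ℝ) :=
    isSmoothField_smul_one hψ hc (Set.subset_univ _)
  have hint : ∀ G : Eu n → Matrix (Fin n) (Fin n) ℝ, IsSmoothField Set.univ G →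
      Integrable fun x => ∑ i, ∑ j, partialDeriv j (partialDeriv i k) x * G x i j := by
    intro G hG
    refine integrable_finsetSum _ fun i _ => integrable_finsetSum _ fun j _ => ?_
    exact ((partialDeriv_contDiff j (partialDeriv_contDiff i hk)).continuous.mul
      (hG.1 i j).continuous).integrable_of_hasCompactSupport (hG.2 i j).mul_left
  rw [integral_mul_hdiv hk f1, integral_mul_hdiv hk f2]
  refine integral_mono (hint _ f1) (hint _ f2) fun x => ?_
  have h2 := sum_mul_le_trace (H := Matrix.of fun i j => partialDeriv j (partialDeriv i k) x)
    (fun i j => partialDeriv_comm hk j i x)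
    (fun v => hessForm_nonneg_of_convexOn hk hkc x v) (h1 x)
  simp only [Matrix.of_apply] at h2
  have e1 : ∑ i, ∑ j, partialDeriv j (partialDeriv i k) x * (ψ x • F x) i j =
      ψ x * ∑ i, ∑ j, partialDeriv j (partialDeriv i k) x * F x i j := by
    simp only [Finset.mul_sum, Matrix.smul_apply, smul_eq_mul]
    exact Finset.sum_congr rfl fun i _ => Finset.sum_congr rfl fun j _ => by ring
  have e2 : ∑ i, ∑ j, partialDeriv j (partialDeriv i k) x *
      (ψ x • (1 : Matrix (Fin n) (Fin n) ℝ)) i j =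
      ψ x * ∑ i, partialDeriv i (partialDeriv i k) x := by
    simp only [Finset.mul_sum]
    refine Finset.sum_congr rfl fun i _ => ?_
    rw [Finset.sum_eq_single i]
    · simp [mul_comm]
    · intro j _ hj
      simp [hj.symm]
    · simp
  simp only
  rw [e1, e2]
  exact mul_le_mul_of_nonneg_left h2 (hψ0 x)

/-- A continuous convex function is approximated on compact sets by smooth convex functions. -/
theorem exists_contDiff_convex_approx {k : Eu n → ℝ} (hk : Continuous k)
    (hkc : ConvexOn ℝ Set.univ k) {S : Set (Eu n)} (hS : IsCompact S) {ε : ℝ} (hε : 0 < ε) :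
    ∃ k' : Eu n → ℝ, ContDiff ℝ ∞ k' ∧ ConvexOn ℝ Set.univ k' ∧ ∀ x ∈ S, |k x - k' x| ≤ ε := by
  have hS' : IsCompact (Metric.cthickening 1 S) := hS.cthickening
  have hu := hS'.uniformContinuousOn_of_continuous hk.continuousOn
  obtain ⟨δ, hδ, hδε⟩ := Metric.uniformContinuousOn_iff.1 hu ε hε
  set r := min δ 1 with hr
  have hr0 : 0 < r := lt_min hδ one_pos
  let φ : ContDiffBump (0 : Eu n) := ⟨r / 2, r, by positivity, by linarith⟩
  have hφr : φ.rOut = r := rfl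
  -- Averaging translates against a nonnegative kernel preserves convexity.
  set k' : Eu n → ℝ := convolution (φ.normed volume) k (ContinuousLinearMap.lsmul ℝ ℝ) volume
    with hk'
  have hli : LocallyIntegrable k volume := hk.locallyIntegrable
  have hex : ∀ x, Integrable (fun t => φ.normed volume t * k (x - t)) := fun x =>
    ((φ.continuous_normed).mul (hk.comp (continuous_const.sub continuous_id))).integrable_of_hasCompactSupport
      (φ.hasCompactSupport_normed).mul_right
  have hval : ∀ x, k' x = ∫ t, φ.normed volume t * k (x - t) := fun x => by
    simp [hk', convolution]
  refine ⟨k', ?_, ⟨convex_univ, fun x _ y _ a b ha hb hab => ?_⟩, fun x hx => ?_⟩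
  · exact φ.hasCompactSupport_normed.contDiff_convolution_left _ φ.contDiff_normed hli
  · rw [hval, hval, hval, smul_eq_mul, smul_eq_mul, ← integral_const_mul, ← integral_const_mul,
      ← integral_add ((hex x).const_mul a) ((hex y).const_mul b)]
    refine integral_mono (hex _) (((hex x).const_mul a).add ((hex y).const_mul b)) fun t => ?_
    simp only
    have h1 := hkc.2 (Set.mem_univ (x - t)) (Set.mem_univ (y - t)) ha hb hab
    have e : a • x + b • y - t = a • (x - t) + b • (y - t) := by
      rw [smul_sub, smul_sub, sub_add_sub_comm, ← add_smul, hab, one_smul]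
    rw [e]
    have h2 := mul_le_mul_of_nonneg_left h1 (φ.nonneg_normed (μ := volume) t)
    simp only [smul_eq_mul] at h2
    linarith
  · rw [abs_sub_comm, ← Real.dist_eq]
    refine φ.dist_normed_convolution_le hk.aestronglyMeasurable fun y hy => ?_
    rw [hφr, Metric.mem_ball] at hy
    refine (hδε y ?_ x (Metric.self_subset_cthickening S hx) (hy.trans_le (min_le_left _ _))).le
    exact Metric.mem_cthickening_of_dist_le y x 1 S hx (hy.le.trans (min_le_right _ _))

/-- For `k` convex, `ψ ≥ 0` and `|F| ≤ 1`, testing the Hessian of `k` with `ψ F` is bounded by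
testing its Laplacian with `ψ`. -/
theorem integral_convex_mul_hdiv_le {k ψ : Eu n → ℝ} (hk : Continuous k)
    (hkc : ConvexOn ℝ Set.univ k) (hψ : ContDiff ℝ ∞ ψ) (hc : HasCompactSupport ψ)
    (hψ0 : ∀ x, 0 ≤ ψ x) {F : Eu n → Matrix (Fin n) (Fin n) ℝ}
    (hF : ∀ i j, ContDiff ℝ ∞ fun x => F x i j) (h1 : ∀ x, OpLeOne (F x)) :
    ∫ x, k x * hdiv (fun x => ψ x • F x) x ≤
      ∫ x, k x * hdiv (fun x => ψ x • (1 : Matrix (Fin n) (Fin n) ℝ)) x := by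
  have f1 : IsSmoothField Set.univ fun x => ψ x • F x := .of_tsupport hψ hc (Set.subset_univ _) hF
  have f2 : IsSmoothField Set.univ fun x => ψ x • (1 : Matrix (Fin n) (Fin n) ℝ) :=
    isSmoothField_smul_one hψ hc (Set.subset_univ _)
  set G₁ := hdiv fun x => ψ x • F x
  set G₂ := hdiv fun x => ψ x • (1 : Matrix (Fin n) (Fin n) ℝ)
  have hle : ∀ ε : ℝ, 0 < ε → ∫ x, k x * G₁ x ≤
      (∫ x, k x * G₂ x) + ε * ((∫ x, |G₁ x|) + ∫ x, |G₂ x|) := by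
    intro ε hε
    obtain ⟨k', hk', hkc', happ⟩ := exists_contDiff_convex_approx hk hkc
      (f1.hasCompactSupport_hdiv.isCompact.union f2.hasCompactSupport_hdiv.isCompact) hε
    have a1 := integral_mul_le_add hk hk'.continuous f1.continuous_hdiv f1.hasCompactSupport_hdiv
      fun x hx => happ x (Or.inl hx)
    have a2 := integral_convex_mul_hdiv_le_of_contDiff hk' hkc' hψ hc hψ0 hF h1
    have a3 := integral_mul_le_add hk'.continuous hk f2.continuous_hdiv f2.hasCompactSupport_hdiv
      (ε := ε) fun x hx => by rw [abs_sub_comm]; exact happ x (Or.inr hx)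
    linarith
  set D := (∫ x, |G₁ x|) + ∫ x, |G₂ x| with hD
  have hD0 : 0 ≤ D := add_nonneg (integral_nonneg fun _ => abs_nonneg _)
    (integral_nonneg fun _ => abs_nonneg _)
  refine le_of_forall_pos_le_add fun ε hε => ?_
  refine (hle (ε / (D + 1)) (by positivity)).trans ?_
  gcongr
  rw [div_mul_eq_mul_div, div_le_iff₀ (by positivity)]
  nlinarith

/-- A continuous convex function is approximated from below on compact sets by finite maxima of
affine functions. -/
theorem exists_finset_affine_sup {k : Eu n → ℝ} (hk : Continuous k)
    (hkc : ConvexOn ℝ Set.univ k) {S : Set (Eu n)} (hS : IsCompact S) {ε : ℝ} (hε : 0 < ε) :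
    ∃ (N : ℕ) (a : Fin (N + 1) → Eu n →ᵃ[ℝ] ℝ), (∀ i x, a i x ≤ k x) ∧
      ∀ x ∈ S, ∃ i, k x - ε ≤ a i x := by
  have key : ∀ y : Eu n, ∃ a : Eu n →ᵃ[ℝ] ℝ, (∀ x, a x ≤ k x) ∧ a y = k y - ε / 2 := by
    intro y
    obtain ⟨l, c, hl, hc⟩ := hkc.exists_affine_le_of_lt (𝕜 := ℝ) (Set.mem_univ y)
      (show k y - ε / 2 < k y by linarith) isClosed_univ (hk.lowerSemicontinuous.lowerSemicontinuousOn _)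
    refine ⟨(l : Eu n →ₗ[ℝ] ℝ).toAffineMap + AffineMap.const ℝ _ c, fun x => ?_, ?_⟩
    · exact hl ⟨x, Set.mem_univ x⟩
    · exact hc
  choose a ha hay using key
  obtain ⟨s, hs, hcov⟩ := hS.elim_nhds_subcover (fun y => {x | k x - ε < a y x}) fun y _ => by
    have hopen : IsOpen {x | k x - ε < a y x} :=
      isOpen_lt (hk.sub continuous_const) (continuous_affineMap (a y))
    refine hopen.mem_nhds ?_
    rw [Set.mem_ofPred_eq, hay]; linarith
  -- The inserted index guarantees a nonempty family even if `S` is empty.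
  set s' := insert (0 : Eu n) s with hs'
  have hne : s'.Nonempty := Finset.insert_nonempty _ _
  obtain ⟨N, hN⟩ : ∃ N, s'.card = N + 1 := ⟨s'.card - 1, by
    have := hne.card_pos; omega⟩
  let e := (s'.equivFinOfCardEq hN).symm
  refine ⟨N, fun i => a (e i), fun i x => ha _ x, fun x hx => ?_⟩
  obtain ⟨y, hy, hxy⟩ := Set.mem_iUnion₂.1 (hcov hx)
  refine ⟨e.symm ⟨y, Finset.mem_insert_of_mem hy⟩, ?_⟩
  simp only [Equiv.apply_symm_apply]
  exact le_of_lt hxy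

end Convex

/-! ### Bounded polyhedra are convex hulls of finite sets. -/

section Polyhedra
variable {n : ℕ}

theorem affineMap_lineMap_eq (a : Eu n →ᵃ[ℝ] ℝ) (x y : Eu n) (t : ℝ) :
    a (x + t • (y - x)) = a x + t * (a y - a x) := by
  rw [affineMap_eq a (x + t • (y - x)), affineMap_eq a x, affineMap_eq a y]
  simp only [map_add, map_smul, map_sub, smul_eq_mul]
  ring

/-- A bounded polyhedron is the convex hull of finitely many points. -/
theorem exists_finset_convexHull_eq {ι : Type*} [Finite ι] (a : ι → Eu n →ᵃ[ℝ] ℝ)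
    (hb : Bornology.IsBounded {y | ∀ i, 0 ≤ a i y}) :
    ∃ s : Finset (Eu n), {y | ∀ i, 0 ≤ a i y} = convexHull ℝ (s : Set (Eu n)) := by
  set K : Set (Eu n) := {y | ∀ i, 0 ≤ a i y} with hK
  have hcl : IsClosed K := by
    have : K = ⋂ i, {y | 0 ≤ a i y} := by ext y; simp [hK]
    rw [this]
    exact isClosed_iInter fun i => isClosed_le continuous_const (continuous_affineMap (a i))
  have hcomp : IsCompact K := Metric.isCompact_of_isClosed_isBounded hcl hb
  have hconv : Convex ℝ K := by
    intro x hx y hy s t hs ht hst i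
    have e : s • x + t • y = x + t • (y - x) := by
      rw [show s = 1 - t by linarith, sub_smul, one_smul, smul_sub]; abel
    rw [e, affineMap_lineMap_eq]
    have h1 := mul_nonneg hs (hx i)
    have h2 := mul_nonneg ht (hy i)
    rw [show s = 1 - t by linarith] at h1
    linarith
  -- An extreme point is determined by its set of active constraints: if `z'` has the same active
  -- set as `z`, a small move along `±(z' - z)` stays in `K`, which forces `z' = z`.
  have hfin : (K.extremePoints ℝ).Finite := by
    refine Set.Finite.of_injOn (f := fun z => {i | a i z = 0}) (t := Set.univ)
      (fun _ _ => Set.mem_univ _) ?_ Set.finite_univ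
    intro z hz z' hz' hzz
    have hact : ∀ i, a i z = 0 → a i z' = 0 := fun i hi => by
      have : i ∈ {i | a i z = 0} := hi
      rw [show {i | a i z = 0} = {i | a i z' = 0} from hzz] at this
      exact this
    have hev : ∀ᶠ t : ℝ in 𝓝 0, ∀ i, 0 ≤ a i (z + t • (z' - z)) := by
      rw [eventually_all]
      intro i
      by_cases hi : a i z = 0
      · refine Eventually.of_forall fun t => ?_
        rw [affineMap_lineMap_eq, hi, hact i hi]; simp
      · have hpos : 0 < a i z := lt_of_le_of_ne (hz.1 i) (Ne.symm hi)
        have hc : Continuous fun t : ℝ => a i (z + t • (z' - z)) :=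
          (continuous_affineMap (a i)).comp (by fun_prop)
        have := hc.tendsto 0
        simp only [zero_smul, add_zero] at this
        exact (this.eventually (lt_mem_nhds hpos)).mono fun t ht => ht.le
    obtain ⟨ε, hε, hb⟩ := Metric.eventually_nhds_iff.1 hev
    have h1 : z + (ε / 2) • (z' - z) ∈ K := hb (by
      rw [Real.dist_eq, sub_zero, abs_of_pos (by positivity)]; linarith)
    have h2 : z + (-(ε / 2)) • (z' - z) ∈ K := hb (by
      rw [Real.dist_eq, sub_zero, abs_neg, abs_of_pos (by positivity)]; linarith)
    have h3 := hz.2 h1 h2 ⟨1 / 2, 1 / 2, by norm_num, by norm_num, by norm_num, by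
      rw [smul_add, smul_add, neg_smul, smul_neg, add_add_add_comm, add_neg_cancel, add_zero,
        ← add_smul]; norm_num⟩
    have h4 : (ε / 2) • (z' - z) = 0 := by simpa using h3
    have h5 := (smul_eq_zero.1 h4).resolve_left (by positivity)
    exact (sub_eq_zero.1 h5).symm
  refine ⟨hfin.toFinset, ?_⟩
  rw [Set.Finite.coe_toFinset]
  have hKM := closure_convexHull_extremePoints hcomp hconv
  rw [(hfin.isCompact_convexHull ℝ).isClosed.closure_eq] at hKM
  exact hKM.symm

end Polyhedra

/-! ### Cells of a hyperplane arrangement, with the integer grid added to make them bounded. -/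

section Arrangement
variable {n N : ℕ} (ℓ : Fin N → Eu n →ᵃ[ℝ] ℝ)

/-- The closed cell of the arrangement of the hyperplanes `ℓ i = ℓ j` and `x k ∈ ℤ` with given
integer parts and signs. -/
def signCell (m : Fin n → ℤ) (s : Fin N → Fin N → SignType) : Set (Eu n) :=
  {y | (∀ k, (m k : ℝ) ≤ y k ∧ y k ≤ m k + 1) ∧ ∀ i j, 0 ≤ (s i j : ℝ) * (ℓ i y - ℓ j y)}

/-- The closed cell containing `x`. -/
def cell (x : Eu n) : Set (Eu n) :=
  signCell ℓ (fun k => ⌊x k⌋) fun i j => SignType.sign (ℓ i x - ℓ j x)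

/-- The open cell containing `x`. -/
def openCell (x : Eu n) : Set (Eu n) :=
  {y | (∀ k, (⌊x k⌋ : ℝ) < y k ∧ y k < ⌊x k⌋ + 1) ∧
    ∀ i j, ℓ i = ℓ j ∨ 0 < (SignType.sign (ℓ i x - ℓ j x) : ℝ) * (ℓ i y - ℓ j y)}

/-- Points which lie on none of the hyperplanes of the arrangement. -/
def IsGeneric (x : Eu n) : Prop :=
  (∀ k, (⌊x k⌋ : ℝ) ≠ x k) ∧ ∀ i j, ℓ i = ℓ j ∨ ℓ i x ≠ ℓ j x

variable {ℓ}

theorem sign_mul_pos {r : ℝ} (h : r ≠ 0) : 0 < (SignType.sign r : ℝ) * r := by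
  rw [sign_mul_self]; exact abs_pos.2 h

theorem IsGeneric.mem_openCell {x : Eu n} (h : IsGeneric ℓ x) : x ∈ openCell ℓ x :=
  ⟨fun k => ⟨lt_of_le_of_ne (Int.floor_le _) (h.1 k), Int.lt_floor_add_one _⟩, fun i j =>
    (h.2 i j).imp_right fun hij => sign_mul_pos (sub_ne_zero.2 hij)⟩

theorem isGeneric_of_mem_openCell {x y : Eu n} (h : y ∈ openCell ℓ x) : IsGeneric ℓ y := by
  refine ⟨fun k hk => ?_, fun i j => (h.2 i j).imp_right fun hij he => ?_⟩
  · obtain ⟨h1, h2⟩ := h.1 k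
    rw [← hk] at h1 h2
    have h1' : ⌊x k⌋ < ⌊y k⌋ := by exact_mod_cast h1
    have h2' : ⌊y k⌋ < ⌊x k⌋ + 1 := (Int.cast_lt (R := ℝ)).1 (by push_cast; exact h2)
    omega
  · rw [he, sub_self, mul_zero] at hij
    exact lt_irrefl _ hij

theorem openCell_subset_cell (x : Eu n) : openCell ℓ x ⊆ cell ℓ x := fun y hy =>
  ⟨fun k => ⟨(hy.1 k).1.le, (hy.1 k).2.le⟩, fun i j => by
    rcases hy.2 i j with h | h
    · rw [h]; simp
    · exact h.le⟩

theorem isOpen_openCell (x : Eu n) : IsOpen (openCell ℓ x) := by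
  have e : openCell ℓ x = (⋂ k, {y : Eu n | (⌊x k⌋ : ℝ) < y k ∧ y k < ⌊x k⌋ + 1}) ∩
      ⋂ i, ⋂ j, {y | ℓ i = ℓ j ∨ 0 < (SignType.sign (ℓ i x - ℓ j x) : ℝ) * (ℓ i y - ℓ j y)} := by
    ext y; simp [openCell]
  rw [e]
  refine IsOpen.inter (isOpen_iInter_of_finite fun k => ?_)
    (isOpen_iInter_of_finite fun i => isOpen_iInter_of_finite fun j => ?_)
  · have hc : Continuous fun y : Eu n => y k := by fun_prop
    exact (isOpen_lt continuous_const hc).inter (isOpen_lt hc continuous_const)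
  · by_cases h : ℓ i = ℓ j
    · simp [h]
    · simp only [h, false_or]
      exact isOpen_lt continuous_const (continuous_const.mul
        ((continuous_affineMap (ℓ i)).sub (continuous_affineMap (ℓ j))))

/-- The inequalities are weak at `y` and strict at the generic point `x`, hence strict on the
half-open segment. -/
theorem add_smul_mem_openCell {x y : Eu n} (hx : IsGeneric ℓ x) (hy : y ∈ cell ℓ x) {t : ℝ}
    (ht : 0 < t) (ht1 : t ≤ 1) : y + t • (x - y) ∈ openCell ℓ x := by
  have hxo := hx.mem_openCell
  refine ⟨fun k => ?_, fun i j => ?_⟩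
  · have e : (y + t • (x - y)) k = (1 - t) * y k + t * x k := by
      simp; ring
    rw [e]
    obtain ⟨h1, h2⟩ := hy.1 k
    obtain ⟨h3, h4⟩ := hxo.1 k
    simp only at h1 h2
    have a1 := mul_le_mul_of_nonneg_left h1 (sub_nonneg.2 ht1)
    have a2 := mul_le_mul_of_nonneg_left h2 (sub_nonneg.2 ht1)
    have a3 := mul_lt_mul_of_pos_left h3 ht
    have a4 := mul_lt_mul_of_pos_left h4 ht
    constructor <;> linarith
  · rcases hxo.2 i j with h | h
    · exact Or.inl h
    · refine Or.inr ?_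
      rw [affineMap_lineMap_eq, affineMap_lineMap_eq]
      have h2 := hy.2 i j
      simp only at h2
      have a1 := mul_nonneg (sub_nonneg.2 ht1) h2
      have a2 := mul_pos ht h
      have e : (SignType.sign (ℓ i x - ℓ j x) : ℝ) * (ℓ i y + t * (ℓ i x - ℓ i y) -
          (ℓ j y + t * (ℓ j x - ℓ j y))) =
          (1 - t) * ((SignType.sign (ℓ i x - ℓ j x) : ℝ) * (ℓ i y - ℓ j y)) +
          t * ((SignType.sign (ℓ i x - ℓ j x) : ℝ) * (ℓ i x - ℓ j x)) := by ring
      rw [e]; linarith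

theorem cell_subset_closure_openCell {x : Eu n} (hx : IsGeneric ℓ x) :
    cell ℓ x ⊆ closure (openCell ℓ x) := by
  intro y hy
  have hc : Continuous fun t : ℝ => y + t • (x - y) := by fun_prop
  have hlim : Tendsto (fun t : ℝ => y + t • (x - y)) (𝓝[>] 0) (𝓝 y) := by
    have := hc.tendsto 0
    simp only [zero_smul, add_zero] at this
    exact this.mono_left nhdsWithin_le_nhds
  refine mem_closure_of_tendsto hlim ?_
  filter_upwards [Ioc_mem_nhdsGT (zero_lt_one (α := ℝ))] with t ht
  exact add_smul_mem_openCell hx hy ht.1 ht.2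

theorem convex_openCell {x : Eu n} (hx : IsGeneric ℓ x) : Convex ℝ (openCell ℓ x) := by
  have hxo := hx.mem_openCell
  intro y hy z hz a b ha hb hab
  rcases eq_or_lt_of_le ha with rfl | ha
  · have : b = 1 := by linarith
    subst this; simpa using hz
  have e : a • y + b • z = y + b • (z - y) := by
    rw [show a = 1 - b by linarith, sub_smul, one_smul, smul_sub]; abel
  refine ⟨fun k => ?_, fun i j => ?_⟩
  · have e2 : (a • y + b • z) k = a * y k + b * z k := by simp
    rw [e2]
    have a1 := mul_lt_mul_of_pos_left (hy.1 k).1 ha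
    have a2 := mul_lt_mul_of_pos_left (hy.1 k).2 ha
    have a3 := mul_le_mul_of_nonneg_left (hz.1 k).1.le hb
    have a4 := mul_le_mul_of_nonneg_left (hz.1 k).2.le hb
    have e3 : (⌊x k⌋ : ℝ) = a * ⌊x k⌋ + b * ⌊x k⌋ := by rw [← add_mul, hab, one_mul]
    constructor
    · rw [e3]; linarith
    · calc a * y k + b * z k < a * (⌊x k⌋ + 1) + b * (⌊x k⌋ + 1) := by linarith
        _ = ⌊x k⌋ + 1 := by rw [← add_mul, hab, one_mul]
  · rcases hy.2 i j with h | h1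
    · exact Or.inl h
    rcases hz.2 i j with h | h2
    · exact Or.inl h
    refine Or.inr ?_
    rw [e, affineMap_lineMap_eq, affineMap_lineMap_eq]
    have a1 := mul_pos ha h1
    have a2 := mul_nonneg hb h2.le
    rw [show a = 1 - b by linarith] at a1
    linarith

/-- A generic point satisfies none of the equalities, so the weak inequalities of the cell determine
its integer parts and signs. -/
theorem cell_eq_of_mem {x w : Eu n} (hx : IsGeneric ℓ x) (hw : IsGeneric ℓ w)
    (h : w ∈ cell ℓ x) : cell ℓ w = cell ℓ x := by
  have h1 : (fun k => ⌊w k⌋) = fun k => ⌊x k⌋ := by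
    funext k
    obtain ⟨h1, h2⟩ := h.1 k
    simp only at h1 h2
    refine Int.floor_eq_iff.2 ⟨h1, lt_of_le_of_ne h2 fun he => hw.1 k ?_⟩
    rw [he]
    have : ((⌊x k⌋ : ℝ) + 1) = ((⌊x k⌋ + 1 : ℤ) : ℝ) := by push_cast; rfl
    rw [this, Int.floor_intCast]
  have h2 : (fun i j => SignType.sign (ℓ i w - ℓ j w)) =
      fun i j => SignType.sign (ℓ i x - ℓ j x) := by
    funext i j
    rcases hx.2 i j with h3 | h3
    · simp [h3]
    rcases hw.2 i j with h4 | h4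
    · simp [h4]
    have h5 := h.2 i j
    simp only at h5
    rcases lt_or_gt_of_ne (sub_ne_zero.2 h3) with h6 | h6
    · rw [sign_neg h6] at h5 ⊢
      refine sign_neg (lt_of_le_of_ne ?_ (sub_ne_zero.2 h4))
      simp at h5; linarith
    · rw [sign_pos h6] at h5 ⊢
      refine sign_pos (lt_of_le_of_ne ?_ (sub_ne_zero.2 h4).symm)
      simp at h5; linarith
  rw [cell, h1, h2, cell]

theorem isBounded_signCell (m : Fin n → ℤ) (s : Fin N → Fin N → SignType) :
    Bornology.IsBounded (signCell ℓ m s) := by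
  rw [isBounded_iff_forall_norm_le]
  obtain ⟨M, hM⟩ := (Set.finite_range fun k => |(m k : ℝ)|).bddAbove
  refine ⟨_, fun y hy => norm_le_of_abs_le (M := M + 1) fun k => ?_⟩
  have h1 := hM ⟨k, rfl⟩
  obtain ⟨h2, h3⟩ := hy.1 k
  rw [abs_le] at *
  constructor <;> linarith [h1.1, h1.2]

theorem isPolytope_cell {x : Eu n} (hx : IsGeneric ℓ x) : IsPolytope (cell ℓ x) := by
  refine ⟨?_, ⟨x, interior_maximal (openCell_subset_cell x) (isOpen_openCell x) hx.mem_openCell⟩⟩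
  obtain ⟨c, hc⟩ : ∃ c : Fin n → ℝ → Eu n →ᵃ[ℝ] ℝ, ∀ k t y, c k t y = y k - t :=
    ⟨fun k t => (exists_affineMap_coord k t).choose,
      fun k t => (exists_affineMap_coord k t).choose_spec⟩
  let a : (Fin n ⊕ Fin n) ⊕ (Fin N × Fin N) → Eu n →ᵃ[ℝ] ℝ := Sum.elim
    (Sum.elim (fun k => c k ⌊x k⌋) fun k => -c k (⌊x k⌋ + 1))
    fun p => (SignType.sign (ℓ p.1 x - ℓ p.2 x) : ℝ) • (ℓ p.1 - ℓ p.2)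
  have e : cell ℓ x = {y | ∀ i, 0 ≤ a i y} := by
    ext y
    constructor
    · rintro ⟨h1, h2⟩ ((k | k) | p)
      · have := (h1 k).1
        simp [a, hc] at *; linarith
      · have := (h1 k).2
        simp [a, hc] at *; linarith
      · exact h2 p.1 p.2
    · intro h
      refine ⟨fun k => ⟨?_, ?_⟩, fun i j => h (Sum.inr (i, j))⟩
      · have := h (Sum.inl (Sum.inl k))
        simp [a, hc] at *; linarith
      · have := h (Sum.inl (Sum.inr k))
        simp [a, hc] at *; linarith
  rw [e]
  exact exists_finset_convexHull_eq a (e ▸ isBounded_signCell _ _)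

theorem ae_isGeneric : ∀ᵐ x : Eu n, IsGeneric ℓ x := by
  have h1 : ∀ᵐ x : Eu n, ∀ (k : Fin n) (m : ℤ), x k ≠ m :=
    ae_all_iff.2 fun k => ae_all_iff.2 fun m =>
      measure_eq_zero_iff_ae_notMem.1 (volume_coord_eq k m)
  have h2 : ∀ᵐ x : Eu n, ∀ i j, ℓ i = ℓ j ∨ ℓ i x ≠ ℓ j x := by
    refine ae_all_iff.2 fun i => ae_all_iff.2 fun j => ?_
    by_cases h : ℓ i = ℓ j
    · simp [h]
    have hex : ∃ x, (ℓ i - ℓ j) x ≠ 0 := by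
      by_contra! hall
      exact h (AffineMap.ext fun x => sub_eq_zero.1 (hall x))
    filter_upwards [measure_eq_zero_iff_ae_notMem.1 (volume_affineMap_eq_zero hex)] with x hx
    refine Or.inr fun he => hx ?_
    exact sub_eq_zero.2 he
  filter_upwards [h1, h2] with x h3 h4
  exact ⟨fun k hk => h3 k _ hk.symm, h4⟩

theorem finite_cells_inter_ball (x : Eu n) (r : ℝ) :
    {P ∈ cell ℓ '' {x | IsGeneric ℓ x} | (P ∩ Metric.ball x r).Nonempty}.Finite := by
  set R := ‖x‖ + r with hR
  have hfin : ((Set.Icc (fun _ : Fin n => ⌊-R - 1⌋) fun _ => ⌈R⌉) ×ˢ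
      (Set.univ : Set (Fin N → Fin N → SignType))).Finite :=
    (Set.finite_Icc _ _).prod Set.finite_univ
  refine (hfin.image fun p => signCell ℓ p.1 p.2).subset ?_
  rintro _ ⟨⟨z, hz, rfl⟩, y, hy, hyb⟩
  refine ⟨(fun k => ⌊z k⌋, fun i j => SignType.sign (ℓ i z - ℓ j z)), ⟨?_, Set.mem_univ _⟩, rfl⟩
  have hyR : ∀ k, |y k| ≤ R := by
    intro k
    have h1 := PiLp.norm_apply_le y k
    have h2 := norm_le_norm_add_norm_sub' y x
    rw [Metric.mem_ball, dist_eq_norm] at hyb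
    rw [Real.norm_eq_abs] at h1
    linarith
  constructor
  · intro k
    have h1 := (hy.1 k).2
    have h2 := (abs_le.1 (hyR k)).1
    simp only at h1
    have h3 := Int.floor_le (-R - 1)
    have : (⌊-R - 1⌋ : ℝ) ≤ ⌊z k⌋ := by linarith
    exact_mod_cast this
  · intro k
    have h1 := (hy.1 k).1
    have h2 := (abs_le.1 (hyR k)).2
    simp only at h1
    have h3 := Int.le_ceil R
    have : (⌊z k⌋ : ℝ) ≤ ⌈R⌉ := by linarith
    exact_mod_cast this

theorem isPolytopalDecomposition_cells :
    IsPolytopalDecomposition (cell ℓ '' {x | IsGeneric ℓ x}) where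
  isPolytope := by
    rintro _ ⟨x, hx, rfl⟩; exact isPolytope_cell hx
  covers := by
    refine Set.eq_univ_of_forall fun y => ?_
    set S := {P ∈ cell ℓ '' {x | IsGeneric ℓ x} | (P ∩ Metric.ball y 1).Nonempty} with hS
    have hfin : S.Finite := finite_cells_inter_ball y 1
    have hcl : IsClosed (⋃ P ∈ S, P) := hfin.isClosed_biUnion fun P hP => by
      obtain ⟨⟨x, hx, rfl⟩, -⟩ := hP
      exact (isPolytope_cell hx).isCompact.isClosed
    have hdense : Dense {x : Eu n | IsGeneric ℓ x} := Measure.dense_of_ae ae_isGeneric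
    have hy : y ∈ closure (Metric.ball y 1 ∩ {x : Eu n | IsGeneric ℓ x}) :=
      hdense.open_subset_closure_inter Metric.isOpen_ball (Metric.mem_ball_self one_pos)
    -- Generic points have full measure, so they are dense; near `y` their cells are finitely many
    -- closed sets, whose union therefore contains `y`.
    have hsub : Metric.ball y 1 ∩ {x : Eu n | IsGeneric ℓ x} ⊆ ⋃ P ∈ S, P := by
      rintro x ⟨hxb, hx⟩
      have hx' := openCell_subset_cell x (IsGeneric.mem_openCell hx)
      exact Set.mem_iUnion₂.2 ⟨cell ℓ x, ⟨⟨x, hx, rfl⟩, x, hx', hxb⟩, hx'⟩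
    obtain ⟨P, hP, hyP⟩ := Set.mem_iUnion₂.1 (closure_minimal hsub hcl hy)
    exact ⟨P, hP.1, hyP⟩
  inter_subset := by
    have key : ∀ x x' z : Eu n, IsGeneric ℓ x → IsGeneric ℓ x' → cell ℓ x ≠ cell ℓ x' →
        z ∈ cell ℓ x → z ∈ cell ℓ x' → z ∈ frontier (cell ℓ x) := by
      intro x x' z hx hx' hne hz hz'
      refine ⟨subset_closure hz, fun hi => hne ?_⟩
      -- If `z` were interior to the first cell, generic points of the second one near `z` would lie
      -- in it, and the two cells would coincide.
      obtain ⟨w, hwi, hwo⟩ := mem_closure_iff.1 (cell_subset_closure_openCell hx' hz') _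
        isOpen_interior hi
      have hw := isGeneric_of_mem_openCell hwo
      rw [← cell_eq_of_mem hx hw (interior_subset hwi),
        ← cell_eq_of_mem hx' hw (openCell_subset_cell x' hwo)]
    rintro _ ⟨x, hx, rfl⟩ _ ⟨x', hx', rfl⟩ hne z ⟨hz, hz'⟩
    exact ⟨key x x' z hx hx' hne hz hz', key x' x z hx' hx hne.symm hz' hz⟩
  locallyFinite := finite_cells_inter_ball

/-- A continuous function which takes at each point the value of one of finitely many affine
functions is CPWL. -/
theorem isCPWL_of_selection {g : Eu n → ℝ} (hg : Continuous g)
    (h : ∀ x, ∃ i, g x = ℓ i x) (Ω : Set (Eu n)) : IsCPWL Ω g := by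
  refine ⟨hg.continuousOn, _, isPolytopalDecomposition_cells (ℓ := ℓ), ?_⟩
  rintro _ ⟨x, hx, rfl⟩
  obtain ⟨i, hi⟩ := h x
  -- Distinct affine functions of the family never agree on an open cell, so there the set where `g
  -- = ℓ i` is both open and closed; by connectedness `g` cannot change its selection.
  set U := openCell ℓ x ∩ {y | ∀ j, ℓ j ≠ ℓ i → g y ≠ ℓ j y} with hU
  have hUo : IsOpen U := by
    refine (isOpen_openCell x).inter ?_
    have e : {y | ∀ j, ℓ j ≠ ℓ i → g y ≠ ℓ j y} = ⋂ j, {y | ℓ j ≠ ℓ i → g y ≠ ℓ j y} := by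
      ext y; simp
    rw [e]
    refine isOpen_iInter_of_finite fun j => ?_
    by_cases hj : ℓ j = ℓ i
    · simp [hj]
    · simp only [ne_eq, hj, not_false_eq_true, forall_const]
      exact (isClosed_eq hg (continuous_affineMap (ℓ j))).isOpen_compl
  have hUi : ∀ y ∈ U, g y = ℓ i y := by
    intro y hy
    obtain ⟨j, hj⟩ := h y
    by_cases hji : ℓ j = ℓ i
    · rw [hj, hji]
    · exact (hy.2 j hji hj).elim
  have hmem : ∀ y ∈ openCell ℓ x, g y = ℓ i y → y ∈ U := by
    intro y hy hyi
    refine ⟨hy, fun j hj he => ?_⟩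
    exact ((isGeneric_of_mem_openCell hy).2 j i).elim hj fun hne => hne (he.symm.trans hyi)
  have hsub : openCell ℓ x ⊆ U := by
    refine (convex_openCell hx).isPreconnected.subset_left_of_subset_union hUo
      (isClosed_eq hg (continuous_affineMap (ℓ i))).isOpen_compl ?_ ?_ ?_
    · rw [Set.disjoint_left]
      exact fun y hy hy' => hy' (hUi y hy)
    · intro y hy
      by_cases hyi : g y = ℓ i y
      · exact Or.inl (hmem y hy hyi)
      · exact Or.inr hyi
    · have hxo := IsGeneric.mem_openCell hx
      exact ⟨x, hxo, hmem x hxo hi⟩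
  refine ⟨ℓ i, fun y hy => ?_⟩
  have hcl : IsClosed {y | g y = ℓ i y} := isClosed_eq hg (continuous_affineMap (ℓ i))
  exact closure_minimal (fun z hz => hUi z (hsub hz)) hcl (cell_subset_closure_openCell hx hy.1)

end Arrangement

/-! ### Variation of a maximum of differences of convex functions. -/

section Gluing
variable {n : ℕ} {κ : Type*} [Fintype κ]

theorem convexOn_of_selection {ι : Type*} {u : Eu n → ℝ} {v : ι → Eu n → ℝ}
    (hv : ∀ k, ConvexOn ℝ Set.univ (v k)) (hle : ∀ k x, v k x ≤ u x) (hex : ∀ x, ∃ k, u x = v k x) :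
    ConvexOn ℝ Set.univ u := by
  refine ⟨convex_univ, fun x _ y _ a b ha hb hab => ?_⟩
  obtain ⟨k, hk⟩ := hex (a • x + b • y)
  rw [hk]
  refine ((hv k).2 (Set.mem_univ x) (Set.mem_univ y) ha hb hab).trans ?_
  simp only [smul_eq_mul]
  exact add_le_add (mul_le_mul_of_nonneg_left (hle k x) ha) (mul_le_mul_of_nonneg_left (hle k y) hb)

theorem convexOn_sum {ι : Type*} (s : Finset ι) {v : ι → Eu n → ℝ}
    (hv : ∀ k ∈ s, ConvexOn ℝ Set.univ (v k)) : ConvexOn ℝ Set.univ fun x => ∑ k ∈ s, v k x := by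
  refine ⟨convex_univ, fun x _ y _ a b ha hb hab => ?_⟩
  simp only [smul_eq_mul, Finset.mul_sum, ← Finset.sum_add_distrib]
  exact Finset.sum_le_sum fun k hk => (hv k hk).2 (Set.mem_univ x) (Set.mem_univ y) ha hb hab

/-- `Δψ`, written as the second divergence of `ψ I`. -/
def hdivOne (ψ : Eu n → ℝ) : Eu n → ℝ := hdiv fun x => ψ x • (1 : Matrix (Fin n) (Fin n) ℝ)

/-- The variation of a maximum of differences of convex functions is controlled by a partition of
unity whose members `ψ k` are supported where the `k`-th difference is maximal. -/
theorem htv_le_of_convex_split {A : Set (Eu n)} {a b : κ → Eu n → ℝ} {g : Eu n → ℝ}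
    (hac : ∀ k, Continuous (a k)) (hbc : ∀ k, Continuous (b k)) (hgc : Continuous g)
    (ha : ∀ k, ConvexOn ℝ Set.univ (a k)) (hb : ∀ k, ConvexOn ℝ Set.univ (b k))
    (hle : ∀ k x, a k x - b k x ≤ g x) (hex : ∀ x, ∃ k, g x = a k x - b k x)
    {ψ : κ → Eu n → ℝ} {χ : Eu n → ℝ} (hψ : ∀ k, ContDiff ℝ ∞ (ψ k))
    (hψc : ∀ k, HasCompactSupport (ψ k)) (hψ0 : ∀ k x, 0 ≤ ψ k x) (hχ : ContDiff ℝ ∞ χ)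
    (hχc : HasCompactSupport χ) (hχ0 : ∀ x, 0 ≤ χ x) (hone : ∀ x ∈ A, ∑ k, ψ k x + χ x = 1)
    (hmax : ∀ k, ∀ x ∈ tsupport (ψ k), g x = a k x - b k x) :
    htv 1 g A ≤ ENNReal.ofReal ((∫ x, g x * hdivOne (fun x => ∑ k, ψ k x + χ x) x) +
      2 * ∑ k, (∫ x, b k x * hdivOne (ψ k) x) + 2 * ∫ x, (∑ k, b k x) * hdivOne χ x) := by
  refine htv_le_of_forall fun F hF h1 => ENNReal.ofReal_le_ofReal ?_
  have s1 : ∀ k, IsSmoothField Set.univ fun x => ψ k x • (1 : Matrix (Fin n) (Fin n) ℝ) := fun k =>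
    isSmoothField_smul_one (hψ k) (hψc k) (Set.subset_univ _)
  have s2 : IsSmoothField Set.univ fun x => χ x • (1 : Matrix (Fin n) (Fin n) ℝ) :=
    isSmoothField_smul_one hχ hχc (Set.subset_univ _)
  have f1 : ∀ k, IsSmoothField Set.univ fun x => ψ k x • F x := fun k =>
    .of_tsupport (hψ k) (hψc k) (Set.subset_univ _) hF.1
  have f2 : IsSmoothField Set.univ fun x => χ x • F x :=
    .of_tsupport hχ hχc (Set.subset_univ _) hF.1
  have cont : ∀ {u : Eu n → ℝ} {G : Eu n → Matrix (Fin n) (Fin n) ℝ}, Continuous u →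
      IsSmoothField Set.univ G → Integrable fun x => u x * hdiv G x := fun hu hG =>
    (hu.mul hG.continuous_hdiv).integrable_of_hasCompactSupport hG.hasCompactSupport_hdiv.mul_left
  have hBc : Continuous fun x => ∑ k, b k x := continuous_finsetSum _ fun k _ => hbc k
  have hgB : Continuous fun x => g x + ∑ k, b k x := hgc.add hBc
  have hBconv : ConvexOn ℝ Set.univ fun x => ∑ k, b k x := convexOn_sum _ fun k _ => hb k
  -- Adding all the `b j` turns each competitor into `a k` plus the remaining `b j`, which is
  -- convex. So `g` is a difference of convex functions also where the maximum switches.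
  have hgBconv : ConvexOn ℝ Set.univ fun x => g x + ∑ k, b k x := by
    classical
    have e : ∀ k x, ∑ j, b j x = b k x + ∑ j ∈ Finset.univ.erase k, b j x := fun k x =>
      (Finset.add_sum_erase _ (fun j => b j x) (Finset.mem_univ k)).symm
    refine convexOn_of_selection (v := fun k x => a k x + ∑ j ∈ Finset.univ.erase k, b j x)
      (fun k => (ha k).add (convexOn_sum _ fun j _ => hb j)) (fun k x => ?_) fun x => ?_
    · rw [e k x]; linarith [hle k x]
    · obtain ⟨k, hk⟩ := hex x
      refine ⟨k, ?_⟩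
      rw [e k x, hk]; ring
  have neg : ∀ x, OpLeOne (-F x) := fun x => (h1 x).neg
  have hFn : ∀ i j, ContDiff ℝ ∞ fun x => (-F x) i j := fun i j => (hF.1 i j).neg
  have hdneg : ∀ {φ : Eu n → ℝ}, IsSmoothField Set.univ (fun x => φ x • F x) → ∀ x,
      hdiv (fun x => φ x • -F x) x = -hdiv (fun x => φ x • F x) x := by
    intro φ hφ x
    have := congrFun (hφ.hdiv_smul (-1)) x
    rw [neg_one_mul] at this
    rw [← this]
    congr 1
    ext y i j
    simp
  have twosided : ∀ {u φ : Eu n → ℝ}, Continuous u → ConvexOn ℝ Set.univ u → ContDiff ℝ ∞ φ →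
      HasCompactSupport φ → (∀ x, 0 ≤ φ x) →
      (∫ x, u x * hdiv (fun x => φ x • F x) x ≤ ∫ x, u x * hdivOne φ x) ∧
      -(∫ x, u x * hdiv (fun x => φ x • F x) x) ≤ ∫ x, u x * hdivOne φ x := by
    intro u φ hu huc hφ hφc hφ0
    refine ⟨integral_convex_mul_hdiv_le hu huc hφ hφc hφ0 hF.1 h1, ?_⟩
    have := integral_convex_mul_hdiv_le hu huc hφ hφc hφ0 hFn neg
    refine le_of_eq_of_le ?_ this
    rw [← integral_neg]
    refine integral_congr_ae (Eventually.of_forall fun x => ?_)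
    simp only
    rw [hdneg (.of_tsupport hφ hφc (Set.subset_univ _) hF.1)]
    ring
  have hdec : ∀ x, hdiv F x = ∑ k, hdiv (fun x => ψ k x • F x) x + hdiv (fun x => χ x • F x) x := by
    have e : F = (∑ k, fun x => ψ k x • F x) + fun x => χ x • F x := by
      funext x
      rw [Pi.add_apply, Finset.sum_apply, ← Finset.sum_smul, ← add_smul]
      by_cases hx : x ∈ A
      · rw [hone x hx, one_smul]
      · have : F x = 0 := by
          ext i j
          exact image_eq_zero_of_notMem_tsupport (f := fun x => F x i j)
            fun hx' => hx (hF.3 i j hx')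
        rw [this, smul_zero]
    intro x
    conv_lhs => rw [e]
    rw [IsSmoothField.hdiv_add (.sum _ fun k _ => f1 k) f2, IsSmoothField.hdiv_sum _ fun k _ => f1 k]
  have hdec1 : ∀ x, hdivOne (fun x => ∑ k, ψ k x + χ x) x =
      ∑ k, hdivOne (ψ k) x + hdivOne χ x := by
    have e : (fun x => (∑ k, ψ k x + χ x) • (1 : Matrix (Fin n) (Fin n) ℝ)) =
        (∑ k, fun x => ψ k x • (1 : Matrix (Fin n) (Fin n) ℝ)) + fun x => χ x • 1 := by
      funext x
      rw [Pi.add_apply, Finset.sum_apply, ← Finset.sum_smul, ← add_smul]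
    intro x
    rw [hdivOne, e, IsSmoothField.hdiv_add (.sum _ fun k _ => s1 k) s2,
      IsSmoothField.hdiv_sum _ fun k _ => s1 k]
    rfl
  have hloc : ∀ k (G : Eu n → Matrix (Fin n) (Fin n) ℝ), IsSmoothField Set.univ (fun x => ψ k x • G x) →
      ∫ x, g x * hdiv (fun x => ψ k x • G x) x =
        (∫ x, a k x * hdiv (fun x => ψ k x • G x) x) -
          ∫ x, b k x * hdiv (fun x => ψ k x • G x) x := by
    intro k G hG
    rw [← integral_sub (cont (hac k) hG) (cont (hbc k) hG)]
    refine integral_congr_ae (Eventually.of_forall fun x => ?_)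
    simp only
    by_cases hx : x ∈ tsupport (ψ k)
    · rw [hmax k x hx]; ring
    · have h0 : hdiv (fun x => ψ k x • G x) x = 0 := by
        refine image_eq_zero_of_notMem_tsupport fun hx' => hx ?_
        have hsf : IsSmoothField (tsupport (ψ k)) fun x => ψ k x • G x :=
          ⟨hG.1, hG.2, fun i j => tsupport_mul_subset_left (f := ψ k) (g := fun x => G x i j)⟩
        exact hsf.tsupport_hdiv_subset hx'
      rw [h0]; ring
  have lhs : ∫ x, g x * hdiv F x = ∑ k, (∫ x, g x * hdiv (fun x => ψ k x • F x) x) +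
      ∫ x, g x * hdiv (fun x => χ x • F x) x := by
    rw [← integral_finsetSum _ fun k _ => cont hgc (f1 k)]
    rw [← integral_add (integrable_finsetSum _ fun k _ => cont hgc (f1 k)) (cont hgc f2)]
    refine integral_congr_ae (Eventually.of_forall fun x => ?_)
    simp only
    rw [hdec, mul_add, Finset.mul_sum]
  have rhs : ∫ x, g x * hdivOne (fun x => ∑ k, ψ k x + χ x) x =
      ∑ k, (∫ x, g x * hdivOne (ψ k) x) + ∫ x, g x * hdivOne χ x := by
    have i1 : ∀ k, Integrable fun x => g x * hdivOne (ψ k) x := fun k => cont hgc (s1 k)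
    have i2 : Integrable fun x => g x * hdivOne χ x := cont hgc s2
    rw [← integral_finsetSum _ fun k _ => i1 k,
      ← integral_add (integrable_finsetSum _ fun k _ => i1 k) i2]
    refine integral_congr_ae (Eventually.of_forall fun x => ?_)
    simp only
    rw [hdec1, mul_add, Finset.mul_sum]
  rw [lhs, rhs]
  -- On the support of `ψ k` one has `g = a k - b k`, so the pairing is at most that of `a k + b k =
  -- g + 2 b k` with the Laplacian of `ψ k`.
  have c1 : ∀ k, ∫ x, g x * hdiv (fun x => ψ k x • F x) x ≤
      (∫ x, g x * hdivOne (ψ k) x) + 2 * ∫ x, b k x * hdivOne (ψ k) x := by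
    intro k
    have t1 := (twosided (hac k) (ha k) (hψ k) (hψc k) (hψ0 k)).1
    have t2 := (twosided (hbc k) (hb k) (hψ k) (hψc k) (hψ0 k)).2
    have t3 := hloc k F (f1 k)
    have t4 : ∫ x, g x * hdivOne (ψ k) x =
      (∫ x, a k x * hdivOne (ψ k) x) - ∫ x, b k x * hdivOne (ψ k) x := hloc k (fun _ => 1) (s1 k)
    linarith
  -- The same bound from the cruder splitting into `g + ∑ b` and `∑ b`; it is affordable because `χ`
  -- will be small in `L¹`.
  have c2 : ∫ x, g x * hdiv (fun x => χ x • F x) x ≤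
      (∫ x, g x * hdivOne χ x) + 2 * ∫ x, (∑ k, b k x) * hdivOne χ x := by
    have t1 := (twosided hgB hgBconv hχ hχc hχ0).1
    have t2 := (twosided hBc hBconv hχ hχc hχ0).2
    have e1 : ∫ x, (g x + ∑ k, b k x) * hdiv (fun x => χ x • F x) x =
        (∫ x, g x * hdiv (fun x => χ x • F x) x) +
          ∫ x, (∑ k, b k x) * hdiv (fun x => χ x • F x) x := by
      rw [← integral_add (cont hgc f2) (cont hBc f2)]
      simp only [add_mul]
    have e2 : ∫ x, (g x + ∑ k, b k x) * hdivOne χ x =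
        (∫ x, g x * hdivOne χ x) + ∫ x, (∑ k, b k x) * hdivOne χ x := by
      have i1 : Integrable fun x => g x * hdivOne χ x := cont hgc s2
      have i2 : Integrable fun x => (∑ k, b k x) * hdivOne χ x := cont hBc s2
      rw [← integral_add i1 i2]
      simp only [add_mul]
    linarith
  have c3 := Finset.sum_le_sum fun k (_ : k ∈ Finset.univ) => c1 k
  rw [Finset.sum_add_distrib, ← Finset.mul_sum] at c3
  linarith

end Gluing

/-! ### The penalty, and the local convex splitting of a smooth function. -/

section Penalty
variable {n : ℕ}

/-- The squared distance to `c`. -/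
def sqDist (c x : Eu n) : ℝ := ∑ k, (x k - c k) * (x k - c k)

/-- The penalty `σ |x - c|² / 2 + L |x - c|⁴`. -/
def pen (σ L : ℝ) (c x : Eu n) : ℝ := σ / 2 * sqDist c x + L * (sqDist c x * sqDist c x)

/-- The quadratic form `⟨x, b x⟩ / 2`. -/
def quadHalf (b : Matrix (Fin n) (Fin n) ℝ) (x : Eu n) : ℝ := ∑ k, ∑ l, 1 / 2 * b k l * (x k * x l)

theorem sqDist_nonneg (c x : Eu n) : 0 ≤ sqDist c x :=
  Finset.sum_nonneg fun _ _ => mul_self_nonneg _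

theorem contDiff_sub_coord (c : ℝ) (k : Fin n) : ContDiff ℝ ∞ fun x : Eu n => x k - c :=
  (contDiff_coord k).sub contDiff_const

theorem partialDeriv_sub_coord (i k : Fin n) (c : ℝ) :
    partialDeriv i (fun x : Eu n => x k - c) = fun _ => if i = k then 1 else 0 := by
  simp only [sub_eq_add_neg]
  rw [partialDeriv_add i ((contDiff_coord k).differentiable (by simp)) (differentiable_const _),
    partialDeriv_coord, partialDeriv_const]
  simp

theorem contDiff_sqDist (c : Eu n) : ContDiff ℝ ∞ (sqDist c) :=
  ContDiff.sum fun k _ => (contDiff_sub_coord (c k) k).mul (contDiff_sub_coord (c k) k)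

theorem partialDeriv_sqDist (i : Fin n) (c : Eu n) :
    partialDeriv i (sqDist c) = fun x => 2 * (x i - c i) := by
  have hd : ∀ k, Differentiable ℝ fun x : Eu n => x k - c k := fun k =>
    (contDiff_sub_coord (c k) k).differentiable (by simp)
  have e : sqDist c = fun x => ∑ k, (x k - c k) * (x k - c k) := rfl
  rw [e, partialDeriv_sum i _ fun k _ => (hd k).fun_mul (hd k)]
  funext x
  simp only [partialDeriv_mul i (hd _) (hd _), partialDeriv_sub_coord]
  rw [Finset.sum_eq_single i]
  · simp; ring
  · intro k _ hk; simp [hk.symm]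
  · simp

theorem contDiff_pen (σ L : ℝ) (c : Eu n) : ContDiff ℝ ∞ (pen σ L c) :=
  (contDiff_const.mul (contDiff_sqDist c)).add
    (contDiff_const.mul ((contDiff_sqDist c).mul (contDiff_sqDist c)))

theorem partialDeriv_pen (i : Fin n) (σ L : ℝ) (c : Eu n) :
    partialDeriv i (pen σ L c) = fun x => (σ + 4 * L * sqDist c x) * (x i - c i) := by
  have hd : Differentiable ℝ (sqDist c) := (contDiff_sqDist c).differentiable (by simp)
  have e : pen σ L c = fun x => σ / 2 * sqDist c x + L * (sqDist c x * sqDist c x) := rfl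
  rw [e, partialDeriv_add i (hd.const_mul _) ((hd.fun_mul hd).const_mul _),
    partialDeriv_const_mul i hd, partialDeriv_const_mul i (hd.fun_mul hd), partialDeriv_mul i hd hd,
    partialDeriv_sqDist]
  funext x
  ring

theorem partialDeriv_two_pen (i j : Fin n) (σ L : ℝ) (c x : Eu n) :
    partialDeriv j (partialDeriv i (pen σ L c)) x =
      8 * L * ((x i - c i) * (x j - c j)) + (σ + 4 * L * sqDist c x) * if j = i then 1 else 0 := by
  have hd : Differentiable ℝ (sqDist c) := (contDiff_sqDist c).differentiable (by simp)
  have hd2 : Differentiable ℝ fun x => σ + 4 * L * sqDist c x := (hd.const_mul _).const_add _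
  have hdi : Differentiable ℝ fun x : Eu n => x i - c i :=
    (contDiff_sub_coord (c i) i).differentiable (by simp)
  rw [partialDeriv_pen, partialDeriv_mul j hd2 hdi,
    partialDeriv_add j (differentiable_const _) (hd.const_mul _), partialDeriv_const_mul j hd,
    partialDeriv_sqDist, partialDeriv_sub_coord, partialDeriv_const]
  simp only [Pi.zero_apply]
  ring

theorem contDiff_quadHalf (b : Matrix (Fin n) (Fin n) ℝ) : ContDiff ℝ ∞ (quadHalf b) :=
  ContDiff.sum fun k _ => ContDiff.sum fun l _ =>
    contDiff_const.mul ((contDiff_coord k).mul (contDiff_coord l))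

theorem partialDeriv_two_quadHalf {b : Matrix (Fin n) (Fin n) ℝ} (hb : ∀ i j, b i j = b j i)
    (i j : Fin n) (x : Eu n) : partialDeriv j (partialDeriv i (quadHalf b)) x = b i j := by
  have hd : ∀ k, Differentiable ℝ fun x : Eu n => x k := fun k =>
    (contDiff_coord k).differentiable (by simp)
  have e1 : partialDeriv i (quadHalf b) = fun x => ∑ l, b i l * x l := by
    have e : quadHalf b = fun x => ∑ k, ∑ l, 1 / 2 * b k l * (x k * x l) := rfl
    rw [e, partialDeriv_sum i _ fun k _ => Differentiable.fun_sum fun l _ =>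
      ((hd k).fun_mul (hd l)).const_mul _]
    funext x
    have e2 : ∀ k, partialDeriv i (fun x : Eu n => ∑ l, 1 / 2 * b k l * (x k * x l)) x =
        ∑ l, 1 / 2 * b k l * ((if i = k then 1 else 0) * x l + x k * if i = l then 1 else 0) := by
      intro k
      rw [partialDeriv_sum i _ fun l _ => ((hd k).fun_mul (hd l)).const_mul _]
      refine Finset.sum_congr rfl fun l _ => ?_
      rw [partialDeriv_const_mul i ((hd k).fun_mul (hd l)), partialDeriv_mul i (hd k) (hd l),
        partialDeriv_coord, partialDeriv_coord]
    simp only [e2, mul_add, Finset.sum_add_distrib]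
    have e3 : ∑ k, ∑ l, 1 / 2 * b k l * ((if i = k then 1 else 0) * x l) =
        ∑ l, 1 / 2 * b i l * x l := by
      rw [Finset.sum_eq_single i]
      · simp
      · intro k _ hk; simp [hk.symm]
      · simp
    have e4 : ∑ k, ∑ l, 1 / 2 * b k l * (x k * if i = l then 1 else 0) =
        ∑ l, 1 / 2 * b i l * x l := by
      refine Finset.sum_congr rfl fun k _ => ?_
      rw [Finset.sum_eq_single i]
      · rw [hb k i]; simp
      · intro l _ hl; simp [hl.symm]
      · simp
    rw [e3, e4, ← Finset.sum_add_distrib]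
    exact Finset.sum_congr rfl fun l _ => by ring
  rw [e1, partialDeriv_sum j _ fun l _ => (hd l).const_mul _]
  simp only [partialDeriv_const_mul j (hd _), partialDeriv_coord]
  simp

theorem partialDeriv_two_add {u w : Eu n → ℝ} (hu : ContDiff ℝ ∞ u) (hw : ContDiff ℝ ∞ w)
    (i j : Fin n) (x : Eu n) : partialDeriv j (partialDeriv i fun x => u x + w x) x =
      partialDeriv j (partialDeriv i u) x + partialDeriv j (partialDeriv i w) x := by
  rw [partialDeriv_add i (hu.differentiable (by simp)) (hw.differentiable (by simp)),
    partialDeriv_add j ((partialDeriv_contDiff i hu).differentiable (by simp))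
      ((partialDeriv_contDiff i hw).differentiable (by simp))]

theorem hessForm_add {u w : Eu n → ℝ} (hu : ContDiff ℝ ∞ u) (hw : ContDiff ℝ ∞ w) (x v : Eu n) :
    hessForm (fun x => u x + w x) x v = hessForm u x v + hessForm w x v := by
  simp only [hessForm, partialDeriv_two_add hu hw, mul_add, Finset.sum_add_distrib]

theorem lap_add {u w : Eu n → ℝ} (hu : ContDiff ℝ ∞ u) (hw : ContDiff ℝ ∞ w) (x : Eu n) :
    lap (fun x => u x + w x) x = lap u x + lap w x := by
  simp only [lap, partialDeriv_two_add hu hw, Finset.sum_add_distrib]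

theorem hessForm_pen (σ L : ℝ) (c x v : Eu n) :
    hessForm (pen σ L c) x v = 8 * L * (∑ i, v i * (x i - c i)) ^ 2 +
      (σ + 4 * L * sqDist c x) * ∑ i, v i ^ 2 := by
  have h : ∀ i, ∑ j, v i * v j * (8 * L * ((x i - c i) * (x j - c j)) +
      (σ + 4 * L * sqDist c x) * if j = i then 1 else 0) =
      8 * L * (v i * (x i - c i)) * (∑ j, v j * (x j - c j)) +
        (σ + 4 * L * sqDist c x) * v i ^ 2 := by
    intro i
    simp only [mul_add, Finset.sum_add_distrib]
    congr 1
    · rw [Finset.mul_sum]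
      exact Finset.sum_congr rfl fun j _ => by ring
    · simp; ring
  simp only [hessForm, partialDeriv_two_pen, h]
  rw [Finset.sum_add_distrib, ← Finset.sum_mul, ← Finset.mul_sum, ← Finset.mul_sum]
  ring

theorem lap_pen (σ L : ℝ) (c x : Eu n) :
    lap (pen σ L c) x = n * σ + (4 * n + 8) * L * sqDist c x := by
  simp only [lap, partialDeriv_two_pen]
  rw [Finset.sum_add_distrib, ← Finset.mul_sum]
  have : ∑ i, (x i - c i) * (x i - c i) = sqDist c x := rfl
  rw [this]
  simp
  ring

theorem hessForm_quadHalf {b : Matrix (Fin n) (Fin n) ℝ} (hb : ∀ i j, b i j = b j i) (x v : Eu n) :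
    hessForm (quadHalf b) x v = ∑ i, ∑ j, v i * v j * b i j := by
  simp only [hessForm, partialDeriv_two_quadHalf hb]

theorem lap_quadHalf {b : Matrix (Fin n) (Fin n) ℝ} (hb : ∀ i j, b i j = b j i) (x : Eu n) :
    lap (quadHalf b) x = ∑ i, b i i := by
  simp only [lap, partialDeriv_two_quadHalf hb]

theorem abs_form_le {e : Fin n → Fin n → ℝ} {η : ℝ} (h : ∀ i j, |e i j| ≤ η) (v : Eu n) :
    |∑ i, ∑ j, v i * v j * e i j| ≤ n * η * ∑ i, v i ^ 2 := by
  have h1 : |∑ i, ∑ j, v i * v j * e i j| ≤ ∑ i, ∑ j, |v i| * |v j| * η := by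
    refine (Finset.abs_sum_le_sum_abs _ _).trans (Finset.sum_le_sum fun i _ =>
      (Finset.abs_sum_le_sum_abs _ _).trans (Finset.sum_le_sum fun j _ => ?_))
    rw [abs_mul, abs_mul]
    exact mul_le_mul_of_nonneg_left (h i j) (by positivity)
  have h2 : ∑ i, ∑ j, |v i| * |v j| * η = (∑ i, |v i|) ^ 2 * η := by
    rw [sq, Finset.sum_mul_sum, Finset.sum_mul]
    exact Finset.sum_congr rfl fun i _ => by rw [Finset.sum_mul]
  have h3 : (∑ i, |v i|) ^ 2 ≤ n * ∑ i, v i ^ 2 := by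
    have := sq_sum_le_card_mul_sum_sq (s := (Finset.univ : Finset (Fin n))) (f := fun i => |v i|)
    simpa using this
  rcases isEmpty_or_nonempty (Fin n) with he | ⟨⟨i⟩⟩
  · simp
  have hη : 0 ≤ η := (abs_nonneg _).trans (h i i)
  calc _ ≤ (∑ i, |v i|) ^ 2 * η := h1.trans_eq h2
    _ ≤ (n * ∑ i, v i ^ 2) * η := by gcongr
    _ = _ := by ring

/-- Locally uniform splitting of a smooth function, minus a steep penalty, as a difference of convex
functions, with nearly optimal Laplacians near the centre. -/
theorem exists_convex_split {f : Eu n → ℝ} (hf : ContDiff ℝ ∞ f) (hfc : HasCompactSupport f)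
    {σ : ℝ} (hσ : 0 < σ) : ∃ L ρ : ℝ, 0 ≤ L ∧ 0 < ρ ∧ ∀ c : Eu n,
      ∃ (B : Eu n → ℝ) (E : Matrix (Fin n) (Fin n) ℝ), ContDiff ℝ ∞ B ∧ ConvexOn ℝ Set.univ B ∧
        ConvexOn ℝ Set.univ (fun x => f x - pen σ L c x + B x) ∧ OpLeOne E ∧
        ∀ x ∈ supBall c ρ, lap f x + 2 * lap B x ≤
          (∑ i, ∑ j, partialDeriv j (partialDeriv i f) x * E i j) + (22 * n + 33) * σ := by
  set H : Fin n → Fin n → Eu n → ℝ := fun i j => partialDeriv j (partialDeriv i f) with hH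
  have hHc : ∀ i j, Continuous (H i j) := fun i j =>
    (partialDeriv_contDiff j (partialDeriv_contDiff i hf)).continuous
  have hHs : ∀ i j, HasCompactSupport (H i j) := fun i j =>
    hasCompactSupport_partialDeriv j (hasCompactSupport_partialDeriv i hfc)
  obtain ⟨M, hM0, hM⟩ : ∃ M : ℝ, 0 ≤ M ∧ ∀ i j x, |H i j x| ≤ M := by
    choose M hM using fun p : Fin n × Fin n =>
      (hHs p.1 p.2).exists_bound_of_continuous (hHc p.1 p.2)
    obtain ⟨K, hK⟩ := (Set.finite_range M).bddAbove
    exact ⟨max K 0, le_max_right _ _, fun i j x => (hM (i, j) x).trans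
      ((hK ⟨(i, j), rfl⟩).trans (le_max_left _ _))⟩
  set η := σ / (n + 1) with hη
  have hη0 : 0 < η := by positivity
  have hnη : n * η ≤ σ := by
    rw [hη, mul_div_assoc', div_le_iff₀ (by positivity)]; nlinarith
  obtain ⟨r, hr, hHr⟩ : ∃ r : ℝ, 0 < r ∧ ∀ x y : Eu n, dist x y < r →
      ∀ i j, |H i j x - H i j y| ≤ η := by
    have h1 : ∀ p : Fin n × Fin n, ∃ r : ℝ, 0 < r ∧ ∀ x y : Eu n, dist x y < r →
        |H p.1 p.2 x - H p.1 p.2 y| ≤ η := by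
      intro p
      have hu := (hHs p.1 p.2).uniformContinuous_of_continuous (hHc p.1 p.2)
      obtain ⟨r, hr, h⟩ := Metric.uniformContinuous_iff.1 hu η hη0
      exact ⟨r, hr, fun x y hxy => (h hxy).le⟩
    choose r hr h using h1
    obtain ⟨r', hr'0, hr'⟩ : ∃ r' : ℝ, 0 < r' ∧ ∀ p, r' ≤ r p := by
      rcases isEmpty_or_nonempty (Fin n × Fin n) with he | he
      · exact ⟨1, one_pos, fun p => he.elim p⟩
      · obtain ⟨p, hp⟩ := Finite.exists_min r
        exact ⟨r p, hr p, hp⟩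
    exact ⟨r', hr'0, fun x y hxy i j => h (i, j) x y (hxy.trans_le (hr' _))⟩
  -- At distance at least `r` from the centre the quartic term then contributes at least `n * M` to
  -- the Hessian form, which dominates that of `f`; within distance `r` the continuity of `D²f` and
  -- the quadratic term suffice.
  set L := n * M / (4 * r ^ 2) with hL
  have hL0 : 0 ≤ L := by positivity
  have hdist : ∀ x c : Eu n, dist x c ^ 2 = sqDist c x := by
    intro x c
    rw [EuclideanSpace.dist_eq, Real.sq_sqrt (Finset.sum_nonneg fun _ _ => sq_nonneg _)]
    refine Finset.sum_congr rfl fun i _ => ?_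
    rw [Real.dist_eq, sq_abs, sq]
  obtain ⟨ρ, hρ, hρr, hρL⟩ : ∃ ρ : ℝ, 0 < ρ ∧ n * ρ ^ 2 < r ^ 2 ∧ L * (n * ρ ^ 2) ≤ σ := by
    have hc : Tendsto (fun ρ : ℝ => n * ρ ^ 2) (𝓝[>] 0) (𝓝 0) := by
      have : Continuous fun ρ : ℝ => n * ρ ^ 2 := by fun_prop
      have := this.tendsto 0
      simp only [ne_eq, OfNat.ofNat_ne_zero, not_false_eq_true, zero_pow, mul_zero] at this
      exact this.mono_left nhdsWithin_le_nhds
    have hc2 : Tendsto (fun ρ : ℝ => L * (n * ρ ^ 2)) (𝓝[>] 0) (𝓝 0) := by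
      simpa using hc.const_mul L
    obtain ⟨ρ, ⟨h1, h2⟩, h3⟩ := ((hc.eventually (gt_mem_nhds (by positivity : 0 < r ^ 2))).and
      (hc2.eventually (gt_mem_nhds hσ)) |>.and self_mem_nhdsWithin).exists
    exact ⟨ρ, h3, h1, h2.le⟩
  refine ⟨L, ρ, hL0, hρ, fun c => ?_⟩
  obtain ⟨b, E, hb, hbpos, hHb, hE, hEtr⟩ := exists_negPart_sign
    (H := Matrix.of fun i j => H i j c) fun i j => partialDeriv_comm hf j i c
  simp only [Matrix.of_apply] at hHb hEtr
  have hpc := contDiff_pen σ L c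
  have hqc := contDiff_quadHalf b
  have hpenpos : ∀ x v, 0 ≤ hessForm (pen σ L c) x v := by
    intro x v
    rw [hessForm_pen]
    have := sqDist_nonneg c x
    positivity
  -- Two copies of the penalty: one is cancelled in `f - pen + B`, and the other makes that function
  -- convex.
  refine ⟨fun x => quadHalf b x + (pen σ L c x + pen σ L c x), E, hqc.add (hpc.add hpc), ?_, ?_,
    hE, fun x hx => ?_⟩
  · refine convexOn_of_hessForm_nonneg (hqc.add (hpc.add hpc)) fun x v => ?_
    rw [hessForm_add hqc (hpc.add hpc), hessForm_add hpc hpc, hessForm_quadHalf hb]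
    linarith [hbpos v, hpenpos x v]
  · have e : (fun x => f x - pen σ L c x + (quadHalf b x + (pen σ L c x + pen σ L c x))) =
        fun x => f x + (quadHalf b x + pen σ L c x) := by
      funext x; ring
    rw [e]
    refine convexOn_of_hessForm_nonneg (hf.add (hqc.add hpc)) fun x v => ?_
    rw [hessForm_add hf (hqc.add hpc), hessForm_add hqc hpc, hessForm_quadHalf hb, hessForm_pen]
    have hq := sqDist_nonneg c x
    have hv : 0 ≤ ∑ i, v i ^ 2 := Finset.sum_nonneg fun _ _ => sq_nonneg _
    have hsq : 0 ≤ 8 * L * (∑ i, v i * (x i - c i)) ^ 2 := by positivity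
    rcases lt_or_ge (dist x c) r with hxr | hxr
    · have h1 := abs_form_le (e := fun i j => H i j x - H i j c) (fun i j => hHr x c hxr i j) v
      have h2 : ∑ i, ∑ j, v i * v j * (H i j x - H i j c) = hessForm f x v -
          ∑ i, ∑ j, v i * v j * H i j c := by
        simp only [hessForm, mul_sub, Finset.sum_sub_distrib, hH]
      have h3 : ∑ i, ∑ j, v i * v j * (H i j c + b i j) = (∑ i, ∑ j, v i * v j * H i j c) +
          ∑ i, ∑ j, v i * v j * b i j := by
        simp only [mul_add, Finset.sum_add_distrib]
      have h4 := hHb v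
      rw [h2] at h1
      have h5 := (abs_le.1 h1).1
      have h6 : n * η * ∑ i, v i ^ 2 ≤ σ * ∑ i, v i ^ 2 := by gcongr
      have h7 : 0 ≤ 4 * L * sqDist c x * ∑ i, v i ^ 2 := by positivity
      rw [h3] at h4
      linarith
    · have h1 := abs_form_le (e := fun i j => H i j x) (fun i j => hM i j x) v
      have h2 : ∑ i, ∑ j, v i * v j * H i j x = hessForm f x v := rfl
      rw [h2] at h1
      have h5 := (abs_le.1 h1).1
      have h6 : n * M ≤ 4 * L * sqDist c x := by
        rw [← hdist, hL]
        have : r ^ 2 ≤ dist x c ^ 2 := by gcongr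
        calc n * M = 4 * (n * M / (4 * r ^ 2)) * r ^ 2 := by field_simp
          _ ≤ _ := by gcongr
      have h7 : n * M * ∑ i, v i ^ 2 ≤ 4 * L * sqDist c x * ∑ i, v i ^ 2 := by gcongr
      have h8 : 0 ≤ σ * ∑ i, v i ^ 2 := by positivity
      linarith [hbpos v]
  -- At `c` the trace of `H` plus twice the trace of `b` is exactly the pairing of `H` with `E`.
  -- Oscillation costs `(n + 1) σ` and the penalties `4 n σ + (16 n + 32) σ`, in all `(21 n + 33)
  -- σ`.
  · have hq : sqDist c x ≤ n * ρ ^ 2 := by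
      calc sqDist c x ≤ ∑ _i : Fin n, ρ ^ 2 := by
            refine Finset.sum_le_sum fun i _ => ?_
            rw [← sq, ← sq_abs]
            gcongr
            exact (hx i).le
        _ = n * ρ ^ 2 := by simp
    have hxr : dist x c < r := by
      refine lt_of_pow_lt_pow_left₀ 2 hr.le ?_
      rw [hdist]; exact hq.trans_lt hρr
    rw [lap_add hqc (hpc.add hpc), lap_add hpc hpc, lap_quadHalf hb, lap_pen]
    have hLq : L * sqDist c x ≤ σ := (mul_le_mul_of_nonneg_left hq hL0).trans hρL
    have h1 : lap f x ≤ ∑ i, H i i c + n * η := by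
      calc lap f x ≤ ∑ i, (H i i c + η) := Finset.sum_le_sum fun i _ => by
            linarith [(abs_le.1 (hHr x c hxr i i)).2]
        _ = _ := by rw [Finset.sum_add_distrib]; simp
    have h2 : ∑ i, ∑ j, H i j c * E i j ≤ ∑ i, ∑ j, H i j x * E i j + n * (n * η) := by
      calc ∑ i, ∑ j, H i j c * E i j ≤ ∑ i : Fin n, ∑ j : Fin n, (H i j x * E i j + η) := by
            refine Finset.sum_le_sum fun i _ => Finset.sum_le_sum fun j _ => ?_
            have h3 := hHr x c hxr i j
            have h4 := hE.abs_le_one i j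
            have h5 : |(H i j x - H i j c) * E i j| ≤ η := by
              rw [abs_mul]
              calc _ ≤ η * 1 := mul_le_mul h3 h4 (abs_nonneg _) hη0.le
                _ = η := mul_one _
            linarith [(abs_le.1 h5).1]
        _ = _ := by
            simp only [Finset.sum_add_distrib]; simp
    have h3 : (4 * n + 8) * (L * sqDist c x) ≤ (4 * n + 8) * σ := by gcongr
    have h4 : n * (n * η) ≤ n * σ := by gcongr
    change lap f x + _ ≤ ∑ i, ∑ j, H i j x * E i j + _
    have h5 : (0 : ℝ) ≤ (n : ℝ) * σ := by positivity
    linarith [hEtr]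

end Penalty

/-! ### The grid of subcubes and its cutoffs. -/

section Grid
variable {n m : ℕ}

/-- The centre of the `k`-th subcube of side `1 / m`. -/
def center (k : Fin n → Fin m) : Eu n := WithLp.toLp 2 fun i => (((k i : ℕ) : ℝ) + 1 / 2) / m

theorem center_apply (k : Fin n → Fin m) (i : Fin n) :
    center k i = (((k i : ℕ) : ℝ) + 1 / 2) / m := rfl

theorem mem_cubeAt_corner_iff (hm : 0 < m) (k : Fin n → Fin m) (x : Eu n) :
    x ∈ cubeAt (corner k) (1 / (m : ℝ)) ↔ ∀ i, |x i - center k i| < 1 / (2 * m) := by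
  have hm' : (0 : ℝ) < m := by exact_mod_cast hm
  refine forall_congr' fun i => ?_
  have e : center k i = corner k i + 1 / (2 * m) := by
    rw [center_apply, corner_apply]; field_simp
  have e2 : (1 : ℝ) / m = 1 / (2 * m) + 1 / (2 * m) := by field_simp; norm_num
  rw [e, abs_lt, e2]
  constructor <;> rintro ⟨h1, h2⟩ <;> constructor <;> linarith

theorem mul_self_lt_of_abs_lt {a b : ℝ} (h : |a| < |b|) : a * a < b * b := by
  rw [← abs_mul_abs_self a, ← abs_mul_abs_self b]
  exact mul_self_lt_mul_self (abs_nonneg a) h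

/-- Centres differ by at least `1 / m` in each coordinate where the indices differ. With
`pen_lt_pen` this makes the competitor of a subcube the strict maximum on it. -/
theorem sqDist_center_lt (hm : 0 < m) {k j : Fin n → Fin m} (hkj : k ≠ j) {x : Eu n}
    (hx : x ∈ cubeAt (corner k) (1 / (m : ℝ))) : sqDist (center k) x < sqDist (center j) x := by
  have hm' : (0 : ℝ) < m := by exact_mod_cast hm
  rw [mem_cubeAt_corner_iff hm] at hx
  have key : ∀ i, k i ≠ j i → |x i - center k i| < |x i - center j i| := by
    intro i hi
    have h1 : (1 : ℝ) / m ≤ |center k i - center j i| := by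
      have e : center k i - center j i = ((((k i : ℕ) : ℤ) - ((j i : ℕ) : ℤ) : ℤ) : ℝ) / m := by
        rw [center_apply, center_apply]; push_cast; field_simp; ring
      rw [e, abs_div, abs_of_pos hm']
      gcongr
      have hne : ((k i : ℕ) : ℤ) - ((j i : ℕ) : ℤ) ≠ 0 := by
        intro h; apply hi; apply Fin.ext; omega
      rw [← Int.cast_abs]
      exact_mod_cast Int.one_le_abs hne
    have h2 : |center k i - center j i| ≤ |x i - center j i| + |x i - center k i| := by
      have := abs_sub (x i - center j i) (x i - center k i)
      rwa [show x i - center j i - (x i - center k i) = center k i - center j i by ring] at this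
    have e2 : (1 : ℝ) / m = 1 / (2 * m) + 1 / (2 * m) := by field_simp; norm_num
    linarith [hx i]
  refine Finset.sum_lt_sum (fun i _ => ?_) ?_
  · by_cases hi : k i = j i
    · rw [center_apply, center_apply, hi]
    · exact (mul_self_lt_of_abs_lt (key i hi)).le
  · obtain ⟨i, hi⟩ := Function.ne_iff.1 hkj
    exact ⟨i, Finset.mem_univ i, mul_self_lt_of_abs_lt (key i hi)⟩

theorem sqDist_le_of_abs_le {c x : Eu n} {r : ℝ} (h : ∀ i, |x i - c i| ≤ r) :
    sqDist c x ≤ n * r ^ 2 := by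
  calc sqDist c x ≤ ∑ _i : Fin n, r ^ 2 := by
        refine Finset.sum_le_sum fun i _ => ?_
        rw [← sq, ← sq_abs]
        gcongr
        exact h i
    _ = n * r ^ 2 := by simp

theorem exists_center_abs_le (hm : 0 < m) {x : Eu n} (hx : x ∈ cube n) :
    ∃ k : Fin n → Fin m, ∀ i, |x i - center k i| ≤ 1 / (2 * m) := by
  have hm' : (0 : ℝ) < m := by exact_mod_cast hm
  have hlt : ∀ i, ⌊m * x i⌋₊ < m := fun i => by
    rw [Nat.floor_lt (mul_nonneg hm'.le (hx i).1.le)]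
    nlinarith [(hx i).2]
  refine ⟨fun i => ⟨⌊m * x i⌋₊, hlt i⟩, fun i => ?_⟩
  have h1 := Nat.floor_le (mul_nonneg hm'.le (hx i).1.le)
  have h2 := Nat.lt_floor_add_one ((m : ℝ) * x i)
  rw [center_apply]
  simp only
  have e : x i - ((⌊m * x i⌋₊ : ℝ) + 1 / 2) / m = (m * x i - ⌊m * x i⌋₊ - 1 / 2) / m := by
    field_simp; ring
  rw [e, abs_div, abs_of_pos hm', div_le_div_iff₀ hm' (by positivity)]
  have : |m * x i - ⌊m * x i⌋₊ - 1 / 2| ≤ 1 / 2 := by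
    rw [abs_le]; constructor <;> linarith
  nlinarith

theorem pen_lt_pen {σ L : ℝ} (hσ : 0 < σ) (hL : 0 ≤ L) {c c' x : Eu n}
    (h : sqDist c x < sqDist c' x) : pen σ L c x < pen σ L c' x := by
  have h0 := sqDist_nonneg c x
  have h1 : sqDist c x * sqDist c x ≤ sqDist c' x * sqDist c' x := mul_self_le_mul_self h0 h.le
  have h2 := mul_le_mul_of_nonneg_left h1 hL
  have h3 := mul_lt_mul_of_pos_left h (half_pos hσ)
  simp only [pen]; linarith

theorem pen_nonneg {σ L : ℝ} (hσ : 0 < σ) (hL : 0 ≤ L) (c x : Eu n) : 0 ≤ pen σ L c x := by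
  have h0 := sqDist_nonneg c x
  simp only [pen]; positivity

theorem pen_le {σ L q : ℝ} (hσ : 0 < σ) (hL : 0 ≤ L) {c x : Eu n} (h : sqDist c x ≤ q)
    (hq : q ≤ 1) : pen σ L c x ≤ (σ + L) * q := by
  have h0 := sqDist_nonneg c x
  have h1 : sqDist c x * sqDist c x ≤ q * 1 := mul_le_mul h (h.trans hq) h0 (h0.trans h)
  have h2 := mul_le_mul_of_nonneg_left h1 hL
  have h3 := mul_le_mul_of_nonneg_left h (half_pos hσ).le
  have h4 : 0 ≤ σ / 2 * q := mul_nonneg (half_pos hσ).le (h0.trans h)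
  simp only [pen]; linarith

/-- Cutoffs supported in the subcubes whose sum is close to one in `L¹`. -/
theorem exists_grid_cutoffs (hm : 0 < m) {δ : ℝ} (hδ : 0 < δ) :
    ∃ θ : (Fin n → Fin m) → Eu n → ℝ, (∀ k, ContDiff ℝ ∞ (θ k)) ∧
      (∀ k, HasCompactSupport (θ k)) ∧ (∀ k, tsupport (θ k) ⊆ cubeAt (corner k) (1 / (m : ℝ))) ∧
      (∀ k x, 0 ≤ θ k x) ∧ (∀ x, ∑ k, θ k x ≤ 1) ∧ ∫ x in cube n, (1 - ∑ k, θ k x) ≤ δ := by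
  set V : (Fin n → Fin m) → Set (Eu n) := fun k => cubeAt (corner k) (1 / (m : ℝ)) with hV
  have hVo : ∀ k, IsOpen (V k) := fun k => isOpen_cubeAt _ _
  have hVf : ∀ k, volume (V k) ≠ ⊤ := fun k =>
    ((measure_mono (cubeAt_corner_subset hm k)).trans_lt volume_cube_lt_top).ne
  set κ : ℝ := ((Fintype.card (Fin n → Fin m) : ℕ) : ℝ) with hκ
  have hδ' : ENNReal.ofReal (δ / (κ + 1)) ≠ 0 := by
    rw [Ne, ENNReal.ofReal_eq_zero, not_le]; positivity
  -- The loss on each of the `κ` subcubes is `δ / (κ + 1)`, so that the total stays below `δ`.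
  choose K hKV hK hKμ using fun k =>
    (hVo k).measurableSet.exists_isCompact_sdiff_lt (hVf k) hδ'
  choose θ h1 h2 h3 h4 h5 using fun k => exists_smooth_cutoff (hK k) (hVo k) (hKV k)
  have hzero : ∀ k x, x ∉ V k → θ k x = 0 := fun k x hx =>
    image_eq_zero_of_notMem_tsupport fun hx' => hx (h3 k hx')
  have hsum : ∀ k x, x ∈ V k → ∑ j, θ j x = θ k x := fun k x hx => by
    refine Finset.sum_eq_single k (fun j _ hj => hzero j x fun hx' => ?_) (by simp)
    exact Set.disjoint_left.1 (disjoint_cubeAt_corner hm hj) hx' hx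
  have hle : ∀ x, ∑ k, θ k x ≤ 1 := by
    intro x
    by_cases hx : ∃ k, x ∈ V k
    · obtain ⟨k, hk⟩ := hx
      rw [hsum k x hk]; exact (h4 k x).2
    · push Not at hx
      rw [Finset.sum_eq_zero fun k _ => hzero k x (hx k)]; exact zero_le_one
  have hpos : ∀ x, 0 ≤ ∑ k, θ k x := fun x => Finset.sum_nonneg fun k _ => (h4 k x).1
  refine ⟨θ, h1, h2, h3, fun k x => (h4 k x).1, hle, ?_⟩
  set D := ⋃ k ∈ (Finset.univ : Finset (Fin n → Fin m)), V k \ K k with hD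
  have hDm : MeasurableSet D := Finset.measurableSet_biUnion _ fun k _ =>
    (hVo k).measurableSet.diff (hK k).isClosed.measurableSet
  have hDμ : volume D ≤ ENNReal.ofReal δ := by
    calc volume D ≤ ∑ k, volume (V k \ K k) := measure_biUnion_finset_le _ _
      _ ≤ ∑ _k : Fin n → Fin m, ENNReal.ofReal (δ / (κ + 1)) :=
        Finset.sum_le_sum fun k _ => (hKμ k).le
      _ = ENNReal.ofReal (κ * (δ / (κ + 1))) := by
        rw [Finset.sum_const, nsmul_eq_mul, ENNReal.ofReal_mul (by positivity), hκ]
        simp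
      _ ≤ ENNReal.ofReal δ := by
        refine ENNReal.ofReal_le_ofReal ?_
        rw [mul_div_assoc', div_le_iff₀ (by positivity)]; nlinarith
  have hcont : Continuous fun x => 1 - ∑ k, θ k x :=
    continuous_const.sub (continuous_finsetSum _ fun k _ => (h1 k).continuous)
  have hDf : volume D ≠ ⊤ := ne_top_of_le_ne_top ENNReal.ofReal_ne_top hDμ
  have hind : Integrable (D.indicator fun _ => (1 : ℝ)) (cubeMeasure n) :=
    (integrable_const 1).indicator hDm
  calc ∫ x in cube n, (1 - ∑ k, θ k x) ≤ ∫ x in cube n, D.indicator (fun _ => (1 : ℝ)) x := by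
        refine integral_mono_ae (memLp_one_iff_integrable.1 (memLp_of_continuous hcont)) hind ?_
        filter_upwards [ae_mem_cubeAt_corner (n := n) hm] with x hx
        obtain ⟨k, hk⟩ := hx
        by_cases hxK : x ∈ K k
        · rw [hsum k x hk, h5 k x hxK, sub_self]
          exact Set.indicator_nonneg (fun _ _ => zero_le_one) _
        · have hxD : x ∈ D := Set.mem_iUnion₂.2 ⟨k, Finset.mem_univ k, hk, hxK⟩
          rw [Set.indicator_of_mem hxD]
          linarith [hpos x]
    _ = (volume.restrict (cube n)).real D := by
        rw [integral_indicator_const _ hDm]; simp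
    _ ≤ δ := by
        refine ENNReal.toReal_le_of_le_ofReal hδ.le ?_
        exact (Measure.restrict_apply_le _ _).trans hDμ

end Grid

/-! ### Replacing convex functions by maxima of affine functions. -/

section Selection
variable {n : ℕ}

/-- Uniform approximation of a convex function on a compact set by a convex function which is a
selection of finitely many affine functions. -/
theorem exists_convex_selection_approx {k : Eu n → ℝ} (hk : Continuous k)
    (hkc : ConvexOn ℝ Set.univ k) {S : Set (Eu n)} (hS : IsCompact S) {ε : ℝ} (hε : 0 < ε) :
    ∃ (N : ℕ) (a : Fin (N + 1) → Eu n →ᵃ[ℝ] ℝ) (k' : Eu n → ℝ), Continuous k' ∧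
      ConvexOn ℝ Set.univ k' ∧ (∀ x, ∃ i, k' x = a i x) ∧ ∀ x ∈ S, |k' x - k x| ≤ ε := by
  obtain ⟨N, a, hle, hge⟩ := exists_finset_affine_sup hk hkc hS hε
  set k' : Eu n → ℝ := fun x => Finset.univ.sup' Finset.univ_nonempty fun i => a i x with hk'
  have hsel : ∀ x, ∃ i, k' x = a i x := fun x => by
    obtain ⟨i, -, hi⟩ := Finset.exists_mem_eq_sup' Finset.univ_nonempty fun i => a i x
    exact ⟨i, hi⟩
  have hup : ∀ i x, a i x ≤ k' x := fun i x =>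
    Finset.le_sup' (fun i => a i x) (Finset.mem_univ i)
  refine ⟨N, a, k', ?_, ?_, hsel, fun x hx => ?_⟩
  · exact Continuous.finset_sup'_apply _ fun i _ => continuous_affineMap (a i)
  · refine convexOn_of_selection (v := fun i x => a i x) (fun i => ?_) hup hsel
    refine ⟨convex_univ, fun x _ y _ s t hs ht hst => le_of_eq ?_⟩
    exact Convex.combo_affine_apply hst
  · obtain ⟨i, hi⟩ := hge x hx
    obtain ⟨j, hj⟩ := hsel x
    rw [abs_le]
    constructor
    · linarith [hup i x]
    · rw [hj]; linarith [hle j x]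

end Selection

section Discretize
variable {n : ℕ}

theorem continuous_hdivOne {ψ : Eu n → ℝ} (hψ : ContDiff ℝ ∞ ψ) (hc : HasCompactSupport ψ) :
    Continuous (hdivOne ψ) :=
  (isSmoothField_smul_one hψ hc (Set.subset_univ _)).continuous_hdiv

theorem tsupport_hdivOne_subset {ψ : Eu n → ℝ} (hψ : ContDiff ℝ ∞ ψ) (hc : HasCompactSupport ψ) :
    tsupport (hdivOne ψ) ⊆ tsupport ψ :=
  (isSmoothField_smul_one hψ hc subset_rfl).tsupport_hdiv_subset

theorem hasCompactSupport_hdivOne {ψ : Eu n → ℝ} (hψ : ContDiff ℝ ∞ ψ)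
    (hc : HasCompactSupport ψ) : HasCompactSupport (hdivOne ψ) :=
  (isSmoothField_smul_one hψ hc (Set.subset_univ _)).hasCompactSupport_hdiv

theorem integral_mul_hdivOne_le_add {k k' ψ : Eu n → ℝ} (hk : Continuous k) (hk' : Continuous k')
    (hψ : ContDiff ℝ ∞ ψ) (hc : HasCompactSupport ψ) {S : Set (Eu n)} (hS : tsupport ψ ⊆ S)
    {ε : ℝ} (h : ∀ x ∈ S, |k x - k' x| ≤ ε) :
    ∫ x, k x * hdivOne ψ x ≤ (∫ x, k' x * hdivOne ψ x) + ε * ∫ x, |hdivOne ψ x| :=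
  integral_mul_le_add hk hk' (continuous_hdivOne hψ hc) (hasCompactSupport_hdivOne hψ hc)
    fun x hx => h x (hS (tsupport_hdivOne_subset hψ hc hx))

theorem abs_sup'_sub_sup'_le {κ : Type*} [Fintype κ] [Nonempty κ] {u v : κ → ℝ} {ε : ℝ}
    (h : ∀ k, |u k - v k| ≤ ε) :
    |Finset.univ.sup' Finset.univ_nonempty u - Finset.univ.sup' Finset.univ_nonempty v| ≤ ε := by
  rw [abs_le]
  have h1 : Finset.univ.sup' Finset.univ_nonempty u ≤
      Finset.univ.sup' Finset.univ_nonempty v + ε := Finset.sup'_le _ _ fun k hk => by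
    linarith [(abs_le.1 (h k)).2, Finset.le_sup' v hk]
  have h2 : Finset.univ.sup' Finset.univ_nonempty v ≤
      Finset.univ.sup' Finset.univ_nonempty u + ε := Finset.sup'_le _ _ fun k hk => by
    linarith [(abs_le.1 (h k)).1, Finset.le_sup' u hk]
  constructor <;> linarith

/-- The bound of `htv_le_of_convex_split` involves the functions only through integrals against
fixed kernels, so it survives uniform approximation. The strict gap on the compact supports of the
`ψ k` keeps the same competitor maximal there. -/
theorem exists_affine_selection_htv_le {κ : Type*} [Fintype κ] [Nonempty κ] {A S : Set (Eu n)}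
    (hS : IsCompact S) {a b : κ → Eu n → ℝ} (hac : ∀ k, Continuous (a k))
    (hbc : ∀ k, Continuous (b k)) (ha : ∀ k, ConvexOn ℝ Set.univ (a k))
    (hb : ∀ k, ConvexOn ℝ Set.univ (b k)) {ψ : κ → Eu n → ℝ} {χ : Eu n → ℝ}
    (hψ : ∀ k, ContDiff ℝ ∞ (ψ k)) (hψS : ∀ k, tsupport (ψ k) ⊆ S) (hψ0 : ∀ k x, 0 ≤ ψ k x)
    (hχ : ContDiff ℝ ∞ χ) (hχS : tsupport χ ⊆ S) (hχ0 : ∀ x, 0 ≤ χ x)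
    (hone : ∀ x ∈ A, ∑ k, ψ k x + χ x = 1)
    (hgap : ∀ k j, j ≠ k → ∀ x ∈ tsupport (ψ k), a j x - b j x < a k x - b k x)
    {ε : ℝ} (hε : 0 < ε) :
    ∃ g : Eu n → ℝ, Continuous g ∧
      (∃ (N : ℕ) (ℓ : Fin N → Eu n →ᵃ[ℝ] ℝ), ∀ x, ∃ i, g x = ℓ i x) ∧
      (∀ x ∈ S, |g x - Finset.univ.sup' Finset.univ_nonempty fun k => a k x - b k x| ≤ ε) ∧
      htv 1 g A ≤ ENNReal.ofReal ((∫ x, (Finset.univ.sup' Finset.univ_nonempty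
        fun k => a k x - b k x) * hdivOne (fun x => ∑ k, ψ k x + χ x) x) +
        2 * ∑ k, (∫ x, b k x * hdivOne (ψ k) x) + 2 * (∫ x, (∑ k, b k x) * hdivOne χ x) + ε) := by
  have hψc : ∀ k, HasCompactSupport (ψ k) := fun k =>
    hS.of_isClosed_subset (isClosed_tsupport _) (hψS k)
  have hχc : HasCompactSupport χ := hS.of_isClosed_subset (isClosed_tsupport _) hχS
  set Φ : Eu n → ℝ := fun x => ∑ k, ψ k x + χ x with hΦ
  have hΦs : ContDiff ℝ ∞ Φ := (ContDiff.sum fun k _ => hψ k).add hχ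
  have hΦS : tsupport Φ ⊆ S := by
    refine closure_minimal (fun x hx => ?_) hS.isClosed
    by_contra hxS
    refine hx ?_
    have h1 : ∀ k, ψ k x = 0 := fun k =>
      image_eq_zero_of_notMem_tsupport fun h => hxS (hψS k h)
    have h2 : χ x = 0 := image_eq_zero_of_notMem_tsupport fun h => hxS (hχS h)
    simp [hΦ, h1, h2]
  have hΦc : HasCompactSupport Φ := hS.of_isClosed_subset (isClosed_tsupport _) hΦS
  set D : ℝ := 2 * (∫ x, |hdivOne Φ x|) + 2 * ∑ k, (∫ x, |hdivOne (ψ k) x|) +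
    2 * (Fintype.card κ * ∫ x, |hdivOne χ x|) with hD
  -- Each difference moves by at most `2 * η`, so a gap of `4 * η` preserves the order. The number
  -- `D` collects the `L¹` norms of the kernels, so the integrals move by at most `η * D`.
  have hev : ∀ᶠ η in 𝓝[>] (0 : ℝ), (∀ k j, j ≠ k → ∀ x ∈ tsupport (ψ k),
      4 * η ≤ (a k x - b k x) - (a j x - b j x)) ∧ η * D < ε ∧ 2 * η < ε := by
    have cont : ∀ c : ℝ, Tendsto (fun η : ℝ => η * c) (𝓝[>] 0) (𝓝 0) := fun c => by
      have : Tendsto (fun η : ℝ => η * c) (𝓝 0) (𝓝 (0 * c)) :=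
        (continuous_id.mul continuous_const).tendsto 0
      rw [zero_mul] at this
      exact this.mono_left nhdsWithin_le_nhds
    refine (eventually_all.2 fun k => eventually_all.2 fun j => ?_).and
      ((cont D |>.eventually (gt_mem_nhds hε)).and ?_)
    · by_cases hjk : j = k
      · exact Eventually.of_forall fun η h => absurd hjk h
      · obtain ⟨γ, hγ, hγ'⟩ := (hψc k).isCompact.exists_forall_le' (a := 0)
          (f := fun x => (a k x - b k x) - (a j x - b j x))
          (((hac k).sub (hbc k)).sub ((hac j).sub (hbc j))).continuousOn
          fun x hx => sub_pos.2 (hgap k j hjk x hx)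
        filter_upwards [(cont 4).eventually (gt_mem_nhds hγ)] with η hη _ x hx
        linarith [hγ' x hx]
    · filter_upwards [(cont 2).eventually (gt_mem_nhds hε)] with η hη
      linarith
  obtain ⟨η, ⟨hη1, hη2, hη3⟩, hη0⟩ := (hev.and self_mem_nhdsWithin).exists
  have hη0 : 0 < η := hη0
  choose Na ra a' hac' ha' hsa ha'S using fun k =>
    exists_convex_selection_approx (hac k) (ha k) hS hη0
  choose Nb rb b' hbc' hb' hsb hb'S using fun k =>
    exists_convex_selection_approx (hbc k) (hb k) hS hη0
  set g : Eu n → ℝ := fun x =>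
    Finset.univ.sup' Finset.univ_nonempty fun k => a' k x - b' k x with hg
  set M : Eu n → ℝ := fun x =>
    Finset.univ.sup' Finset.univ_nonempty fun k => a k x - b k x with hM
  have hgc : Continuous g := Continuous.finset_sup'_apply _ fun k _ => (hac' k).sub (hbc' k)
  have hMc : Continuous M := Continuous.finset_sup'_apply _ fun k _ => (hac k).sub (hbc k)
  have hex : ∀ x, ∃ k, g x = a' k x - b' k x := fun x => by
    obtain ⟨k, -, hk⟩ := Finset.exists_mem_eq_sup' Finset.univ_nonempty fun k => a' k x - b' k x
    exact ⟨k, hk⟩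
  have hle : ∀ k x, a' k x - b' k x ≤ g x := fun k x =>
    Finset.le_sup' (fun k => a' k x - b' k x) (Finset.mem_univ k)
  have hab : ∀ k, ∀ x ∈ S, |(a' k x - b' k x) - (a k x - b k x)| ≤ 2 * η := fun k x hx => by
    have h1 := abs_le.1 (ha'S k x hx)
    have h2 := abs_le.1 (hb'S k x hx)
    rw [abs_le]; constructor <;> linarith
  have hgM : ∀ x ∈ S, |g x - M x| ≤ 2 * η := fun x hx => abs_sup'_sub_sup'_le fun k => hab k x hx
  refine ⟨g, hgc, ?_, fun x hx => (hgM x hx).trans hη3.le, ?_⟩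
  · let I := Σ k, Fin (Na k + 1) × Fin (Nb k + 1)
    let e := Fintype.equivFin I
    refine ⟨Fintype.card I, fun i => ra (e.symm i).1 (e.symm i).2.1 - rb (e.symm i).1 (e.symm i).2.2,
      fun x => ?_⟩
    obtain ⟨k, hk⟩ := hex x
    obtain ⟨i, hi⟩ := hsa k x
    obtain ⟨j, hj⟩ := hsb k x
    refine ⟨e ⟨k, i, j⟩, ?_⟩
    beta_reduce
    rw [Equiv.symm_apply_apply, hk, hi, hj]; rfl
  · have hmax : ∀ k, ∀ x ∈ tsupport (ψ k), g x = a' k x - b' k x := fun k x hx => by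
      refine le_antisymm (Finset.sup'_le _ _ fun j _ => ?_) (hle k x)
      by_cases hjk : j = k
      · rw [hjk]
      · have h1 := hη1 k j hjk x hx
        have h2 := abs_le.1 (hab k x (hψS k hx))
        have h3 := abs_le.1 (hab j x (hψS k hx))
        linarith
    refine (htv_le_of_convex_split hac' hbc' hgc ha' hb' hle hex hψ hψc hψ0 hχ hχc hχ0 hone
      hmax).trans (ENNReal.ofReal_le_ofReal ?_)
    have e1 : ∫ x, g x * hdivOne Φ x ≤ (∫ x, M x * hdivOne Φ x) + 2 * η * ∫ x, |hdivOne Φ x| :=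
      integral_mul_hdivOne_le_add hgc hMc hΦs hΦc hΦS hgM
    have e2 : ∑ k, ∫ x, b' k x * hdivOne (ψ k) x ≤ ∑ k, (∫ x, b k x * hdivOne (ψ k) x) +
        η * ∑ k, ∫ x, |hdivOne (ψ k) x| := by
      rw [Finset.mul_sum, ← Finset.sum_add_distrib]
      exact Finset.sum_le_sum fun k _ =>
        integral_mul_hdivOne_le_add (hbc' k) (hbc k) (hψ k) (hψc k) (hψS k) (hb'S k)
    have e3 : ∫ x, (∑ k, b' k x) * hdivOne χ x ≤ (∫ x, (∑ k, b k x) * hdivOne χ x) +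
        Fintype.card κ * η * ∫ x, |hdivOne χ x| := by
      refine integral_mul_hdivOne_le_add (continuous_finsetSum _ fun k _ => hbc' k)
        (continuous_finsetSum _ fun k _ => hbc k) hχ hχc hχS fun x hx => ?_
      rw [← Finset.sum_sub_distrib]
      refine (Finset.abs_sum_le_sum_abs _ _).trans ?_
      refine (Finset.sum_le_sum fun k _ => hb'S k x hx).trans ?_
      simp
    have e4 : η * D = 2 * η * (∫ x, |hdivOne Φ x|) + 2 * (η * ∑ k, ∫ x, |hdivOne (ψ k) x|) +
        2 * (Fintype.card κ * η * ∫ x, |hdivOne χ x|) := by rw [hD]; ring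
    linarith

end Discretize

/-! ### Density in energy for smooth functions. -/

section SmoothCase
variable {n : ℕ}

theorem continuous_lap {u : Eu n → ℝ} (hu : ContDiff ℝ ∞ u) : Continuous (lap u) :=
  continuous_finsetSum _ fun i _ => (partialDeriv_contDiff i (partialDeriv_contDiff i hu)).continuous

/-- The field `∑ ψ k • E k` is admissible because the sets `V k` are disjoint, and testing `f` with
it bounds its variation from below by nearly the left-hand side. -/
theorem sum_integral_mul_lap_le {κ : Type*} [Fintype κ] {V : κ → Set (Eu n)}
    (hVd : ∀ k j, j ≠ k → Disjoint (V k) (V j)) (hV : ∀ k, V k ⊆ cube n) {f : Eu n → ℝ}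
    (hf : ContDiff ℝ ∞ f) (hfin : htv 1 f (cube n) ≠ ⊤) {B : κ → Eu n → ℝ}
    (hB : ∀ k, ContDiff ℝ ∞ (B k)) {E : κ → Matrix (Fin n) (Fin n) ℝ} (hE : ∀ k, OpLeOne (E k))
    {ψ : κ → Eu n → ℝ} (hψ : ∀ k, ContDiff ℝ ∞ (ψ k)) (hψc : ∀ k, HasCompactSupport (ψ k))
    (hψV : ∀ k, tsupport (ψ k) ⊆ V k) (hψ0 : ∀ k x, 0 ≤ ψ k x) (hψ1 : ∀ k x, ψ k x ≤ 1) {c : ℝ}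
    (hc : 0 ≤ c) (h : ∀ k, ∀ x ∈ V k, lap f x + 2 * lap (B k) x ≤
      (∑ i, ∑ j, partialDeriv j (partialDeriv i f) x * E k i j) + c) :
    ∑ k, ∫ x, ψ k x * (lap f x + 2 * lap (B k) x) ≤
      (htv 1 f (cube n)).toReal + c * volume.real (cube n) := by
  have hzero : ∀ k x, x ∉ V k → ψ k x = 0 := fun k x hx =>
    image_eq_zero_of_notMem_tsupport fun hx' => hx (hψV k hx')
  have hsm : ∀ k, IsSmoothField (cube n) fun x => ψ k x • E k := fun k =>
    .of_tsupport (hψ k) (hψc k) ((hψV k).trans (hV k)) fun _ _ => contDiff_const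
  have hF : IsSmoothField (cube n) (∑ k, fun x => ψ k x • E k) := .sum _ fun k _ => hsm k
  have hFx : ∀ x, (∑ k, fun x => ψ k x • E k) x = ∑ k, ψ k x • E k := fun x =>
    Finset.sum_apply _ _ _
  have hother : ∀ k x, x ∈ V k → ∀ j, j ≠ k → ψ j x = 0 := fun k x hx j hj =>
    hzero j x fun hx' => Set.disjoint_left.1 (hVd k j hj) hx hx'
  have hF1 : ∀ x, OpLeOne ((∑ k, fun x => ψ k x • E k) x) := by
    intro x
    rw [hFx]
    by_cases hx : ∃ k, x ∈ V k
    · obtain ⟨k, hk⟩ := hx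
      rw [Finset.sum_eq_single k (fun j _ hj => by rw [hother k x hk j hj, zero_smul]) (by simp)]
      exact (hE k).smul (abs_le.2 ⟨by linarith [hψ0 k x], hψ1 k x⟩)
    · push Not at hx
      rw [Finset.sum_eq_zero fun k _ => by rw [hzero k x (hx k), zero_smul]]
      exact OpLeOne.zero
  have key := integral_le_toReal_htv hF hF1 hfin
  rw [integral_mul_hdiv hf hF] at key
  have i1 : ∀ k, Integrable fun x => ψ k x * (lap f x + 2 * lap (B k) x) := fun k =>
    ((hψ k).continuous.mul ((continuous_lap hf).add (continuous_const.mul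
      (continuous_lap (hB k))))).integrable_of_hasCompactSupport (hψc k).mul_right
  have i2 : Integrable fun x => ∑ i, ∑ j, partialDeriv j (partialDeriv i f) x *
      (∑ k, fun x => ψ k x • E k) x i j :=
    integrable_finsetSum _ fun i _ => integrable_finsetSum _ fun j _ =>
      ((partialDeriv_contDiff j (partialDeriv_contDiff i hf)).continuous.mul
        (hF.1 i j).continuous).integrable_of_hasCompactSupport (hF.2 i j).mul_left
  have hcm : MeasurableSet (cube n) := (isOpen_cube n).measurableSet
  have i3 : Integrable ((cube n).indicator fun _ => c) :=
    (integrable_indicator_iff hcm).2 (integrableOn_const volume_cube_lt_top.ne)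
  have e3 : ∫ x, (cube n).indicator (fun _ => c) x = c * volume.real (cube n) := by
    rw [integral_indicator_const _ hcm, smul_eq_mul, mul_comm]
  rw [← integral_finsetSum _ fun k _ => i1 k, ← e3]
  refine le_trans ?_ (add_le_add_left key _)
  rw [← integral_add i2 i3]
  refine integral_mono (integrable_finsetSum _ fun k _ => i1 k) (i2.add i3) fun x => ?_
  simp only [hFx]
  by_cases hx : ∃ k, x ∈ V k
  · obtain ⟨k, hk⟩ := hx
    rw [Set.indicator_of_mem (hV k hk),
      Finset.sum_eq_single k (fun j _ hj => by rw [hother k x hk j hj, zero_mul]) (by simp),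
      Finset.sum_eq_single k (fun j _ hj => by rw [hother k x hk j hj, zero_smul]) (by simp)]
    have e : ∑ i, ∑ j, partialDeriv j (partialDeriv i f) x * (ψ k x • E k) i j =
        ψ k x * ∑ i, ∑ j, partialDeriv j (partialDeriv i f) x * E k i j := by
      simp only [Finset.mul_sum, Matrix.smul_apply, smul_eq_mul]
      exact Finset.sum_congr rfl fun i _ => Finset.sum_congr rfl fun j _ => by ring
    rw [e]
    have h1 := mul_le_mul_of_nonneg_left (h k x hk) (hψ0 k x)
    have h2 := mul_le_mul_of_nonneg_right (hψ1 k x) hc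
    linarith
  · push Not at hx
    have e1 : ∑ k, ψ k x * (lap f x + 2 * lap (B k) x) = 0 :=
      Finset.sum_eq_zero fun k _ => by rw [hzero k x (hx k), zero_mul]
    have e2 : ∑ k, ψ k x • E k = 0 :=
      Finset.sum_eq_zero fun k _ => by rw [hzero k x (hx k), zero_smul]
    rw [e1, e2]
    simpa using Set.indicator_nonneg (fun _ _ => hc) x

/-- Approximation in energy of smooth functions by continuous selections of affine functions. -/
theorem exists_affine_selection_of_contDiff {f : Eu n → ℝ} (hf : ContDiff ℝ ∞ f)
    (hfc : HasCompactSupport f) (hfin : htv 1 f (cube n) ≠ ⊤) {K : Set (Eu n)} (hK : IsCompact K)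
    (hKc : K ⊆ cube n) {ε : ℝ} (hε : 0 < ε) :
    ∃ g : Eu n → ℝ, Continuous g ∧
      (∃ (N : ℕ) (ℓ : Fin N → Eu n →ᵃ[ℝ] ℝ), ∀ x, ∃ i, g x = ℓ i x) ∧
      (∀ x ∈ cube n, |g x - f x| ≤ ε) ∧ htv 1 g K ≤ htv 1 f (cube n) + ENNReal.ofReal ε := by
  obtain ⟨Φ, hΦ, hΦc, hΦΩ, hΦ01, hΦK⟩ := exists_smooth_cutoff hK (isOpen_cube n) hKc
  -- The order of choices matters: `C` depends only on the cutoff `Φ` and is fixed before the grid,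
  -- so the uniform error `τ` between the maximum and `f` costs only `τ * C` in energy. Each error
  -- is kept below `ε / 5`.
  set C : ℝ := ∫ x, |hdivOne Φ x| with hC
  have hC0 : 0 ≤ C := integral_nonneg fun x => abs_nonneg _
  set v : ℝ := volume.real (cube n) with hv
  have hv0 : 0 ≤ v := measureReal_nonneg
  set q : ℝ := 22 * n + 33 with hq
  have hq0 : 0 < q := by positivity
  set σ : ℝ := ε / (5 * q * (v + 1)) with hσ
  have hσ0 : 0 < σ := by positivity
  have hσv : q * σ * v ≤ ε / 5 := by
    have e : q * σ * v = ε / 5 * (v / (v + 1)) := by rw [hσ]; field_simp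
    rw [e]
    exact mul_le_of_le_one_right (by positivity) ((div_le_one (by positivity)).2 (by linarith))
  set τ : ℝ := ε / (5 * (C + 1)) with hτ
  have hτ0 : 0 < τ := by positivity
  have hτC : τ * C ≤ ε / 5 := by
    have e : τ * C = ε / 5 * (C / (C + 1)) := by rw [hτ]; field_simp
    rw [e]
    exact mul_le_of_le_one_right (by positivity) ((div_le_one (by positivity)).2 (by linarith))
  have hτε : τ ≤ ε / 5 := by
    rw [hτ]; exact div_le_div_of_nonneg_left hε.le (by norm_num) (by linarith)
  obtain ⟨L, ρ, hL, hρ, hsplit⟩ := exists_convex_split hf hfc hσ0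
  have hlim : ∀ c : ℝ, Tendsto (fun m : ℕ => c / (m : ℝ)) atTop (𝓝 0) :=
    tendsto_const_div_atTop_nhds_zero_nat
  -- The grid is fine enough for the smallest penalty to be at most `τ` everywhere and for each
  -- subcube to lie in the region of radius `ρ` where the splitting is sharp.
  obtain ⟨m, hm, hm1, hm2, hm3⟩ := ((eventually_gt_atTop 0).and
    (((hlim n).eventually (ge_mem_nhds zero_lt_one)).and
      (((hlim ((σ + L) * n)).eventually (ge_mem_nhds hτ0)).and
        ((hlim 1).eventually (ge_mem_nhds hρ))))).exists
  have hm' : (1 : ℝ) ≤ m := by exact_mod_cast hm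
  have hm0 : (0 : ℝ) < m := by linarith
  choose B E hBs hBc hAc hE hBE using fun k : Fin n → Fin m => hsplit (center k)
  have : Nonempty (Fin m) := ⟨⟨0, hm⟩⟩
  -- The bound `R` may grow with the number of subcubes; this is harmless, because the cutoffs and
  -- hence the smallness of `χ` are chosen afterwards.
  obtain ⟨R, hR⟩ := (isCompact_box (n := n) le_rfl).exists_bound_of_continuousOn
    (f := fun x => lap f x + 2 * lap (fun x => ∑ k, B k x) x)
    ((continuous_lap hf).add (continuous_const.mul (continuous_lap
      (ContDiff.sum fun k _ => hBs k)))).continuousOn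
  set δ : ℝ := ε / (5 * (|R| + 1)) with hδ
  have hδ0 : 0 < δ := by positivity
  have hδR : |R| * δ ≤ ε / 5 := by
    have e : |R| * δ = ε / 5 * (|R| / (|R| + 1)) := by rw [hδ]; field_simp
    rw [e]
    exact mul_le_of_le_one_right (by positivity) ((div_le_one (by positivity)).2 (by linarith))
  obtain ⟨θ, hθ, hθc, hθV, hθ0, hθ1, hθδ⟩ := exists_grid_cutoffs (n := n) hm hδ0
  set ψ : (Fin n → Fin m) → Eu n → ℝ := fun k x => Φ x * θ k x with hψdef
  set χ : Eu n → ℝ := fun x => Φ x * (1 - ∑ k, θ k x) with hχdef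
  have hψ : ∀ k, ContDiff ℝ ∞ (ψ k) := fun k => hΦ.mul (hθ k)
  have hχ : ContDiff ℝ ∞ χ := hΦ.mul (contDiff_const.sub (ContDiff.sum fun k _ => hθ k))
  have hψV : ∀ k, tsupport (ψ k) ⊆ cubeAt (corner k) (1 / (m : ℝ)) := fun k =>
    tsupport_mul_subset_right.trans (hθV k)
  have hψΩ : ∀ k, tsupport (ψ k) ⊆ cube n := fun k => (hψV k).trans (cubeAt_corner_subset hm k)
  have hχΩ : tsupport χ ⊆ cube n := tsupport_mul_subset_left.trans hΦΩ
  have hψc : ∀ k, HasCompactSupport (ψ k) := fun k => hΦc.mul_right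
  have hχc : HasCompactSupport χ := hΦc.mul_right
  have hψ0 : ∀ k x, 0 ≤ ψ k x := fun k x => mul_nonneg (hΦ01 x).1 (hθ0 k x)
  have hχ0 : ∀ x, 0 ≤ χ x := fun x => mul_nonneg (hΦ01 x).1 (sub_nonneg.2 (hθ1 x))
  have hψ1 : ∀ k x, ψ k x ≤ 1 := fun k x =>
    mul_le_one₀ (hΦ01 x).2 (hθ0 k x) ((Finset.single_le_sum (fun j _ => hθ0 j x)
      (Finset.mem_univ k)).trans (hθ1 x))
  have hsumΦ : (fun x => ∑ k, ψ k x + χ x) = Φ := by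
    funext x
    simp only [hψdef, hχdef, ← Finset.mul_sum]; ring
  have hone : ∀ x ∈ K, ∑ k, ψ k x + χ x = 1 := fun x hx =>
    (congrFun hsumΦ x).trans (hΦK x hx)
  have hfcont : Continuous f := hf.continuous
  have hac : ∀ k, Continuous fun x => f x - pen σ L (center k) x + B k x := fun k =>
    (hfcont.sub (contDiff_pen σ L (center k)).continuous).add (hBs k).continuous
  obtain ⟨g, hgc, hgsel, hgM, hghtv⟩ := exists_affine_selection_htv_le (A := K)
    (isCompact_box (n := n) le_rfl) hac (fun k => (hBs k).continuous) hAc hBc hψ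
    (fun k => (hψΩ k).trans cube_subset_box) hψ0 hχ (hχΩ.trans cube_subset_box) hχ0 hone
    (fun k j hjk x hx => by
      have := pen_lt_pen hσ0 hL (sqDist_center_lt hm hjk.symm (hψV k hx))
      linarith) (ε := ε / 5) (by positivity)
  simp only [add_sub_cancel_right] at hgM hghtv
  set M : Eu n → ℝ := fun x => Finset.univ.sup' Finset.univ_nonempty
    fun k : Fin n → Fin m => f x - pen σ L (center k) x with hM
  have hMc : Continuous M := Continuous.finset_sup'_apply _ fun k _ =>
    hfcont.sub (contDiff_pen σ L (center k)).continuous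
  have hMf : ∀ x ∈ cube n, |M x - f x| ≤ τ := by
    intro x hx
    have h1 : M x ≤ f x := Finset.sup'_le _ _ fun k _ => by
      linarith [pen_nonneg hσ0 hL (center k) x]
    obtain ⟨k, hk⟩ := exists_center_abs_le hm hx
    have h2 : sqDist (center k) x ≤ n / m := by
      refine (sqDist_le_of_abs_le hk).trans ?_
      have h : (1 / (2 * (m : ℝ))) ^ 2 ≤ 1 / m := by
        rw [div_pow, one_pow]
        exact one_div_le_one_div_of_le hm0 (by nlinarith)
      calc (n : ℝ) * (1 / (2 * (m : ℝ))) ^ 2 ≤ n * (1 / m) :=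
            mul_le_mul_of_nonneg_left h (Nat.cast_nonneg n)
        _ = n / m := by ring
    have h3 : pen σ L (center k) x ≤ τ := by
      refine (pen_le hσ0 hL h2 hm1).trans ?_
      rwa [mul_div_assoc']
    have h4 : f x - pen σ L (center k) x ≤ M x :=
      Finset.le_sup' (fun k => f x - pen σ L (center k) x) (Finset.mem_univ k)
    rw [abs_le]; constructor <;> linarith
  refine ⟨g, hgc, hgsel, fun x hx => ?_, hghtv.trans ?_⟩
  · have h1 := abs_le.1 (hgM x (cube_subset_box hx))
    have h2 := abs_le.1 (hMf x hx)
    rw [abs_le]; constructor <;> linarith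
  · have hB' : ContDiff ℝ ∞ fun x => ∑ k, B k x := ContDiff.sum fun k _ => hBs k
    rw [hsumΦ]
    have t1 : ∫ x, M x * hdivOne Φ x ≤ (∫ x, f x * hdivOne Φ x) + τ * C :=
      integral_mul_hdivOne_le_add hMc hfcont hΦ hΦc hΦΩ hMf
    have intc : ∀ {φ w : Eu n → ℝ}, ContDiff ℝ ∞ φ → HasCompactSupport φ → ContDiff ℝ ∞ w →
        Integrable fun x => φ x * lap w x := fun h hc hw =>
      (h.continuous.mul (continuous_lap hw)).integrable_of_hasCompactSupport hc.mul_right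
    have t2 : ∫ x, f x * hdivOne Φ x = ∑ k, (∫ x, ψ k x * lap f x) + ∫ x, χ x * lap f x := by
      rw [← integral_finsetSum _ fun k _ => intc (hψ k) (hψc k) hf,
        ← integral_add (integrable_finsetSum _ fun k _ => intc (hψ k) (hψc k) hf)
          (intc hχ hχc hf)]
      refine (integral_mul_hdiv_smul_one hf hΦ hΦc).trans ?_
      refine integral_congr_ae (Eventually.of_forall fun x => ?_)
      simp only
      rw [← congrFun hsumΦ x, add_mul, Finset.sum_mul]
    have t3 : ∀ k, ∫ x, B k x * hdivOne (ψ k) x = ∫ x, ψ k x * lap (B k) x := fun k =>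
      integral_mul_hdiv_smul_one (hBs k) (hψ k) (hψc k)
    have t4 : ∫ x, (∑ k, B k x) * hdivOne χ x = ∫ x, χ x * lap (fun x => ∑ k, B k x) x :=
      integral_mul_hdiv_smul_one hB' hχ hχc
    have comb : ∀ {φ w : Eu n → ℝ}, ContDiff ℝ ∞ φ → HasCompactSupport φ → ContDiff ℝ ∞ w →
        ∫ x, φ x * (lap f x + 2 * lap w x) =
          (∫ x, φ x * lap f x) + 2 * ∫ x, φ x * lap w x := fun h hc hw => by
      have j1 := intc h hc hf
      have j2 := (intc h hc hw).const_mul 2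
      rw [← integral_const_mul, ← integral_add j1 j2]
      exact integral_congr_ae (Eventually.of_forall fun x => by simp only; ring)
    have t5 := sum_integral_mul_lap_le (V := fun k => cubeAt (corner k) (1 / (m : ℝ)))
      (fun k j hjk => disjoint_cubeAt_corner hm hjk.symm) (fun k => cubeAt_corner_subset hm k)
      hf hfin hBs hE hψ hψc hψV hψ0 hψ1 (c := q * σ) (by positivity) fun k x hx => by
        refine hBE k x fun i => ?_
        refine ((mem_cubeAt_corner_iff hm k x).1 hx i).trans_le (le_trans ?_ hm3)
        exact div_le_div_of_nonneg_left zero_le_one hm0 (by linarith)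
    simp only [comb (hψ _) (hψc _) (hBs _), Finset.sum_add_distrib, ← Finset.mul_sum] at t5
    have t6 : ∫ x, χ x * (lap f x + 2 * lap (fun x => ∑ k, B k x) x) ≤ |R| * δ := by
      have hsub : Function.support (fun x => χ x * (lap f x + 2 * lap (fun x => ∑ k, B k x) x)) ⊆
          cube n := fun x hx => hχΩ (subset_tsupport _ fun h0 => hx (by simp [h0]))
      rw [← setIntegral_eq_integral_of_forall_compl_eq_zero fun x hx => by
        by_contra h; exact hx (hsub h)]
      refine le_trans ?_ (mul_le_mul_of_nonneg_left hθδ (abs_nonneg R))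
      rw [← integral_const_mul]
      refine setIntegral_mono_on ?_ ?_ (isOpen_cube n).measurableSet fun x hx => ?_
      · exact ((hχ.continuous.mul ((continuous_lap hf).add (continuous_const.mul
          (continuous_lap hB')))).integrable_of_hasCompactSupport hχc.mul_right).integrableOn
      · exact memLp_one_iff_integrable.1 (memLp_of_continuous (continuous_const.mul
          (continuous_const.sub (continuous_finsetSum _ fun k _ => (hθ k).continuous))))
      · have h1 := hR x (cube_subset_box hx)
        rw [Real.norm_eq_abs] at h1
        have h2 : lap f x + 2 * lap (fun x => ∑ k, B k x) x ≤ |R| :=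
          (le_abs_self _).trans (h1.trans (le_abs_self R))
        have h3 : χ x ≤ 1 - ∑ k, θ k x :=
          mul_le_of_le_one_left (sub_nonneg.2 (hθ1 x)) (hΦ01 x).2
        calc χ x * (lap f x + 2 * lap (fun x => ∑ k, B k x) x) ≤ χ x * |R| :=
              mul_le_mul_of_nonneg_left h2 (hχ0 x)
          _ ≤ (1 - ∑ k, θ k x) * |R| := mul_le_mul_of_nonneg_right h3 (abs_nonneg R)
          _ = |R| * (1 - ∑ k, θ k x) := mul_comm _ _
    rw [comb hχ hχc hB'] at t6
    simp only [t3, t4]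
    rw [← ENNReal.ofReal_toReal hfin, ← ENNReal.ofReal_add ENNReal.toReal_nonneg hε.le]
    refine ENNReal.ofReal_le_ofReal ?_
    linarith

end SmoothCase

/-! ### Mollification. -/

section Mollify
variable {n : ℕ}

/-- The convolution of `w` with the normalized bump function `φ`. -/
def mollify (φ : ContDiffBump (0 : Eu n)) (w : Eu n → ℝ) (x : Eu n) : ℝ :=
  ∫ t, φ.normed volume t * w (x - t)

variable (φ : ContDiffBump (0 : Eu n)) {w w' : Eu n → ℝ}

theorem mollify_eq_convolution (w : Eu n → ℝ) : mollify φ w =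
    convolution (φ.normed volume) w (ContinuousLinearMap.lsmul ℝ ℝ) volume := by
  funext x
  simp [mollify, convolution]

theorem contDiff_mollify (hw : LocallyIntegrable w) : ContDiff ℝ ∞ (mollify φ w) := by
  rw [mollify_eq_convolution]
  exact φ.hasCompactSupport_normed.contDiff_convolution_left _ φ.contDiff_normed hw

theorem hasCompactSupport_mollify (hw : HasCompactSupport w) :
    HasCompactSupport (mollify φ w) := by
  rw [mollify_eq_convolution]
  exact φ.hasCompactSupport_normed.convolution _ hw

theorem integrable_bump_mul (hw : LocallyIntegrable w) (x : Eu n) :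
    Integrable fun t => φ.normed volume t * w (x - t) :=
  φ.hasCompactSupport_normed.convolutionExists_left (ContinuousLinearMap.lsmul ℝ ℝ)
    φ.continuous_normed hw x

theorem mollify_sub (hw : LocallyIntegrable w) (hw' : LocallyIntegrable w') (x : Eu n) :
    mollify φ (fun y => w y - w' y) x = mollify φ w x - mollify φ w' x := by
  rw [mollify, mollify, mollify, ← integral_sub (integrable_bump_mul φ hw x)
    (integrable_bump_mul φ hw' x)]
  simp only [mul_sub]

theorem integrable_bump_mul_prod (hw : Integrable w) :
    Integrable (fun p : Eu n × Eu n => φ.normed volume p.2 * w (p.1 - p.2))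
      (volume.prod volume) :=
  Integrable.convolution_integrand (ContinuousLinearMap.lsmul ℝ ℝ) φ.integrable_normed hw

theorem lintegral_mollify_le (hw : Integrable w) :
    ∫⁻ x, ‖mollify φ w x‖ₑ ≤ ∫⁻ x, ‖w x‖ₑ := by
  calc ∫⁻ x, ‖mollify φ w x‖ₑ ≤ ∫⁻ x, ∫⁻ t, ‖φ.normed volume t * w (x - t)‖ₑ :=
        lintegral_mono fun x => enorm_integral_le_lintegral_enorm _
    _ = ∫⁻ t, ∫⁻ x, ‖φ.normed volume t * w (x - t)‖ₑ :=
        lintegral_lintegral_swap (integrable_bump_mul_prod φ hw).1.enorm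
    _ = ∫⁻ t, ‖φ.normed volume t‖ₑ * ∫⁻ x, ‖w x‖ₑ := by
        refine lintegral_congr fun t => ?_
        simp only [enorm_mul]
        rw [lintegral_const_mul' _ _ enorm_ne_top,
          lintegral_sub_right_eq_self (fun x => ‖w x‖ₑ) t]
    _ = ∫⁻ x, ‖w x‖ₑ := by
        rw [lintegral_mul_const _ φ.continuous_normed.measurable.enorm,
          ← ofReal_integral_norm_eq_lintegral_enorm φ.integrable_normed]
        simp only [Real.norm_eq_abs, abs_of_nonneg (φ.nonneg_normed _), φ.integral_normed]
        simp

/-- A mollification is an average of translates; by translation invariance each of them has on `A`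
at most the variation of `w` on `B`. -/
theorem htv_mollify_le (hw : Integrable w) {A B : Set (Eu n)}
    (h : ∀ x ∈ A, ∀ t ∈ Metric.ball (0 : Eu n) φ.rOut, x - t ∈ B) :
    htv 1 (mollify φ w) A ≤ htv 1 w B := by
  by_cases hfin : htv 1 w B = ⊤
  · rw [hfin]; exact le_top
  refine htv_le_of_forall fun F hF h1 => ?_
  have hin : ∀ t ∈ Metric.ball (0 : Eu n) φ.rOut,
      ∫ x, w (x - t) * hdiv F x ≤ (htv 1 w B).toReal := by
    intro t ht
    have h2 := htv_comp_homothety_le w B (-t) one_pos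
    simp only [one_smul, one_pow, div_one, ENNReal.ofReal_one, one_mul] at h2
    have h3 : htv 1 (fun x => w (-t + x)) A ≤ htv 1 w B :=
      (htv_mono _ fun x hx => by
        simp only [Set.mem_preimage]
        rw [neg_add_eq_sub]; exact h x hx t ht).trans h2
    have h4 := integral_le_toReal_htv hF h1 (ne_top_of_le_ne_top hfin h3)
    simp only [neg_add_eq_sub] at h4 h3
    exact h4.trans (ENNReal.toReal_mono hfin h3)
  obtain ⟨C, -, hC⟩ := hF.exists_bound
  have hint : Integrable (fun p : Eu n × Eu n =>
      φ.normed volume p.2 * w (p.1 - p.2) * hdiv F p.1) (volume.prod volume) :=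
    (integrable_bump_mul_prod φ hw).mul_bdd (c := C)
      (hF.continuous_hdiv.comp continuous_fst).aestronglyMeasurable
      (Eventually.of_forall fun p => hC p.1)
  have e : ∫ x, mollify φ w x * hdiv F x =
      ∫ t, φ.normed volume t * ∫ x, w (x - t) * hdiv F x := by
    calc ∫ x, mollify φ w x * hdiv F x =
          ∫ x, ∫ t, φ.normed volume t * w (x - t) * hdiv F x :=
          integral_congr_ae (Eventually.of_forall fun x => (integral_mul_const _ _).symm)
      _ = ∫ t, ∫ x, φ.normed volume t * w (x - t) * hdiv F x :=
          integral_integral_swap hint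
      _ = _ := by
          refine integral_congr_ae (Eventually.of_forall fun t => ?_)
          simp only [mul_assoc]
          rw [integral_const_mul]
  have hint2 : Integrable fun t => φ.normed volume t * ∫ x, w (x - t) * hdiv F x := by
    refine hint.integral_prod_right.congr (Eventually.of_forall fun t => ?_)
    simp only [mul_assoc]
    rw [integral_const_mul]
  rw [e, ← ENNReal.ofReal_toReal hfin]
  refine ENNReal.ofReal_le_ofReal ?_
  calc ∫ t, φ.normed volume t * ∫ x, w (x - t) * hdiv F x
      ≤ ∫ t, φ.normed volume t * (htv 1 w B).toReal := by
        refine integral_mono hint2 (φ.integrable_normed.mul_const _) fun t => ?_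
        simp only
        by_cases ht : t ∈ Metric.ball (0 : Eu n) φ.rOut
        · exact mul_le_mul_of_nonneg_left (hin t ht) (φ.nonneg_normed t)
        · rw [← φ.support_normed_eq (μ := volume), Function.notMem_support] at ht
          rw [ht, zero_mul, zero_mul]
    _ = (htv 1 w B).toReal := by rw [integral_mul_const, φ.integral_normed, one_mul]

end Mollify

/-! ### Homotheties about the centre of the cube, combined with mollification. -/

section Dilation
variable {n : ℕ}

/-- The centre of the unit cube. -/
def mid (n : ℕ) : Eu n := WithLp.toLp 2 fun _ => 1 / 2

/-- The homothety with ratio `r` which fixes the centre of the cube. -/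
def shrink (r : ℝ) (x : Eu n) : Eu n := (1 - r) • mid n + r • x

theorem shrink_apply (r : ℝ) (x : Eu n) (i : Fin n) :
    shrink r x i = (1 - r) * (1 / 2) + r * x i := rfl

theorem continuous_shrink (r : ℝ) : Continuous (shrink (n := n) r) :=
  continuous_const.add (continuous_const_smul r)

theorem shrink_mem_cube {r : ℝ} (h0 : 0 ≤ r) (h1 : r < 1) {x : Eu n} (hx : x ∈ box n 0) :
    shrink r x ∈ cube n := fun i => by
  have h := hx i
  rw [shrink_apply]
  constructor <;> nlinarith [h.1, h.2]

theorem shrink_sub_mem_cube {r : ℝ} (h0 : 0 ≤ r) (h1 : r < 1) {x t : Eu n} (hx : x ∈ box n 0)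
    (ht : ‖t‖ ≤ (1 - r) / 4) : shrink r (x - t) ∈ cube n := fun i => by
  have h := hx i
  have hti : |t i| ≤ (1 - r) / 4 := (PiLp.norm_apply_le t i).trans ht
  rw [abs_le] at hti
  rw [shrink_apply, PiLp.sub_apply]
  constructor <;> nlinarith [h.1, h.2]

theorem norm_shrink_sub_le {r : ℝ} (h1 : r ≤ 1) {x : Eu n} (hx : x ∈ box n 0) :
    ‖shrink r x - x‖ ≤ (1 - r) * √n := by
  have e : shrink r x - x = (1 - r) • (mid n - x) := by
    simp only [shrink]; module
  rw [e, norm_smul, Real.norm_of_nonneg (by linarith)]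
  refine mul_le_mul_of_nonneg_left ?_ (by linarith)
  refine (norm_le_of_abs_le (M := 1) fun i => ?_).trans_eq (mul_one _)
  have h := hx i
  have e2 : (mid n - x) i = 1 / 2 - x i := rfl
  rw [e2, abs_le]; constructor <;> linarith

theorem norm_shrink_sub_shrink {r : ℝ} (h0 : 0 ≤ r) (x y : Eu n) :
    ‖shrink r x - shrink r y‖ = r * ‖x - y‖ := by
  have e : shrink r x - shrink r y = r • (x - y) := by simp only [shrink]; module
  rw [e, norm_smul, Real.norm_of_nonneg h0]

theorem integrable_comp_shrink {u : Eu n → ℝ} (hu : Integrable u) {r : ℝ} (hr : 0 < r) :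
    Integrable fun x => u (shrink r x) :=
  (hu.comp_add_left ((1 - r) • mid n)).comp_smul hr.ne'

theorem lintegral_comp_shrink (f : Eu n → ℝ≥0∞) {r : ℝ} (hr : 0 < r) :
    ∫⁻ x, f (shrink r x) = ENNReal.ofReal (r ^ n)⁻¹ * ∫⁻ x, f x := by
  simpa [shrink] using setLIntegral_homothety f Set.univ ((1 - r) • mid n) hr

end Dilation

section DilatedMollification
variable {n : ℕ}

theorem hasCompactSupport_comp_shrink {u : Eu n → ℝ} (hu : ∀ x, x ∉ cube n → u x = 0) {r : ℝ}
    (hr : 0 < r) : HasCompactSupport fun x => u (shrink r x) := by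
  have hK : IsCompact ((homothetyHomeo ((1 - r) • mid n) hr.ne').symm '' box n 0) :=
    (isCompact_box le_rfl).image (homothetyHomeo _ hr.ne').symm.continuous
  refine HasCompactSupport.intro hK fun x hx => hu _ fun h => hx ⟨shrink r x, cube_subset_box h, ?_⟩
  exact (homothetyHomeo ((1 - r) • mid n) hr.ne').symm_apply_apply x

/-- Approximation in energy of integrable functions by smooth ones, composed with a homothety. -/
theorem exists_mollify_shrink {u : Eu n → ℝ} (hu : Integrable u)
    (hu0 : ∀ x, x ∉ cube n → u x = 0) (hfin : htv 1 u (cube n) ≠ ⊤) {ε : ℝ} (hε : 0 < ε) :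
    ∃ (r : ℝ) (h : Eu n → ℝ), 0 < r ∧ r < 1 ∧ ContDiff ℝ ∞ h ∧ HasCompactSupport h ∧
      ENNReal.ofReal (r ^ 2 / r ^ n) * (htv 1 h (cube n) + ENNReal.ofReal ε) ≤
        htv 1 u (cube n) + ENNReal.ofReal (3 * ε) ∧ htv 1 h (cube n) ≠ ⊤ ∧
      ∫⁻ x in cube n, ‖h (shrink r x) - u x‖ₑ ≤ ENNReal.ofReal ε := by
  set v : ℝ := volume.real (cube n) with hv
  have hv0 : 0 ≤ v := measureReal_nonneg
  -- The final error is `2 e + e v + e`, from the mollified difference, the continuous approximation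
  -- `p` and its distance from `u`.
  set e : ℝ := ε / (v + 3) with he
  have he0 : 0 < e := by positivity
  obtain ⟨p, hpc, hpe, hpcont, hpint⟩ := hu.exists_hasCompactSupport_lintegral_sub_le
    (ε := ENNReal.ofReal e) (by simpa using he0)
  obtain ⟨d, hd, hdp⟩ := Metric.uniformContinuous_iff.1
    (hpc.uniformContinuous_of_continuous hpcont) e he0
  set H : ℝ := (htv 1 u (cube n)).toReal with hH
  have hH0 : 0 ≤ H := ENNReal.toReal_nonneg
  have hpow : Tendsto (fun r : ℝ => r ^ 2 / r ^ n) (𝓝[<] 1) (𝓝 1) := by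
    have : ContinuousAt (fun r : ℝ => r ^ 2 / r ^ n) 1 :=
      (continuous_pow 2).continuousAt.div (continuous_pow n).continuousAt (by simp)
    simpa [ContinuousAt] using this.tendsto.mono_left nhdsWithin_le_nhds
  have hinv : Tendsto (fun r : ℝ => (r ^ n)⁻¹ * (r ^ n)⁻¹) (𝓝[<] 1) (𝓝 1) := by
    have h1 : ContinuousAt (fun r : ℝ => (r ^ n)⁻¹) 1 :=
      (continuous_pow n).continuousAt.inv₀ (by simp)
    have h2 : Tendsto (fun r : ℝ => (r ^ n)⁻¹) (𝓝[<] 1) (𝓝 1) := by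
      simpa [ContinuousAt] using h1.tendsto.mono_left nhdsWithin_le_nhds
    simpa using h2.mul h2
  -- The factor `r ^ 2 / r ^ n` occurs twice: for the dilation before the mollification, and for the
  -- second one in `exists_isCPWL_approx`.
  have henergy : Tendsto (fun r : ℝ => r ^ 2 / r ^ n * (r ^ 2 / r ^ n * H + ε)) (𝓝[<] 1)
      (𝓝 (H + ε)) := by
    have := hpow.mul ((hpow.mul_const H).add_const ε)
    simpa using this
  have hdist : Tendsto (fun r : ℝ => (1 - r) * √n) (𝓝[<] 1) (𝓝 0) := by
    have : ContinuousAt (fun r : ℝ => (1 - r) * √n) 1 := by fun_prop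
    simpa [ContinuousAt] using this.tendsto.mono_left nhdsWithin_le_nhds
  have hpos : ∀ᶠ r : ℝ in 𝓝[<] 1, 0 < r := nhdsWithin_le_nhds (lt_mem_nhds zero_lt_one)
  obtain ⟨r, hr1, hr0, hr2, hr3, hr4⟩ := ((eventually_mem_nhdsWithin (a := (1 : ℝ)) (s := Set.Iio 1)).and
    (hpos.and
    ((henergy.eventually (gt_mem_nhds (show H + ε < H + 3 * ε by linarith))).and
    ((hinv.eventually (gt_mem_nhds one_lt_two)).and
    (hdist.eventually (gt_mem_nhds (show 0 < d / 4 by positivity))))))).exists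
  have hr1 : r < 1 := hr1
  have hr0 : 0 < r := hr0
  -- The bound `(1 - r) / 4` keeps the translates of the shrunk cube inside the cube, and `d / 4`
  -- serves the uniform continuity of `p`.
  set R : ℝ := min (d / 4) ((1 - r) / 4) with hR
  have hR0 : 0 < R := lt_min (by positivity) (by linarith)
  let φ : ContDiffBump (0 : Eu n) := ⟨R / 2, R, by positivity, by linarith⟩
  have hφR : φ.rOut = R := rfl
  set w : Eu n → ℝ := fun x => u (shrink r x) with hw
  set q : Eu n → ℝ := fun x => p (shrink r x) with hq
  have hwi : Integrable w := integrable_comp_shrink hu hr0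
  have hqi : Integrable q := integrable_comp_shrink hpint hr0
  have hqc : Continuous q := hpcont.comp (continuous_shrink r)
  have hhtv : htv 1 (mollify φ w) (cube n) ≤
      ENNReal.ofReal (r ^ 2 / r ^ n) * htv 1 u (cube n) := by
    refine (htv_mollify_le φ hwi fun x hx t ht => ?_).trans
      (htv_comp_homothety_le u (cube n) ((1 - r) • mid n) hr0)
    rw [hφR, mem_ball_zero_iff] at ht
    exact shrink_sub_mem_cube hr0.le hr1 (cube_subset_box hx) (ht.le.trans (min_le_right _ _))
  have hhfin : htv 1 (mollify φ w) (cube n) ≠ ⊤ :=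
    ne_top_of_le_ne_top (ENNReal.mul_ne_top ENNReal.ofReal_ne_top hfin) hhtv
  refine ⟨r, mollify φ w, hr0, hr1, contDiff_mollify φ hwi.locallyIntegrable,
    hasCompactSupport_mollify φ (hasCompactSupport_comp_shrink hu0 hr0), ?_, hhfin, ?_⟩
  · have hc0 : 0 ≤ r ^ 2 / r ^ n := by positivity
    refine (mul_le_mul_right (add_le_add_left hhtv _) _).trans ?_
    rw [← ENNReal.ofReal_toReal hfin, ← hH, ← ENNReal.ofReal_mul hc0,
      ← ENNReal.ofReal_add (by positivity) hε.le, ← ENNReal.ofReal_mul hc0,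
      ← ENNReal.ofReal_add hH0 (by positivity)]
    exact ENNReal.ofReal_le_ofReal hr2.le
  · have hpt : ∀ x ∈ cube n, ‖mollify φ w (shrink r x) - u x‖ₑ ≤
        ‖mollify φ (fun y => w y - q y) (shrink r x)‖ₑ + ENNReal.ofReal e + ‖u x - p x‖ₑ := by
      intro x hx
      have hx' := cube_subset_box hx
      have hs := cube_subset_box (shrink_mem_cube hr0.le hr1 hx')
      have h1 : |mollify φ q (shrink r x) - p x| ≤ e := by
        rw [mollify_eq_convolution, ← Real.dist_eq]
        refine dist_convolution_le he0.le φ.support_normed_eq.subset φ.nonneg_normed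
          φ.integral_normed hqc.aestronglyMeasurable fun y hy => ?_
        rw [hφR, mem_ball_iff_norm] at hy
        refine (hdp ?_).le
        rw [dist_eq_norm]
        have a1 : ‖shrink r y - shrink r (shrink r x)‖ ≤ R := by
          rw [norm_shrink_sub_shrink hr0.le]
          exact (mul_le_of_le_one_left (norm_nonneg _) hr1.le).trans hy.le
        have a2 := norm_shrink_sub_le hr1.le hs
        have a3 := norm_shrink_sub_le hr1.le hx'
        have a4 : shrink r y - x = (shrink r y - shrink r (shrink r x)) +
          ((shrink r (shrink r x) - shrink r x) + (shrink r x - x)) := by abel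
        rw [a4]
        have a5 := norm_add_le (shrink r y - shrink r (shrink r x))
          ((shrink r (shrink r x) - shrink r x) + (shrink r x - x))
        have a6 := norm_add_le (shrink r (shrink r x) - shrink r x) (shrink r x - x)
        have a7 : R ≤ d / 4 := min_le_left _ _
        linarith
      have h2 := mollify_sub φ hwi.locallyIntegrable hqi.locallyIntegrable (shrink r x)
      have h3 : mollify φ w (shrink r x) - u x = mollify φ (fun y => w y - q y) (shrink r x) +
          (mollify φ q (shrink r x) - p x) + -(u x - p x) := by rw [h2]; ring
      rw [h3]
      refine (enorm_add_le _ _).trans ?_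
      rw [enorm_neg]
      gcongr
      refine (enorm_add_le _ _).trans ?_
      gcongr
      rw [Real.enorm_eq_ofReal_abs]
      exact ENNReal.ofReal_le_ofReal h1
    have hm1 : Measurable fun x => ‖mollify φ (fun y => w y - q y) (shrink r x)‖ₑ :=
      ((contDiff_mollify φ (hwi.sub hqi).locallyIntegrable).continuous.comp
        (continuous_shrink r)).measurable.enorm
    have t1 : ∫⁻ x in cube n, ‖mollify φ (fun y => w y - q y) (shrink r x)‖ₑ ≤
        ENNReal.ofReal (2 * e) := by
      calc ∫⁻ x in cube n, ‖mollify φ (fun y => w y - q y) (shrink r x)‖ₑ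
          ≤ ∫⁻ x, ‖mollify φ (fun y => w y - q y) (shrink r x)‖ₑ := setLIntegral_le_lintegral _ _
        _ = ENNReal.ofReal (r ^ n)⁻¹ * ∫⁻ x, ‖mollify φ (fun y => w y - q y) x‖ₑ :=
          lintegral_comp_shrink (fun x => ‖mollify φ (fun y => w y - q y) x‖ₑ) hr0
        _ ≤ ENNReal.ofReal (r ^ n)⁻¹ * ∫⁻ x, ‖w x - q x‖ₑ :=
          mul_le_mul_right (lintegral_mollify_le φ (hwi.sub hqi)) _
        _ = ENNReal.ofReal (r ^ n)⁻¹ * (ENNReal.ofReal (r ^ n)⁻¹ * ∫⁻ x, ‖u x - p x‖ₑ) := by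
          rw [← lintegral_comp_shrink (fun x => ‖u x - p x‖ₑ) hr0]
        _ ≤ ENNReal.ofReal (r ^ n)⁻¹ * (ENNReal.ofReal (r ^ n)⁻¹ * ENNReal.ofReal e) :=
          mul_le_mul_right (mul_le_mul_right hpe _) _
        _ = ENNReal.ofReal ((r ^ n)⁻¹ * (r ^ n)⁻¹ * e) := by
          rw [← ENNReal.ofReal_mul (by positivity), ← ENNReal.ofReal_mul (by positivity), mul_assoc]
        _ ≤ ENNReal.ofReal (2 * e) :=
          ENNReal.ofReal_le_ofReal (mul_le_mul_of_nonneg_right hr3.le he0.le)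
    have t2 : ∫⁻ x in cube n, ‖u x - p x‖ₑ ≤ ENNReal.ofReal e :=
      (setLIntegral_le_lintegral _ _).trans hpe
    have t3 : ∫⁻ _x in cube n, ENNReal.ofReal e = ENNReal.ofReal (e * v) := by
      rw [setLIntegral_const, ENNReal.ofReal_mul he0.le, hv,
        ofReal_measureReal volume_cube_lt_top.ne]
    refine (setLIntegral_mono' (isOpen_cube n).measurableSet hpt).trans ?_
    rw [lintegral_add_left (hm1.add_const _), lintegral_add_left hm1, t3]
    refine (add_le_add (add_le_add_left t1 _) t2).trans ?_
    rw [← ENNReal.ofReal_add (by positivity) (by positivity),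
      ← ENNReal.ofReal_add (by positivity) (by positivity)]
    refine ENNReal.ofReal_le_ofReal (le_of_eq ?_)
    rw [he]; field_simp; ring

end DilatedMollification

/-! ### Density in energy for all functions of finite variation. -/

section Density
variable {n : ℕ}

/-- A locally integrable function of finite variation is integrable on the cube. -/
theorem memLp_of_htv_ne_top {f : Eu n → ℝ} (hf : LocallyIntegrableOn f (cube n))
    (hfin : htv 1 f (cube n) ≠ ⊤) : MemLp f 1 (cubeMeasure n) := by
  obtain ⟨C, hC, hP⟩ := exists_affine_lintegral_le n
  obtain ⟨a, ha⟩ := hP f hf hfin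
  have hmem : MemLp (fun x => f x - a x) 1 (cubeMeasure n) := by
    refine ⟨hf.aestronglyMeasurable.sub (continuous_affineMap a).aestronglyMeasurable, ?_⟩
    rw [eLpNorm_one_eq_lintegral_enorm]
    exact ha.trans_lt (ENNReal.mul_lt_top ENNReal.ofReal_lt_top hfin.lt_top)
  refine (memLp_congr_ae (Eventually.of_forall fun x => ?_)).1 (hmem.add (memLp_affineMap a))
  simp

/-- The smooth case controls the variation only on a compact subset of the open cube. Composing with
the homothety once more maps the whole cube into such a set, and a selection of affine functions
remains one. -/
theorem exists_isCPWL_approx {f : Eu n → ℝ} (hf : LocallyIntegrableOn f (cube n))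
    (hfin : htv 1 f (cube n) ≠ ⊤) {ε : ℝ} (hε : 0 < ε) :
    ∃ g : Eu n → ℝ, Continuous g ∧ IsCPWL (cube n) g ∧
      eLpNorm (g - f) 1 (cubeMeasure n) ≤ ENNReal.ofReal ε ∧
      htv 1 g (cube n) ≤ htv 1 f (cube n) + ENNReal.ofReal ε := by
  have hcm : MeasurableSet (cube n) := (isOpen_cube n).measurableSet
  set u : Eu n → ℝ := (cube n).indicator f with hu
  have huf : u =ᵐ[cubeMeasure n] f := indicator_ae_eq_restrict hcm
  have hui : Integrable u := (integrable_indicator_iff hcm).2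
    (memLp_one_iff_integrable.1 (memLp_of_htv_ne_top hf hfin))
  have huh : htv 1 u (cube n) = htv 1 f (cube n) := htv_congr_ae huf
  set v : ℝ := volume.real (cube n) with hv
  have hv0 : 0 ≤ v := measureReal_nonneg
  set e : ℝ := ε / (v + 3) with he
  have he0 : 0 < e := by positivity
  have he1 : e * v + e ≤ ε := by
    have : e * (v + 3) = ε := by rw [he]; field_simp
    linarith
  have he3 : 3 * e ≤ ε := by
    have : e * (v + 3) = ε := by rw [he]; field_simp
    nlinarith
  obtain ⟨r, h, hr0, hr1, hh, hhc, hhe, hhfin, hhu⟩ := exists_mollify_shrink hui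
    (fun x hx => Set.indicator_of_notMem hx f) (huh ▸ hfin) he0
  set K : Set (Eu n) := shrink r '' box n 0 with hK
  obtain ⟨g, hgc, ⟨N, ℓ, hℓ⟩, hgh, hghtv⟩ := exists_affine_selection_of_contDiff hh hhc hhfin
    (K := K) ((isCompact_box le_rfl).image (continuous_shrink r)) (by
      rintro _ ⟨x, hx, rfl⟩; exact shrink_mem_cube hr0.le hr1 hx) he0
  set T : Eu n →ᵃ[ℝ] Eu n := AffineMap.const ℝ (Eu n) ((1 - r) • mid n) + r • AffineMap.id ℝ (Eu n)
    with hT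
  have hTx : ∀ x, T x = shrink r x := fun x => by simp [hT, shrink]
  have hgc' : Continuous fun x => g (shrink r x) := hgc.comp (continuous_shrink r)
  refine ⟨fun x => g (shrink r x), hgc', isCPWL_of_selection (ℓ := fun i => (ℓ i).comp T) hgc'
    (fun x => ?_) _, ?_, ?_⟩
  · obtain ⟨i, hi⟩ := hℓ (shrink r x)
    exact ⟨i, by rw [hi, AffineMap.comp_apply, hTx]⟩
  · rw [eLpNorm_one_eq_lintegral_enorm]
    have e1 : ∫⁻ x in cube n, ‖((fun x => g (shrink r x)) - f) x‖ₑ =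
        ∫⁻ x in cube n, ‖g (shrink r x) - u x‖ₑ := by
      refine lintegral_congr_ae ?_
      filter_upwards [huf] with x hx
      rw [hx, Pi.sub_apply]
    rw [e1]
    calc ∫⁻ x in cube n, ‖g (shrink r x) - u x‖ₑ
        ≤ ∫⁻ x in cube n, (ENNReal.ofReal e + ‖h (shrink r x) - u x‖ₑ) := by
          refine setLIntegral_mono' hcm fun x hx => ?_
          have h1 : g (shrink r x) - u x =
            (g (shrink r x) - h (shrink r x)) + (h (shrink r x) - u x) := by ring
          rw [h1]
          refine (enorm_add_le _ _).trans ?_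
          gcongr
          rw [Real.enorm_eq_ofReal_abs]
          exact ENNReal.ofReal_le_ofReal
            (hgh _ (shrink_mem_cube hr0.le hr1 (cube_subset_box hx)))
      _ ≤ ENNReal.ofReal (e * v) + ENNReal.ofReal e := by
          rw [lintegral_add_left measurable_const, setLIntegral_const, ENNReal.ofReal_mul he0.le, hv,
            ofReal_measureReal volume_cube_lt_top.ne]
          gcongr
      _ ≤ ENNReal.ofReal ε := by
          rw [← ENNReal.ofReal_add (by positivity) he0.le]
          exact ENNReal.ofReal_le_ofReal he1
  · calc htv 1 (fun x => g (shrink r x)) (cube n)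
        ≤ htv 1 (fun x => g (shrink r x)) (shrink r ⁻¹' K) :=
          htv_mono _ fun x hx => ⟨x, cube_subset_box hx, rfl⟩
      _ ≤ ENNReal.ofReal (r ^ 2 / r ^ n) * htv 1 g K :=
          htv_comp_homothety_le g K ((1 - r) • mid n) hr0
      _ ≤ ENNReal.ofReal (r ^ 2 / r ^ n) * (htv 1 h (cube n) + ENNReal.ofReal e) :=
          mul_le_mul_right hghtv _
      _ ≤ htv 1 u (cube n) + ENNReal.ofReal (3 * e) := hhe
      _ ≤ htv 1 f (cube n) + ENNReal.ofReal ε := by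
          rw [huh]; gcongr

/-- `CPWL(Ω)` is dense in energy. -/
theorem cpwlDenseInEnergy (n : ℕ) : CPWLDenseInEnergy n := by
  intro f hf hfin
  choose g hgc hg hgL hgE using fun k : ℕ =>
    exists_isCPWL_approx hf hfin.ne (ε := 1 / ((k : ℝ) + 1)) (by positivity)
  have h0 : Tendsto (fun k : ℕ => ENNReal.ofReal (1 / ((k : ℝ) + 1))) atTop (𝓝 0) := by
    have := ENNReal.tendsto_ofReal (tendsto_one_div_add_atTop_nhds_zero_nat (𝕜 := ℝ))
    rwa [ENNReal.ofReal_zero] at this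
  have hL : Tendsto (fun k => eLpNorm (g k - f) 1 (cubeMeasure n)) atTop (𝓝 0) :=
    tendsto_of_tendsto_of_tendsto_of_le_of_le tendsto_const_nhds h0 (fun _ => zero_le) hgL
  -- The lower bound is lower semicontinuity; the upper bound is built into the approximants.
  refine ⟨g, hg, hL, tendsto_of_le_liminf_of_limsup_le ?_ ?_⟩
  · exact htv_le_liminf (fun k => (hgc k).locallyIntegrable.locallyIntegrableOn _) hf hL
  · have h1 : Tendsto (fun k : ℕ => htv 1 f (cube n) + ENNReal.ofReal (1 / ((k : ℝ) + 1))) atTop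
        (𝓝 (htv 1 f (cube n))) := by
      simpa using h0.const_add (htv 1 f (cube n))
    exact (limsup_le_limsup (Eventually.of_forall hgE)).trans_eq h1.limsup_eq

end Density

end HessianSchatten

end

theorem theorem5p3 :
    ((HessianSchatten.unitBall 2).extremePoints ℝ ⊆
        closure (HessianSchatten.cpwlExtremePoints 2) ∧
      ∀ f : HessianSchatten.Eu 2 →ₘ[HessianSchatten.cubeMeasure 2] ℝ,
        HessianSchatten.IsExtremeModAffine (HessianSchatten.locUnitBall 2) f →
          ∃ h : HessianSchatten.L1Cube 2,
            (h : HessianSchatten.Eu 2 →ₘ[HessianSchatten.cubeMeasure 2] ℝ) = f ∧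
              HessianSchatten.proj 2 h ∈ closure (HessianSchatten.cpwlExtremePoints 2)) ∧
    ∀ n : ℕ, 1 ≤ n → HessianSchatten.CPWLDenseInEnergy n →
      (HessianSchatten.unitBall n).extremePoints ℝ ⊆
          closure (HessianSchatten.cpwlExtremePoints n) ∧
        ∀ f : HessianSchatten.Eu n →ₘ[HessianSchatten.cubeMeasure n] ℝ,
          HessianSchatten.IsExtremeModAffine (HessianSchatten.locUnitBall n) f →
            ∃ h : HessianSchatten.L1Cube n,
              (h : HessianSchatten.Eu n →ₘ[HessianSchatten.cubeMeasure n] ℝ) = f ∧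
                HessianSchatten.proj n h ∈ closure (HessianSchatten.cpwlExtremePoints n) := by
  have main : ∀ n : ℕ, HessianSchatten.CPWLDenseInEnergy n →
      (HessianSchatten.unitBall n).extremePoints ℝ ⊆
          closure (HessianSchatten.cpwlExtremePoints n) ∧
        ∀ f : HessianSchatten.Eu n →ₘ[HessianSchatten.cubeMeasure n] ℝ,
          HessianSchatten.IsExtremeModAffine (HessianSchatten.locUnitBall n) f →
            ∃ h : HessianSchatten.L1Cube n,
              (h : HessianSchatten.Eu n →ₘ[HessianSchatten.cubeMeasure n] ℝ) = f ∧
                HessianSchatten.proj n h ∈ closure (HessianSchatten.cpwlExtremePoints n) := by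
    intro n hd
    refine ⟨HessianSchatten.extremePoints_unitBall_subset_closure hd, fun f hf => ?_⟩
    obtain ⟨h, hhf, hh⟩ := HessianSchatten.exists_L1_of_isExtremeModAffine hf
    exact ⟨h, hhf, HessianSchatten.extremePoints_unitBall_subset_closure hd hh⟩
  -- The planar case needs no separate argument: density in energy has been established in every
  -- dimension.
  exact ⟨main 2 (HessianSchatten.cpwlDenseInEnergy 2), fun n _ => main n⟩
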